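/- Let $k$ be a field, $t$ a positive integer, $K=k^t$, and $\otimes=\otimes_K$. All gradings are by $\mathbb Z$, differentials have degree $-1$, and the Koszul sign rule is used. Let $A$ be an augmented dg $K$-ring (a dg $K$-bimodule, with $k$ acting centrally, equipped with a unital associative product $\mu:A\otimes A\to A$, unit $\eta:K\to A$ and augmentation $\varepsilon:A\to K$, all compatible with gradings and differentials). Assume that $A$ is locally finite (each $A_n$ is finite dimensional over $k$), bounded above or below ($A_n=0$ for $n\gg0$, or $A_n=0$ for $n\ll0$), and complete ($\bigcap_{i\ge1}\overline A^{\,i}=0$, where $\overline A=\operatorname{Ker}\varepsilon$). Let $C=A^\vee=\bigoplus_n\operatorname{Hom}_k(A_n,k)$ be the graded dual coaugmented dg $K$-coring, with coproduct $\Delta$ the transpose of $\mu$ under the canonical isomorphism $A^\vee\otimes A^\vee\cong(A\otimes A)^\vee$, counit $\varepsilon_C=\eta^\vee$, coaugmentation $\varepsilon^\vee$ and differential $f\mapsto-(-1)^{|f|}f\circ d_A$. Let $\overline C=\operatorname{Ker}\varepsilon_C$, and let $\Omega=\Omega A^\vee$ be its cobar construction: the tensor $K$-ring $T(s^{-1}\overline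 C)$ with the differential that is the derivation given by $\langle c\rangle\mapsto-\langle dc\rangle-\sum(-1)^{|c_1|}\langle c_1|c_2\rangle$, where $\sum c_1\otimes c_2=\Delta(c)-1\otimes c-c\otimes1$. It is an augmented dg $K$-ring. Let $\iota:C\to\Omega$ be the universal twisting morphism, $\iota(c)=\langle c\rangle$ for $c\in\overline C$ and $\iota|_K=0$. For an augmented dg $K$-ring $R$, a coaugmented dg $K$-coring $D$ and a twisting morphism $\alpha:D\to R$, let $R\otimes_\alpha D\otimes_\alpha R$ be the $R$-bimodule $R\otimes D\otimes R$ with the differential $d_{R\otimes D\otimes R}+\mathrm{id}\otimes d^r_\alpha-d^l_\alpha\otimes\mathrm{id}$, where $d^r_\alpha=(\mathrm{id}\otimes\mu_R)(\mathrm{id}\otimes\alpha\otimes\mathrm{id})(\Delta_D\otimes\mathrm{id})$ and $d^l_\alpha=(\mu_R\otimes\mathrm{id})(\mathrm{id}\otimes\alpha\otimes\mathrm{id})(\mathrm{id}\otimes\Delta_D)$, and let $\mu_R(\mathrm{id}\otimes\varepsilon_D\otimes\mathrm{id}):R\otimes_\alpha D\otimes_\alpha R\to R$ be its canonical map. Then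 the dg $\Omega$-bimodule $\Omega\otimes_\iota A^\vee\otimes_\iota\Omega$ is a semi-projective resolution of the dg $\Omega$-bimodule $\Omega$: it is a semi-projective dg $\Omega$-bimodule (that is, $\operatorname{Hom}(\Omega\otimes_\iota A^\vee\otimes_\iota\Omega,-)$, the complex of graded bimodule maps, sends surjective quasi-isomorphisms of dg $\Omega$-bimodules to surjective quasi-isomorphisms), and its canonical map to $\Omega$ is a quasi-isomorphism of dg $\Omega$-bimodules. Moreover, let $B\Omega=T^c(s\overline\Omega)$ be the bar construction of $\Omega$, whose differential is the coderivation with components $[a]\mapsto-[da]$ and $[a_1|a_2]\mapsto(-1)^{|a_1|}[a_1a_2]$, and let $\pi:B\Omega\to\Omega$ be its universal twisting morphism (the projection onto $s\overline\Omega$ followed by $s^{-1}:s\overline\Omega\cong\overline\Omega\subset\Omega$). Then there is a homotopy equivalence of dg $\Omega$-bimodules from $\Omega\otimes_\iota A^\vee\otimes_\iota\Omega$ to the two-sided bar resolution $\Omega\otimes_\pi B\Omega\otimes_\pi\Omega$ that commutes with the canonical maps to $\Omega$. -/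

import Mathlib

open scoped TensorProduct

universe u v w x y

/-! ## Bimodules over `K = k ^ t` and their tensor products over `K` -/

/-- A bimodule over `K = k ^ t` on which `k` acts centrally: a `k`-vector space with commuting left
and right actions `l`, `r` of the commutative `k`-algebra `K`. -/
structure KBimod (k : Type u) [Field k] (t : ℕ) where
  carrier : Type v
  [addCommGroup : AddCommGroup carrier]
  [module : Module k carrier]
  l : (Fin t → k) →ₐ[k] Module.End k carrier
  r : (Fin t → k) →ₐ[k] Module.End k carrier
  comm : ∀ (a b : Fin t → k) (m : carrier), l a (r b m) = r b (l a m)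

attribute [instance] KBimod.addCommGroup KBimod.module

/-- A morphism of `K`-bimodules. -/
structure KHom {k : Type u} [Field k] {t : ℕ} (V : KBimod.{u, v} k t) (W : KBimod.{u, w} k t) where
  toLin : V.carrier →ₗ[k] W.carrier
  map_l : ∀ (a : Fin t → k) (m : V.carrier), toLin (V.l a m) = W.l a (toLin m)
  map_r : ∀ (a : Fin t → k) (m : V.carrier), toLin (V.r a m) = W.r a (toLin m)

namespace KHom

variable {k : Type u} [Field k] {t : ℕ}

instance {V : KBimod.{u, v} k t} {W : KBimod.{u, w} k t} :
    CoeFun (KHom V W) (fun _ => V.carrier → W.carrier) := ⟨fun f => f.toLin⟩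

/-- The identity morphism. -/
def id (V : KBimod.{u, v} k t) : KHom V V := ⟨LinearMap.id, fun _ _ => rfl, fun _ _ => rfl⟩

/-- The composition `g ∘ f`. -/
def comp {V : KBimod.{u, v} k t} {W : KBimod.{u, w} k t} {X : KBimod.{u, x} k t}
    (g : KHom W X) (f : KHom V W) : KHom V X :=
  ⟨g.toLin ∘ₗ f.toLin, fun a m => by simp [f.map_l, g.map_l], fun a m => by simp [f.map_r, g.map_r]⟩

instance {V : KBimod.{u, v} k t} {W : KBimod.{u, w} k t} : Zero (KHom V W) :=
  ⟨⟨0, fun _ _ => by simp, fun _ _ => by simp⟩⟩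

instance {V : KBimod.{u, v} k t} {W : KBimod.{u, w} k t} : Add (KHom V W) :=
  ⟨fun f g => ⟨f.toLin + g.toLin, fun a m => by simp [f.map_l, g.map_l],
    fun a m => by simp [f.map_r, g.map_r]⟩⟩

instance {V : KBimod.{u, v} k t} {W : KBimod.{u, w} k t} : Neg (KHom V W) :=
  ⟨fun f => ⟨-f.toLin, fun a m => by simp [f.map_l], fun a m => by simp [f.map_r]⟩⟩

instance {V : KBimod.{u, v} k t} {W : KBimod.{u, w} k t} : Sub (KHom V W) :=
  ⟨fun f g => f + -g⟩

end KHom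

namespace KBimod

variable {k : Type u} [Field k] {t : ℕ}

/-- The regular bimodule `K`. -/
abbrev unit (k : Type u) [Field k] (t : ℕ) : KBimod.{u, u} k t where
  carrier := Fin t → k
  l := Algebra.lmul k (Fin t → k)
  r := Algebra.lmul k (Fin t → k)
  comm a b m := by simp only [Algebra.coe_lmul_eq_mul, LinearMap.mul_apply_apply]; ring

/-- The relations `v x ⊗ w = v ⊗ x w`, for `x` in `K`. -/
def rel (V : KBimod.{u, v} k t) (W : KBimod.{u, w} k t) :
    Submodule k (V.carrier ⊗[k] W.carrier) :=
  Submodule.span k {q | ∃ (m : V.carrier) (a : Fin t → k) (n : W.carrier),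
    q = (V.r a m) ⊗ₜ[k] n - m ⊗ₜ[k] (W.l a n)}

/-- The underlying vector space of `V ⊗_K W`: the quotient of `V ⊗_k W` by the relations
`v x ⊗ w = v ⊗ x w`. -/
def Tens (V : KBimod.{u, v} k t) (W : KBimod.{u, w} k t) : Type (max v w) :=
  (V.carrier ⊗[k] W.carrier) ⧸ rel V W

instance (V : KBimod.{u, v} k t) (W : KBimod.{u, w} k t) : AddCommGroup (Tens V W) :=
  inferInstanceAs (AddCommGroup ((V.carrier ⊗[k] W.carrier) ⧸ rel V W))

instance (V : KBimod.{u, v} k t) (W : KBimod.{u, w} k t) : Module k (Tens V W) :=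
  inferInstanceAs (Module k ((V.carrier ⊗[k] W.carrier) ⧸ rel V W))

/-- The projection `V ⊗_k W → V ⊗_K W`. -/
def tmk (V : KBimod.{u, v} k t) (W : KBimod.{u, w} k t) :
    (V.carrier ⊗[k] W.carrier) →ₗ[k] Tens V W := (rel V W).mkQ

/-- `m ↦ n ↦ m ⊗ n` as a `k`-bilinear map. -/
def tmL (V : KBimod.{u, v} k t) (W : KBimod.{u, w} k t) :
    V.carrier →ₗ[k] W.carrier →ₗ[k] Tens V W := (TensorProduct.mk k _ _).compr₂ (tmk V W)

section Tens

variable {V : KBimod.{u, v} k t} {W : KBimod.{u, w} k t}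

theorem tmL_balance (a : Fin t → k) (m : V.carrier) (n : W.carrier) :
    tmL V W (V.r a m) n = tmL V W m (W.l a n) :=
  (Submodule.Quotient.eq _).2 (Submodule.subset_span ⟨m, a, n, rfl⟩)

theorem tens_induction {p : Tens V W → Prop} (h0 : p 0)
    (ht : ∀ m n, p (tmL V W m n)) (ha : ∀ q q', p q → p q' → p (q + q')) (q : Tens V W) :
    p q := by
  obtain ⟨q, rfl⟩ := (rel V W).mkQ_surjective q
  change p (tmk V W q)
  induction q with
  | zero => rw [map_zero]; exact h0
  | tmul m n => exact ht m n
  | add p q hp hq => rw [map_add]; exact ha _ _ hp hq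

theorem tens_ext {X : Type x} [AddCommGroup X] [Module k X] {f g : Tens V W →ₗ[k] X}
    (h : ∀ m n, f (tmL V W m n) = g (tmL V W m n)) : f = g := by
  ext q
  induction q using tens_induction with
  | h0 => simp
  | ht m n => exact h m n
  | ha p q hp hq => simp only [map_add, hp, hq]

/-- The universal property of `V ⊗_K W`: a `k`-bilinear map `f` with `f (v x) w = f v (x w)`
factors through `V ⊗_K W`. -/
def lift {X : Type x} [AddCommGroup X] [Module k X]
    (f : V.carrier →ₗ[k] W.carrier →ₗ[k] X) (h : ∀ a m n, f (V.r a m) n = f m (W.l a n)) :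
    Tens V W →ₗ[k] X :=
  (rel V W).liftQ (TensorProduct.lift f) (by
    refine Submodule.span_le.2 ?_
    rintro _ ⟨m, a, n, rfl⟩
    simp [h])

theorem lift_tmL {X : Type x} [AddCommGroup X] [Module k X]
    (f : V.carrier →ₗ[k] W.carrier →ₗ[k] X) (h : ∀ a m n, f (V.r a m) n = f m (W.l a n)) (m n) :
    lift f h (tmL V W m n) = f m n := rfl

end Tens

/-- The left action of `x` on `V ⊗_K W`. -/
def tensL (V : KBimod.{u, v} k t) (W : KBimod.{u, w} k t) (a : Fin t → k) :
    Module.End k (Tens V W) :=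
  lift ((tmL V W).comp (V.l a)) (fun b m n => by
    simp only [LinearMap.comp_apply, V.comm, tmL_balance])

/-- The right action of `x` on `V ⊗_K W`. -/
def tensR (V : KBimod.{u, v} k t) (W : KBimod.{u, w} k t) (a : Fin t → k) :
    Module.End k (Tens V W) :=
  lift ((tmL V W).compl₂ (W.r a)) (fun b m n => by
    simp only [LinearMap.compl₂_apply, ← W.comm, tmL_balance])

theorem tensL_tmL (V : KBimod.{u, v} k t) (W : KBimod.{u, w} k t) (a : Fin t → k) (m n) :
    tensL V W a (tmL V W m n) = tmL V W (V.l a m) n := rfl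

theorem tensR_tmL (V : KBimod.{u, v} k t) (W : KBimod.{u, w} k t) (a : Fin t → k) (m n) :
    tensR V W a (tmL V W m n) = tmL V W m (W.r a n) := rfl

/-- The tensor product `V ⊗_K W`, with the left action of `K` on `V` and the right action on `W`. -/
abbrev tensor (V : KBimod.{u, v} k t) (W : KBimod.{u, w} k t) : KBimod.{u, max v w} k t where
  carrier := Tens V W
  l := AlgHom.ofLinearMap
    { toFun := tensL V W
      map_add' := fun a b => tens_ext fun m n => by simp [tensL_tmL]
      map_smul' := fun a b => tens_ext fun m n => by simp [tensL_tmL] }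
    (tens_ext fun m n => by simp [tensL_tmL])
    (fun a b => tens_ext fun m n => by simp [tensL_tmL])
  r := AlgHom.ofLinearMap
    { toFun := tensR V W
      map_add' := fun a b => tens_ext fun m n => by simp [tensR_tmL]
      map_smul' := fun a b => tens_ext fun m n => by simp [tensR_tmL] }
    (tens_ext fun m n => by simp [tensR_tmL])
    (fun a b => tens_ext fun m n => by simp [tensR_tmL])
  comm a b q := by
    change tensL V W a (tensR V W b q) = tensR V W b (tensL V W a q)
    induction q using tens_induction with
    | h0 => simp
    | ht m n => simp [tensL_tmL, tensR_tmL]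
    | ha p q hp hq => simp only [map_add, hp, hq]

/-- The class of `m ⊗ n` in `V ⊗_K W`. -/
def tm {V : KBimod.{u, v} k t} {W : KBimod.{u, w} k t} (m : V.carrier) (n : W.carrier) :
    (tensor V W).carrier := tmL V W m n

theorem tm_balance {V : KBimod.{u, v} k t} {W : KBimod.{u, w} k t}
    (a : Fin t → k) (m : V.carrier) (n : W.carrier) : tm (V.r a m) n = tm m (W.l a n) :=
  tmL_balance a m n

theorem tensor_induction {V : KBimod.{u, v} k t} {W : KBimod.{u, w} k t}
    {p : (tensor V W).carrier → Prop} (h0 : p 0)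
    (ht : ∀ m n, p (tm m n)) (ha : ∀ q q', p q → p q' → p (q + q')) (q : (tensor V W).carrier) :
    p q := tens_induction h0 ht ha q

/-- `m ↦ n ↦ m ⊗ n` as a `k`-bilinear map. -/
def tmLin (V : KBimod.{u, v} k t) (W : KBimod.{u, w} k t) :
    V.carrier →ₗ[k] W.carrier →ₗ[k] (tensor V W).carrier := tmL V W

/-- The universal property of `V ⊗_K W`, for morphisms of bimodules. -/
def liftHom {V : KBimod.{u, v} k t} {W : KBimod.{u, w} k t} {X : KBimod.{u, x} k t}
    (f : V.carrier →ₗ[k] W.carrier →ₗ[k] X.carrier)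
    (h : ∀ a m n, f (V.r a m) n = f m (W.l a n)) (hl : ∀ a m n, f (V.l a m) n = X.l a (f m n))
    (hr : ∀ a m n, f m (W.r a n) = X.r a (f m n)) : KHom (tensor V W) X where
  toLin := lift f h
  map_l a q := by
    induction q using tensor_induction with
    | h0 => simp
    | ht m n => exact hl a m n
    | ha p q hp hq => simp only [map_add, hp, hq]
  map_r a q := by
    induction q using tensor_induction with
    | h0 => simp
    | ht m n => exact hr a m n
    | ha p q hp hq => simp only [map_add, hp, hq]

/-- The map `m ⊗ n ↦ f m ⊗ g n` (without any sign). -/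
def map {V : KBimod.{u, v} k t} {W : KBimod.{u, w} k t} {V' : KBimod.{u, x} k t}
    {W' : KBimod.{u, y} k t} (f : KHom V V') (g : KHom W W') :
    KHom (tensor V W) (tensor V' W') :=
  liftHom ((tmLin V' W').compl₁₂ f.toLin g.toLin)
    (fun a m n => by
      change tm (f (V.r a m)) (g n) = tm (f m) (g (W.l a n))
      rw [f.map_r, g.map_l, tm_balance])
    (fun a m n => by
      change tm (f (V.l a m)) (g n) = _
      rw [f.map_l]; rfl)
    (fun a m n => by
      change tm (f m) (g (W.r a n)) = _
      rw [g.map_r]; rfl)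

/-- The associativity isomorphism `(V ⊗ W) ⊗ X → V ⊗ (W ⊗ X)`. -/
def assoc (V : KBimod.{u, v} k t) (W : KBimod.{u, w} k t) (X : KBimod.{u, x} k t) :
    KHom (tensor (tensor V W) X) (tensor V (tensor W X)) :=
  liftHom
    (lift (LinearMap.mk₂ k (fun m n => (tmLin V (tensor W X) m) ∘ₗ (tmLin W X n))
        (fun _ _ _ => by ext; simp) (fun _ _ _ => by ext; simp)
        (fun _ _ _ => by ext; simp) (fun _ _ _ => by ext; simp))
      (fun a m n => by
        ext q
        change tm (V.r a m) (tm n q) = tm m (tm (W.l a n) q)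
        rw [tm_balance]; rfl))
    (fun a p q => by
      induction p using tensor_induction with
      | h0 => simp
      | ht m n =>
        change tm m (tm (W.r a n) q) = tm m (tm n (X.l a q))
        rw [tm_balance]
      | ha p p' hp hp' => simp only [map_add, LinearMap.add_apply, hp, hp'])
    (fun a p q => by
      induction p using tensor_induction with
      | h0 => simp
      | ht m n => rfl
      | ha p p' hp hp' => simp only [map_add, LinearMap.add_apply, hp, hp'])
    (fun a p q => by
      induction p using tensor_induction with
      | h0 => simp
      | ht m n => rfl
      | ha p p' hp hp' => simp only [map_add, LinearMap.add_apply, hp, hp'])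

/-- The associativity isomorphism `V ⊗ (W ⊗ X) → (V ⊗ W) ⊗ X`. -/
def assocInv (V : KBimod.{u, v} k t) (W : KBimod.{u, w} k t) (X : KBimod.{u, x} k t) :
    KHom (tensor V (tensor W X)) (tensor (tensor V W) X) :=
  liftHom
    (LinearMap.flip (lift (LinearMap.mk₂ k
        (fun n q => (LinearMap.flip (tmLin (tensor V W) X) q) ∘ₗ (LinearMap.flip (tmLin V W) n))
        (fun _ _ _ => by ext; simp) (fun _ _ _ => by ext; simp)
        (fun _ _ _ => by ext; simp) (fun _ _ _ => by ext; simp))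
      (fun a n q => by
        ext m
        change tm (tm m (W.r a n)) q = tm (tm m n) (X.l a q)
        rw [← tm_balance]; rfl)))
    (fun a m p => by
      induction p using tensor_induction with
      | h0 => simp
      | ht n q =>
        change tm (tm (V.r a m) n) q = tm (tm m (W.l a n)) q
        rw [tm_balance]
      | ha p p' hp hp' => simp only [map_add, hp, hp'])
    (fun a m p => by
      induction p using tensor_induction with
      | h0 => simp
      | ht n q => rfl
      | ha p p' hp hp' => simp only [map_add, hp, hp'])
    (fun a m p => by
      induction p using tensor_induction with
      | h0 => simp
      | ht n q => rfl
      | ha p p' hp hp' => simp only [map_add, hp, hp'])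

/-- The isomorphism `K ⊗ V → V`, `x ⊗ v ↦ x v`. -/
def leftUnit (V : KBimod.{u, v} k t) : KHom (tensor (unit k t) V) V :=
  liftHom (V := unit k t) V.l.toLinearMap
    (fun a (b : Fin t → k) m => by
      change V.l (a * b) m = V.l b (V.l a m)
      rw [mul_comm, map_mul]; rfl)
    (fun a (b : Fin t → k) m => by
      change V.l (a * b) m = V.l a (V.l b m)
      rw [map_mul]; rfl)
    (fun a (b : Fin t → k) m => V.comm b a m)

/-- The isomorphism `V → K ⊗ V`, `v ↦ 1 ⊗ v`. -/
def leftUnitInv (V : KBimod.{u, v} k t) : KHom V (tensor (unit k t) V) where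
  toLin := tmLin (unit k t) V (1 : Fin t → k)
  map_l a m := by
    refine (tm_balance (V := unit k t) a (1 : Fin t → k) m).symm.trans ?_
    rfl
  map_r _ _ := rfl

/-- The isomorphism `V ⊗ K → V`, `v ⊗ x ↦ v x`. -/
def rightUnit (V : KBimod.{u, v} k t) : KHom (tensor V (unit k t)) V :=
  liftHom (W := unit k t) (LinearMap.flip V.r.toLinearMap)
    (fun a m (b : Fin t → k) => by
      change V.r b (V.r a m) = V.r (a * b) m
      rw [mul_comm, map_mul]; rfl)
    (fun a m (b : Fin t → k) => (V.comm a b m).symm)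
    (fun a m (b : Fin t → k) => by
      change V.r (a * b) m = V.r a (V.r b m)
      rw [map_mul]; rfl)

/-- The isomorphism `V → V ⊗ K`, `v ↦ v ⊗ 1`. -/
def rightUnitInv (V : KBimod.{u, v} k t) : KHom V (tensor V (unit k t)) where
  toLin := LinearMap.flip (tmLin V (unit k t)) (1 : Fin t → k)
  map_l _ _ := rfl
  map_r a m := by
    refine (tm_balance (W := unit k t) a m (1 : Fin t → k)).trans ?_
    rfl

/-- A direct sum of `K`-bimodules. -/
abbrev dsum (V : ℕ → KBimod.{u, v} k t) : KBimod.{u, v} k t where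
  carrier := DirectSum ℕ (fun n => (V n).carrier)
  l := AlgHom.ofLinearMap
    { toFun := fun a => DirectSum.lmap (fun n => (V n).l a)
      map_add' := fun a b => by ext; simp
      map_smul' := fun a b => by ext; simp }
    (by ext; simp) (fun a b => by ext; simp)
  r := AlgHom.ofLinearMap
    { toFun := fun a => DirectSum.lmap (fun n => (V n).r a)
      map_add' := fun a b => by ext; simp
      map_smul' := fun a b => by ext; simp }
    (by ext; simp) (fun a b => by ext; simp)
  comm a b q := by
    refine DFinsupp.ext fun n => ?_
    simpa using (V n).comm a b (q n)

/-- The inclusion of a summand. -/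
def incl (V : ℕ → KBimod.{u, v} k t) (n : ℕ) : KHom (V n) (dsum V) where
  toLin := DirectSum.lof k ℕ (fun n => (V n).carrier) n
  map_l a m := (DirectSum.lmap_lof (R := k) (fun n => (V n).l a) n m).symm
  map_r a m := (DirectSum.lmap_lof (R := k) (fun n => (V n).r a) n m).symm

/-- Maps out of a direct sum. -/
def desc {V : ℕ → KBimod.{u, v} k t} {X : KBimod.{u, x} k t} (f : ∀ n, KHom (V n) X) :
    KHom (dsum V) X where
  toLin := DirectSum.toModule k ℕ X.carrier (fun n => (f n).toLin)
  map_l a m := by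
    have : (DirectSum.toModule k ℕ X.carrier (fun n => (f n).toLin)) ∘ₗ (dsum V).l a =
        X.l a ∘ₗ (DirectSum.toModule k ℕ X.carrier (fun n => (f n).toLin)) := by
      ext n m
      have h := (incl V n).map_l a m
      simp only [LinearMap.comp_apply]
      refine (congrArg _ h.symm).trans ?_
      simp [incl, (f n).map_l]
    exact LinearMap.congr_fun this m
  map_r a m := by
    have : (DirectSum.toModule k ℕ X.carrier (fun n => (f n).toLin)) ∘ₗ (dsum V).r a =
        X.r a ∘ₗ (DirectSum.toModule k ℕ X.carrier (fun n => (f n).toLin)) := by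
      ext n m
      have h := (incl V n).map_r a m
      simp only [LinearMap.comp_apply]
      refine (congrArg _ h.symm).trans ?_
      simp [incl, (f n).map_r]
    exact LinearMap.congr_fun this m

theorem dsum_induction {V : ℕ → KBimod.{u, v} k t} {p : (dsum V).carrier → Prop} (h0 : p 0)
    (hi : ∀ n m, p (incl V n m)) (ha : ∀ q q', p q → p q' → p (q + q')) (q : (dsum V).carrier) :
    p q := DirectSum.induction_on (motive := p) q h0 hi ha

/-- Maps out of `(⨁ V n) ⊗ W`. -/
def descLeft {V : ℕ → KBimod.{u, v} k t} {W : KBimod.{u, w} k t} {X : KBimod.{u, x} k t}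
    (f : ∀ n, KHom (tensor (V n) W) X) : KHom (tensor (dsum V) W) X :=
  let F : (dsum V).carrier →ₗ[k] W.carrier →ₗ[k] X.carrier :=
    DirectSum.toModule k ℕ (W.carrier →ₗ[k] X.carrier)
      (fun n => (tmLin (V n) W).compr₂ (f n).toLin)
  have hF : ∀ n m m', F (incl V n m) m' = f n (tm m m') := fun n m m' =>
    LinearMap.congr_fun (DirectSum.toModule_lof k (φ := fun n =>
      (tmLin (V n) W).compr₂ (f n).toLin) n m) m'
  liftHom F
    (fun a m n => by
      induction m using dsum_induction with
      | h0 => simp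
      | hi i m => rw [← (incl V i).map_r, hF, hF, tm_balance]
      | ha p q hp hq => simp only [map_add, LinearMap.add_apply, hp, hq])
    (fun a m n => by
      induction m using dsum_induction with
      | h0 => simp
      | hi i m =>
        rw [← (incl V i).map_l, hF, hF, ← (f i).map_l]
        rfl
      | ha p q hp hq => simp only [map_add, LinearMap.add_apply, hp, hq])
    (fun a m n => by
      induction m using dsum_induction with
      | h0 => simp
      | hi i m =>
        rw [hF, hF, ← (f i).map_r]
        rfl
      | ha p q hp hq => simp only [map_add, LinearMap.add_apply, hp, hq])

/-- Maps out of `V ⊗ (⨁ W n)`. -/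
def descRight {V : KBimod.{u, v} k t} {W : ℕ → KBimod.{u, w} k t} {X : KBimod.{u, x} k t}
    (f : ∀ n, KHom (tensor V (W n)) X) : KHom (tensor V (dsum W)) X :=
  let F : (dsum W).carrier →ₗ[k] V.carrier →ₗ[k] X.carrier :=
    DirectSum.toModule k ℕ (V.carrier →ₗ[k] X.carrier)
      (fun n => ((tmLin V (W n)).compr₂ (f n).toLin).flip)
  have hF : ∀ n m m', F (incl W n m) m' = f n (tm m' m) := fun n m m' =>
    LinearMap.congr_fun (DirectSum.toModule_lof k (φ := fun n =>
      ((tmLin V (W n)).compr₂ (f n).toLin).flip) n m) m'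
  liftHom (LinearMap.flip F)
    (fun a m n => by
      simp only [LinearMap.flip_apply]
      induction n using dsum_induction with
      | h0 => simp
      | hi i n => rw [← (incl W i).map_l, hF, hF, tm_balance]
      | ha p q hp hq => simp only [map_add, LinearMap.add_apply, hp, hq])
    (fun a m n => by
      simp only [LinearMap.flip_apply]
      induction n using dsum_induction with
      | h0 => simp
      | hi i n =>
        rw [hF, hF, ← (f i).map_l]
        rfl
      | ha p q hp hq => simp only [map_add, LinearMap.add_apply, hp, hq])
    (fun a m n => by
      simp only [LinearMap.flip_apply]
      induction n using dsum_induction with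
      | h0 => simp
      | hi i n =>
        rw [← (incl W i).map_r, hF, hF, ← (f i).map_r]
        rfl
      | ha p q hp hq => simp only [map_add, LinearMap.add_apply, hp, hq])

/-- The tensor powers `V ^ ⊗ n = V ⊗ (V ⊗ (⋯ ⊗ (V ⊗ K)))`. -/
def pow (V : KBimod.{u, u} k t) : ℕ → KBimod.{u, u} k t
  | 0 => unit k t
  | n + 1 => tensor V (pow V n)

/-- The bimodule `T(V) = ⨁ V ^ ⊗ n`. -/
abbrev tens (V : KBimod.{u, u} k t) : KBimod.{u, u} k t := dsum (pow V)

/-- The inclusion `K → T(V)`. -/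
def tensOne (V : KBimod.{u, u} k t) : KHom (unit k t) (tens V) := incl (pow V) 0

/-- The projection `T(V) → K`. -/
def tensProj (V : KBimod.{u, u} k t) : KHom (tens V) (unit k t) :=
  desc fun n => match n with
    | 0 => KHom.id (unit k t)
    | _ + 1 => 0

/-- `V ⊗ T(V) → T(V)`, `v ⊗ (v₁ ⊗ ⋯ ⊗ vₙ) ↦ v ⊗ v₁ ⊗ ⋯ ⊗ vₙ`. -/
def tensCons (V : KBimod.{u, u} k t) : KHom (tensor V (tens V)) (tens V) :=
  descRight fun n => incl (pow V) (n + 1)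

/-- The inclusion `V → T(V)`. -/
def tensIncl (V : KBimod.{u, u} k t) : KHom V (tens V) :=
  (tensCons V).comp ((map (KHom.id V) (tensOne V)).comp (rightUnitInv V))

/-- The projection `T(V) → V`. -/
def tensProjV (V : KBimod.{u, u} k t) : KHom (tens V) V :=
  desc fun n => match n with
    | 1 => rightUnit V
    | _ => 0

/-- Concatenation of tensors `V ^ ⊗ n ⊗ T(V) → T(V)`. -/
def concatAux (V : KBimod.{u, u} k t) : ∀ n, KHom (tensor (pow V n) (tens V)) (tens V)
  | 0 => leftUnit (tens V)
  | n + 1 => (tensCons V).comp ((map (KHom.id V) (concatAux V n)).comp (assoc V (pow V n) (tens V)))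

/-- Concatenation of tensors `T(V) ⊗ T(V) → T(V)`. -/
def concat (V : KBimod.{u, u} k t) : KHom (tensor (tens V) (tens V)) (tens V) :=
  descLeft (concatAux V)

/-- Deconcatenation on `V ^ ⊗ n`, through `Δ(x) = x ⊗ 1` for `x` in `K` and
`Δ(v ⊗ u) = 1 ⊗ (v ⊗ u) + (v ⊗ -) Δ(u)`. -/
def deconcatAux (V : KBimod.{u, u} k t) : ∀ n, KHom (pow V n) (tensor (tens V) (tens V))
  | 0 => (map (tensOne V) (tensOne V)).comp (rightUnitInv (unit k t))
  | n + 1 =>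
    (map (tensOne V) (incl (pow V) (n + 1))).comp (leftUnitInv (pow V (n + 1))) +
      KHom.comp (V := pow V (n + 1)) (map (tensCons V) (KHom.id (tens V)))
        ((assocInv V (tens V) (tens V)).comp (map (KHom.id V) (deconcatAux V n)))

/-- Deconcatenation `v₁ ⊗ ⋯ ⊗ vₙ ↦ ∑ i, (v₁ ⊗ ⋯ ⊗ vᵢ) ⊗ (vᵢ₊₁ ⊗ ⋯ ⊗ vₙ)`. -/
def deconcat (V : KBimod.{u, u} k t) : KHom (tens V) (tensor (tens V) (tens V)) :=
  desc (deconcatAux V)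

/-- Given a parity operator `s` on `V` and a map `f : V → T(V)` of odd degree, the map
`v₁ ⊗ ⋯ ⊗ vₙ ↦ ∑ i, s v₁ ⊗ ⋯ ⊗ s vᵢ₋₁ ⊗ f vᵢ ⊗ vᵢ₊₁ ⊗ ⋯ ⊗ vₙ`, on `V ^ ⊗ n`. -/
def derAux {V : KBimod.{u, u} k t} (s : KHom V V) (f : KHom V (tens V)) :
    ∀ n, KHom (pow V n) (tens V)
  | 0 => 0
  | n + 1 => (concat V).comp (map f (incl (pow V) n)) + (tensCons V).comp (map s (derAux s f n))

/-- The map `∑ id ^ ⊗ (i - 1) ⊗ f ⊗ id ^ ⊗ (n - i)` on `T(V)`, with Koszul signs, for a map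
`f : V → T(V)` of odd degree. Here `s` is the parity operator of `V`. -/
def der {V : KBimod.{u, u} k t} (s : KHom V V) (f : KHom V (tens V)) : KHom (tens V) (tens V) :=
  desc (derAux s f)

/-- Given a parity operator `s` on `V` and a map `g : V ⊗ V → V` of odd degree, the map
`v₁ ⊗ ⋯ ⊗ vₙ ↦ ∑ i, s v₁ ⊗ ⋯ ⊗ s vᵢ₋₁ ⊗ g(vᵢ ⊗ vᵢ₊₁) ⊗ vᵢ₊₂ ⊗ ⋯ ⊗ vₙ`, on `V ^ ⊗ n`. -/
def mergeAux {V : KBimod.{u, u} k t} (s : KHom V V) (g : KHom (tensor V V) V) :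
    ∀ n, KHom (pow V n) (tens V)
  | 0 => 0
  | 1 => 0
  | n + 2 =>
    KHom.comp (V := pow V (n + 2)) (incl (pow V) (n + 1))
        ((map g (KHom.id (pow V n))).comp (assocInv V V (pow V n))) +
      KHom.comp (V := pow V (n + 2)) (tensCons V) (map s (mergeAux s g (n + 1)))

/-- The map `∑ id ^ ⊗ (i - 1) ⊗ g ⊗ id ^ ⊗ (n - i - 1)` on `T(V)`, with Koszul signs, for a map
`g : V ⊗ V → V` of odd degree. Here `s` is the parity operator of `V`. -/
def merge {V : KBimod.{u, u} k t} (s : KHom V V) (g : KHom (tensor V V) V) :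
    KHom (tens V) (tens V) :=
  desc (mergeAux s g)


/-- The kernel of a morphism. -/
abbrev ker {V : KBimod.{u, v} k t} {W : KBimod.{u, w} k t} (f : KHom V W) : KBimod.{u, v} k t where
  carrier := LinearMap.ker f.toLin
  l := AlgHom.ofLinearMap
    { toFun := fun a => (V.l a).restrict (fun m hm => by
        rw [LinearMap.mem_ker] at hm ⊢
        rw [f.map_l, hm, map_zero])
      map_add' := fun a b => by ext; simp
      map_smul' := fun a b => by ext; simp }
    (by ext; simp) (fun a b => by ext; simp)
  r := AlgHom.ofLinearMap
    { toFun := fun a => (V.r a).restrict (fun m hm => by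
        rw [LinearMap.mem_ker] at hm ⊢
        rw [f.map_r, hm, map_zero])
      map_add' := fun a b => by ext; simp
      map_smul' := fun a b => by ext; simp }
    (by ext; simp) (fun a b => by ext; simp)
  comm a b m := Subtype.ext (V.comm a b m)

/-- The inclusion of the kernel. -/
def kerIncl {V : KBimod.{u, v} k t} {W : KBimod.{u, w} k t} (f : KHom V W) : KHom (ker f) V :=
  ⟨(LinearMap.ker f.toLin).subtype, fun _ _ => rfl, fun _ _ => rfl⟩

/-- If `e ∘ η = id`, the projection `V → Ker e`, `m ↦ m - η (e m)`. -/
def kerProj {V : KBimod.{u, v} k t} {W : KBimod.{u, w} k t} (e : KHom V W) (η : KHom W V)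
    (h : ∀ a, e (η a) = a) : KHom V (ker e) where
  toLin := (LinearMap.id - η.toLin ∘ₗ e.toLin).codRestrict _ (fun m => by
    simp [LinearMap.mem_ker, h])
  map_l a m := Subtype.ext (by simp [e.map_l, η.map_l])
  map_r a m := Subtype.ext (by simp [e.map_r, η.map_r])

end KBimod

/-! ## Graded bimodules with a differential -/

section

open KBimod

/-- The data underlying a dg `K`-bimodule: a `K`-bimodule with homogeneous components `gr n`
(lower degree `n`), the parity operator `par` (that is `m ↦ (-1) ^ |m| m`, which implements the
Koszul sign rule) and the differential `d`. The axioms are in `PreDGModule.IsDG`. -/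
structure PreDGModule (k : Type u) [Field k] (t : ℕ) extends KBimod.{u, v} k t where
  gr : ℤ → Submodule k carrier
  par : KHom toKBimod toKBimod
  d : KHom toKBimod toKBimod

namespace PreDGModule

variable {k : Type u} [Field k] {t : ℕ}

/-- The axioms of a dg `K`-bimodule. -/
structure IsDG (M : PreDGModule.{u, v} k t) : Prop where
  internal : DirectSum.IsInternal M.gr
  l_mem : ∀ n a, ∀ m ∈ M.gr n, M.l a m ∈ M.gr n
  r_mem : ∀ n a, ∀ m ∈ M.gr n, M.r a m ∈ M.gr n
  par_apply : ∀ n, ∀ m ∈ M.gr n, M.par m = (n.negOnePow : ℤ) • m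
  d_mem : ∀ n, ∀ m ∈ M.gr n, M.d m ∈ M.gr (n - 1)
  d_d : ∀ m, M.d (M.d m) = 0

/-- `K`, in degree zero. -/
def unit (k : Type u) [Field k] (t : ℕ) : PreDGModule.{u, u} k t where
  toKBimod := KBimod.unit k t
  gr n := if n = 0 then ⊤ else ⊥
  par := KHom.id _
  d := 0

/-- The tensor product over `K`, with `d (m ⊗ n) = d m ⊗ n + (-1) ^ |m| m ⊗ d n`. -/
def tensor (M : PreDGModule.{u, v} k t) (N : PreDGModule.{u, w} k t) :
    PreDGModule.{u, max v w} k t where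
  toKBimod := KBimod.tensor M.toKBimod N.toKBimod
  gr n := Submodule.span k {q | ∃ (i j : ℤ) (a : M.carrier) (b : N.carrier),
    a ∈ M.gr i ∧ b ∈ N.gr j ∧ i + j = n ∧ q = tm a b}
  par := map M.par N.par
  d := map M.d (KHom.id _) + map M.par N.d

/-- The suspension `s M`, with `(s M)ₙ = Mₙ₋₁` and `d (s m) = - s (d m)`. -/
def susp (M : PreDGModule.{u, v} k t) : PreDGModule.{u, v} k t where
  toKBimod := M.toKBimod
  gr n := M.gr (n - 1)
  par := -M.par
  d := -M.d

/-- The desuspension `s⁻¹ M`, with `(s⁻¹ M)ₙ = Mₙ₊₁` and `d (s⁻¹ m) = - s⁻¹ (d m)`. -/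
def desusp (M : PreDGModule.{u, v} k t) : PreDGModule.{u, v} k t where
  toKBimod := M.toKBimod
  gr n := M.gr (n + 1)
  par := -M.par
  d := -M.d

/-- The tensor powers of a dg `K`-bimodule, with their total degree and parity. -/
def pow (M : PreDGModule.{u, u} k t) : ∀ n : ℕ,
    (ℤ → Submodule k (KBimod.pow M.toKBimod n).carrier) ×
      KHom (KBimod.pow M.toKBimod n) (KBimod.pow M.toKBimod n)
  | 0 => ((unit k t).gr, (unit k t).par)
  | n + 1 => (fun i => Submodule.span k {q | ∃ (i₁ i₂ : ℤ) (a : M.carrier)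
      (b : (KBimod.pow M.toKBimod n).carrier),
      a ∈ M.gr i₁ ∧ b ∈ (pow M n).1 i₂ ∧ i₁ + i₂ = i ∧ q = tm a b}, map M.par (pow M n).2)

/-- The bimodule `T(M) = ⨁ M ^ ⊗ n` with its grading by total degree and with a given
differential. -/
def tens (M : PreDGModule.{u, u} k t) (D : KHom (KBimod.tens M.toKBimod) (KBimod.tens M.toKBimod)) :
    PreDGModule.{u, u} k t where
  toKBimod := KBimod.tens M.toKBimod
  gr i := ⨆ n, ((pow M n).1 i).map (incl (KBimod.pow M.toKBimod) n).toLin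
  par := desc fun n => (incl (KBimod.pow M.toKBimod) n).comp (pow M n).2
  d := D

/-- The kernel of an augmentation `e` that is split by `η`. The operators are compressed to the
kernel by means of the projection `m ↦ m - η (e m)`; when they commute with `e`, as the
differential and the parity operator of an augmented object do, this is their restriction. -/
def ker (M : PreDGModule.{u, u} k t) (e : KHom M.toKBimod (KBimod.unit k t))
    (η : KHom (KBimod.unit k t) M.toKBimod) (h : ∀ a, e (η a) = a) : PreDGModule.{u, u} k t where
  toKBimod := KBimod.ker e
  gr n := (M.gr n).comap (kerIncl e).toLin
  par := (kerProj e η h).comp (M.par.comp (kerIncl e))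
  d := (kerProj e η h).comp (M.d.comp (kerIncl e))

end PreDGModule

/-! ## Augmented dg `K`-rings and coaugmented dg `K`-corings -/

/-- The data underlying an augmented dg `K`-ring: product, unit, augmentation. The axioms are in
`PreDGRing.IsAugDGRing`. -/
structure PreDGRing (k : Type u) [Field k] (t : ℕ) extends PreDGModule.{u, u} k t where
  mul : KHom (KBimod.tensor toKBimod toKBimod) toKBimod
  one : KHom (KBimod.unit k t) toKBimod
  aug : KHom toKBimod (KBimod.unit k t)
  aug_one : ∀ a, aug (one a) = a

/-- The data underlying a coaugmented dg `K`-coring: coproduct, counit, coaugmentation. -/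
structure PreDGCoring (k : Type u) [Field k] (t : ℕ) extends PreDGModule.{u, u} k t where
  comul : KHom toKBimod (KBimod.tensor toKBimod toKBimod)
  counit : KHom toKBimod (KBimod.unit k t)
  coaug : KHom (KBimod.unit k t) toKBimod
  counit_coaug : ∀ a, counit (coaug a) = a

namespace PreDGRing

variable {k : Type u} [Field k] {t : ℕ} (A : PreDGRing.{u} k t)

/-- The product of two elements. -/
def m (a b : A.carrier) : A.carrier := A.mul (tm a b)

/-- The axioms of an augmented dg `K`-ring. -/
structure IsAugDGRing : Prop extends A.toPreDGModule.IsDG where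
  mul_assoc : ∀ a b c, A.m (A.m a b) c = A.m a (A.m b c)
  one_mul : ∀ x a, A.m (A.one x) a = A.l x a
  mul_one : ∀ a x, A.m a (A.one x) = A.r x a
  mul_mem : ∀ i j, ∀ a ∈ A.gr i, ∀ b ∈ A.gr j, A.m a b ∈ A.gr (i + j)
  one_mem : ∀ x, A.one x ∈ A.gr 0
  leibniz : ∀ a b, A.d (A.m a b) = A.m (A.d a) b + A.m (A.par a) (A.d b)
  d_one : ∀ x, A.d (A.one x) = 0
  aug_mul : ∀ a b, A.aug (A.m a b) = (A.aug a * A.aug b : Fin t → k)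
  aug_gr : ∀ n, n ≠ 0 → ∀ a ∈ A.gr n, A.aug a = 0
  aug_d : ∀ a, A.aug (A.d a) = 0

/-- All homogeneous components are finite dimensional over `k`. -/
def LocallyFinite : Prop := ∀ n, FiniteDimensional k (A.gr n)

/-- `Aₙ = 0` for `n ≫ 0`. -/
def BoundedAbove : Prop := ∃ N : ℤ, ∀ n, N < n → A.gr n = ⊥

/-- `Aₙ = 0` for `n ≪ 0`. -/
def BoundedBelow : Prop := ∃ N : ℤ, ∀ n, n < N → A.gr n = ⊥

/-- The power `I ^ (n + 1)` of the augmentation ideal `I`. -/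
def augPow : ℕ → Submodule k A.carrier
  | 0 => LinearMap.ker A.aug.toLin
  | n + 1 => Submodule.span k {c | ∃ a b, A.aug a = 0 ∧ b ∈ augPow n ∧ c = A.m a b}

/-- The powers of the augmentation ideal have zero intersection. -/
def IsComplete : Prop := ⨅ n, A.augPow n = ⊥

end PreDGRing

/-! ## The graded dual coring -/

namespace PreDGRing

variable {k : Type u} [Field k] {t : ℕ} (A : PreDGRing.{u} k t)

/-- The linear forms that vanish on all but finitely many homogeneous components. -/
def gradedDual : Submodule k (Module.Dual k A.carrier) where
  carrier := {f | ∃ S : Finset ℤ, ∀ n ∉ S, ∀ a ∈ A.gr n, f a = 0}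
  zero_mem' := ⟨∅, fun _ _ _ _ => rfl⟩
  add_mem' := by
    classical
    rintro f g ⟨S, hS⟩ ⟨T, hT⟩
    refine ⟨S ∪ T, fun n hn a ha => ?_⟩
    rw [Finset.mem_union, not_or] at hn
    simp [hS n hn.1 a ha, hT n hn.2 a ha]
  smul_mem' := by
    rintro c f ⟨S, hS⟩
    exact ⟨S, fun n hn a ha => by simp [hS n hn a ha]⟩

variable {A}

/-- Precomposition with an operator that preserves the degree up to a shift. -/
def dualMap (φ : Module.End k A.carrier) (e : ℤ) (h : ∀ n, ∀ a ∈ A.gr n, φ a ∈ A.gr (n + e)) :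
    Module.End k A.gradedDual :=
  (Module.Dual.transpose (R := k) φ).restrict (by
    classical
    rintro f ⟨S, hS⟩
    refine ⟨S.image (fun n => n - e), fun n hn a ha => hS (n + e) (fun hm => hn ?_) _ (h n a ha)⟩
    exact Finset.mem_image.2 ⟨n + e, hm, by ring⟩)

/-- The bimodule structure of the graded dual: `(x f y) a = f (y a x)`. -/
abbrev dualBimod (hA : A.IsAugDGRing) : KBimod.{u, u} k t where
  carrier := A.gradedDual
  l := AlgHom.ofLinearMap
    { toFun := fun x => dualMap (A.r x) 0 (fun n a ha => by simpa using hA.r_mem n x a ha)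
      map_add' := fun x y => by ext f a; simp [dualMap]
      map_smul' := fun x y => by ext f a; simp [dualMap] }
    (by
      ext f a
      exact congrArg f.1 (LinearMap.congr_fun (map_one A.r) a))
    (fun x y => by
      ext f a
      have : A.r (x * y) a = A.r y (A.r x a) := by rw [_root_.mul_comm, map_mul]; rfl
      exact congrArg f.1 this)
  r := AlgHom.ofLinearMap
    { toFun := fun x => dualMap (A.l x) 0 (fun n a ha => by simpa using hA.l_mem n x a ha)
      map_add' := fun x y => by ext f a; simp [dualMap]
      map_smul' := fun x y => by ext f a; simp [dualMap] }
    (by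
      ext f a
      exact congrArg f.1 (LinearMap.congr_fun (map_one A.l) a))
    (fun x y => by
      ext f a
      have : A.l (x * y) a = A.l y (A.l x a) := by rw [_root_.mul_comm, map_mul]; rfl
      exact congrArg f.1 this)
  comm x y f := by
    ext a
    exact congrArg f.1 (A.comm y x a)

theorem par_mem (hA : A.IsAugDGRing) (n : ℤ) (a : A.carrier) (ha : a ∈ A.gr n) :
    A.par a ∈ A.gr n := by
  rw [hA.par_apply n a ha]
  exact zsmul_mem ha _

/-- The graded dual, with `d f = - (-1) ^ |f| f ∘ d`. -/
def dualModule (hA : A.IsAugDGRing) : PreDGModule.{u, u} k t where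
  toKBimod := dualBimod hA
  gr n :=
    { carrier := {f | ∀ i, i ≠ -n → ∀ a ∈ A.gr i, f.1 a = 0}
      zero_mem' := fun _ _ _ _ => rfl
      add_mem' := fun {f g} hf hg i hi a ha => by
        simp [hf i hi a ha, hg i hi a ha]
      smul_mem' := fun c f hf i hi a ha => by
        simp [hf i hi a ha] }
  par :=
    { toLin := dualMap A.par.toLin 0 (fun n a ha => by simpa using par_mem hA n a ha)
      map_l := fun x f => by
        ext a
        exact congrArg f.1 (A.par.map_r x a).symm
      map_r := fun x f => by
        ext a
        exact congrArg f.1 (A.par.map_l x a).symm }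
  d := -
    { toLin := dualMap (A.par.toLin ∘ₗ A.d.toLin) (-1) (fun n a ha =>
        par_mem hA _ _ (hA.d_mem n a ha))
      map_l := fun x f => by
        ext a
        exact congrArg f.1 ((A.par.comp A.d).map_r x a).symm
      map_r := fun x f => by
        ext a
        exact congrArg f.1 ((A.par.comp A.d).map_l x a).symm }

/-- The canonical map `A^∨ ⊗ A^∨ → (A ⊗ A)^∨`: the form attached to `f ⊗ g` sends `u ⊗ v` to
`∑ j, g (u eⱼ) f (eⱼ v)`, where `eⱼ` runs through the standard basis of `K = k ^ t`. For `u` in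
`A eⱼ` and `v` in `eⱼ A` this is `g u * f v`. -/
def dualPairing (hA : A.IsAugDGRing) :
    (KBimod.tensor (dualBimod hA) (dualBimod hA)).carrier →ₗ[k] A.carrier →ₗ[k] A.carrier →ₗ[k] k :=
  KBimod.lift
    (LinearMap.mk₂ k
      (fun (f g : A.gradedDual) => LinearMap.mk₂ k (fun (a b : A.carrier) => ∑ j : Fin t,
          g.1 (A.r (Pi.single j 1) a) * f.1 (A.l (Pi.single j 1) b))
        (fun a a' b => by simp [add_mul, Finset.sum_add_distrib])
        (fun c a b => by simp [Finset.mul_sum, mul_assoc])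
        (fun a b b' => by simp [mul_add, Finset.sum_add_distrib])
        (fun c a b => by simp [Finset.mul_sum, mul_left_comm]))
      (fun f f' g => by ext a b; simp [mul_add, Finset.sum_add_distrib])
      (fun c f g => by ext a b; simp [Finset.mul_sum, mul_left_comm])
      (fun f g g' => by ext a b; simp [add_mul, Finset.sum_add_distrib])
      (fun c f g => by ext a b; simp [Finset.mul_sum, _root_.mul_assoc]))
    (fun x (f g : A.gradedDual) => by
      ext a b
      change ∑ j : Fin t, g.1 (A.r (Pi.single j 1) a) * f.1 (A.l x (A.l (Pi.single j 1) b)) =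
        ∑ j : Fin t, g.1 (A.r x (A.r (Pi.single j 1) a)) * f.1 (A.l (Pi.single j 1) b)
      refine Finset.sum_congr rfl fun j _ => ?_
      have hx : x * Pi.single j 1 = x j • (Pi.single j 1 : Fin t → k) := by
        ext i
        by_cases h : i = j
        · subst h; simp
        · simp [h]
      have h1 : A.l x (A.l (Pi.single j 1) b) = x j • A.l (Pi.single j 1) b := by
        rw [← LinearMap.smul_apply, ← map_smul, ← hx, map_mul]; rfl
      have h2 : A.r x (A.r (Pi.single j 1) a) = x j • A.r (Pi.single j 1) a := by
        rw [← LinearMap.smul_apply, ← map_smul, ← hx, map_mul]; rfl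
      rw [h1, h2]
      simp [mul_left_comm, _root_.mul_assoc])

theorem dualPairing_tm (hA : A.IsAugDGRing) (f g : A.gradedDual) (a b : A.carrier) :
    dualPairing hA (tm (V := dualBimod hA) (W := dualBimod hA) f g) a b =
      ∑ j : Fin t, g.1 (A.r (Pi.single j 1) a) * f.1 (A.l (Pi.single j 1) b) := rfl

/-- The decomposition of `A` as the direct sum of its homogeneous components. -/
noncomputable def decomp (hA : A.IsAugDGRing) : A.carrier ≃ₗ[k] DirectSum ℤ (fun n => A.gr n) :=
  (LinearEquiv.ofBijective (DirectSum.coeLinearMap A.gr)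
    (show Function.Bijective (DirectSum.coeLinearMap A.gr) from hA.internal)).symm

theorem decomp_symm (hA : A.IsAugDGRing) (q : DirectSum ℤ (fun n => A.gr n)) :
    (decomp hA).symm q = DirectSum.coeLinearMap A.gr q := rfl

/-- The projection of `A` onto its component of degree `n`. -/
noncomputable def proj (hA : A.IsAugDGRing) (n : ℤ) : A.carrier →ₗ[k] A.gr n :=
  DirectSum.component k ℤ (fun n => A.gr n) n ∘ₗ (decomp hA).toLinearMap

theorem proj_of_mem (hA : A.IsAugDGRing) {n : ℤ} (m : ℤ) {a : A.carrier} (ha : a ∈ A.gr n) :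
    (proj hA m a : A.carrier) = if n = m then a else 0 := by
  have h : decomp hA a = DirectSum.lof k ℤ (fun n => A.gr n) n ⟨a, ha⟩ := by
    rw [← LinearEquiv.eq_symm_apply, decomp_symm]
    simp
  simp only [proj, LinearMap.comp_apply, LinearEquiv.coe_coe, h]
  split_ifs with hnm
  · subst hnm
    rw [DirectSum.component.lof_self]
  · rw [DirectSum.component.of, dif_neg hnm]
    rfl

theorem exists_sum_proj (hA : A.IsAugDGRing) (a : A.carrier) :
    ∃ S : Finset ℤ, (∀ n ∉ S, proj hA n a = 0) ∧ ∑ n ∈ S, (proj hA n a : A.carrier) = a := by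
  classical
  refine ⟨DFinsupp.support (decomp hA a), fun n hn => ?_, ?_⟩
  · exact DFinsupp.notMem_support_iff.1 hn
  · conv_rhs => rw [← (decomp hA).symm_apply_apply a, decomp_symm,
      DirectSum.coeLinearMap_eq_dfinsuppSum]
    rfl

/-- The form `f (b · -)`. -/
def leftTranslate (hA : A.IsAugDGRing) (n : ℤ) (b : A.gr n) : A.gradedDual →ₗ[k] A.gradedDual :=
  (Module.Dual.transpose (R := k)
    (A.mul.toLin ∘ₗ tmLin A.toKBimod A.toKBimod b.1)).restrict (by
      classical
      rintro f ⟨S, hS⟩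
      refine ⟨S.image (fun i => i - n), fun i hi a ha =>
        hS (n + i) (fun hm => hi ?_) _ (hA.mul_mem n i _ b.2 a ha)⟩
      exact Finset.mem_image.2 ⟨n + i, hm, by ring⟩)

theorem leftTranslate_apply (hA : A.IsAugDGRing) (n : ℤ) (b : A.gr n) (f : A.gradedDual)
    (a : A.carrier) : (leftTranslate hA n b f).1 a = f.1 (A.m b.1 a) := rfl

/-- The extension by zero of a linear form on the component of degree `n`. -/
noncomputable def extendForm (hA : A.IsAugDGRing) (n : ℤ) :
    Module.Dual k (A.gr n) →ₗ[k] A.gradedDual :=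
  (Module.Dual.transpose (R := k) (proj hA n)).codRestrict _ (fun φ =>
    ⟨{n}, fun i hi a ha => by
      have h : proj hA n a = 0 := Subtype.ext (by
        rw [proj_of_mem hA n ha, if_neg (by simpa using hi)]; rfl)
      change φ (proj hA n a) = 0
      rw [h, map_zero]⟩)

theorem extendForm_apply (hA : A.IsAugDGRing) (n : ℤ) (φ : Module.Dual k (A.gr n)) (a : A.carrier) :
    (extendForm hA n φ).1 a = φ (proj hA n a) := rfl

theorem m_add_left (a a' b : A.carrier) : A.m (a + a') b = A.m a b + A.m a' b :=
  LinearMap.congr_fun (((tmLin A.toKBimod A.toKBimod).compr₂ A.mul.toLin).map_add a a') b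

theorem m_sum_left {ι : Type*} (s : Finset ι) (a : ι → A.carrier) (b : A.carrier) :
    A.m (∑ i ∈ s, a i) b = ∑ i ∈ s, A.m (a i) b :=
  map_sum (((tmLin A.toKBimod A.toKBimod).compr₂ A.mul.toLin).flip b) a s

theorem m_smul_left (c : k) (a b : A.carrier) : A.m (c • a) b = c • A.m a b :=
  LinearMap.congr_fun (((tmLin A.toKBimod A.toKBimod).compr₂ A.mul.toLin).map_smul c a) b

theorem m_sum_right {ι : Type*} (s : Finset ι) (a : A.carrier) (b : ι → A.carrier) :
    A.m a (∑ i ∈ s, b i) = ∑ i ∈ s, A.m a (b i) :=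
  map_sum (((tmLin A.toKBimod A.toKBimod).compr₂ A.mul.toLin) a) b s

theorem m_balance (x : Fin t → k) (a b : A.carrier) : A.m (A.r x a) b = A.m a (A.l x b) :=
  congrArg A.mul.toLin (tm_balance x a b)

/-- The component `∑ f (b · -) ⊗ b^*` of the coproduct of `f`, where `b` runs through a basis of
the component of degree `n`. -/
noncomputable def comulAux (hA : A.IsAugDGRing) {n : ℤ} {ι : Type} [Fintype ι]
    (b : Module.Basis ι k (A.gr n)) :
    A.gradedDual →ₗ[k] (KBimod.tensor (dualBimod hA) (dualBimod hA)).carrier :=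
  ∑ i, LinearMap.flip (tmLin (dualBimod hA) (dualBimod hA)) (extendForm hA n (b.coord i)) ∘ₗ
    leftTranslate hA n (b i)

section comul

variable (hA : A.IsAugDGRing) {n : ℤ} {ι : Type} [Fintype ι] (b : Module.Basis ι k (A.gr n))

theorem comulAux_apply (f : A.gradedDual) :
    comulAux hA b f = ∑ i, tm (V := dualBimod hA) (W := dualBimod hA)
      (leftTranslate hA n (b i) f) (extendForm hA n (b.coord i)) := by
  simp only [comulAux, LinearMap.sum_apply]
  rfl

theorem comulAux_l (x : Fin t → k) (f : A.gradedDual) : comulAux hA b ((dualBimod hA).l x f) =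
    (KBimod.tensor (dualBimod hA) (dualBimod hA)).l x (comulAux hA b f) := by
  rw [comulAux_apply, comulAux_apply, map_sum]
  refine Finset.sum_congr rfl fun i _ => ?_
  have h : leftTranslate hA n (b i) ((dualBimod hA).l x f) =
      (dualBimod hA).l x (leftTranslate hA n (b i) f) := by
    ext a
    exact congrArg f.1 (A.mul.map_r x (tm (b i).1 a)).symm
  rw [h]
  rfl

theorem comulAux_r (x : Fin t → k) (f : A.gradedDual) : comulAux hA b ((dualBimod hA).r x f) =
    (KBimod.tensor (dualBimod hA) (dualBimod hA)).r x (comulAux hA b f) := by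
  rw [comulAux_apply, comulAux_apply, map_sum]
  let y : Module.End k (A.gr n) := (A.l x).restrict (hA.l_mem n x)
  have h1 : ∀ i, leftTranslate hA n (b i) ((dualBimod hA).r x f) =
      ∑ j, b.repr (y (b i)) j • leftTranslate hA n (b j) f := by
    intro i
    ext a
    have h : A.l x (b i).1 = ∑ j, b.repr (y (b i)) j • (b j).1 := by
      have h2 : A.l x (b i).1 = (y (b i)).1 := rfl
      have h3 := congrArg Subtype.val (b.sum_repr (y (b i)))
      simp only [Submodule.coe_sum, Submodule.coe_smul] at h3
      rw [h2, ← h3]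
    have h' : ((leftTranslate hA n (b i) ((dualBimod hA).r x f)).1) a =
        f.1 (A.m (A.l x (b i).1) a) :=
      congrArg f.1 (A.mul.map_l x (tm (b i).1 a)).symm
    rw [h', h, m_sum_left]
    simp [m_smul_left, leftTranslate_apply]
  have h2 : ∀ j, (dualBimod hA).r x (extendForm hA n (b.coord j)) =
      ∑ i, b.repr (y (b i)) j • extendForm hA n (b.coord i) := by
    intro j
    ext a
    have h3 : proj hA n (A.l x a) = y (proj hA n a) := by
      obtain ⟨S, hS, ha⟩ := exists_sum_proj hA a
      have : ∀ i ∈ S, proj hA n (A.l x (proj hA i a).1) = y (proj hA n (proj hA i a).1) := by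
        intro i _
        refine Subtype.ext ?_
        have e1 := proj_of_mem hA n (hA.l_mem i x _ (proj hA i a).2)
        have e2 := proj_of_mem hA n (proj hA i a).2
        change _ = A.l x (proj hA n (proj hA i a).1).1
        rw [e1, e2]
        split_ifs <;> simp
      conv_lhs => rw [← ha]
      conv_rhs => rw [← ha]
      simp only [map_sum]
      exact Finset.sum_congr rfl this
    change b.coord j (proj hA n (A.l x a)) = _
    rw [h3]
    simp only [Submodule.coe_sum, Submodule.coe_smul, LinearMap.sum_apply, LinearMap.smul_apply,
      extendForm_apply]
    have h5 : y (proj hA n a) = ∑ i, b.repr (proj hA n a) i • y (b i) := by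
      conv_lhs => rw [← b.sum_repr (proj hA n a)]
      simp only [map_sum, map_smul]
    rw [h5]
    simp only [map_sum, map_smul, smul_eq_mul, Module.Basis.coord_apply, mul_comm]
  have h3 : ∀ i, (KBimod.tensor (dualBimod hA) (dualBimod hA)).r x
      (tm (V := dualBimod hA) (W := dualBimod hA)
        (leftTranslate hA n (b i) f) (extendForm hA n (b.coord i))) =
      tmLin (dualBimod hA) (dualBimod hA) (leftTranslate hA n (b i) f)
        ((dualBimod hA).r x (extendForm hA n (b.coord i))) := fun i => rfl
  have h4 : ∀ i, tm (V := dualBimod hA) (W := dualBimod hA)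
        (leftTranslate hA n (b i) ((dualBimod hA).r x f)) (extendForm hA n (b.coord i)) =
      tmLin (dualBimod hA) (dualBimod hA) (leftTranslate hA n (b i) ((dualBimod hA).r x f))
        (extendForm hA n (b.coord i)) := fun i => rfl
  refine (Finset.sum_congr rfl fun i _ => h4 i).trans ?_
  refine Eq.trans ?_ (Finset.sum_congr rfl fun i _ => h3 i).symm
  simp only [h1, h2, map_sum, map_smul, LinearMap.sum_apply, LinearMap.smul_apply]
  exact Finset.sum_comm

theorem comulAux_pairing (f : A.gradedDual) (u v : A.carrier) :
    dualPairing hA (comulAux hA b f) u v =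
      ∑ j : Fin t, f.1 (A.m (proj hA n (A.r (Pi.single j 1) u)) (A.l (Pi.single j 1) v)) := by
  rw [comulAux_apply, map_sum]
  simp only [LinearMap.sum_apply]
  refine (Finset.sum_congr rfl fun i _ => dualPairing_tm hA _ _ u v).trans ?_
  rw [Finset.sum_comm]
  refine Finset.sum_congr rfl fun j _ => ?_
  conv_rhs => rw [← b.sum_repr (proj hA n (A.r (Pi.single j 1) u))]
  simp only [Submodule.coe_sum, Submodule.coe_smul, m_sum_left, m_smul_left, map_sum, map_smul]
  rfl

theorem comulAux_eq_zero (f : A.gradedDual)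
    (h : ∀ a ∈ A.gr n, ∀ i, ∀ c ∈ A.gr i, f.1 (A.m a c) = 0) : comulAux hA b f = 0 := by
  rw [comulAux_apply]
  refine Finset.sum_eq_zero fun i _ => ?_
  have : leftTranslate hA n (b i) f = 0 := by
    ext c
    obtain ⟨S, -, hc⟩ := exists_sum_proj hA c
    rw [leftTranslate_apply, ← hc, m_sum_right, map_sum]
    exact Finset.sum_eq_zero fun j _ => h _ (b i).2 j _ (proj hA j c).2
  rw [this]
  exact LinearMap.map_zero₂ (tmLin (dualBimod hA) (dualBimod hA)) _

end comul

theorem exists_comul (hA : A.IsAugDGRing) (hf : A.LocallyFinite)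
    (hb : A.BoundedAbove ∨ A.BoundedBelow) :
    ∃ Δ : KHom (dualBimod hA) (KBimod.tensor (dualBimod hA) (dualBimod hA)),
      ∀ (f : A.gradedDual) (u v : A.carrier), dualPairing hA (Δ f) u v = f.1 (A.m u v) := by
  classical
  have := hf
  let F : ℤ → A.gradedDual →ₗ[k] (KBimod.tensor (dualBimod hA) (dualBimod hA)).carrier :=
    fun n => haveI := hf n; comulAux hA (Module.finBasis k (A.gr n))
  have hfin : ∀ f, (Function.support fun n => F n f).Finite := by
    rintro ⟨f, S, hS⟩
    obtain ⟨M, hM⟩ : ∃ M : ℤ, ∀ s ∈ S, -M ≤ s ∧ s ≤ M := by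
      refine ⟨∑ s ∈ S, |s|, fun s hs => ?_⟩
      have := Finset.single_le_sum (f := fun s : ℤ => |s|) (fun i _ => abs_nonneg i) hs
      exact abs_le.1 this
    have key : ∀ n, F n ⟨f, S, hS⟩ ≠ 0 → ∃ i, A.gr n ≠ ⊥ ∧ A.gr i ≠ ⊥ ∧ n + i ∈ S := by
      intro n hn
      by_contra! hc
      refine hn (comulAux_eq_zero hA _ _ fun a ha i c hc' => ?_)
      by_cases h1 : A.gr n = ⊥
      · rw [h1, Submodule.mem_bot] at ha
        subst ha
        simpa using congrArg f (m_smul_left (A := A) 0 0 c)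
      · by_cases h2 : A.gr i = ⊥
        · rw [h2, Submodule.mem_bot] at hc'
          subst hc'
          have : A.m a 0 = 0 := by simpa using m_sum_right (A := A) (∅ : Finset ℕ) a (fun _ => 0)
          simp [this]
        · exact hS _ (hc i h1 h2) _ (hA.mul_mem n i a ha c hc')
    rcases hb with ⟨N, hN⟩ | ⟨N, hN⟩
    · refine (Set.finite_Icc (-M - N) N).subset fun n hn => ?_
      obtain ⟨i, h1, h2, h3⟩ := key n hn
      have h4 : n ≤ N := not_lt.1 fun h => h1 (hN n h)
      have h5 : i ≤ N := not_lt.1 fun h => h2 (hN i h)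
      have h6 := hM _ h3
      constructor <;> linarith
    · refine (Set.finite_Icc N (M - N)).subset fun n hn => ?_
      obtain ⟨i, h1, h2, h3⟩ := key n hn
      have h4 : N ≤ n := not_lt.1 fun h => h1 (hN n h)
      have h5 : N ≤ i := not_lt.1 fun h => h2 (hN i h)
      have h6 := hM _ h3
      constructor <;> linarith
  refine ⟨⟨⟨⟨fun f => ∑ᶠ n, F n f, fun f g => ?_⟩, fun c f => ?_⟩, fun x f => ?_, fun x f => ?_⟩,
    fun f u v => ?_⟩
  · simp only [map_add]
    exact finsum_add_distrib (hfin f) (hfin g)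
  · simp only [map_smul, RingHom.id_apply]
    exact (smul_finsum c _).symm
  · change ∑ᶠ n, F n ((dualBimod hA).l x f) =
      ((KBimod.tensor (dualBimod hA) (dualBimod hA)).l x) (∑ᶠ n, F n f)
    refine Eq.trans (finsum_congr fun n => comulAux_l hA _ x f) ?_
    exact (AddMonoidHom.map_finsum
      ((KBimod.tensor (dualBimod hA) (dualBimod hA)).l x).toAddMonoidHom (hfin f)).symm
  · change ∑ᶠ n, F n ((dualBimod hA).r x f) =
      ((KBimod.tensor (dualBimod hA) (dualBimod hA)).r x) (∑ᶠ n, F n f)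
    refine Eq.trans (finsum_congr fun n => comulAux_r hA _ x f) ?_
    exact (AddMonoidHom.map_finsum
      ((KBimod.tensor (dualBimod hA) (dualBimod hA)).r x).toAddMonoidHom (hfin f)).symm
  · change dualPairing hA (∑ᶠ n, F n f) u v = _
    choose T hT hT' using fun j : Fin t => exists_sum_proj hA (A.r (Pi.single j 1) u)
    let U : Finset ℤ := (hfin f).toFinset ∪ Finset.univ.biUnion T
    rw [finsum_eq_sum_of_support_subset (s := U) _ (by
      intro n hn
      simp only [U, Finset.coe_union, Set.mem_union, Set.Finite.coe_toFinset]
      exact Or.inl hn), map_sum]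
    simp only [LinearMap.sum_apply]
    refine Eq.trans (Finset.sum_congr rfl fun n _ => comulAux_pairing hA _ f u v) ?_
    rw [Finset.sum_comm]
    have h1 : ∀ j : Fin t, ∑ n ∈ U, f.1 (A.m (proj hA n (A.r (Pi.single j 1) u))
        (A.l (Pi.single j 1) v)) = f.1 (A.m u (A.l (Pi.single j 1) v)) := by
      intro j
      rw [← map_sum, ← m_sum_left, ← Finset.sum_subset (s₁ := T j), hT' j, m_balance,
        ← Module.End.mul_apply, ← map_mul]
      · congr 4
        ext i
        by_cases h : i = j
        · subst h; simp
        · simp [h]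
      · intro n hn
        exact Finset.mem_union_right _ (Finset.mem_biUnion.2 ⟨j, Finset.mem_univ _, hn⟩)
      · intro n _ hn
        rw [hT j n hn]; rfl
    rw [Finset.sum_congr rfl fun j _ => h1 j, ← map_sum, ← m_sum_right]
    have h2 : ∑ j : Fin t, A.l (Pi.single j 1) v = v := by
      rw [← LinearMap.sum_apply, ← map_sum, Finset.univ_sum_single (fun _ : Fin t => (1 : k))]
      exact LinearMap.congr_fun (map_one A.l) v
    rw [h2]

theorem mul_single_eq (x : Fin t → k) (j : Fin t) :
    x * Pi.single j 1 = x j • (Pi.single j 1 : Fin t → k) := by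
  ext i
  by_cases h : i = j
  · subst h; simp
  · simp [h]

/-- The graded dual coring `A^∨` of a locally finite augmented dg `K`-ring that is bounded above or
below. Its coproduct is `ω⁻¹ ∘ μ^∨`, where `μ^∨ f = (u ⊗ v ↦ f (u v))` and `ω` is the canonical
injection `A^∨ ⊗ A^∨ → (A ⊗ A)^∨`; its counit is `f ↦ f ∘ η`, where a linear form `φ` on `K` is
identified with `∑ j, φ(eⱼ) eⱼ`; its coaugmentation is the transpose of the augmentation of `A`. -/
noncomputable def dual (hA : A.IsAugDGRing) (hf : A.LocallyFinite)
    (hb : A.BoundedAbove ∨ A.BoundedBelow) : PreDGCoring.{u} k t where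
  toPreDGModule := dualModule hA
  comul := (exists_comul hA hf hb).choose
  counit :=
    { toLin := LinearMap.pi fun j =>
        (LinearMap.applyₗ (R := k) (A.one (Pi.single j (1 : k) : Fin t → k))) ∘ₗ
          A.gradedDual.subtype
      map_l := fun x f => by
        ext j
        refine (congrArg f.1 (A.one.map_r x (Pi.single j (1 : k) : Fin t → k)).symm).trans ?_
        have h : x * Pi.single j 1 = x j • (Pi.single j 1 : Fin t → k) := mul_single_eq x j
        change f.1 (A.one.toLin (x * Pi.single j 1 : Fin t → k)) = _
        rw [h, map_smul, map_smul]
        rfl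
      map_r := fun x f => by
        ext j
        refine (congrArg f.1 (A.one.map_l x (Pi.single j (1 : k) : Fin t → k)).symm).trans ?_
        have h : x * Pi.single j 1 = x j • (Pi.single j 1 : Fin t → k) := mul_single_eq x j
        change f.1 (A.one.toLin (x * Pi.single j 1 : Fin t → k)) = _
        rw [h, map_smul, map_smul]
        rfl }
  coaug :=
    { toLin := (LinearMap.mk₂ k (fun (x : Fin t → k) a => ∑ j, x j * (A.aug a : Fin t → k) j)
        (fun x y a => by simp [add_mul, Finset.sum_add_distrib])
        (fun c x a => by simp [Finset.mul_sum, mul_assoc])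
        (fun x a b => by simp [mul_add, Finset.sum_add_distrib])
        (fun c x a => by simp [Finset.mul_sum, mul_left_comm])).codRestrict A.gradedDual
          (fun x => ⟨{0}, fun n hn a ha => by
            have h : (A.aug a : Fin t → k) = 0 := hA.aug_gr n (by simpa using hn) a ha
            change ∑ j, x j * (A.aug a : Fin t → k) j = 0
            refine Finset.sum_eq_zero fun j _ => ?_
            have h' : (A.aug a : Fin t → k) j = 0 := congrFun h j
            rw [h', mul_zero]⟩)
      map_l := fun x y => by
        refine Subtype.ext (LinearMap.ext fun a => ?_)
        change ∑ j, (x * y : Fin t → k) j * (A.aug a : Fin t → k) j =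
          ∑ j, (y : Fin t → k) j * (A.aug (A.r x a) : Fin t → k) j
        refine Finset.sum_congr rfl fun j _ => ?_
        have h : (A.aug (A.r x a) : Fin t → k) j = x j * (A.aug a : Fin t → k) j :=
          congrFun (A.aug.map_r x a) j
        rw [h, Pi.mul_apply]
        ring
      map_r := fun x y => by
        refine Subtype.ext (LinearMap.ext fun a => ?_)
        change ∑ j, (x * y : Fin t → k) j * (A.aug a : Fin t → k) j =
          ∑ j, (y : Fin t → k) j * (A.aug (A.l x a) : Fin t → k) j
        refine Finset.sum_congr rfl fun j _ => ?_
        have h : (A.aug (A.l x a) : Fin t → k) j = x j * (A.aug a : Fin t → k) j :=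
          congrFun (A.aug.map_l x a) j
        rw [h, Pi.mul_apply]
        ring }
  counit_coaug x := by
    ext j
    change ∑ i, (x : Fin t → k) i * (A.aug (A.one (Pi.single j (1 : k) : Fin t → k)) : Fin t → k) i
      = x j
    rw [A.aug_one]
    simp [Pi.single_apply]

end PreDGRing

/-! ## Bar and cobar constructions -/

variable {k : Type u} [Field k] {t : ℕ}

theorem KBimod.tensProj_tensOne (V : KBimod.{u, u} k t) (x : Fin t → k) :
    tensProj V (tensOne V x) = x := by
  unfold tensProj tensOne desc incl
  exact DirectSum.toModule_lof (M := fun n => (KBimod.pow V n).carrier) k 0 x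

/-- The coaugmentation coideal `Ker ε` of a coring. -/
def PreDGCoring.red (C : PreDGCoring.{u} k t) : PreDGModule.{u, u} k t :=
  C.toPreDGModule.ker C.counit C.coaug C.counit_coaug

/-- The projection of a coring onto its coaugmentation coideal. -/
def PreDGCoring.redProj (C : PreDGCoring.{u} k t) : KHom C.toKBimod C.red.toKBimod :=
  kerProj C.counit C.coaug C.counit_coaug

/-- The reduced coproduct `x ↦ Δ x - 1 ⊗ x - x ⊗ 1` of the coaugmentation coideal. -/
def PreDGCoring.redComul (C : PreDGCoring.{u} k t) :
    KHom C.red.toKBimod (KBimod.tensor C.red.toKBimod C.red.toKBimod) :=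
  (map C.redProj C.redProj).comp (C.comul.comp (kerIncl C.counit))

/-- The augmentation ideal `Ker ε` of a ring. -/
def PreDGRing.red (A : PreDGRing.{u} k t) : PreDGModule.{u, u} k t :=
  A.toPreDGModule.ker A.aug A.one A.aug_one

/-- The product of the augmentation ideal. -/
def PreDGRing.redMul (A : PreDGRing.{u} k t) :
    KHom (KBimod.tensor A.red.toKBimod A.red.toKBimod) A.red.toKBimod :=
  (kerProj A.aug A.one A.aug_one).comp (A.mul.comp (map (kerIncl A.aug) (kerIncl A.aug)))

/-- The cobar construction: the tensor ring of `s⁻¹ C̄`, where `C̄` is the coaugmentation coideal,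
with the derivation that sends `⟨c⟩` to `- ⟨d c⟩ - ∑ (-1) ^ |c₁| ⟨c₁ | c₂⟩`. -/
def PreDGCoring.cobar (C : PreDGCoring.{u} k t) : PreDGRing.{u} k t where
  toPreDGModule :=
    let V := C.red.desusp
    let dQuad : KHom V.toKBimod (KBimod.tens V.toKBimod) :=
      (tensCons V.toKBimod).comp ((map (KHom.id _) (tensIncl V.toKBimod)).comp
        ((map V.par (KHom.id _)).comp C.redComul))
    V.tens (der V.par ((tensIncl V.toKBimod).comp V.d + dQuad))
  mul := concat _
  one := tensOne _
  aug := tensProj _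
  aug_one x := tensProj_tensOne _ x

/-- The bar construction: the tensor coring of `s Ā`, where `Ā` is the augmentation ideal, with the
coderivation whose components are `[a] ↦ - [d a]` and `[a₁ | a₂] ↦ (-1) ^ |a₁| [a₁ a₂]`. -/
def PreDGRing.bar (A : PreDGRing.{u} k t) : PreDGCoring.{u} k t where
  toPreDGModule :=
    let V := A.red.susp
    let g : KHom (KBimod.tensor V.toKBimod V.toKBimod) V.toKBimod :=
      A.redMul.comp (map A.red.par (KHom.id _))
    V.tens (der V.par ((tensIncl V.toKBimod).comp V.d) + merge V.par g)
  comul := deconcat _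
  counit := tensProj _
  coaug := tensOne _
  counit_coaug x := tensProj_tensOne _ x

/-- The universal twisting morphism `ι : C → Ω C`, `c ↦ ⟨c⟩` on the coaugmentation coideal and
`ι(1) = 0`. -/
def PreDGCoring.iota (C : PreDGCoring.{u} k t) : KHom C.toKBimod C.cobar.toKBimod :=
  (tensIncl C.red.desusp.toKBimod).comp C.redProj

/-- The universal twisting morphism `π : B A → A`: the projection onto the tensors of length one. -/
def PreDGRing.piBar (A : PreDGRing.{u} k t) : KHom A.bar.toKBimod A.toKBimod :=
  (kerIncl A.aug).comp (tensProjV A.red.susp.toKBimod)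

/-! ## Dg bimodules -/

/-- The data underlying a dg bimodule over a dg `K`-ring. The axioms are in
`PreDGBimodule.IsDGBimodule`. -/
structure PreDGBimodule (R : PreDGRing.{u} k t) extends PreDGModule.{u, w} k t where
  lact : KHom (KBimod.tensor R.toKBimod toKBimod) toKBimod
  ract : KHom (KBimod.tensor toKBimod R.toKBimod) toKBimod

namespace PreDGBimodule

variable {R : PreDGRing.{u} k t}

/-- The left action `a m`. -/
def la (M : PreDGBimodule.{u, w} R) (a : R.carrier) (m : M.carrier) : M.carrier := M.lact (tm a m)

/-- The right action `m a`. -/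
def ra (M : PreDGBimodule.{u, w} R) (m : M.carrier) (a : R.carrier) : M.carrier := M.ract (tm m a)

/-- The axioms of a dg bimodule. -/
structure IsDGBimodule (M : PreDGBimodule.{u, w} R) : Prop extends M.toPreDGModule.IsDG where
  la_la : ∀ a b m, M.la a (M.la b m) = M.la (R.m a b) m
  ra_ra : ∀ m a b, M.ra (M.ra m a) b = M.ra m (R.m a b)
  la_ra : ∀ a m b, M.ra (M.la a m) b = M.la a (M.ra m b)
  one_la : ∀ x m, M.la (R.one x) m = M.l x m
  ra_one : ∀ m x, M.ra m (R.one x) = M.r x m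
  la_mem : ∀ i j, ∀ a ∈ R.gr i, ∀ m ∈ M.gr j, M.la a m ∈ M.gr (i + j)
  ra_mem : ∀ i j, ∀ m ∈ M.gr i, ∀ a ∈ R.gr j, M.ra m a ∈ M.gr (i + j)
  d_la : ∀ a m, M.d (M.la a m) = M.la (R.d a) m + M.la (R.par a) (M.d m)
  d_ra : ∀ m a, M.d (M.ra m a) = M.ra (M.d m) a + M.ra (M.par m) (R.d a)

/-- `f` is a homogeneous bimodule morphism of degree `n`: `f (a m) = (-1) ^ (n |a|) a f(m)` for
homogeneous `a`, and `f (m b) = f(m) b`. No compatibility with the differentials is required. -/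
structure IsHom {M : PreDGBimodule.{u, w} R} {N : PreDGBimodule.{u, x} R} (n : ℤ)
    (f : KHom M.toKBimod N.toKBimod) : Prop where
  map_gr : ∀ i, ∀ m ∈ M.gr i, f m ∈ N.gr (i + n)
  map_la : ∀ i, ∀ a ∈ R.gr i, ∀ m, f (M.la a m) = ((n * i).negOnePow : ℤ) • N.la a (f m)
  map_ra : ∀ m b, f (M.ra m b) = N.ra (f m) b

/-- The differential `d ∘ f - (-1) ^ n f ∘ d` of a homogeneous map `f` of degree `n`, evaluated at
an element. -/
def homD {M : PreDGBimodule.{u, w} R} {N : PreDGBimodule.{u, x} R} (n : ℤ)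
    (f : KHom M.toKBimod N.toKBimod) (m : M.carrier) : N.carrier :=
  N.d (f m) - (n.negOnePow : ℤ) • f (M.d m)

/-- `f` is a morphism of dg bimodules. -/
def IsDGHom {M : PreDGBimodule.{u, w} R} {N : PreDGBimodule.{u, x} R}
    (f : KHom M.toKBimod N.toKBimod) : Prop :=
  IsHom 0 f ∧ ∀ m, f (M.d m) = N.d (f m)

/-- `f` induces isomorphisms in homology: surjectivity and injectivity, in every degree. -/
def IsQuasiIso {M : PreDGBimodule.{u, w} R} {N : PreDGBimodule.{u, x} R}
    (f : KHom M.toKBimod N.toKBimod) : Prop :=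
  (∀ i, ∀ n ∈ N.gr i, N.d n = 0 →
    ∃ m ∈ M.gr i, M.d m = 0 ∧ ∃ b ∈ N.gr (i + 1), f m - n = N.d b) ∧
  (∀ i, ∀ m ∈ M.gr i, M.d m = 0 → (∃ b ∈ N.gr (i + 1), f m = N.d b) →
    ∃ c ∈ M.gr (i + 1), m = M.d c)

/-- `P` is semi-projective: it is a dg bimodule, and for every surjective quasi-isomorphism
`q : X → Y` of dg bimodules the map of complexes `Hom(P, X) → Hom(P, Y)` is surjective and induces
surjections and injections in homology. -/
def IsSemiProjective (P : PreDGBimodule.{u, x} R) : Prop :=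
  P.IsDGBimodule ∧
  ∀ (X Y : PreDGBimodule.{u, w} R), X.IsDGBimodule → Y.IsDGBimodule →
    ∀ q : KHom X.toKBimod Y.toKBimod, IsDGHom q → Function.Surjective q → IsQuasiIso q →
      ∀ n : ℤ,
        (∀ f : KHom P.toKBimod Y.toKBimod, IsHom (M := P) (N := Y) n f →
          ∃ g : KHom P.toKBimod X.toKBimod, IsHom (M := P) (N := X) n g ∧ ∀ m, q (g m) = f m) ∧
        (∀ f : KHom P.toKBimod Y.toKBimod, IsHom (M := P) (N := Y) n f →
          (∀ m, homD (M := P) (N := Y) n f m = 0) →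
          ∃ g : KHom P.toKBimod X.toKBimod, IsHom (M := P) (N := X) n g ∧
            (∀ m, homD (M := P) (N := X) n g m = 0) ∧
            ∃ h : KHom P.toKBimod Y.toKBimod, IsHom (M := P) (N := Y) (n + 1) h ∧
              ∀ m, q (g m) - f m = homD (M := P) (N := Y) (n + 1) h m) ∧
        (∀ g : KHom P.toKBimod X.toKBimod, IsHom (M := P) (N := X) n g →
          (∀ m, homD (M := P) (N := X) n g m = 0) →
          (∃ h : KHom P.toKBimod Y.toKBimod, IsHom (M := P) (N := Y) (n + 1) h ∧
            ∀ m, q (g m) = homD (M := P) (N := Y) (n + 1) h m) →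
          ∃ h : KHom P.toKBimod X.toKBimod, IsHom (M := P) (N := X) (n + 1) h ∧
            ∀ m, g m = homD (M := P) (N := X) (n + 1) h m)

/-- `p : P → M` is a semi-projective resolution of the dg bimodule `M`. -/
def IsSemiProjectiveResolution {P : PreDGBimodule.{u, x} R} {M : PreDGBimodule.{u, y} R}
    (p : KHom P.toKBimod M.toKBimod) : Prop :=
  IsSemiProjective.{u, w} P ∧ IsDGHom (M := P) (N := M) p ∧ IsQuasiIso (M := P) (N := M) p

/-- `f` and `g` are homotopic bimodule morphisms: `f - g = d h + h d` for a bimodule morphism `h`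
of degree one. -/
def Homotopic {M : PreDGBimodule.{u, w} R} {N : PreDGBimodule.{u, x} R}
    (f g : KHom M.toKBimod N.toKBimod) : Prop :=
  ∃ h : KHom M.toKBimod N.toKBimod, IsHom (M := M) (N := N) 1 h ∧
    ∀ m, f m - g m = N.d (h m) + h (M.d m)

/-- `f` is a homotopy equivalence of dg bimodules. -/
def IsHomotopyEquiv {M : PreDGBimodule.{u, w} R} {N : PreDGBimodule.{u, x} R}
    (f : KHom M.toKBimod N.toKBimod) : Prop :=
  IsDGHom (M := M) (N := N) f ∧ ∃ g : KHom N.toKBimod M.toKBimod, IsDGHom (M := N) (N := M) g ∧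
    Homotopic (M := M) (N := M) (g.comp f) (KHom.id _) ∧
    Homotopic (M := N) (N := N) (f.comp g) (KHom.id _)

end PreDGBimodule

namespace PreDGRing

variable (R : PreDGRing.{u} k t)

/-- The regular bimodule. -/
def regular : PreDGBimodule.{u, u} R where
  toPreDGModule := R.toPreDGModule
  lact := R.mul
  ract := R.mul

variable (C : PreDGCoring.{u} k t) (α : KHom C.toKBimod R.toKBimod)

/-- The map `d_α^r` on `C ⊗ R`, that is `(id ⊗ μ) (id ⊗ α ⊗ id) (Δ ⊗ id)`, for `α` of degree
`-1`: `c ⊗ b ↦ ∑ (-1) ^ |c₁| c₁ ⊗ α(c₂) b`. -/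
def twistRight : KHom (KBimod.tensor C.toKBimod R.toKBimod) (KBimod.tensor C.toKBimod R.toKBimod) :=
  (map (KHom.id _) R.mul).comp ((assoc _ _ _).comp
    ((map (map C.par α) (KHom.id _)).comp (map C.comul (KHom.id _))))

/-- The map `d_α^l` on `R ⊗ C`, that is `(μ ⊗ id) (id ⊗ α ⊗ id) (id ⊗ Δ)`, for `α` of degree
`-1`: `a ⊗ c ↦ ∑ (-1) ^ |a| a α(c₁) ⊗ c₂`. -/
def twistLeft : KHom (KBimod.tensor R.toKBimod C.toKBimod) (KBimod.tensor R.toKBimod C.toKBimod) :=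
  (map R.mul (KHom.id _)).comp ((assocInv _ _ _).comp
    ((map R.par (map α (KHom.id _))).comp (map (KHom.id _) C.comul)))

/-- The two-sided twisted tensor product `R ⊗_α C ⊗_α R`, with differential
`d + id ⊗ d_α^r - d_α^l ⊗ id` and with the actions of `R` on the outer factors. -/
def twisted : PreDGBimodule.{u, u} R where
  toPreDGModule :=
    let T := (R.toPreDGModule.tensor C.toPreDGModule).tensor R.toPreDGModule
    let dr : KHom T.toKBimod T.toKBimod :=
      (assocInv _ _ _).comp ((map R.par (twistRight R C α)).comp (assoc _ _ _))
    let dl : KHom T.toKBimod T.toKBimod := map (twistLeft R C α) (KHom.id _)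
    { T with d := T.d + dr - dl }
  lact := (map (map R.mul (KHom.id _)) (KHom.id _)).comp
    ((map (assocInv _ _ _) (KHom.id _)).comp (assocInv _ _ _))
  ract := (map (KHom.id _) R.mul).comp (assoc _ _ _)

/-- The twisted tensor product `Ω ⊗_ι C ⊗_ι Ω`, where `Ω` is the cobar construction of `C` and `ι`
is the universal twisting morphism. -/
def _root_.PreDGCoring.cobarResolution (C : PreDGCoring.{u} k t) : PreDGBimodule.{u, u} C.cobar :=
  twisted C.cobar C C.iota

/-- The two-sided bar resolution `R ⊗_π B R ⊗_π R`. -/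
def barResolution : PreDGBimodule.{u, u} R := twisted R R.bar R.piBar

/-- The map `μ (id ⊗ ε ⊗ id) : R ⊗_α C ⊗_α R → R`, `a ⊗ c ⊗ b ↦ a ε(c) b`. -/
def twistedAug : KHom (twisted R C α).toKBimod R.regular.toKBimod :=
  R.mul.comp (map ((rightUnit _).comp (map (KHom.id _) C.counit)) (KHom.id _))

end PreDGRing

end

/-! Two properties of R ⊗_α C ⊗_α R, for a twisting morphism α : C → R, are proved separately, each
for ι : C → Ω and for π : BΩ → Ω: it is semi-projective, and its canonical map to R is a
quasi-isomorphism. The homotopy equivalence is then formal.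

Semi-projectivity. A homogeneous bimodule morphism out of R ⊗_α C ⊗_α R is the same as a homogeneous
map out of C, by restriction to the elements 1 ⊗ c ⊗ 1. A K-bimodule splits into its pieces e_i M
e_j, which are vector spaces, so every map of graded K-bimodules has a graded pseudo-inverse. Hence
a surjective quasi-isomorphism q : X → Y has a graded section, and its acyclic kernel has a
contraction s (`IsQuasiIso.exists_contraction`). What remains is the twisting part of the
differential. It is controlled by an exhaustive filtration 0 = F_0 ⊆ F_1 ⊆ … of C for which (α ⊗
id)Δ and (id ⊗ α)Δ send F_{n+1} into R ⊗ F_n and F_n ⊗ R (`ConilpotentFiltration`; F_n need not be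
stable under d_C). Let f be closed with values in ker q, and zero on F_n. On F_{n+1} neither f nor
the extension of s ∘ f sees the twisting terms, so the boundary of that extension agrees with f
there, because ds + sd = id on ker q. Subtracting it gives a closed morphism that is zero on
F_{n+1}. The corrections add up to a locally finite sum whose boundary is f (`exists_homDiff_eq`).
Strict lifting of closed morphisms along q and reflection of boundaries follow, and with them
semi-projectivity.

The filtrations. BΩ is filtered by the length of words. On A^∨ one takes for F_n the forms that
vanish on Ā^n. Since ι factors through the projection to the coaugmentation coideal, the two
conditions on the coproduct are dual to Ā^n · Ā ⊆ Ā^{n+1} and Ā · Ā^n ⊆ Ā^{n+1}. The filtration is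
exhaustive because in the finite dimensional space A_s the chain Ā^n ∩ A_s stabilises, its
intersection is zero by completeness, and a graded form sees only finitely many degrees.

The quasi-isomorphisms. Both canonical maps have explicit contractions. For the bar resolution it is
a ⊗ x ⊗ b ↦ 1 ⊗ [a|x] ⊗ b, up to sign (`barHomotopy_spec`). For Ω ⊗_ι C ⊗_ι Ω there is the
derivation D on Ω with ⟨c⟩ ↦ 1 ⊗ c ⊗ 1, for which dD(u) + D(du) = (1 ⊗ 1 ⊗ 1)u - u(1 ⊗ 1 ⊗ 1); then
a ⊗ c ⊗ b ↦ (-1)^{|a|} a ε(c) D(b) is a homotopy from the identity to the projection onto Ω ⊗ 1 ⊗ 1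
(`cobarHomotopy_spec`).

Comparison. The canonical maps are surjective quasi-isomorphisms out of objects with the lifting
property, so each resolution maps to the other strictly over Ω. Each composite differs from the
identity by a closed morphism that becomes zero over Ω, and such a morphism is a boundary.

The rest is the verification that the objects are what they should be: Ω is a dg ring, BΩ and A^∨
are dg corings, ι and π are twisting morphisms, and the twisted differential squares to zero.
Identities on tensor rings are proved by prepending one letter at a time; identities in A^∨ ⊗ A^∨
are tested by pairing with A ⊗ A. -/

section

/-! ### Elementwise rules for morphisms and tensor products of K-bimodules -/

namespace KHom

variable {k : Type u} [Field k] {t : ℕ}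

theorem ext {V : KBimod.{u, v} k t} {W : KBimod.{u, w} k t} {f g : KHom V W}
    (h : ∀ m, f m = g m) : f = g := by
  cases f; cases g
  congr
  exact LinearMap.ext h

section

variable {V : KBimod.{u, v} k t} {W : KBimod.{u, w} k t} {X : KBimod.{u, x} k t}

theorem id_apply (m : V.carrier) : KHom.id V m = m := rfl

theorem comp_apply (g : KHom W X) (f : KHom V W) (m : V.carrier) : g.comp f m = g (f m) := rfl

theorem zero_apply (m : V.carrier) : (0 : KHom V W) m = 0 := rfl

theorem add_apply (f g : KHom V W) (m : V.carrier) : (f + g) m = f m + g m := rfl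

theorem neg_apply (f : KHom V W) (m : V.carrier) : (-f) m = -f m := rfl

theorem sub_apply (f g : KHom V W) (m : V.carrier) : (f - g) m = f m - g m :=
  (sub_eq_add_neg _ _).symm

/-- The pointwise sum of a family of morphisms, only finitely many of which are nonzero at each
element. -/
noncomputable def finsum {ι : Type y} (F : ι → KHom V W)
    (hF : ∀ m, (Function.support fun i => F i m).Finite) : KHom V W where
  toLin :=
    { toFun := fun m => ∑ᶠ i, F i m
      map_add' := fun m n => by
        simp only [map_add]
        exact finsum_add_distrib (hF m) (hF n)
      map_smul' := fun c m => by
        simp only [map_smul, RingHom.id_apply]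
        exact (smul_finsum c _).symm }
  map_l a m := by
    change ∑ᶠ i, F i (V.l a m) = W.l a (∑ᶠ i, F i m)
    simp only [map_l]
    exact (AddMonoidHom.map_finsum (W.l a).toAddMonoidHom (hF m)).symm
  map_r a m := by
    change ∑ᶠ i, F i (V.r a m) = W.r a (∑ᶠ i, F i m)
    simp only [map_r]
    exact (AddMonoidHom.map_finsum (W.r a).toAddMonoidHom (hF m)).symm

theorem finsum_apply {ι : Type y} (F : ι → KHom V W)
    (hF : ∀ m, (Function.support fun i => F i m).Finite) (m : V.carrier) :
    finsum F hF m = ∑ᶠ i, F i m := rfl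

end

end KHom

namespace KBimod

variable {k : Type u} [Field k] {t : ℕ}

section

variable {V : KBimod.{u, v} k t} {W : KBimod.{u, w} k t}

theorem tm_add_left (m m' : V.carrier) (n : W.carrier) : tm (m + m') n = tm m n + tm m' n :=
  LinearMap.map_add₂ (tmLin V W) m m' n

theorem tm_add_right (m : V.carrier) (n n' : W.carrier) : tm m (n + n') = tm m n + tm m n' :=
  map_add (tmLin V W m) n n'

theorem tm_zero_left (n : W.carrier) : tm (0 : V.carrier) n = 0 :=
  LinearMap.map_zero₂ (tmLin V W) n

theorem tm_zero_right (m : V.carrier) : tm m (0 : W.carrier) = 0 :=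
  map_zero (tmLin V W m)

theorem tm_neg_left (m : V.carrier) (n : W.carrier) : tm (-m) n = -tm m n :=
  LinearMap.map_neg₂ (tmLin V W) m n

theorem tm_neg_right (m : V.carrier) (n : W.carrier) : tm m (-n) = -tm m n :=
  map_neg (tmLin V W m) n

theorem tm_sub_left (m m' : V.carrier) (n : W.carrier) : tm (m - m') n = tm m n - tm m' n :=
  LinearMap.map_sub₂ (tmLin V W) m m' n

theorem tm_sub_right (m : V.carrier) (n n' : W.carrier) : tm m (n - n') = tm m n - tm m n' :=
  map_sub (tmLin V W m) n n'

theorem tm_smul_left (c : k) (m : V.carrier) (n : W.carrier) : tm (c • m) n = c • tm m n :=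
  LinearMap.map_smul₂ (tmLin V W) c m n

theorem tm_smul_right (c : k) (m : V.carrier) (n : W.carrier) : tm m (c • n) = c • tm m n :=
  map_smul (tmLin V W m) c n

theorem tm_zsmul_left (c : ℤ) (m : V.carrier) (n : W.carrier) : tm (c • m) n = c • tm m n :=
  map_zsmul ((tmLin V W).flip n) c m

theorem tm_zsmul_right (c : ℤ) (m : V.carrier) (n : W.carrier) : tm m (c • n) = c • tm m n :=
  map_zsmul (tmLin V W m) c n

theorem l_tm (a : Fin t → k) (m : V.carrier) (n : W.carrier) :
    (tensor V W).l a (tm m n) = tm (V.l a m) n := rfl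

theorem r_tm (a : Fin t → k) (m : V.carrier) (n : W.carrier) :
    (tensor V W).r a (tm m n) = tm m (W.r a n) := rfl

theorem l_one (m : V.carrier) : V.l 1 m = m := by rw [map_one]; rfl

theorem r_one (m : V.carrier) : V.r 1 m = m := by rw [map_one]; rfl

theorem l_l (a b : Fin t → k) (m : V.carrier) : V.l a (V.l b m) = V.l (a * b) m := by
  rw [map_mul]; rfl

theorem r_r (a b : Fin t → k) (m : V.carrier) : V.r a (V.r b m) = V.r (a * b) m := by
  rw [map_mul]; rfl

theorem leftUnit_tm (a : Fin t → k) (m : V.carrier) :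
    leftUnit V (tm (V := unit k t) a m) = V.l a m := rfl

theorem rightUnit_tm (m : V.carrier) (a : Fin t → k) :
    rightUnit V (tm (W := unit k t) m a) = V.r a m := rfl

end

section

variable {V : KBimod.{u, v} k t} {W : KBimod.{u, w} k t} {V' : KBimod.{u, x} k t}
    {W' : KBimod.{u, y} k t}

theorem map_tm (f : KHom V V') (g : KHom W W') (m : V.carrier) (n : W.carrier) :
    map f g (tm m n) = tm (f m) (g n) := rfl

theorem assoc_tm (m : V.carrier) (n : W.carrier) (q : V'.carrier) :
    assoc V W V' (tm (tm m n) q) = tm m (tm n q) := rfl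

theorem linear_ext {X : Type*} [AddCommGroup X] [Module k X]
    {f g : (tensor V W).carrier →ₗ[k] X} (h : ∀ m n, f (tm m n) = g (tm m n))
    (q : (tensor V W).carrier) : f q = g q := by
  induction q using tensor_induction with
  | h0 => simp
  | ht m n => exact h m n
  | ha p q hp hq => simp only [map_add, hp, hq]

end

theorem desc_incl {V : ℕ → KBimod.{u, v} k t} {X : KBimod.{u, x} k t} (f : ∀ n, KHom (V n) X)
    (n : ℕ) (m : (V n).carrier) : desc f (incl V n m) = f n m :=
  DirectSum.toModule_lof (M := fun n => (V n).carrier) k n m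

theorem descLeft_tm {V : ℕ → KBimod.{u, v} k t} {W : KBimod.{u, w} k t} {X : KBimod.{u, x} k t}
    (f : ∀ n, KHom (tensor (V n) W) X) (n : ℕ) (m : (V n).carrier) (m' : W.carrier) :
    descLeft f (tm (incl V n m) m') = f n (tm m m') :=
  LinearMap.congr_fun (DirectSum.toModule_lof k (φ := fun n =>
      (tmLin (V n) W).compr₂ (f n).toLin) n m) m'

theorem descRight_tm {V : KBimod.{u, v} k t} {W : ℕ → KBimod.{u, w} k t} {X : KBimod.{u, x} k t}
    (f : ∀ n, KHom (tensor V (W n)) X) (n : ℕ) (m' : V.carrier) (m : (W n).carrier) :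
    descRight f (tm m' (incl W n m)) = f n (tm m' m) :=
  LinearMap.congr_fun (DirectSum.toModule_lof k (φ := fun n =>
      ((tmLin V (W n)).compr₂ (f n).toLin).flip) n m) m'

section Ker

variable {V : KBimod.{u, v} k t} {W : KBimod.{u, w} k t}

theorem kerIncl_kerProj (e : KHom V W) (η : KHom W V) (h : ∀ a, e (η a) = a) (m : V.carrier) :
    kerIncl e (kerProj e η h m) = m - η (e m) := rfl

theorem kerProj_kerIncl (e : KHom V W) (η : KHom W V) (h : ∀ a, e (η a) = a)
    (m : (ker e).carrier) : kerProj e η h (kerIncl e m) = m := by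
  refine Subtype.ext ?_
  have hm : e m.1 = 0 := m.2
  change m.1 - η (e m.1) = m.1
  rw [hm, map_zero, sub_zero]

theorem kerIncl_injective (e : KHom V W) {m n : (ker e).carrier}
    (h : kerIncl e m = kerIncl e n) : m = n := Subtype.ext h

theorem apply_kerIncl (e : KHom V W) (m : (ker e).carrier) : e (kerIncl e m) = 0 := m.2

theorem kerProj_unit (e : KHom V W) (η : KHom W V) (h : ∀ a, e (η a) = a) (a : W.carrier) :
    kerProj e η h (η a) = 0 := by
  refine kerIncl_injective e ?_
  rw [kerIncl_kerProj, h, sub_self, map_zero]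

end Ker

end KBimod

/-! ### Graded bimodules: homogeneous projections, degrees of maps, tensor products, shifts, kernels
-/

open KBimod

/-- A family of submodules that spans and admits projections is a direct sum decomposition. -/
theorem isInternal_of_projections {k : Type u} [Field k] {M : Type v} [AddCommGroup M] [Module k M]
    (gr : ℤ → Submodule k M) (htop : iSup gr = ⊤) (π : ℤ → M →ₗ[k] M)
    (h1 : ∀ i, ∀ m ∈ gr i, π i m = m) (h2 : ∀ i j, j ≠ i → ∀ m ∈ gr j, π i m = 0) :
    DirectSum.IsInternal gr := by
  rw [DirectSum.isInternal_submodule_iff_iSupIndep_and_iSup_eq_top]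
  refine ⟨fun i => Submodule.disjoint_def.2 fun m hm hm' => ?_, htop⟩
  have : (⨆ j, ⨆ (_ : j ≠ i), gr j) ≤ LinearMap.ker (π i) :=
    iSup₂_le fun j hj m hm => h2 i j hj m hm
  rw [← h1 i m hm]
  exact this hm'

namespace PreDGModule

variable {k : Type u} [Field k] {t : ℕ}

/-- The axioms of a graded bimodule, without the differential. -/
structure IsGraded (M : PreDGModule.{u, v} k t) : Prop where
  internal : DirectSum.IsInternal M.gr
  l_mem : ∀ n a, ∀ m ∈ M.gr n, M.l a m ∈ M.gr n
  r_mem : ∀ n a, ∀ m ∈ M.gr n, M.r a m ∈ M.gr n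
  par_apply : ∀ n, ∀ m ∈ M.gr n, M.par m = (n.negOnePow : ℤ) • m

theorem IsDG.isGraded {M : PreDGModule.{u, v} k t} (h : M.IsDG) : M.IsGraded :=
  ⟨h.internal, h.l_mem, h.r_mem, h.par_apply⟩

/-- A morphism that raises degrees by `e`. -/
def HasDeg (M : PreDGModule.{u, v} k t) (N : PreDGModule.{u, w} k t) (e : ℤ)
    (f : KHom M.toKBimod N.toKBimod) : Prop := ∀ i, ∀ m ∈ M.gr i, f m ∈ N.gr (i + e)

theorem negOnePow_smul_smul {A : Type*} [AddCommGroup A] (n : ℤ) (a : A) :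
    (n.negOnePow : ℤ) • (n.negOnePow : ℤ) • a = a := by
  rw [smul_smul, ← Units.val_mul, Int.units_mul_self, Units.val_one, one_smul]

namespace IsGraded

variable {M : PreDGModule.{u, v} k t} (hM : M.IsGraded)
include hM

theorem iSup_eq_top : iSup M.gr = ⊤ := hM.internal.submodule_iSup_eq_top

theorem induction {p : M.carrier → Prop} (h0 : p 0) (hg : ∀ i, ∀ m ∈ M.gr i, p m)
    (ha : ∀ m n, p m → p n → p (m + n)) (m : M.carrier) : p m :=
  Submodule.iSup_induction M.gr (motive := p) (by rw [hM.iSup_eq_top]; trivial) hg h0 ha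

theorem linear_ext {X : Type*} [AddCommGroup X] [Module k X] {f g : M.carrier →ₗ[k] X}
    (h : ∀ i, ∀ m ∈ M.gr i, f m = g m) (m : M.carrier) : f m = g m := by
  induction m using hM.induction with
  | h0 => simp
  | hg i m hm => exact h i m hm
  | ha m n hm hn => simp only [map_add, hm, hn]

theorem par_par (m : M.carrier) : M.par (M.par m) = m := by
  refine hM.linear_ext (f := M.par.toLin ∘ₗ M.par.toLin) (g := LinearMap.id) (fun i m hm => ?_) m
  simp only [LinearMap.comp_apply, hM.par_apply i m hm, map_zsmul, negOnePow_smul_smul,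
    LinearMap.id_apply]

theorem par_mem {i : ℤ} {m : M.carrier} (hm : m ∈ M.gr i) : M.par m ∈ M.gr i := by
  rw [hM.par_apply i m hm]
  exact zsmul_mem hm _

/-- The parity operator is a sign on each component, so a map that shifts degrees by e commutes with
it up to (-1)^e. The Koszul signs of later computations are obtained from this rule instead of from
degrees of elements. -/
theorem hasDeg_par_comm {N : PreDGModule.{u, w} k t} (hN : N.IsGraded) {e : ℤ}
    {f : KHom M.toKBimod N.toKBimod} (hf : HasDeg M N e f) (m : M.carrier) :
    f (M.par m) = (e.negOnePow : ℤ) • N.par (f m) := by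
  refine hM.linear_ext (f := f.toLin ∘ₗ M.par.toLin)
    (g := (e.negOnePow : ℤ) • (N.par.toLin ∘ₗ f.toLin)) (fun i m hm => ?_) m
  simp only [LinearMap.comp_apply, LinearMap.smul_apply, hM.par_apply i m hm,
    hN.par_apply _ _ (hf i m hm), map_zsmul, Int.negOnePow_add, Units.val_mul]
  rw [mul_comm, mul_smul, negOnePow_smul_smul]

theorem par_comm_zero {N : PreDGModule.{u, w} k t} (hN : N.IsGraded)
    {f : KHom M.toKBimod N.toKBimod} (hf : HasDeg M N 0 f) (m : M.carrier) :
    f (M.par m) = N.par (f m) := by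
  simpa using hM.hasDeg_par_comm hN hf m

theorem par_comm_neg_one {N : PreDGModule.{u, w} k t} (hN : N.IsGraded)
    {f : KHom M.toKBimod N.toKBimod} (hf : HasDeg M N (-1) f) (m : M.carrier) :
    f (M.par m) = -N.par (f m) := by
  simpa using hM.hasDeg_par_comm hN hf m

/-- The decomposition into homogeneous components. -/
noncomputable def decomp : M.carrier ≃ₗ[k] DirectSum ℤ (fun n => M.gr n) :=
  (LinearEquiv.ofBijective (DirectSum.coeLinearMap M.gr)
    (show Function.Bijective (DirectSum.coeLinearMap M.gr) from hM.internal)).symm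

/-- The projection onto the component of degree `n`, as a linear map. -/
noncomputable def prLin (n : ℤ) : M.carrier →ₗ[k] M.carrier :=
  (M.gr n).subtype ∘ₗ DirectSum.component k ℤ (fun n => M.gr n) n ∘ₗ hM.decomp.toLinearMap

theorem prLin_of_mem {i : ℤ} (n : ℤ) {m : M.carrier} (hm : m ∈ M.gr i) :
    hM.prLin n m = if i = n then m else 0 := by
  have h : hM.decomp m = DirectSum.lof k ℤ (fun n => M.gr n) i ⟨m, hm⟩ := by
    rw [decomp, LinearEquiv.symm_apply_eq]
    simp
  simp only [prLin, LinearMap.comp_apply, LinearEquiv.coe_coe, h]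
  split_ifs with hnm
  · subst hnm
    rw [DirectSum.component.lof_self]
    rfl
  · rw [DirectSum.component.of, dif_neg hnm]
    rfl

/-- The projection onto the component of degree `n`. -/
noncomputable def pr (n : ℤ) : KHom M.toKBimod M.toKBimod where
  toLin := hM.prLin n
  map_l a m := by
    refine hM.linear_ext (f := hM.prLin n ∘ₗ M.l a) (g := M.l a ∘ₗ hM.prLin n)
      (fun i m hm => ?_) m
    simp only [LinearMap.comp_apply, hM.prLin_of_mem n hm, hM.prLin_of_mem n (hM.l_mem i a m hm)]
    split_ifs <;> simp
  map_r a m := by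
    refine hM.linear_ext (f := hM.prLin n ∘ₗ M.r a) (g := M.r a ∘ₗ hM.prLin n)
      (fun i m hm => ?_) m
    simp only [LinearMap.comp_apply, hM.prLin_of_mem n hm, hM.prLin_of_mem n (hM.r_mem i a m hm)]
    split_ifs <;> simp

theorem pr_of_mem {i : ℤ} (n : ℤ) {m : M.carrier} (hm : m ∈ M.gr i) :
    hM.pr n m = if i = n then m else 0 := hM.prLin_of_mem n hm

theorem pr_mem (n : ℤ) (m : M.carrier) : hM.pr n m ∈ M.gr n := Subtype.prop _

theorem pr_finite (m : M.carrier) : (Function.support fun n => hM.pr n m).Finite := by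
  induction m using hM.induction with
  | h0 => simp
  | hg i m hm =>
    refine (Set.finite_singleton i).subset fun n hn => ?_
    by_contra h
    exact hn ((hM.pr_of_mem n hm).trans (if_neg fun h' => h h'.symm))
  | ha m n hm hn =>
    refine (hm.union hn).subset fun i hi => ?_
    by_contra h
    simp only [Set.mem_union, Function.mem_support, not_or, not_not] at h
    exact hi (by simp only [map_add, h.1, h.2, add_zero])

theorem finsum_pr (m : M.carrier) : ∑ᶠ n, hM.pr n m = m := by
  induction m using hM.induction with
  | h0 => simp
  | hg i m hm =>
    rw [finsum_eq_single _ i fun n hn => (hM.pr_of_mem n hm).trans (if_neg hn.symm)]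
    exact (hM.pr_of_mem i hm).trans (if_pos rfl)
  | ha m n hm hn =>
    simp only [map_add]
    rw [finsum_add_distrib (hM.pr_finite m) (hM.pr_finite n), hm, hn]

/-- Serves to prove homogeneity of an element known only through a pairing, such as a coproduct in
the graded dual. -/
theorem mem_of_pr {m : M.carrier} {i : ℤ} (h : ∀ n, n ≠ i → hM.pr n m = 0) : m ∈ M.gr i := by
  rw [← hM.finsum_pr m, finsum_eq_single _ i h]
  exact hM.pr_mem i m

end IsGraded

/-- A spanning family with compatible projections is a grading. -/
theorem isGraded_of_projections {M : PreDGModule.{u, v} k t} (htop : iSup M.gr = ⊤)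
    (π : ℤ → M.carrier →ₗ[k] M.carrier) (h1 : ∀ i, ∀ m ∈ M.gr i, π i m = m)
    (h2 : ∀ i j, j ≠ i → ∀ m ∈ M.gr j, π i m = 0)
    (l_mem : ∀ n a, ∀ m ∈ M.gr n, M.l a m ∈ M.gr n)
    (r_mem : ∀ n a, ∀ m ∈ M.gr n, M.r a m ∈ M.gr n)
    (par_apply : ∀ n, ∀ m ∈ M.gr n, M.par m = (n.negOnePow : ℤ) • m) : M.IsGraded :=
  ⟨isInternal_of_projections M.gr htop π h1 h2, l_mem, r_mem, par_apply⟩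

namespace HasDeg

variable {M : PreDGModule.{u, v} k t} {N : PreDGModule.{u, w} k t} {X : PreDGModule.{u, x} k t}

theorem comp {e e' : ℤ} {g : KHom N.toKBimod X.toKBimod} {f : KHom M.toKBimod N.toKBimod}
    (hg : HasDeg N X e' g) (hf : HasDeg M N e f) : HasDeg M X (e + e') (g.comp f) :=
  fun i m hm => by rw [← add_assoc]; exact hg _ _ (hf i m hm)

theorem add {e : ℤ} {f g : KHom M.toKBimod N.toKBimod}
    (hf : HasDeg M N e f) (hg : HasDeg M N e g) : HasDeg M N e (f + g) :=
  fun i m hm => add_mem (hf i m hm) (hg i m hm)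

theorem neg {e : ℤ} {f : KHom M.toKBimod N.toKBimod}
    (hf : HasDeg M N e f) : HasDeg M N e (-f) :=
  fun i m hm => neg_mem (hf i m hm)

theorem sub {e : ℤ} {f g : KHom M.toKBimod N.toKBimod}
    (hf : HasDeg M N e f) (hg : HasDeg M N e g) : HasDeg M N e (f - g) := hf.add hg.neg

theorem congr {e e' : ℤ} {f : KHom M.toKBimod N.toKBimod} (hf : HasDeg M N e f) (h : e = e') :
    HasDeg M N e' f := h ▸ hf

end HasDeg

section

variable {M : PreDGModule.{u, v} k t} {N : PreDGModule.{u, w} k t} {X : PreDGModule.{u, x} k t}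

theorem IsDG.hasDeg_d (hM : M.IsDG) : HasDeg M M (-1) M.d := hM.d_mem

theorem IsGraded.hasDeg_par (hM : M.IsGraded) : HasDeg M M 0 M.par :=
  fun i m hm => by rw [add_zero]; exact hM.par_mem hm

theorem hasDeg_id : HasDeg M M 0 (KHom.id _) :=
  fun i m hm => by rw [add_zero]; exact hm

theorem IsDG.par_d (hM : M.IsDG) (m : M.carrier) : M.par (M.d m) = -M.d (M.par m) := by
  rw [hM.isGraded.par_comm_neg_one hM.isGraded hM.hasDeg_d, neg_neg]

theorem tm_mem {i j : ℤ} {m : M.carrier} {n : N.carrier} (hm : m ∈ M.gr i) (hn : n ∈ N.gr j) :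
    tm m n ∈ ((M.tensor N).gr (i + j) :
      Submodule k (KBimod.tensor M.toKBimod N.toKBimod).carrier) :=
  Submodule.subset_span (M := (KBimod.tensor M.toKBimod N.toKBimod).carrier)
    ⟨i, j, m, n, hm, hn, rfl, rfl⟩

theorem tensor_hasDeg {e : ℤ} {f : KHom (KBimod.tensor M.toKBimod N.toKBimod) X.toKBimod}
    (h : ∀ i j, ∀ m ∈ M.gr i, ∀ n ∈ N.gr j, f (tm m n) ∈ X.gr (i + j + e)) :
    HasDeg (M.tensor N) X e f := by
  intro n q hq
  refine Submodule.span_induction (p := fun q _ => f q ∈ X.gr (n + e)) ?_ ?_ ?_ ?_ hq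
  · rintro _ ⟨i, j, a, b, ha, hb, rfl, rfl⟩
    exact h i j a ha b hb
  · rw [map_zero]; exact zero_mem _
  · intro p q _ _ hp hq
    rw [map_add]; exact add_mem hp hq
  · intro c p _ hp
    rw [map_smul]; exact Submodule.smul_mem _ c hp

theorem HasDeg.map {M' : PreDGModule.{u, y} k t} {N' : PreDGModule.{u, x} k t} {e e' : ℤ}
    {f : KHom M.toKBimod M'.toKBimod} {g : KHom N.toKBimod N'.toKBimod}
    (hf : HasDeg M M' e f) (hg : HasDeg N N' e' g) :
    HasDeg (M.tensor N) (M'.tensor N') (e + e') (KBimod.map f g) :=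
  tensor_hasDeg fun i j m hm n hn => by
    have := tm_mem (hf i m hm) (hg j n hn)
    rwa [show i + e + (j + e') = i + j + (e + e') by ring] at this

theorem mem_unit_gr {i : ℤ} {m : Fin t → k} : m ∈ (unit k t).gr i ↔ i = 0 ∨ m = 0 := by
  by_cases h : i = 0
  · subst h
    change m ∈ (if (0 : ℤ) = 0 then (⊤ : Submodule k (Fin t → k)) else ⊥) ↔ _
    simp
  · change m ∈ (if i = 0 then (⊤ : Submodule k (Fin t → k)) else ⊥) ↔ _
    simp [h]

theorem unit_isGraded : (unit k t).IsGraded := by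
  refine isGraded_of_projections ?_ (fun i => if i = 0 then LinearMap.id else 0) ?_ ?_ ?_ ?_ ?_
  · refine eq_top_iff.2 fun m _ => ?_
    exact le_iSup (unit k t).gr (0 : ℤ) (mem_unit_gr.2 (Or.inl rfl))
  · intro i m hm
    rcases mem_unit_gr.1 hm with h | h
    · simp [h]
    · exact (congrArg _ h).trans ((map_zero _).trans h.symm)
  · intro i j hij m hm
    rcases mem_unit_gr.1 hm with h | h
    · have : i ≠ 0 := fun hi => hij (h.trans hi.symm)
      simp [this]
    · exact (congrArg _ h).trans (map_zero _)
  · intro n a m hm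
    refine mem_unit_gr.2 ((mem_unit_gr.1 hm).imp_right fun h => ?_)
    exact (congrArg _ h).trans (map_zero _)
  · intro n a m hm
    refine mem_unit_gr.2 ((mem_unit_gr.1 hm).imp_right fun h => ?_)
    exact (congrArg _ h).trans (map_zero _)
  · intro n m hm
    rcases mem_unit_gr.1 hm with h | h
    · subst h
      refine Eq.trans (b := m) rfl ?_
      simp
    · refine Eq.trans (b := m) rfl ?_
      exact h.trans ((congrArg (fun x => (n.negOnePow : ℤ) • x) h).trans (smul_zero _)).symm

theorem IsGraded.tensor (hM : M.IsGraded) (hN : N.IsGraded) : (M.tensor N).IsGraded := by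
  -- The projection onto total degree n is the sum over i of pr_i ⊗ pr_{n-i}; it has finitely many
  -- nonzero terms on each tensor.
  have hfin : ∀ n : ℤ, ∀ q, (Function.support fun i =>
      (KBimod.map (hM.pr i) (hN.pr (n - i)) : KHom _ _) q).Finite := by
    intro n q
    induction q using tensor_induction with
    | h0 => simp
    | ht a b =>
      refine (hM.pr_finite a).subset fun i hi => ?_
      intro h
      refine hi ?_
      change tm (hM.pr i a) (hN.pr (n - i) b) = 0
      rw [show hM.pr i a = 0 from h, tm_zero_left]
    | ha p q hp hq =>
      refine (hp.union hq).subset fun i hi => ?_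
      by_contra h
      simp only [Set.mem_union, Function.mem_support, not_or, not_not] at h
      exact hi (by simp only [map_add, h.1, h.2, add_zero])
  have key : ∀ n i j, ∀ a ∈ M.gr i, ∀ b ∈ N.gr j,
      KHom.finsum _ (hfin n) (tm a b) = if i + j = n then tm a b else 0 := by
    intro n i j a ha b hb
    rw [KHom.finsum_apply, finsum_eq_single _ i]
    · rw [map_tm, hM.pr_of_mem i ha, hN.pr_of_mem _ hb, if_pos rfl]
      by_cases h : i + j = n
      · rw [if_pos h, if_pos (by omega)]
      · rw [if_neg h, if_neg (by omega), tm_zero_right]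
    · intro i' hi'
      rw [map_tm, hM.pr_of_mem i' ha, if_neg hi'.symm, tm_zero_left]
  refine isGraded_of_projections ?_ (fun n => (KHom.finsum _ (hfin n)).toLin) ?_ ?_ ?_ ?_ ?_
  · rw [eq_top_iff]
    rintro q -
    induction q using tensor_induction with
    | h0 => exact zero_mem _
    | ht a b =>
      induction a using hM.induction with
      | h0 => rw [tm_zero_left]; exact zero_mem _
      | hg i a ha =>
        induction b using hN.induction with
        | h0 => rw [tm_zero_right]; exact zero_mem _
        | hg j b hb => exact le_iSup (M.tensor N).gr (i + j) (tm_mem ha hb)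
        | ha b b' hb hb' => rw [tm_add_right]; exact add_mem hb hb'
      | ha a a' ha ha' => rw [tm_add_left]; exact add_mem ha ha'
    | ha p q hp hq => exact add_mem hp hq
  · intro n
    change (M.tensor N).gr n ≤ LinearMap.eqLocus (KHom.finsum _ (hfin n)).toLin LinearMap.id
    refine Submodule.span_le.2 ?_
    rintro _ ⟨i, j, a, b, ha, hb, h, rfl⟩
    exact (key n i j a ha b hb).trans (if_pos h)
  · intro n n' hn
    change (M.tensor N).gr n' ≤ LinearMap.ker (KHom.finsum _ (hfin n)).toLin
    refine Submodule.span_le.2 ?_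
    rintro _ ⟨i, j, a, b, ha, hb, h, rfl⟩
    exact (key n i j a ha b hb).trans (if_neg (by omega))
  · intro n a
    change (M.tensor N).gr n ≤ ((M.tensor N).gr n).comap ((M.tensor N).l a)
    refine Submodule.span_le.2 ?_
    rintro _ ⟨i, j, b, c, hb, hc, rfl, rfl⟩
    exact tm_mem (hM.l_mem i a b hb) hc
  · intro n a
    change (M.tensor N).gr n ≤ ((M.tensor N).gr n).comap ((M.tensor N).r a)
    refine Submodule.span_le.2 ?_
    rintro _ ⟨i, j, b, c, hb, hc, rfl, rfl⟩
    exact tm_mem hb (hN.r_mem j a c hc)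
  · intro n
    change (M.tensor N).gr n ≤
      LinearMap.eqLocus (M.tensor N).par.toLin ((n.negOnePow : ℤ) • LinearMap.id)
    refine Submodule.span_le.2 ?_
    rintro _ ⟨i, j, a, b, ha, hb, rfl, rfl⟩
    change tm (M.par a) (N.par b) = ((i + j).negOnePow : ℤ) • tm a b
    rw [hM.par_apply i a ha, hN.par_apply j b hb, tm_zsmul_left, tm_zsmul_right, smul_smul,
      Int.negOnePow_add, Units.val_mul]

/-- The two mixed terms dm ⊗ dn cancel because d anticommutes with the parity operator. -/
theorem IsDG.tensor_d_d (hM : M.IsDG) (hN : N.IsDG)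
    (q : (KBimod.tensor M.toKBimod N.toKBimod).carrier) :
    (M.tensor N).d ((M.tensor N).d q) = 0 := by
  let D : KHom (KBimod.tensor M.toKBimod N.toKBimod) (KBimod.tensor M.toKBimod N.toKBimod) :=
    (M.tensor N).d
  have hD : ∀ a b, D (tm a b) = tm (M.d a) b + tm (M.par a) (N.d b) := fun _ _ => rfl
  refine KBimod.linear_ext (f := D.toLin ∘ₗ D.toLin) (g := 0) (fun a b => ?_) q
  simp only [LinearMap.comp_apply, hD, map_add, hM.d_d, hN.d_d, hM.par_d, tm_zero_left,
    tm_zero_right, tm_neg_left, LinearMap.zero_apply]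
  abel

theorem IsDG.hasDeg_tensor_d (hM : M.IsDG) (hN : N.IsDG) :
    HasDeg (M.tensor N) (M.tensor N) (-1) (M.tensor N).d := by
  have h1 : HasDeg (M.tensor N) (M.tensor N) (-1) (KBimod.map M.d (KHom.id _)) :=
    (HasDeg.map hM.hasDeg_d (hasDeg_id (M := N))).congr (by ring)
  have h2 : HasDeg (M.tensor N) (M.tensor N) (-1) (KBimod.map M.par N.d) :=
    (HasDeg.map hM.isGraded.hasDeg_par hN.hasDeg_d).congr (by ring)
  exact h1.add h2

theorem IsDG.tensor (hM : M.IsDG) (hN : N.IsDG) : (M.tensor N).IsDG :=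
  have h := hM.isGraded.tensor hN.isGraded
  ⟨h.internal, h.l_mem, h.r_mem, h.par_apply, hM.hasDeg_tensor_d hN, hM.tensor_d_d hN⟩

theorem IsDG.susp (hM : M.IsDG) : M.susp.IsDG where
  internal := by
    have hM := hM.isGraded
    refine isInternal_of_projections (M := M.carrier) (fun n => M.gr (n - 1)) ?_
      (fun n => (hM.pr (n - 1)).toLin) ?_ ?_
    · rw [← hM.iSup_eq_top]
      exact (Equiv.subRight (1 : ℤ)).iSup_comp (g := M.gr)
    · intro i m hm
      exact (hM.pr_of_mem _ hm).trans (if_pos rfl)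
    · intro i j hij m hm
      exact (hM.pr_of_mem _ hm).trans (if_neg (by omega))
  l_mem n := hM.l_mem (n - 1)
  r_mem n := hM.r_mem (n - 1)
  par_apply n (m : M.carrier) hm := by
    change -M.par m = (n.negOnePow : ℤ) • m
    rw [hM.par_apply (n - 1) m hm, Int.negOnePow_sub, Int.negOnePow_one]
    simp
  d_mem n m hm := neg_mem (hM.d_mem (n - 1) m hm)
  d_d (m : M.carrier) := by
    change -M.d (-M.d m) = 0
    rw [map_neg, hM.d_d, neg_zero, neg_zero]

theorem IsDG.desusp (hM : M.IsDG) : M.desusp.IsDG where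
  internal := by
    have hM := hM.isGraded
    refine isInternal_of_projections (M := M.carrier) (fun n => M.gr (n + 1)) ?_
      (fun n => (hM.pr (n + 1)).toLin) ?_ ?_
    · rw [← hM.iSup_eq_top]
      exact (Equiv.addRight (1 : ℤ)).iSup_comp (g := M.gr)
    · intro i m hm
      exact (hM.pr_of_mem _ hm).trans (if_pos rfl)
    · intro i j hij m hm
      exact (hM.pr_of_mem _ hm).trans (if_neg (by omega))
  l_mem n := hM.l_mem (n + 1)
  r_mem n := hM.r_mem (n + 1)
  par_apply n (m : M.carrier) hm := by
    change -M.par m = (n.negOnePow : ℤ) • m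
    rw [hM.par_apply (n + 1) m hm, Int.negOnePow_add, Int.negOnePow_one]
    simp
  d_mem n (m : M.carrier) hm := by
    have := neg_mem (hM.d_mem (n + 1) m hm)
    rwa [show n + 1 - 1 = n - 1 + 1 by ring] at this
  d_d (m : M.carrier) := by
    change -M.d (-M.d m) = 0
    rw [map_neg, hM.d_d, neg_zero, neg_zero]

end

section

variable {M : PreDGModule.{u, u} k t}

/-- The conditions under which the kernel of a split augmentation is a dg submodule. -/
theorem IsDG.ker (hM : M.IsDG) {e : KHom M.toKBimod (KBimod.unit k t)}
    {η : KHom (KBimod.unit k t) M.toKBimod} (h : ∀ a, e (η a) = a)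
    (he : ∀ n, n ≠ 0 → ∀ m ∈ M.gr n, e m = 0) (hd : ∀ m, e (M.d m) = 0) :
    (M.ker e η h).IsDG ∧ (∀ m, kerIncl e ((M.ker e η h).par m) = M.par (kerIncl e m)) ∧
      ∀ m, kerIncl e ((M.ker e η h).d m) = M.d (kerIncl e m) := by
  have hg := hM.isGraded
  -- The augmentation sees only degree 0, where the parity operator is the identity. Together with
  -- `hd`, this makes the compressed operators genuine restrictions.
  have hepar : ∀ m, e (M.par m) = e m := by
    intro m
    refine hg.linear_ext (f := e.toLin ∘ₗ M.par.toLin) (g := e.toLin) (fun i m hm => ?_) m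
    rw [LinearMap.comp_apply, hM.par_apply i m hm, map_zsmul]
    by_cases hi : i = 0
    · subst hi; simp
    · rw [he i hi m hm, smul_zero]
  have hpar : ∀ m, kerIncl e ((M.ker e η h).par m) = M.par (kerIncl e m) := by
    intro (m : (KBimod.ker e).carrier)
    change M.par (kerIncl e m) - η (e (M.par (kerIncl e m))) = _
    rw [hepar, apply_kerIncl, map_zero, sub_zero]
  have hd' : ∀ m, kerIncl e ((M.ker e η h).d m) = M.d (kerIncl e m) := by
    intro (m : (KBimod.ker e).carrier)
    change M.d (kerIncl e m) - η (e (M.d (kerIncl e m))) = _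
    rw [hd, map_zero, sub_zero]
  have hpr : ∀ n m, e m = 0 → e (hg.pr n m) = 0 := by
    intro n m hm
    by_cases hn : n = 0
    · subst hn
      rw [← hm]
      refine hg.linear_ext (f := e.toLin ∘ₗ (hg.pr 0).toLin) (g := e.toLin) (fun i m hm => ?_) m
      rw [LinearMap.comp_apply, hg.pr_of_mem 0 hm]
      split_ifs with hi
      · rfl
      · rw [he i hi m hm, map_zero]
    · exact he n hn _ (hg.pr_mem n m)
  refine ⟨⟨?_, ?_, ?_, ?_, ?_, ?_⟩, hpar, hd'⟩
  · let π : ℤ → (LinearMap.ker e.toLin) →ₗ[k] (LinearMap.ker e.toLin) := fun n =>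
      (hg.pr n).toLin.restrict fun m hm => hpr n m hm
    refine isInternal_of_projections (M := LinearMap.ker e.toLin)
      (fun n => (M.gr n).comap (LinearMap.ker e.toLin).subtype) ?_ π ?_ ?_
    · rw [eq_top_iff]
      rintro m -
      have h1 : m = ∑ n ∈ (hg.pr_finite m.1).toFinset, π n m := by
        refine Subtype.ext ?_
        rw [Submodule.coe_sum]
        refine (hg.finsum_pr m.1).symm.trans ?_
        rw [finsum_eq_sum_of_support_subset (s := (hg.pr_finite m.1).toFinset) _ (by simp)]
        rfl
      rw [h1]
      exact sum_mem fun n _ => (le_iSup (fun n => (M.gr n).comap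
        (LinearMap.ker e.toLin).subtype) n) (hg.pr_mem n m.1)
    · intro i m hm
      exact Subtype.ext ((hg.pr_of_mem i hm).trans (if_pos rfl))
    · intro i j hij m hm
      exact Subtype.ext ((hg.pr_of_mem i hm).trans (if_neg hij))
  · intro n a m hm
    exact hM.l_mem n a _ hm
  · intro n a m hm
    exact hM.r_mem n a _ hm
  · intro n m hm
    refine kerIncl_injective e ((hpar m).trans ?_)
    exact (hM.par_apply n _ hm).trans (map_zsmul (kerIncl e).toLin _ m).symm
  · intro n m hm
    have := hM.d_mem n _ hm
    exact (congrArg (· ∈ M.gr (n - 1)) (hd' m)).mpr this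
  · intro m
    refine kerIncl_injective e ((hd' _).trans ?_)
    exact (congrArg M.d.toLin (hd' m)).trans ((hM.d_d _).trans (map_zero _).symm)

/-- The tensor powers as graded bimodules. -/
noncomputable def powModule (M : PreDGModule.{u, u} k t) (n : ℕ) : PreDGModule.{u, u} k t where
  toKBimod := KBimod.pow M.toKBimod n
  gr := (pow M n).1
  par := (pow M n).2
  d := 0

theorem powModule_isGraded (hM : M.IsGraded) : ∀ n, (powModule M n).IsGraded
  | 0 => by
    have h : (unit k t).IsGraded := unit_isGraded
    exact ⟨h.internal, h.l_mem, h.r_mem, h.par_apply⟩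
  | n + 1 => by
    have h := hM.tensor (powModule_isGraded hM n)
    exact ⟨h.internal, h.l_mem, h.r_mem, h.par_apply⟩

theorem tens_hasDeg {D : KHom (KBimod.tens M.toKBimod) (KBimod.tens M.toKBimod)}
    {X : PreDGModule.{u, x} k t} {e : ℤ} {f : KHom (M.tens D).toKBimod X.toKBimod}
    (h : ∀ n, HasDeg (powModule M n) X e (KHom.comp f (incl (KBimod.pow M.toKBimod) n))) :
    HasDeg (M.tens D) X e f := by
  intro i m hm
  have : (M.tens D).gr i ≤ (X.gr (i + e)).comap f.toLin := iSup_le fun n => by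
    rintro _ ⟨m, hm, rfl⟩
    exact h n i m hm
  exact this hm

theorem incl_hasDeg (D : KHom (KBimod.tens M.toKBimod) (KBimod.tens M.toKBimod)) (n : ℕ) :
    HasDeg (powModule M n) (M.tens D) 0 (incl (KBimod.pow M.toKBimod) n) := by
  intro i m hm
  rw [add_zero]
  exact le_iSup (fun n => ((pow M n).1 i).map (incl (KBimod.pow M.toKBimod) n).toLin) n
    (Submodule.mem_map_of_mem hm)

theorem IsGraded.tens (hM : M.IsGraded)
    (D : KHom (KBimod.tens M.toKBimod) (KBimod.tens M.toKBimod)) : (M.tens D).IsGraded := by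
  have hp := powModule_isGraded hM
  have key : ∀ i n j, ∀ m ∈ (powModule M n).gr j,
      desc (fun n => (incl (KBimod.pow M.toKBimod) n).comp ((hp n).pr i))
        (incl (KBimod.pow M.toKBimod) n m) =
          if j = i then incl (KBimod.pow M.toKBimod) n m else 0 := by
    intro i n j m hm
    refine (desc_incl _ n m).trans ?_
    refine (congrArg (incl (KBimod.pow M.toKBimod) n).toLin ((hp n).pr_of_mem i hm)).trans ?_
    split_ifs
    · rfl
    · exact map_zero _
  refine isGraded_of_projections ?_ (fun i => (desc fun n =>
    (incl (KBimod.pow M.toKBimod) n).comp ((hp n).pr i)).toLin) ?_ ?_ ?_ ?_ ?_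
  · rw [eq_top_iff]
    rintro q -
    induction q using dsum_induction with
    | h0 => exact zero_mem _
    | hi n m =>
      refine (hp n).induction (M := powModule M n)
        (p := fun m => incl (KBimod.pow M.toKBimod) n m ∈ iSup (M.tens D).gr) ?_ ?_ ?_ m
      · exact (congrArg (· ∈ iSup (M.tens D).gr) (map_zero _)).mpr (zero_mem _)
      · intro i m hm
        have := incl_hasDeg D n i m hm
        rw [add_zero] at this
        exact le_iSup (M.tens D).gr i this
      · intro m m' hm hm'
        exact (congrArg (· ∈ iSup (M.tens D).gr) (map_add _ _ _)).mpr (add_mem hm hm')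
    | ha p q hp hq => exact add_mem hp hq
  · intro i
    change (M.tens D).gr i ≤ LinearMap.eqLocus (desc fun n =>
      (incl (KBimod.pow M.toKBimod) n).comp ((hp n).pr i)).toLin LinearMap.id
    refine iSup_le fun n => ?_
    rintro _ ⟨m, hm, rfl⟩
    exact (key i n i m hm).trans (if_pos rfl)
  · intro i j hij
    change (M.tens D).gr j ≤ LinearMap.ker (desc fun n =>
      (incl (KBimod.pow M.toKBimod) n).comp ((hp n).pr i)).toLin
    refine iSup_le fun n => ?_
    rintro _ ⟨m, hm, rfl⟩
    exact (key i n j m hm).trans (if_neg hij)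
  · intro i a
    change (M.tens D).gr i ≤ ((M.tens D).gr i).comap ((M.tens D).l a)
    refine iSup_le fun n => ?_
    rintro _ ⟨m, hm, rfl⟩
    have := incl_hasDeg D n i _ ((hp n).l_mem i a m hm)
    rw [add_zero] at this
    exact (congrArg (· ∈ (M.tens D).gr i)
      ((incl (KBimod.pow M.toKBimod) n).map_l a m)).mp this
  · intro i a
    change (M.tens D).gr i ≤ ((M.tens D).gr i).comap ((M.tens D).r a)
    refine iSup_le fun n => ?_
    rintro _ ⟨m, hm, rfl⟩
    have := incl_hasDeg D n i _ ((hp n).r_mem i a m hm)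
    rw [add_zero] at this
    exact (congrArg (· ∈ (M.tens D).gr i)
      ((incl (KBimod.pow M.toKBimod) n).map_r a m)).mp this
  · intro i
    change (M.tens D).gr i ≤
      LinearMap.eqLocus (M.tens D).par.toLin ((i.negOnePow : ℤ) • LinearMap.id)
    refine iSup_le fun n => ?_
    rintro _ ⟨m, hm, rfl⟩
    refine (desc_incl _ n m).trans ?_
    refine (congrArg (incl (KBimod.pow M.toKBimod) n).toLin ((hp n).par_apply i m hm)).trans ?_
    exact map_zsmul _ _ _

end

end PreDGModule

end

/-! ### Recursive formulas on T(V): concatenation, derivations, merging, deconcatenation -/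

section

namespace KBimod

variable {k : Type u} [Field k] {t : ℕ} (V : KBimod.{u, u} k t)

theorem tensCons_tm (v : V.carrier) (n : ℕ) (m : (pow V n).carrier) :
    tensCons V (tm v (incl (pow V) n m)) = incl (pow V) (n + 1) (tm v m) :=
  descRight_tm _ n v m

variable {V}

/-- Induction on elements of the tensor ring, by prepending elements of `V`. -/
theorem tensRing_induction {p : (tens V).carrier → Prop}
    (h1 : ∀ x : Fin t → k, p (tensOne V x)) (hc : ∀ v u, p u → p (tensCons V (tm v u)))
    (ha : ∀ u u', p u → p u' → p (u + u')) (u : (tens V).carrier) : p u := by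
  have h0 : p 0 := by
    have := h1 0
    rwa [map_zero] at this
  have key : ∀ n m, p (incl (pow V) n m) := by
    intro n
    induction n with
    | zero => exact h1
    | succ n ih =>
      intro m
      refine tensor_induction (V := V) (W := pow V n)
        (p := fun m => p (incl (pow V) (n + 1) m)) ?_ ?_ ?_ m
      · exact (congrArg p (map_zero _)).mpr h0
      · intro v m
        rw [← tensCons_tm]
        exact hc v _ (ih m)
      · intro q q' hq hq'
        exact (congrArg p (map_add _ _ _)).mpr (ha _ _ hq hq')
  induction u using dsum_induction with
  | h0 => exact h0
  | hi n m => exact key n m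
  | ha q q' hq hq' => exact ha q q' hq hq'

/-- Two morphisms out of `V ⊗ T(V)` agree as soon as they agree on all `v ⊗ uₙ`, where `uₙ` is a
tensor of length `n`. -/
theorem tensor_tens_hom_ext {W : KBimod.{u, v} k t} {X : KBimod.{u, x} k t}
    {f g : KHom (tensor W (tens V)) X}
    (h : ∀ n w (m : (pow V n).carrier), f (tm w (incl (pow V) n m)) = g (tm w (incl (pow V) n m)))
    (q : (tensor W (tens V)).carrier) : f q = g q := by
  refine linear_ext (f := f.toLin) (g := g.toLin) (fun w u => ?_) q
  induction u using dsum_induction with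
  | h0 => rw [tm_zero_right, map_zero, map_zero]
  | hi n m => exact h n w m
  | ha u u' hu hu' => rw [tm_add_right, map_add, map_add, hu, hu']

/-- Having `D = desc F` as a hypothesis lets `rfl` unfold any map that is defined length by length;
this lemma and the next yield the recursions of `der`, `merge`, `deconcat` and the projections. -/
theorem pow_hom_zero_apply {X : KBimod.{u, x} k t} {D : KHom (tens V) X}
    {F : ∀ n, KHom (pow V n) X} (hD : D = desc F) (x : Fin t → k) :
    D (tensOne V x) = F 0 x := by
  subst hD
  exact desc_incl F 0 x

theorem pow_hom_succ_apply {X : KBimod.{u, x} k t} {D : KHom (tens V) X}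
    {F : ∀ n, KHom (pow V n) X} (hD : D = desc F) (n : ℕ) (v : V.carrier)
    (m : (pow V n).carrier) :
    D (tensCons V (tm v (incl (pow V) n m))) = F (n + 1) (tm v m) := by
  subst hD
  rw [tensCons_tm]
  exact desc_incl F (n + 1) _

theorem concat_one (x : Fin t → k) (w : (tens V).carrier) :
    concat V (tm (tensOne V x) w) = (tens V).l x w :=
  descLeft_tm (concatAux V) 0 x w

theorem concat_cons (v : V.carrier) (u w : (tens V).carrier) :
    concat V (tm (tensCons V (tm v u)) w) = tensCons V (tm v (concat V (tm u w))) := by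
  induction u using dsum_induction with
  | h0 => simp only [tm_zero_right, map_zero, tm_zero_left]
  | hi n m =>
    rw [tensCons_tm]
    refine (descLeft_tm (concatAux V) (n + 1) _ w).trans ?_
    refine congrArg (fun z => tensCons V (tm v z)) ?_
    exact (descLeft_tm (concatAux V) n m w).symm
  | ha u u' hu hu' => rw [tm_add_right, map_add, tm_add_left, map_add, hu, hu', tm_add_left,
      map_add, tm_add_right, map_add]

theorem concat_one_right (w : (tens V).carrier) (x : Fin t → k) :
    concat V (tm w (tensOne V x)) = (tens V).r x w := by
  induction w using tensRing_induction with
  | h1 y =>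
    rw [concat_one, ← (tensOne V).map_l, ← (tensOne V).map_r]
    exact congrArg (tensOne V).toLin (mul_comm y x)
  | hc v u hu => rw [concat_cons, hu, ← r_tm, (tensCons V).map_r]
  | ha u u' hu hu' => rw [tm_add_left, map_add, hu, hu', map_add]

theorem concat_assoc (a b c : (tens V).carrier) :
    concat V (tm (concat V (tm a b)) c) = concat V (tm a (concat V (tm b c))) := by
  induction a using tensRing_induction with
  | h1 x => rw [concat_one, concat_one, ← (concat V).map_l]; rfl
  | hc v u hu => rw [concat_cons, concat_cons, concat_cons, hu]
  | ha u u' hu hu' =>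
    rw [tm_add_left, tm_add_left, map_add, map_add, tm_add_left, map_add, hu, hu']

theorem tensIncl_eq (v : V.carrier) :
    tensIncl V v = tensCons V (tm v (tensOne V (1 : Fin t → k))) := rfl

theorem concat_incl (v : V.carrier) (u : (tens V).carrier) :
    concat V (tm (tensIncl V v) u) = tensCons V (tm v u) := by
  rw [tensIncl_eq, concat_cons, concat_one, l_one]

theorem tensProj_one (x : Fin t → k) : tensProj V (tensOne V x) = x := tensProj_tensOne V x

theorem tensProj_cons (q : (tensor V (tens V)).carrier) : tensProj V (tensCons V q) = 0 := by
  refine tensor_tens_hom_ext (f := (tensProj V).comp (tensCons V)) (g := 0) (fun n v m => ?_) q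
  exact pow_hom_succ_apply (D := tensProj V) rfl n v m

theorem tensProjV_one (x : Fin t → k) : tensProjV V (tensOne V x) = 0 :=
  pow_hom_zero_apply (D := tensProjV V) rfl x

theorem tensProjV_cons_one (v : V.carrier) (x : Fin t → k) :
    tensProjV V (tensCons V (tm v (tensOne V x))) = V.r x v :=
  pow_hom_succ_apply (D := tensProjV V) rfl 0 v x

theorem tensProjV_cons_cons (v : V.carrier) (q : (tensor V (tens V)).carrier) :
    tensProjV V (tensCons V (tm v (tensCons V q))) = 0 := by
  refine linear_ext (g := 0)
    (f := (tensProjV V).toLin ∘ₗ (tensCons V).toLin ∘ₗ tmLin V (tens V) v ∘ₗ (tensCons V).toLin)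
    (fun w u => ?_) q
  change tensProjV V (tensCons V (tm v (tensCons V (tm w u)))) = 0
  induction u using dsum_induction with
  | h0 => rw [tm_zero_right, map_zero, tm_zero_right, map_zero, map_zero]
  | hi n m =>
    rw [tensCons_tm]
    exact pow_hom_succ_apply (D := tensProjV V) rfl (n + 1) v _
  | ha u u' hu hu' =>
    rw [tm_add_right, map_add, tm_add_right, map_add, map_add, hu, hu', add_zero]

section der

variable {s : KHom V V} {f : KHom V (tens V)}

theorem der_one (x : Fin t → k) : der s f (tensOne V x) = 0 :=
  pow_hom_zero_apply (D := der s f) rfl x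

/-- Turns the recursion over the length of tensors into a recursion on T(V), where the tail u is
arbitrary. Later proofs use only this form. -/
theorem der_cons (v : V.carrier) (u : (tens V).carrier) : der s f (tensCons V (tm v u)) =
    concat V (tm (f v) u) + tensCons V (tm (s v) (der s f u)) := by
  refine tensor_tens_hom_ext (f := (der s f).comp (tensCons V))
    (g := (concat V).comp (map f (KHom.id _)) + (tensCons V).comp (map s (der s f)))
    (fun n v m => ?_) (tm v u)
  refine (pow_hom_succ_apply (D := der s f) rfl n v m).trans ?_
  refine congrArg (fun z => concat V (tm (f v) (incl (pow V) n m)) + tensCons V (tm (s v) z)) ?_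
  exact (desc_incl (derAux s f) n m).symm

end der

section merge

/-- The map `mergeHead` on tensors of a given length. -/
def mergeHeadAux (g : KHom (tensor V V) V) : ∀ n, KHom (tensor V (pow V n)) (tens V)
  | 0 => 0
  | n + 1 => (incl (pow V) (n + 1)).comp
      ((map g (KHom.id (pow V n))).comp (assocInv V V (pow V n)))

/-- The map `v ⊗ v₁ ⊗ ⋯ ⊗ vₙ ↦ g(v ⊗ v₁) ⊗ v₂ ⊗ ⋯ ⊗ vₙ`. -/
def mergeHead (g : KHom (tensor V V) V) : KHom (tensor V (tens V)) (tens V) :=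
  descRight (mergeHeadAux g)

variable {s : KHom V V} {g : KHom (tensor V V) V}

theorem mergeHead_one (v : V.carrier) (x : Fin t → k) :
    mergeHead g (tm v (tensOne V x)) = 0 :=
  descRight_tm (mergeHeadAux g) 0 v x

theorem mergeHead_incl (v : V.carrier) (n : ℕ) (m : (pow V n).carrier) :
    mergeHead g (tm v (incl (pow V) n m)) = mergeHeadAux g n (tm v m) :=
  descRight_tm (mergeHeadAux g) n v m

theorem mergeHead_cons (v w : V.carrier) (u : (tens V).carrier) :
    mergeHead g (tm v (tensCons V (tm w u))) = tensCons V (tm (g (tm v w)) u) := by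
  induction u using dsum_induction with
  | h0 => rw [tm_zero_right, map_zero, tm_zero_right, map_zero, tm_zero_right, map_zero]
  | hi n m =>
    rw [tensCons_tm, tensCons_tm]
    exact mergeHead_incl v (n + 1) _
  | ha u u' hu hu' =>
    rw [tm_add_right, map_add, tm_add_right, map_add, hu, hu', tm_add_right, map_add]

theorem merge_one (x : Fin t → k) : merge s g (tensOne V x) = 0 :=
  pow_hom_zero_apply (D := merge s g) rfl x

theorem merge_cons (v : V.carrier) (u : (tens V).carrier) : merge s g (tensCons V (tm v u)) =
    mergeHead g (tm v u) + tensCons V (tm (s v) (merge s g u)) := by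
  refine tensor_tens_hom_ext (f := (merge s g).comp (tensCons V))
    (g := mergeHead g + (tensCons V).comp (map s (merge s g))) (fun n v m => ?_) (tm v u)
  refine (pow_hom_succ_apply (D := merge s g) rfl n v m).trans ?_
  change _ = mergeHead g (tm v (incl (pow V) n m)) +
    tensCons V (tm (s v) (merge s g (incl (pow V) n m)))
  rw [show merge s g (incl (pow V) n m) = mergeAux s g n m from desc_incl (mergeAux s g) n m,
    mergeHead_incl]
  -- For n = 0 there is nothing to merge: `mergeAux` is zero on lengths 0 and 1, and `mergeHeadAux`
  -- is zero on a tail of length 0.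
  cases n with
  | zero =>
    change (0 : (tens V).carrier) = 0 + tensCons V (tm (s v) (0 : (tens V).carrier))
    rw [tm_zero_right, map_zero, add_zero]
  | succ n => rfl

end merge

section deconcat

theorem deconcat_one (x : Fin t → k) :
    deconcat V (tensOne V x) = tm (tensOne V x) (tensOne V (1 : Fin t → k)) :=
  pow_hom_zero_apply (D := deconcat V) rfl x

theorem deconcat_cons (v : V.carrier) (u : (tens V).carrier) : deconcat V (tensCons V (tm v u)) =
    tm (tensOne V (1 : Fin t → k)) (tensCons V (tm v u)) +
      map (tensCons V) (KHom.id (tens V)) (assocInv V (tens V) (tens V) (tm v (deconcat V u))) := by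
  refine tensor_tens_hom_ext (f := (deconcat V).comp (tensCons V))
    (g := (map (tensOne V) (tensCons V)).comp (leftUnitInv _) +
      (map (tensCons V) (KHom.id (tens V))).comp
        ((assocInv V (tens V) (tens V)).comp (map (KHom.id V) (deconcat V))))
    (fun n v m => ?_) (tm v u)
  refine (pow_hom_succ_apply (D := deconcat V) rfl n v m).trans ?_
  change _ = tm (tensOne V (1 : Fin t → k)) (tensCons V (tm v (incl (pow V) n m))) +
    map (tensCons V) (KHom.id (tens V)) (assocInv V (tens V) (tens V)
      (tm v (deconcat V (incl (pow V) n m))))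
  rw [tensCons_tm, show deconcat V (incl (pow V) n m) = deconcatAux V n m from desc_incl _ n m]
  rfl

end deconcat

end KBimod

end

/-! ### Axioms of dg corings and twisting morphisms; linearity of products and actions -/

section

open KBimod PreDGModule

namespace PreDGModule

variable {k : Type u} [Field k] {t : ℕ} {M : PreDGModule.{u, v} k t} {N : PreDGModule.{u, w} k t}
  {X : PreDGModule.{u, x} k t} {Y : PreDGModule.{u, y} k t}

theorem tensor_gr_induction {n : ℤ} {p : (KBimod.tensor M.toKBimod N.toKBimod).carrier → Prop}
    (h0 : p 0) (ha : ∀ q q', p q → p q' → p (q + q')) (hs : ∀ (c : k) q, p q → p (c • q))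
    (h : ∀ i j, i + j = n → ∀ m ∈ M.gr i, ∀ n ∈ N.gr j, p (tm m n))
    (q : (KBimod.tensor M.toKBimod N.toKBimod).carrier) (hq : q ∈ (M.tensor N).gr n) : p q := by
  refine Submodule.span_induction (p := fun q _ => p q) ?_ h0 ?_ ?_ hq
  · rintro _ ⟨i, j, a, b, ha, hb, hn, rfl⟩
    exact h i j hn a ha b hb
  · intro p q _ _ hp hq
    exact ha _ _ hp hq
  · intro c p _ hp
    exact hs c _ hp

theorem tensor_hasDeg_left {e : ℤ}
    {f : KHom (KBimod.tensor (KBimod.tensor M.toKBimod N.toKBimod) X.toKBimod) Y.toKBimod}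
    (h : ∀ i j l, ∀ a ∈ M.gr i, ∀ b ∈ N.gr j, ∀ c ∈ X.gr l,
      f (tm (tm a b) c) ∈ Y.gr (i + j + l + e)) :
    HasDeg ((M.tensor N).tensor X) Y e f := by
  refine tensor_hasDeg (M := M.tensor N) fun i j q hq c hc => ?_
  refine tensor_gr_induction (p := fun q => f (tm q c) ∈ Y.gr (i + j + e)) ?_ ?_ ?_ ?_ q hq
  · rw [tm_zero_left, map_zero]; exact zero_mem _
  · intro q q' hq hq'
    rw [tm_add_left, map_add]; exact add_mem hq hq'
  · intro x q hq
    rw [tm_smul_left, map_smul]; exact Submodule.smul_mem _ _ hq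
  · rintro i' j' rfl a ha b hb
    exact h i' j' j a ha b hb c hc

theorem tensor_hasDeg_right {e : ℤ}
    {f : KHom (KBimod.tensor M.toKBimod (KBimod.tensor N.toKBimod X.toKBimod)) Y.toKBimod}
    (h : ∀ i j l, ∀ a ∈ M.gr i, ∀ b ∈ N.gr j, ∀ c ∈ X.gr l,
      f (tm a (tm b c)) ∈ Y.gr (i + j + l + e)) :
    HasDeg (M.tensor (N.tensor X)) Y e f := by
  refine tensor_hasDeg (N := N.tensor X) fun i j a ha q hq => ?_
  refine tensor_gr_induction (p := fun q => f (tm a q) ∈ Y.gr (i + j + e)) ?_ ?_ ?_ ?_ q hq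
  · rw [tm_zero_right, map_zero]; exact zero_mem _
  · intro q q' hq hq'
    rw [tm_add_right, map_add]; exact add_mem hq hq'
  · intro x q hq
    rw [tm_smul_right, map_smul]; exact Submodule.smul_mem _ _ hq
  · rintro i' j' rfl b hb c hc
    have := h i i' j' a ha b hb c hc
    rwa [add_assoc i i' j'] at this

theorem hasDeg_assoc : HasDeg ((M.tensor N).tensor X) (M.tensor (N.tensor X)) 0
    (assoc M.toKBimod N.toKBimod X.toKBimod) :=
  tensor_hasDeg_left fun i j l a ha b hb c hc => by
    have := tm_mem ha (tm_mem (M := N) (N := X) hb hc)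
    rw [add_zero, add_assoc]
    exact this

theorem hasDeg_assocInv : HasDeg (M.tensor (N.tensor X)) ((M.tensor N).tensor X) 0
    (assocInv M.toKBimod N.toKBimod X.toKBimod) :=
  tensor_hasDeg_right fun i j l a ha b hb c hc => by
    have := tm_mem (tm_mem (M := M) (N := N) ha hb) hc
    rw [add_zero]
    exact this

end PreDGModule

variable {k : Type u} [Field k] {t : ℕ}

/-- The axioms of a coaugmented dg `K`-coring. -/
structure PreDGCoring.IsCoaugDGCoring (C : PreDGCoring.{u} k t) : Prop
    extends C.toPreDGModule.IsDG where
  coassoc : ∀ c, assoc _ _ _ (map C.comul (KHom.id _) (C.comul c)) =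
    map (KHom.id _) C.comul (C.comul c)
  counit_left : ∀ c, leftUnit _ (map C.counit (KHom.id _) (C.comul c)) = c
  counit_right : ∀ c, rightUnit _ (map (KHom.id _) C.counit (C.comul c)) = c
  comul_deg : HasDeg C.toPreDGModule (C.toPreDGModule.tensor C.toPreDGModule) 0 C.comul
  comul_d : ∀ c, C.comul (C.d c) =
    map C.d (KHom.id _) (C.comul c) + map C.par C.d (C.comul c)
  comul_coaug : ∀ x : Fin t → k, C.comul (C.coaug x) = tm (C.coaug x) (C.coaug (1 : Fin t → k))
  coaug_mem : ∀ x : Fin t → k, C.coaug x ∈ C.gr 0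
  d_coaug : ∀ x : Fin t → k, C.d (C.coaug x) = 0
  counit_gr : ∀ n, n ≠ 0 → ∀ c ∈ C.gr n, C.counit c = 0
  counit_d : ∀ c, C.counit (C.d c) = 0

/-- The axioms of a twisting morphism: it has degree `-1`, vanishes on the coaugmentation, and
satisfies the Maurer–Cartan equation. -/
structure PreDGRing.IsTwisting (R : PreDGRing.{u} k t) (C : PreDGCoring.{u} k t)
    (α : KHom C.toKBimod R.toKBimod) : Prop where
  deg : HasDeg C.toPreDGModule R.toPreDGModule (-1) α
  coaug : ∀ x : Fin t → k, α (C.coaug x) = 0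
  maurerCartan : ∀ c, R.d (α c) + α (C.d c) +
    R.mul (map (α.comp C.par) α (C.comul c)) = 0

theorem PreDGCoring.IsCoaugDGCoring.comul_par {C : PreDGCoring.{u} k t} (hC : C.IsCoaugDGCoring)
    (c : C.carrier) : C.comul (C.par c) = map C.par C.par (C.comul c) :=
  hC.toIsDG.isGraded.par_comm_zero (hC.toIsDG.isGraded.tensor hC.toIsDG.isGraded) hC.comul_deg c

namespace PreDGRing

section ring

variable {R : PreDGRing.{u} k t}

theorem m_add_right (a b b' : R.carrier) : R.m a (b + b') = R.m a b + R.m a b' := by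
  simp only [m, tm_add_right, map_add]

theorem m_neg_left (a b : R.carrier) : R.m (-a) b = -R.m a b := by
  simp only [m, tm_neg_left, map_neg]

theorem m_neg_right (a b : R.carrier) : R.m a (-b) = -R.m a b := by
  simp only [m, tm_neg_right, map_neg]

theorem m_sub_left (a a' b : R.carrier) : R.m (a - a') b = R.m a b - R.m a' b := by
  simp only [m, tm_sub_left, map_sub]

theorem m_sub_right (a b b' : R.carrier) : R.m a (b - b') = R.m a b - R.m a b' := by
  simp only [m, tm_sub_right, map_sub]

theorem m_zero_left (b : R.carrier) : R.m 0 b = 0 := by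
  simp only [m, tm_zero_left, map_zero]

theorem m_zero_right (a : R.carrier) : R.m a 0 = 0 := by
  simp only [m, tm_zero_right, map_zero]

theorem l_m (x : Fin t → k) (a b : R.carrier) : R.l x (R.m a b) = R.m (R.l x a) b :=
  (R.mul.map_l x (tm a b)).symm

theorem r_m (x : Fin t → k) (a b : R.carrier) : R.r x (R.m a b) = R.m a (R.r x b) :=
  (R.mul.map_r x (tm a b)).symm

namespace IsAugDGRing

variable (hR : R.IsAugDGRing)
include hR

theorem isGraded : R.toPreDGModule.IsGraded := hR.toIsDG.isGraded

theorem mul_deg : HasDeg (R.toPreDGModule.tensor R.toPreDGModule) R.toPreDGModule 0 R.mul :=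
  tensor_hasDeg fun i j a ha b hb => by
    rw [add_zero]
    exact hR.mul_mem i j a ha b hb

theorem par_m (a b : R.carrier) : R.par (R.m a b) = R.m (R.par a) (R.par b) :=
  (hR.isGraded.tensor hR.isGraded |>.par_comm_zero hR.isGraded hR.mul_deg (tm a b)).symm

theorem par_one (x : Fin t → k) : R.par (R.one x) = R.one x := by
  rw [hR.par_apply 0 _ (hR.one_mem x)]
  simp

theorem par_par (a : R.carrier) : R.par (R.par a) = a := hR.isGraded.par_par a

theorem par_d (a : R.carrier) : R.par (R.d a) = -R.d (R.par a) := hR.toIsDG.par_d a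

theorem m_one (a : R.carrier) : R.m a (R.one (1 : Fin t → k)) = a := by
  rw [hR.mul_one, r_one]

theorem one_m (a : R.carrier) : R.m (R.one (1 : Fin t → k)) a = a := by
  rw [hR.one_mul, l_one]

end IsAugDGRing

end ring

end PreDGRing

namespace PreDGBimodule

variable {R : PreDGRing.{u} k t} {M : PreDGBimodule.{u, w} R}

theorem la_add_left (a a' : R.carrier) (m : M.carrier) :
    M.la (a + a') m = M.la a m + M.la a' m := by simp only [la, tm_add_left, map_add]

theorem la_add_right (a : R.carrier) (m m' : M.carrier) :
    M.la a (m + m') = M.la a m + M.la a m' := by simp only [la, tm_add_right, map_add]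

theorem la_sub_right (a : R.carrier) (m m' : M.carrier) :
    M.la a (m - m') = M.la a m - M.la a m' := by simp only [la, tm_sub_right, map_sub]

theorem la_neg_left (a : R.carrier) (m : M.carrier) : M.la (-a) m = -M.la a m := by
  simp only [la, tm_neg_left, map_neg]

theorem la_neg_right (a : R.carrier) (m : M.carrier) : M.la a (-m) = -M.la a m := by
  simp only [la, tm_neg_right, map_neg]

theorem la_zero_left (m : M.carrier) : M.la 0 m = 0 := by
  simp only [la, tm_zero_left, map_zero]

theorem la_zero_right (a : R.carrier) : M.la a 0 = 0 := by
  simp only [la, tm_zero_right, map_zero]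

theorem la_zsmul_left (n : ℤ) (a : R.carrier) (m : M.carrier) :
    M.la (n • a) m = n • M.la a m := by simp only [la, tm_zsmul_left, map_zsmul]

theorem la_zsmul_right (n : ℤ) (a : R.carrier) (m : M.carrier) :
    M.la a (n • m) = n • M.la a m := by simp only [la, tm_zsmul_right, map_zsmul]

theorem ra_add_left (m m' : M.carrier) (a : R.carrier) :
    M.ra (m + m') a = M.ra m a + M.ra m' a := by simp only [ra, tm_add_left, map_add]

theorem ra_add_right (m : M.carrier) (a a' : R.carrier) :
    M.ra m (a + a') = M.ra m a + M.ra m a' := by simp only [ra, tm_add_right, map_add]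

theorem ra_sub_left (m m' : M.carrier) (a : R.carrier) :
    M.ra (m - m') a = M.ra m a - M.ra m' a := by simp only [ra, tm_sub_left, map_sub]

theorem ra_neg_left (m : M.carrier) (a : R.carrier) : M.ra (-m) a = -M.ra m a := by
  simp only [ra, tm_neg_left, map_neg]

theorem ra_neg_right (m : M.carrier) (a : R.carrier) : M.ra m (-a) = -M.ra m a := by
  simp only [ra, tm_neg_right, map_neg]

theorem ra_zero_left (a : R.carrier) : M.ra 0 a = 0 := by
  simp only [ra, tm_zero_left, map_zero]

theorem ra_zero_right (m : M.carrier) : M.ra m 0 = 0 := by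
  simp only [ra, tm_zero_right, map_zero]

theorem ra_zsmul_left (n : ℤ) (m : M.carrier) (a : R.carrier) :
    M.ra (n • m) a = n • M.ra m a := by simp only [ra, tm_zsmul_left, map_zsmul]

end PreDGBimodule

namespace PreDGRing

theorem regular_isDGBimodule {R : PreDGRing.{u} k t} (hR : R.IsAugDGRing) :
    R.regular.IsDGBimodule where
  toIsDG := hR.toIsDG
  la_la a b m := (hR.mul_assoc a b m).symm
  ra_ra m a b := hR.mul_assoc m a b
  la_ra a m b := hR.mul_assoc a m b
  one_la := hR.one_mul
  ra_one := hR.mul_one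
  la_mem := hR.mul_mem
  ra_mem := hR.mul_mem
  d_la := hR.leibniz
  d_ra := hR.leibniz

/-! ### The two-sided twisted tensor product: its elements and the terms of its differential -/

section twisted

variable {R : PreDGRing.{u} k t} {C : PreDGCoring.{u} k t} (α : KHom C.toKBimod R.toKBimod)

/-- The element `a ⊗ c ⊗ b` of `R ⊗_α C ⊗_α R`. -/
def tw (a : R.carrier) (c : C.carrier) (b : R.carrier) : (twisted R C α).carrier :=
  tm (V := KBimod.tensor R.toKBimod C.toKBimod) (W := R.toKBimod) (tm a c) b

variable {α}

theorem twisted_linear_ext {X : Type*} [AddCommGroup X] [Module k X]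
    {f g : (twisted R C α).carrier →ₗ[k] X} (h : ∀ a c b, f (tw α a c b) = g (tw α a c b))
    (p : (twisted R C α).carrier) : f p = g p := by
  refine linear_ext (V := KBimod.tensor R.toKBimod C.toKBimod) (W := R.toKBimod)
    (f := f) (g := g) (fun q b => ?_) p
  exact linear_ext (V := R.toKBimod) (W := C.toKBimod)
    (f := f ∘ₗ (tmLin (KBimod.tensor R.toKBimod C.toKBimod) R.toKBimod).flip b)
    (g := g ∘ₗ (tmLin (KBimod.tensor R.toKBimod C.toKBimod) R.toKBimod).flip b)
    (fun a c => h a c b) q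

theorem twisted_induction {p : (twisted R C α).carrier → Prop}
    (h : ∀ a c b, p (tw α a c b)) (ha : ∀ q q', p q → p q' → p (q + q'))
    (q : (twisted R C α).carrier) : p q := by
  have h0 : p 0 := by
    have h1 : tw α 0 0 0 = 0 := tm_zero_right _
    rw [← h1]
    exact h 0 0 0
  refine tensor_induction (V := KBimod.tensor R.toKBimod C.toKBimod) (W := R.toKBimod)
    (p := p) h0 (fun q b => ?_) ha q
  refine tensor_induction (V := R.toKBimod) (W := C.toKBimod)
    (p := fun q => p (tm (V := KBimod.tensor R.toKBimod C.toKBimod) (W := R.toKBimod) q b))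
    ?_ (fun a c => h a c b) (fun q q' hq hq' => ?_) q
  · exact (congrArg p (tm_zero_left _)).mpr h0
  · exact (congrArg p (tm_add_left _ _ _)).mpr (ha _ _ hq hq')

theorem tw_add_left (a a' : R.carrier) (c : C.carrier) (b : R.carrier) :
    tw α (a + a') c b = tw α a c b + tw α a' c b :=
  (congrArg (fun q => tm q b) (tm_add_left a a' c)).trans (tm_add_left _ _ _)

theorem tw_neg_left (a : R.carrier) (c : C.carrier) (b : R.carrier) :
    tw α (-a) c b = -tw α a c b :=
  (congrArg (fun q => tm q b) (tm_neg_left a c)).trans (tm_neg_left _ _)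

theorem tw_zero_left (c : C.carrier) (b : R.carrier) : tw α 0 c b = 0 :=
  (congrArg (fun q => tm q b) (tm_zero_left c)).trans (tm_zero_left _)

theorem tw_sub_left (a a' : R.carrier) (c : C.carrier) (b : R.carrier) :
    tw α (a - a') c b = tw α a c b - tw α a' c b := by
  rw [sub_eq_add_neg, tw_add_left, tw_neg_left, sub_eq_add_neg]

theorem tw_add_mid (a : R.carrier) (c c' : C.carrier) (b : R.carrier) :
    tw α a (c + c') b = tw α a c b + tw α a c' b :=
  (congrArg (fun q => tm q b) (tm_add_right a c c')).trans (tm_add_left _ _ _)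

theorem tw_neg_mid (a : R.carrier) (c : C.carrier) (b : R.carrier) :
    tw α a (-c) b = -tw α a c b :=
  (congrArg (fun q => tm q b) (tm_neg_right a c)).trans (tm_neg_left _ _)

theorem tw_zero_mid (a b : R.carrier) : tw α a 0 b = 0 :=
  (congrArg (fun q => tm q b) (tm_zero_right a)).trans (tm_zero_left _)

theorem tw_smul_mid (x : k) (a : R.carrier) (c : C.carrier) (b : R.carrier) :
    tw α a (x • c) b = x • tw α a c b :=
  (congrArg (fun q => tm q b) (tm_smul_right x a c)).trans (tm_smul_left _ _ _)

theorem tw_add_right (a : R.carrier) (c : C.carrier) (b b' : R.carrier) :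
    tw α a c (b + b') = tw α a c b + tw α a c b' := tm_add_right _ _ _

theorem tw_neg_right (a : R.carrier) (c : C.carrier) (b : R.carrier) :
    tw α a c (-b) = -tw α a c b := tm_neg_right _ _

theorem tw_zero_right (a : R.carrier) (c : C.carrier) : tw α a c 0 = 0 := tm_zero_right _

theorem tw_balance_left (x : Fin t → k) (a : R.carrier) (c : C.carrier) (b : R.carrier) :
    tw α (R.r x a) c b = tw α a (C.l x c) b :=
  congrArg (fun q => tm q b) (tm_balance x a c)

theorem tw_balance_right (x : Fin t → k) (a : R.carrier) (c : C.carrier) (b : R.carrier) :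
    tw α a (C.r x c) b = tw α a c (R.l x b) :=
  tm_balance (V := KBimod.tensor R.toKBimod C.toKBimod) x (tm a c) b

theorem la_tw (x a : R.carrier) (c : C.carrier) (b : R.carrier) :
    (twisted R C α).la x (tw α a c b) = tw α (R.m x a) c b := rfl

theorem ra_tw (a : R.carrier) (c : C.carrier) (b y : R.carrier) :
    (twisted R C α).ra (tw α a c b) y = tw α a c (R.m b y) := rfl

theorem par_tw (a : R.carrier) (c : C.carrier) (b : R.carrier) :
    (twisted R C α).par (tw α a c b) = tw α (R.par a) (C.par c) (R.par b) := rfl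

variable (α)

/-- The map `x ⊗ y ↦ (-1) ^ |x| a ⊗ x ⊗ α(y) b`. -/
def twR (a b : R.carrier) :
    (KBimod.tensor C.toKBimod C.toKBimod).carrier →ₗ[k] (twisted R C α).carrier :=
  (assocInv R.toKBimod C.toKBimod R.toKBimod).toLin ∘ₗ
    tmLin R.toKBimod (KBimod.tensor C.toKBimod R.toKBimod) a ∘ₗ (map (KHom.id _) R.mul).toLin ∘ₗ
      (assoc C.toKBimod R.toKBimod R.toKBimod).toLin ∘ₗ (map (map C.par α) (KHom.id _)).toLin ∘ₗ
        (tmLin (KBimod.tensor C.toKBimod C.toKBimod) R.toKBimod).flip b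

/-- The map `x ⊗ y ↦ a α(x) ⊗ y ⊗ b`. -/
def twL (a b : R.carrier) :
    (KBimod.tensor C.toKBimod C.toKBimod).carrier →ₗ[k] (twisted R C α).carrier :=
  (tmLin (KBimod.tensor R.toKBimod C.toKBimod) R.toKBimod).flip b ∘ₗ
    (map R.mul (KHom.id _)).toLin ∘ₗ (assocInv R.toKBimod R.toKBimod C.toKBimod).toLin ∘ₗ
      tmLin R.toKBimod (KBimod.tensor R.toKBimod C.toKBimod) a ∘ₗ (map α (KHom.id _)).toLin

variable {α}

theorem twR_tm (a b : R.carrier) (x y : C.carrier) :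
    twR α a b (tm x y) = tw α a (C.par x) (R.m (α y) b) := rfl

theorem twL_tm (a b : R.carrier) (x y : C.carrier) :
    twL α a b (tm x y) = tw α (R.m a (α x)) y b := rfl

/-- Both twisting terms carry the sign (-1)^{|a|}: the operator d^r has to move past a, and in d^l
the morphism α does. -/
theorem d_tw (a : R.carrier) (c : C.carrier) (b : R.carrier) :
    (twisted R C α).d (tw α a c b) = tw α (R.d a) c b + tw α (R.par a) (C.d c) b +
      tw α (R.par a) (C.par c) (R.d b) + twR α (R.par a) b (C.comul c) -
        twL α (R.par a) b (C.comul c) := by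
  rw [sub_eq_add_neg]
  exact congrArg (fun z : (twisted R C α).carrier => z + tw α (R.par a) (C.par c) (R.d b) +
    twR α (R.par a) b (C.comul c) + -twL α (R.par a) b (C.comul c)) (tm_add_left
      (V := KBimod.tensor R.toKBimod C.toKBimod) (tm (R.d a) c) (tm (R.par a) (C.d c)) b)

theorem twisted_isGraded (hR : R.IsAugDGRing) (hC : C.IsCoaugDGCoring) :
    (twisted R C α).IsGraded := by
  have h := (hR.isGraded.tensor hC.toIsDG.isGraded).tensor hR.isGraded
  exact ⟨h.internal, h.l_mem, h.r_mem, h.par_apply⟩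

theorem twisted_hasDeg {X : PreDGModule.{u, x} k t} {e : ℤ}
    {f : KHom (twisted R C α).toKBimod X.toKBimod}
    (h : ∀ i j l, ∀ a ∈ R.gr i, ∀ c ∈ C.gr j, ∀ b ∈ R.gr l,
      f (tw α a c b) ∈ X.gr (i + j + l + e)) :
    HasDeg (twisted R C α).toPreDGModule X e f :=
  tensor_hasDeg_left (M := R.toPreDGModule) (N := C.toPreDGModule) (X := R.toPreDGModule) h

theorem tw_mem {i j l : ℤ} {a : R.carrier} {c : C.carrier} {b : R.carrier} (ha : a ∈ R.gr i)
    (hc : c ∈ C.gr j) (hb : b ∈ R.gr l) : tw α a c b ∈ (twisted R C α).gr (i + j + l) :=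
  tm_mem (M := R.toPreDGModule.tensor C.toPreDGModule) (tm_mem ha hc) hb

theorem twisted_d_mem (hR : R.IsAugDGRing) (hC : C.IsCoaugDGCoring) (hα : R.IsTwisting C α) :
    HasDeg (twisted R C α).toPreDGModule (twisted R C α).toPreDGModule (-1) (twisted R C α).d := by
  let T := (R.toPreDGModule.tensor C.toPreDGModule).tensor R.toPreDGModule
  have h1 : HasDeg T T (-1) T.d :=
    ((hR.toIsDG.tensor hC.toIsDG).hasDeg_tensor_d hR.toIsDG)
  have hr : HasDeg (C.toPreDGModule.tensor R.toPreDGModule)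
      (C.toPreDGModule.tensor R.toPreDGModule) (-1) (twistRight R C α) :=
    (((hasDeg_id.map hR.mul_deg).comp (hasDeg_assoc.comp
      (((hC.toIsDG.isGraded.hasDeg_par.map hα.deg).map hasDeg_id).comp
        (hC.comul_deg.map hasDeg_id)))).congr (by ring))
  have hl : HasDeg (R.toPreDGModule.tensor C.toPreDGModule)
      (R.toPreDGModule.tensor C.toPreDGModule) (-1) (twistLeft R C α) :=
    (((hR.mul_deg.map hasDeg_id).comp (hasDeg_assocInv.comp
      ((hR.isGraded.hasDeg_par.map (hα.deg.map hasDeg_id)).comp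
        (hasDeg_id.map hC.comul_deg)))).congr (by ring))
  have h2 : HasDeg T T (-1) ((assocInv _ _ _).comp
      ((map R.par (twistRight R C α)).comp (assoc _ _ _))) :=
    (hasDeg_assocInv.comp ((hR.isGraded.hasDeg_par.map hr).comp hasDeg_assoc)).congr (by ring)
  have h3 : HasDeg T T (-1) (map (twistLeft R C α) (KHom.id _)) :=
    (hl.map hasDeg_id).congr (by ring)
  exact (h1.add h2).sub h3

end twisted

end PreDGRing

end

/-! ### The twisted differential squares to zero; the canonical map to R -/

section

open KBimod PreDGModule

variable {k : Type u} [Field k] {t : ℕ}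

namespace PreDGRing

section twisted

variable {R : PreDGRing.{u} k t} {C : PreDGCoring.{u} k t} {α : KHom C.toKBimod R.toKBimod}

theorem twR_la (x a b : R.carrier) (q) :
    twR α (R.m x a) b q = (twisted R C α).la x (twR α a b q) :=
  linear_ext (f := twR α (R.m x a) b)
    (g := (twisted R C α).lact.toLin ∘ₗ tmLin R.toKBimod (twisted R C α).toKBimod x ∘ₗ twR α a b)
    (fun _ _ => rfl) q

theorem twL_la (hR : R.IsAugDGRing) (x a b : R.carrier) (q) :
    twL α (R.m x a) b q = (twisted R C α).la x (twL α a b q) :=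
  linear_ext (f := twL α (R.m x a) b)
    (g := (twisted R C α).lact.toLin ∘ₗ tmLin R.toKBimod (twisted R C α).toKBimod x ∘ₗ twL α a b)
    (fun p q => by
      refine (twL_tm _ _ p q).trans ?_
      rw [hR.mul_assoc]
      rfl) q

theorem twR_ra (hR : R.IsAugDGRing) (a b y : R.carrier) (q) :
    twR α a (R.m b y) q = (twisted R C α).ra (twR α a b q) y :=
  linear_ext (f := twR α a (R.m b y))
    (g := (twisted R C α).ract.toLin ∘ₗ
      (tmLin (twisted R C α).toKBimod R.toKBimod).flip y ∘ₗ twR α a b)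
    (fun p q => by
      refine (twR_tm _ _ p q).trans ?_
      rw [← hR.mul_assoc]
      rfl) q

theorem twL_ra (a b y : R.carrier) (q) :
    twL α a (R.m b y) q = (twisted R C α).ra (twL α a b q) y :=
  linear_ext (f := twL α a (R.m b y))
    (g := (twisted R C α).ract.toLin ∘ₗ
      (tmLin (twisted R C α).toKBimod R.toKBimod).flip y ∘ₗ twL α a b)
    (fun _ _ => rfl) q

/-- Each term of `d_tw` respects multiplication on the outer factors. Together with the right-handed
version this determines d by its values on 1 ⊗ c ⊗ 1, where the later identities are checked. -/
theorem twisted_d_la (hR : R.IsAugDGRing) (x : R.carrier) (p : (twisted R C α).carrier) :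
    (twisted R C α).d ((twisted R C α).la x p) =
      (twisted R C α).la (R.d x) p + (twisted R C α).la (R.par x) ((twisted R C α).d p) := by
  induction p using twisted_induction with
  | h a c b =>
    rw [la_tw, la_tw, d_tw, d_tw, PreDGBimodule.la_sub_right, PreDGBimodule.la_add_right,
      PreDGBimodule.la_add_right, PreDGBimodule.la_add_right, la_tw, la_tw, la_tw, hR.par_m,
      twR_la, twL_la hR, hR.leibniz, tw_add_left]
    abel
  | ha p q hp hq =>
    simp only [PreDGBimodule.la_add_right, map_add, hp, hq]
    abel

theorem twisted_d_ra (hR : R.IsAugDGRing) (p : (twisted R C α).carrier) (y : R.carrier) :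
    (twisted R C α).d ((twisted R C α).ra p y) = (twisted R C α).ra ((twisted R C α).d p) y +
      (twisted R C α).ra ((twisted R C α).par p) (R.d y) := by
  induction p using twisted_induction with
  | h a c b =>
    rw [ra_tw, d_tw, d_tw, sub_eq_add_neg, sub_eq_add_neg, PreDGBimodule.ra_add_left,
      PreDGBimodule.ra_add_left, PreDGBimodule.ra_add_left, PreDGBimodule.ra_add_left,
      PreDGBimodule.ra_neg_left, ra_tw, ra_tw, ra_tw, par_tw, ra_tw,
      twR_ra hR, twL_ra, hR.leibniz, tw_add_right]
    abel
  | ha p q hp hq =>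
    simp only [PreDGBimodule.ra_add_left, map_add, hp, hq]
    abel

variable (α)

/-- The map `c ↦ 1 ⊗ c ⊗ 1`. -/
def tw1 : KHom C.toKBimod (twisted R C α).toKBimod where
  toLin :=
    { toFun := fun c => tw α (R.one (1 : Fin t → k)) c (R.one (1 : Fin t → k))
      map_add' := fun c c' => tw_add_mid _ c c' _
      map_smul' := fun x c => tw_smul_mid x _ c _ }
  map_l x c := by
    change tw α _ (C.l x c) _ = tw α (R.l x (R.one (1 : Fin t → k))) c _
    rw [← tw_balance_left, ← R.one.map_r, ← R.one.map_l]
  map_r x c := by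
    change tw α _ (C.r x c) _ = tw α _ c (R.r x (R.one (1 : Fin t → k)))
    rw [tw_balance_right, ← R.one.map_l, ← R.one.map_r]

variable {α}

theorem tw1_apply (c : C.carrier) :
    tw1 α c = tw α (R.one (1 : Fin t → k)) c (R.one (1 : Fin t → k)) := rfl

theorem la_tw1 (hR : R.IsAugDGRing) (a : R.carrier) (c : C.carrier) :
    (twisted R C α).la a (tw1 α c) = tw α a c (R.one (1 : Fin t → k)) := by
  rw [tw1_apply, la_tw, hR.m_one]

theorem ra_tw1 (hR : R.IsAugDGRing) (c : C.carrier) (b : R.carrier) :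
    (twisted R C α).ra (tw1 α c) b = tw α (R.one (1 : Fin t → k)) c b := by
  rw [tw1_apply, ra_tw, hR.one_m]

theorem tw_eq (hR : R.IsAugDGRing) (a : R.carrier) (c : C.carrier) (b : R.carrier) :
    tw α a c b = (twisted R C α).la a ((twisted R C α).ra (tw1 α c) b) := by
  rw [ra_tw1 hR, la_tw, hR.m_one]

theorem par_tw1 (hR : R.IsAugDGRing) (c : C.carrier) :
    (twisted R C α).par (tw1 α c) = tw1 α (C.par c) := by
  rw [tw1_apply, par_tw, hR.par_one]; rfl

theorem tw1_hasDeg (hR : R.IsAugDGRing) :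
    HasDeg C.toPreDGModule (twisted R C α).toPreDGModule 0 (tw1 α) := fun i c hc => by
  have := tw_mem (α := α) (hR.one_mem (1 : Fin t → k)) hc (hR.one_mem (1 : Fin t → k))
  rw [zero_add] at this
  exact this

variable (α) in
/-- The map `x ⊗ y ↦ 1 ⊗ x ⊗ α(y)`, up to the sign `(-1) ^ |x|`. -/
abbrev twR1 : (KBimod.tensor C.toKBimod C.toKBimod).carrier →ₗ[k] (twisted R C α).carrier :=
  twR α (R.one (1 : Fin t → k)) (R.one (1 : Fin t → k))

variable (α) in
/-- The map `x ⊗ y ↦ α(x) ⊗ y ⊗ 1`. -/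
abbrev twL1 : (KBimod.tensor C.toKBimod C.toKBimod).carrier →ₗ[k] (twisted R C α).carrier :=
  twL α (R.one (1 : Fin t → k)) (R.one (1 : Fin t → k))

theorem d_tw1 (hR : R.IsAugDGRing) (c : C.carrier) : (twisted R C α).d (tw1 α c) =
    tw1 α (C.d c) + twR1 α (C.comul c) - twL1 α (C.comul c) := by
  rw [tw1_apply, d_tw, hR.d_one, hR.par_one, tw_zero_left, tw_zero_right, zero_add, add_zero]
  rfl

theorem twR1_tm (hR : R.IsAugDGRing) (x y : C.carrier) :
    twR1 α (tm x y) = (twisted R C α).ra (tw1 α (C.par x)) (α y) := by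
  refine (twR_tm _ _ x y).trans ?_
  rw [hR.m_one, ra_tw1 hR]

theorem twL1_tm (hR : R.IsAugDGRing) (x y : C.carrier) :
    twL1 α (tm x y) = (twisted R C α).la (α x) (tw1 α y) := by
  refine (twL_tm _ _ x y).trans ?_
  rw [hR.one_m, la_tw1 hR]

theorem twisted_la_la (hR : R.IsAugDGRing) (a b : R.carrier) (p : (twisted R C α).carrier) :
    (twisted R C α).la a ((twisted R C α).la b p) = (twisted R C α).la (R.m a b) p := by
  induction p using twisted_induction with
  | h x c y => rw [la_tw, la_tw, la_tw, hR.mul_assoc]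
  | ha p q hp hq => simp only [PreDGBimodule.la_add_right, hp, hq]

theorem twisted_ra_ra (hR : R.IsAugDGRing) (p : (twisted R C α).carrier) (a b : R.carrier) :
    (twisted R C α).ra ((twisted R C α).ra p a) b = (twisted R C α).ra p (R.m a b) := by
  induction p using twisted_induction with
  | h x c y => rw [ra_tw, ra_tw, ra_tw, hR.mul_assoc]
  | ha p q hp hq => simp only [PreDGBimodule.ra_add_left, hp, hq]

theorem twisted_la_ra (a : R.carrier) (p : (twisted R C α).carrier) (b : R.carrier) :
    (twisted R C α).ra ((twisted R C α).la a p) b =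
      (twisted R C α).la a ((twisted R C α).ra p b) := by
  induction p using twisted_induction with
  | h x c y => rfl
  | ha p q hp hq => simp only [PreDGBimodule.ra_add_left, PreDGBimodule.la_add_right, hp, hq]

variable (α)

/-- The convolution square of `α`. -/
def convSq : KHom (KBimod.tensor C.toKBimod C.toKBimod) R.toKBimod :=
  R.mul.comp (map (α.comp C.par) α)

/-- The map `x ⊗ (y ⊗ z) ↦ 1 ⊗ x ⊗ α(s y) α(z)`, where `s` is the parity operator. -/
def cubicR : KHom (KBimod.tensor C.toKBimod (KBimod.tensor C.toKBimod C.toKBimod))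
    (twisted R C α).toKBimod :=
  (twisted R C α).ract.comp (map (tw1 α) (convSq α))

/-- The map `x ⊗ (y ⊗ z) ↦ α(s x) ⊗ s y ⊗ α(z)`, where `s` is the parity operator. -/
def cubicM : KHom (KBimod.tensor C.toKBimod (KBimod.tensor C.toKBimod C.toKBimod))
    (twisted R C α).toKBimod :=
  (twisted R C α).lact.comp (map (α.comp C.par)
    ((twisted R C α).ract.comp (map ((tw1 α).comp C.par) α)))

/-- The map `x ⊗ (y ⊗ z) ↦ α(s x) α(y) ⊗ z ⊗ 1`, where `s` is the parity operator. -/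
def cubicL : KHom (KBimod.tensor C.toKBimod (KBimod.tensor C.toKBimod C.toKBimod))
    (twisted R C α).toKBimod :=
  (twisted R C α).lact.comp (map (α.comp C.par)
    ((twisted R C α).lact.comp (map α (tw1 α))))

variable {α}

theorem cubicR_tm (x : C.carrier) (q) :
    cubicR α (tm x q) = (twisted R C α).ra (tw1 α x) (convSq α q) := rfl

theorem cubicM_comul (hR : R.IsAugDGRing) (x : C.carrier) (q) :
    cubicM α (tm x q) = (twisted R C α).la (α (C.par x)) (twR1 α q) :=
  linear_ext (f := (cubicM α).toLin ∘ₗ tmLin C.toKBimod (KBimod.tensor C.toKBimod C.toKBimod) x)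
    (g := (twisted R C α).lact.toLin ∘ₗ
      tmLin R.toKBimod (twisted R C α).toKBimod (α (C.par x)) ∘ₗ twR1 α)
    (fun y z => congrArg ((twisted R C α).la (α (C.par x))) (twR1_tm hR y z).symm) q

theorem cubicL_comul (hR : R.IsAugDGRing) (x : C.carrier) (q) :
    cubicL α (tm x q) = (twisted R C α).la (α (C.par x)) (twL1 α q) :=
  linear_ext (f := (cubicL α).toLin ∘ₗ tmLin C.toKBimod (KBimod.tensor C.toKBimod C.toKBimod) x)
    (g := (twisted R C α).lact.toLin ∘ₗ
      tmLin R.toKBimod (twisted R C α).toKBimod (α (C.par x)) ∘ₗ twL1 α)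
    (fun y z => congrArg ((twisted R C α).la (α (C.par x))) (twL1_tm hR y z).symm) q

theorem cubicR_assoc (hR : R.IsAugDGRing) (hC : C.IsCoaugDGCoring) (q) (z : C.carrier) :
    cubicR α (assoc _ _ _ (tm q z)) =
      (twisted R C α).ra (twR1 α (map C.par C.par q)) (α z) :=
  linear_ext (f := (cubicR α).toLin ∘ₗ (assoc _ _ _).toLin ∘ₗ
      (tmLin (KBimod.tensor C.toKBimod C.toKBimod) C.toKBimod).flip z)
    (g := (twisted R C α).ract.toLin ∘ₗ (tmLin (twisted R C α).toKBimod R.toKBimod).flip (α z) ∘ₗ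
      twR1 α ∘ₗ (map C.par C.par).toLin)
    (fun x y => by
      change (twisted R C α).ra (tw1 α x) (R.m (α (C.par y)) (α z)) =
        (twisted R C α).ra (twR1 α (tm (C.par x) (C.par y))) (α z)
      rw [twR1_tm hR, hC.toIsDG.isGraded.par_par, twisted_ra_ra hR]) q

theorem cubicM_assoc (hR : R.IsAugDGRing) (q) (z : C.carrier) :
    cubicM α (assoc _ _ _ (tm q z)) =
      (twisted R C α).ra (twL1 α (map C.par C.par q)) (α z) :=
  linear_ext (f := (cubicM α).toLin ∘ₗ (assoc _ _ _).toLin ∘ₗ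
      (tmLin (KBimod.tensor C.toKBimod C.toKBimod) C.toKBimod).flip z)
    (g := (twisted R C α).ract.toLin ∘ₗ (tmLin (twisted R C α).toKBimod R.toKBimod).flip (α z) ∘ₗ
      twL1 α ∘ₗ (map C.par C.par).toLin)
    (fun x y => by
      change (twisted R C α).la (α (C.par x)) ((twisted R C α).ra (tw1 α (C.par y)) (α z)) =
        (twisted R C α).ra (twL1 α (tm (C.par x) (C.par y))) (α z)
      rw [twL1_tm hR, twisted_la_ra]) q

theorem cubicL_assoc (hR : R.IsAugDGRing) (q) (z : C.carrier) :
    cubicL α (assoc _ _ _ (tm q z)) = (twisted R C α).la (convSq α q) (tw1 α z) :=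
  linear_ext (f := (cubicL α).toLin ∘ₗ (assoc _ _ _).toLin ∘ₗ
      (tmLin (KBimod.tensor C.toKBimod C.toKBimod) C.toKBimod).flip z)
    (g := (twisted R C α).lact.toLin ∘ₗ (tmLin R.toKBimod (twisted R C α).toKBimod).flip
      (tw1 α z) ∘ₗ (convSq α).toLin)
    (fun x y => by
      change (twisted R C α).la (α (C.par x)) ((twisted R C α).la (α y) (tw1 α z)) =
        (twisted R C α).la (R.m (α (C.par x)) (α y)) (tw1 α z)
      rw [twisted_la_la hR]) q

variable (C) in
/-- The map `(id ⊗ Δ) - (Δ ⊗ id)`. -/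
def coassocDefect : KHom (KBimod.tensor C.toKBimod C.toKBimod)
    (KBimod.tensor C.toKBimod (KBimod.tensor C.toKBimod C.toKBimod)) :=
  map (KHom.id _) C.comul - (assoc _ _ _).comp (map C.comul (KHom.id _))

/-- The Maurer–Cartan equation exchanges d ∘ α + α ∘ d for the convolution square of α, after which
the remaining terms form a fixed cubic map applied to (id ⊗ Δ)q - (Δ ⊗ id)q. An arbitrary q is
allowed so that the identity can be checked on x ⊗ y; coassociativity is needed only afterwards, for
q = Δ c. -/
theorem twisted_d_quadratic (hR : R.IsAugDGRing) (hC : C.IsCoaugDGCoring)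
    (hα : R.IsTwisting C α) (q) :
    (twisted R C α).d (twR1 α q - twL1 α q) +
      (twR1 α - twL1 α) (map C.d (KHom.id _) q + map C.par C.d q) =
    (cubicM α - cubicR α - cubicL α) (coassocDefect C q) := by
  refine linear_ext
    (f := (twisted R C α).d.toLin ∘ₗ (twR1 α - twL1 α) +
      (twR1 α - twL1 α) ∘ₗ ((map C.d (KHom.id _)).toLin + (map C.par C.d).toLin))
    (g := (cubicM α - cubicR α - cubicL α).toLin ∘ₗ (coassocDefect C).toLin) (fun x y => ?_) q
  have hpα : ∀ z, R.par (α z) = -α (C.par z) := fun z => by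
    rw [hC.toIsDG.isGraded.par_comm_neg_one hR.isGraded hα.deg, neg_neg]
  have hmc : ∀ z, convSq α (C.comul z) = -(R.d (α z) + α (C.d z)) := fun z =>
    eq_neg_of_add_eq_zero_right (hα.maurerCartan z)
  have h1 : (cubicM α - cubicR α - cubicL α) (coassocDefect C (tm x y)) =
      (cubicM α (tm x (C.comul y)) - cubicR α (tm x (C.comul y)) - cubicL α (tm x (C.comul y))) -
      (cubicM α (assoc _ _ _ (tm (C.comul x) y)) - cubicR α (assoc _ _ _ (tm (C.comul x) y)) -
        cubicL α (assoc _ _ _ (tm (C.comul x) y))) := by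
    have h2 : coassocDefect C (tm x y) =
        (tmLin C.toKBimod (KBimod.tensor C.toKBimod C.toKBimod) x (C.comul y)) -
          assoc _ _ _ (tm (C.comul x) y) := KHom.sub_apply _ _ _
    rw [h2, map_sub]
    rw [KHom.sub_apply, KHom.sub_apply, KHom.sub_apply, KHom.sub_apply]
    rfl
  refine Eq.trans ?_ h1.symm
  -- Of the six cubic terms, four are twisting terms of Δ x or Δ y multiplied by a value of α. The
  -- other two contain the convolution square of Δ x or Δ y, which Maurer–Cartan rewrites.
  rw [cubicM_comul hR, cubicR_tm, cubicL_comul hR, cubicM_assoc hR, cubicR_assoc hR hC,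
    cubicL_assoc hR, ← hC.comul_par, hmc, hmc]
  simp only [LinearMap.add_apply, LinearMap.sub_apply, LinearMap.comp_apply, map_add, twR1_tm hR,
    twL1_tm hR]
  rw [map_tm, map_tm, twR1_tm hR, twL1_tm hR, twR1_tm hR, twL1_tm hR, KHom.id_apply, map_sub,
    twisted_d_ra hR, twisted_d_la hR, d_tw1 hR, d_tw1 hR, par_tw1 hR, hpα,
    hC.toIsDG.par_d, hC.toIsDG.isGraded.par_par]
  simp only [map_neg, PreDGBimodule.la_neg_left, PreDGBimodule.ra_neg_left,
    PreDGBimodule.la_add_right, PreDGBimodule.la_add_left, PreDGBimodule.ra_add_left,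
    PreDGBimodule.ra_add_right, PreDGBimodule.la_sub_right, PreDGBimodule.ra_sub_left,
    PreDGBimodule.ra_neg_right]
  abel

theorem twisted_d_d_tw1 (hR : R.IsAugDGRing) (hC : C.IsCoaugDGCoring) (hα : R.IsTwisting C α)
    (c : C.carrier) : (twisted R C α).d ((twisted R C α).d (tw1 α c)) = 0 := by
  have h := twisted_d_quadratic hR hC hα (C.comul c)
  have h0 : coassocDefect C (C.comul c) = 0 := by
    have := hC.coassoc c
    exact (KHom.sub_apply _ _ _).trans (sub_eq_zero.2 this.symm)
  rw [h0, map_zero, ← hC.comul_d] at h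
  rw [d_tw1 hR, add_sub_assoc, map_add, d_tw1 hR, hC.d_d, map_zero, zero_add, add_comm, ← h]
  rfl

theorem twisted_d_d (hR : R.IsAugDGRing) (hC : C.IsCoaugDGCoring) (hα : R.IsTwisting C α)
    (p : (twisted R C α).carrier) : (twisted R C α).d ((twisted R C α).d p) = 0 := by
  have hpar : ∀ p, (twisted R C α).par ((twisted R C α).d p) =
      -(twisted R C α).d ((twisted R C α).par p) := fun p => by
    have hg := twisted_isGraded (α := α) hR hC
    rw [hg.par_comm_neg_one hg (twisted_d_mem hR hC hα), neg_neg]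
  induction p using twisted_induction with
  | h a c b =>
    rw [tw_eq hR, twisted_d_la hR, map_add, twisted_d_la hR, twisted_d_la hR, twisted_d_ra hR,
      map_add, twisted_d_ra hR, twisted_d_ra hR, twisted_d_d_tw1 hR hC hα, hR.d_d, hR.d_d,
      hR.par_d, hpar]
    simp only [PreDGBimodule.la_zero_left, PreDGBimodule.la_neg_left, PreDGBimodule.ra_zero_right,
      PreDGBimodule.ra_zero_left, PreDGBimodule.ra_neg_left, PreDGBimodule.la_add_right,
      PreDGBimodule.la_neg_right]
    abel
  | ha p q hp hq => rw [map_add, map_add, hp, hq, add_zero]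

/-- The two-sided twisted tensor product is a dg bimodule. -/
theorem twisted_isDGBimodule (hR : R.IsAugDGRing) (hC : C.IsCoaugDGCoring)
    (hα : R.IsTwisting C α) : (twisted R C α).IsDGBimodule :=
  have hg := twisted_isGraded (α := α) hR hC
  { internal := hg.internal
    l_mem := hg.l_mem
    r_mem := hg.r_mem
    par_apply := hg.par_apply
    d_mem := twisted_d_mem hR hC hα
    d_d := twisted_d_d hR hC hα
    la_la := twisted_la_la hR
    ra_ra := twisted_ra_ra hR
    la_ra := twisted_la_ra
    one_la := fun x p => by
      induction p using twisted_induction with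
      | h a c b => rw [la_tw, hR.one_mul]; rfl
      | ha p q hp hq => rw [PreDGBimodule.la_add_right, hp, hq, map_add]
    ra_one := fun p x => by
      induction p using twisted_induction with
      | h a c b => rw [ra_tw, hR.mul_one]; rfl
      | ha p q hp hq => rw [PreDGBimodule.ra_add_left, hp, hq, map_add]
    la_mem := fun i j a ha m hm => by
      have : HasDeg (R.toPreDGModule.tensor (twisted R C α).toPreDGModule)
          (twisted R C α).toPreDGModule 0 (twisted R C α).lact :=
        (((hR.mul_deg.map hasDeg_id).map hasDeg_id).comp
          ((hasDeg_assocInv.map hasDeg_id).comp (hasDeg_assocInv (M := R.toPreDGModule)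
            (N := R.toPreDGModule.tensor C.toPreDGModule) (X := R.toPreDGModule)))).congr
              (by ring)
      have h := this _ _ (tm_mem ha hm)
      rwa [add_zero] at h
    ra_mem := fun i j m hm a ha => by
      have : HasDeg ((twisted R C α).toPreDGModule.tensor R.toPreDGModule)
          (twisted R C α).toPreDGModule 0 (twisted R C α).ract :=
        ((hasDeg_id.map hR.mul_deg).comp (hasDeg_assoc
          (M := R.toPreDGModule.tensor C.toPreDGModule) (N := R.toPreDGModule)
          (X := R.toPreDGModule))).congr (by ring)
      have h := this _ _ (tm_mem hm ha)
      rwa [add_zero] at h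
    d_la := twisted_d_la hR
    d_ra := twisted_d_ra hR }

theorem twistedAug_tw (a : R.carrier) (c : C.carrier) (b : R.carrier) :
    twistedAug R C α (tw α a c b) = R.m (R.r (C.counit c) a) b := rfl

theorem twistedAug_la (hR : R.IsAugDGRing) (x : R.carrier) (p : (twisted R C α).carrier) :
    twistedAug R C α ((twisted R C α).la x p) = R.regular.la x (twistedAug R C α p) := by
  induction p using twisted_induction with
  | h a c b =>
    rw [la_tw, twistedAug_tw, twistedAug_tw, r_m, hR.mul_assoc]
    rfl
  | ha p q hp hq => rw [PreDGBimodule.la_add_right, map_add, hp, hq, map_add,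
      PreDGBimodule.la_add_right]

theorem twistedAug_ra (hR : R.IsAugDGRing) (p : (twisted R C α).carrier) (y : R.carrier) :
    twistedAug R C α ((twisted R C α).ra p y) = R.regular.ra (twistedAug R C α p) y := by
  induction p using twisted_induction with
  | h a c b =>
    rw [ra_tw, twistedAug_tw, twistedAug_tw, ← hR.mul_assoc]
    rfl
  | ha p q hp hq => rw [PreDGBimodule.ra_add_left, map_add, hp, hq, map_add,
      PreDGBimodule.ra_add_left]

theorem counit_hasDeg (hC : C.IsCoaugDGCoring) :
    HasDeg C.toPreDGModule (PreDGModule.unit k t) 0 C.counit := fun i c hc => by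
  rw [add_zero]
  by_cases h : i = 0
  · exact mem_unit_gr.2 (Or.inl h)
  · exact mem_unit_gr.2 (Or.inr (hC.counit_gr i h c hc))

/-- By the two counit axioms each twisting term contributes α(c), with opposite signs, and ε(dc) =
0. -/
theorem twistedAug_d_tw1 (hR : R.IsAugDGRing) (hC : C.IsCoaugDGCoring) (c : C.carrier) :
    twistedAug R C α ((twisted R C α).d (tw1 α c)) = 0 := by
  have hpar : ∀ c, C.counit (C.par c) = C.counit c := fun c =>
    hC.toIsDG.isGraded.par_comm_zero unit_isGraded (counit_hasDeg hC) c
  rw [d_tw1 hR, map_sub, map_add]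
  have h0 : ∀ c b, twistedAug R C α (tw α (R.one (1 : Fin t → k)) c b) = R.l (C.counit c) b := by
    intro c b
    rw [twistedAug_tw, m_balance, hR.one_m]
  have h1 : twistedAug R C α (tw1 α (C.d c)) = 0 := by
    rw [tw1_apply, h0, hC.counit_d, map_zero]
    rfl
  have h2 : twistedAug R C α (twR1 α (C.comul c)) = α c := by
    conv_rhs => rw [← hC.counit_left c]
    refine linear_ext (f := (twistedAug R C α).toLin ∘ₗ twR1 α)
      (g := α.toLin ∘ₗ (leftUnit _).toLin ∘ₗ (map C.counit (KHom.id _)).toLin)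
      (fun x y => ?_) (C.comul c)
    change twistedAug R C α (twR1 α (tm x y)) = α (C.l (C.counit x) y)
    rw [twR1_tm hR, ra_tw1 hR, h0, hpar, α.map_l]
  have h3 : twistedAug R C α (twL1 α (C.comul c)) = α c := by
    conv_rhs => rw [← hC.counit_right c]
    refine linear_ext (f := (twistedAug R C α).toLin ∘ₗ twL1 α)
      (g := α.toLin ∘ₗ (rightUnit _).toLin ∘ₗ (map (KHom.id _) C.counit).toLin)
      (fun x y => ?_) (C.comul c)
    change twistedAug R C α (twL1 α (tm x y)) = α (C.r (C.counit y) x)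
    rw [twL1_tm hR, la_tw1 hR, twistedAug_tw, hR.m_one, α.map_r]
  rw [h1, h2, h3]
  exact (congrArg (· - α c) (zero_add (α c))).trans (sub_self _)

/-- The augmentation of the two-sided twisted tensor product is a morphism of dg bimodules. -/
theorem twistedAug_isDGHom (hR : R.IsAugDGRing) (hC : C.IsCoaugDGCoring)
    (hα : R.IsTwisting C α) :
    PreDGBimodule.IsDGHom (M := twisted R C α) (N := R.regular) (twistedAug R C α) := by
  have hdeg : HasDeg (twisted R C α).toPreDGModule R.regular.toPreDGModule 0
      (twistedAug R C α) := by
    refine twisted_hasDeg (X := R.toPreDGModule) fun i j l a ha c hc b hb => ?_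
    rw [add_zero]
    change R.m (R.r (C.counit c) a) b ∈ _
    refine hR.mul_mem _ _ _ ?_ _ hb
    by_cases h : j = 0
    · subst h
      rw [add_zero]
      exact hR.r_mem _ _ _ ha
    · have h0 : C.counit c = 0 := hC.counit_gr j h c hc
      rw [h0, map_zero]
      exact zero_mem _
  refine ⟨⟨hdeg, fun i a _ m => ?_, twistedAug_ra hR⟩, fun p => ?_⟩
  · rw [twistedAug_la hR]
    simp
  · have hP := twisted_isDGBimodule hR hC hα
    have hM := regular_isDGBimodule hR
    have hpar : ∀ p, twistedAug R C α ((twisted R C α).par p) =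
        R.regular.par (twistedAug R C α p) := fun p =>
      hP.toIsDG.isGraded.par_comm_zero hM.toIsDG.isGraded hdeg p
    induction p using twisted_induction with
    | h a c b =>
      have h0 : R.regular.d (twistedAug R C α (tw1 α c)) = 0 := by
        rw [tw1_apply, twistedAug_tw, m_balance, hR.one_m, ← R.one.map_l]
        exact hR.d_one _
      rw [tw_eq hR, hP.d_la, map_add, twistedAug_la hR, twistedAug_la hR, hP.d_ra, map_add,
        twistedAug_ra hR, twistedAug_ra hR, twistedAug_ra hR, twistedAug_d_tw1 hR hC, hpar,
        twistedAug_la hR,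
        twistedAug_ra hR, hM.d_la, hM.d_ra, h0]
    | ha p q hp hq => simp only [map_add, hp, hq]

end twisted

end PreDGRing

end

/-! ### Degrees and derivations on the tensor ring -/

section

open KBimod PreDGModule

variable {k : Type u} [Field k] {t : ℕ}

namespace PreDGModule

variable {M : PreDGModule.{u, u} k t}
  {D : KHom (KBimod.tens M.toKBimod) (KBimod.tens M.toKBimod)}

theorem tens_gr_induction {i : ℤ} {p : (KBimod.tens M.toKBimod).carrier → Prop} (h0 : p 0)
    (ha : ∀ q q', p q → p q' → p (q + q'))
    (h : ∀ n, ∀ m ∈ (powModule M n).gr i, p (incl (KBimod.pow M.toKBimod) n m))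
    (q : (KBimod.tens M.toKBimod).carrier) (hq : q ∈ (M.tens D).gr i) : p q := by
  refine Submodule.iSup_induction
    (fun n => ((pow M n).1 i).map (incl (KBimod.pow M.toKBimod) n).toLin) (motive := p) hq ?_ h0 ha
  rintro n _ ⟨m, hm, rfl⟩
  exact h n m hm

theorem descLeft_hasDeg {N : PreDGModule.{u, w} k t} {X : PreDGModule.{u, x} k t} {e : ℤ}
    {F : ∀ n, KHom (KBimod.tensor (KBimod.pow M.toKBimod n) N.toKBimod) X.toKBimod}
    (h : ∀ n, HasDeg ((powModule M n).tensor N) X e (F n)) :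
    HasDeg ((M.tens D).tensor N) X e (descLeft F) :=
  tensor_hasDeg (M := M.tens D) fun i j a ha b hb => by
    refine tens_gr_induction (p := fun a => descLeft F (tm a b) ∈ X.gr (i + j + e))
      ?_ ?_ ?_ a ha
    · rw [tm_zero_left, map_zero]; exact zero_mem _
    · intro q q' hq hq'
      rw [tm_add_left, map_add]; exact add_mem hq hq'
    · intro n m hm
      exact (congrArg (· ∈ X.gr (i + j + e)) (descLeft_tm F n m b)).mpr
        (h n _ _ (tm_mem (M := powModule M n) hm hb))

theorem descRight_hasDeg {N : PreDGModule.{u, w} k t} {X : PreDGModule.{u, x} k t} {e : ℤ}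
    {F : ∀ n, KHom (KBimod.tensor N.toKBimod (KBimod.pow M.toKBimod n)) X.toKBimod}
    (h : ∀ n, HasDeg (N.tensor (powModule M n)) X e (F n)) :
    HasDeg (N.tensor (M.tens D)) X e (descRight F) :=
  tensor_hasDeg (N := M.tens D) fun i j a ha b hb => by
    refine tens_gr_induction (p := fun b => descRight F (tm a b) ∈ X.gr (i + j + e))
      ?_ ?_ ?_ b hb
    · rw [tm_zero_right, map_zero]; exact zero_mem _
    · intro q q' hq hq'
      rw [tm_add_right, map_add]; exact add_mem hq hq'
    · intro n m hm
      exact (congrArg (· ∈ X.gr (i + j + e)) (descRight_tm F n a m)).mpr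
        (h n _ _ (tm_mem (N := powModule M n) ha hm))

theorem desc_hasDeg {X : PreDGModule.{u, x} k t} {e : ℤ}
    {F : ∀ n, KHom (KBimod.pow M.toKBimod n) X.toKBimod}
    (h : ∀ n, HasDeg (powModule M n) X e (F n)) : HasDeg (M.tens D) X e (desc F) :=
  tens_hasDeg fun n => by
    have : (desc F).comp (incl (KBimod.pow M.toKBimod) n) = F n :=
      KHom.ext fun m => desc_incl F n m
    intro i m hm
    exact (congrArg (· ∈ X.gr (i + e)) (desc_incl F n m)).mpr (h n i m hm)

theorem tensOne_hasDeg : HasDeg (unit k t) (M.tens D) 0 (tensOne M.toKBimod) :=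
  incl_hasDeg D 0

theorem tensCons_hasDeg : HasDeg (M.tensor (M.tens D)) (M.tens D) 0 (tensCons M.toKBimod) :=
  descRight_hasDeg fun n => incl_hasDeg D (n + 1)

theorem leftUnit_hasDeg {N : PreDGModule.{u, w} k t} (hN : N.IsGraded) :
    HasDeg ((unit k t).tensor N) N 0 (leftUnit N.toKBimod) :=
  tensor_hasDeg (M := unit k t) fun i j a ha b hb => by
    rw [add_zero]
    change N.l a b ∈ _
    rcases mem_unit_gr.1 ha with h | h
    · rw [h, zero_add]
      exact hN.l_mem j a b hb
    · have h0 : N.l a b = 0 := (congrArg (fun x => N.l x b) h).trans (by rw [map_zero]; rfl)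
      rw [h0]
      exact zero_mem _

theorem rightUnitInv_hasDeg {N : PreDGModule.{u, w} k t} :
    HasDeg N (N.tensor (unit k t)) 0 (rightUnitInv N.toKBimod) := fun _ _ hm =>
  tm_mem (N := unit k t) hm (mem_unit_gr.2 (Or.inl rfl))

theorem leftUnitInv_hasDeg {N : PreDGModule.{u, w} k t} :
    HasDeg N ((unit k t).tensor N) 0 (leftUnitInv N.toKBimod) := fun i m hm => by
  have := tm_mem (M := unit k t) (m := (1 : Fin t → k)) (mem_unit_gr.2 (Or.inl rfl)) hm
  rw [add_zero]
  rw [zero_add] at this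
  exact this

theorem tensIncl_hasDeg : HasDeg M (M.tens D) 0 (tensIncl M.toKBimod) :=
  (tensCons_hasDeg.comp ((hasDeg_id.map tensOne_hasDeg).comp rightUnitInv_hasDeg)).congr (by ring)

theorem concatAux_hasDeg (hM : M.IsGraded) : ∀ n,
    HasDeg ((powModule M n).tensor (M.tens D)) (M.tens D) 0 (concatAux M.toKBimod n)
  | 0 => leftUnit_hasDeg (hM.tens D)
  | n + 1 => (tensCons_hasDeg.comp ((hasDeg_id.map (concatAux_hasDeg hM n)).comp
      (hasDeg_assoc (M := M) (N := powModule M n) (X := M.tens D)))).congr (by ring)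

theorem concat_hasDeg (hM : M.IsGraded) :
    HasDeg ((M.tens D).tensor (M.tens D)) (M.tens D) 0 (concat M.toKBimod) :=
  descLeft_hasDeg (concatAux_hasDeg hM)

theorem derAux_hasDeg (hM : M.IsGraded) {f : KHom M.toKBimod (KBimod.tens M.toKBimod)}
    (hf : HasDeg M (M.tens D) (-1) f) : ∀ n,
    HasDeg (powModule M n) (M.tens D) (-1) (derAux M.par f n)
  | 0 => fun _ _ _ => zero_mem _
  | n + 1 =>
    HasDeg.add (M := powModule M (n + 1)) (N := M.tens D)
      (((concat_hasDeg hM).comp (hf.map (incl_hasDeg D n))).congr (by ring))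
      ((tensCons_hasDeg.comp (hM.hasDeg_par.map (derAux_hasDeg hM hf n))).congr (by ring))

theorem der_hasDeg (hM : M.IsGraded) {f : KHom M.toKBimod (KBimod.tens M.toKBimod)}
    (hf : HasDeg M (M.tens D) (-1) f) : HasDeg (M.tens D) (M.tens D) (-1) (der M.par f) :=
  desc_hasDeg (derAux_hasDeg hM hf)

theorem tens_par_one (x : Fin t → k) :
    (M.tens D).par (tensOne M.toKBimod x) = tensOne M.toKBimod x :=
  pow_hom_zero_apply (D := (M.tens D).par) rfl x

theorem tens_par_cons (v : M.carrier) (u : (KBimod.tens M.toKBimod).carrier) :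
    (M.tens D).par (tensCons M.toKBimod (tm v u)) =
      tensCons M.toKBimod (tm (M.par v) ((M.tens D).par u)) := by
  refine tensor_tens_hom_ext (f := ((M.tens D).par : KHom (KBimod.tens M.toKBimod)
    (KBimod.tens M.toKBimod)).comp (tensCons M.toKBimod))
    (g := (tensCons M.toKBimod).comp (map M.par (M.tens D).par)) (fun n v m => ?_) (tm v u)
  refine (pow_hom_succ_apply (D := (M.tens D).par) rfl n v m).trans ?_
  change _ = tensCons M.toKBimod (tm (M.par v) ((M.tens D).par (incl _ n m)))
  rw [show (M.tens D).par (incl (KBimod.pow M.toKBimod) n m) = incl _ n ((pow M n).2 m) from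
    desc_incl _ n m, tensCons_tm]
  rfl

theorem tensProj_gr (i : ℤ) (hi : i ≠ 0) (q : (KBimod.tens M.toKBimod).carrier)
    (hq : q ∈ (M.tens D).gr i) : tensProj M.toKBimod q = 0 := by
  refine tens_gr_induction (p := fun q => tensProj M.toKBimod q = 0) ?_ ?_ ?_ q hq
  · exact map_zero _
  · intro q q' hq hq'
    exact (map_add _ _ _).trans ((congrArg₂ (· + ·) hq hq').trans (add_zero _))
  · intro n m hm
    refine (desc_incl _ n m).trans ?_
    cases n with
    | zero =>
      exact (mem_unit_gr.1 hm).resolve_left hi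
    | succ n => rfl

end PreDGModule

theorem KBimod.tensProj_concat {V : KBimod.{u, u} k t} (a b : (tens V).carrier) :
    tensProj V (concat V (tm a b)) = (tensProj V a * tensProj V b : Fin t → k) := by
  induction a using tensRing_induction with
  | h1 x => rw [concat_one, (tensProj V).map_l, tensProj_one]; rfl
  | hc v u _ => rw [concat_cons, tensProj_cons, tensProj_cons]; exact (zero_mul _).symm
  | ha u u' hu hu' =>
    rw [tm_add_left, map_add, map_add, hu, hu', map_add]
    exact (add_mul _ _ _).symm

namespace PreDGModule

variable {M : PreDGModule.{u, u} k t} {f : KHom M.toKBimod (KBimod.tens M.toKBimod)}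

theorem der_concat {D : KHom (KBimod.tens M.toKBimod) (KBimod.tens M.toKBimod)}
    (a b : (KBimod.tens M.toKBimod).carrier) :
    der M.par f (concat _ (tm a b)) = concat _ (tm (der M.par f a) b) +
      concat _ (tm ((M.tens D).par a) (der M.par f b)) := by
  induction a using tensRing_induction with
  | h1 x =>
    rw [concat_one, (der M.par f).map_l, der_one, tm_zero_left, map_zero, zero_add]
    exact (concat_one x _).symm.trans
      (congrArg (fun z => concat _ (tm z (der M.par f b))) (tens_par_one x).symm)
  | hc v u hu =>
    have h1 : concat _ (tm ((M.tens D).par (tensCons M.toKBimod (tm v u))) (der M.par f b)) =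
        tensCons _ (tm (M.par v) (concat _ (tm ((M.tens D).par u) (der M.par f b)))) :=
      (congrArg (fun z => concat _ (tm z (der M.par f b))) (tens_par_cons v u)).trans
        (concat_cons _ _ _)
    rw [h1, concat_cons, der_cons, der_cons, hu, tm_add_left, map_add, tm_add_right, map_add,
      concat_assoc, concat_cons]
    abel
  | ha u u' hu hu' =>
    have h1 : concat _ (tm ((M.tens D).par (u + u')) (der M.par f b)) =
        concat _ (tm ((M.tens D).par u) (der M.par f b)) +
        concat _ (tm ((M.tens D).par u') (der M.par f b)) := by
      refine (congrArg (fun z => concat _ (tm z (der M.par f b))) (map_add _ _ _)).trans ?_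
      exact (congrArg (concat _).toLin (tm_add_left _ _ _)).trans (map_add _ _ _)
    rw [h1, tm_add_left, map_add, map_add, hu, hu', map_add, tm_add_left, map_add]
    abel

/-- The tensor ring of a graded bimodule with the derivation that extends `f`. -/
def tensRing (M : PreDGModule.{u, u} k t) (f : KHom M.toKBimod (KBimod.tens M.toKBimod)) :
    PreDGRing.{u} k t where
  toPreDGModule := M.tens (der M.par f)
  mul := concat _
  one := tensOne _
  aug := tensProj _
  aug_one x := tensProj_tensOne _ x

/-- The square of an odd derivation is a derivation, so vanishing on generators suffices. The mixed
terms cancel because f, being odd, anticommutes with the parity operators. -/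
theorem der_der (hM : M.IsGraded) (hf : HasDeg M (M.tens (der M.par f)) (-1) f)
    (hff : ∀ v, der M.par f (f v) = 0) (u : (KBimod.tens M.toKBimod).carrier) :
    der M.par f (der M.par f u) = 0 := by
  induction u using tensRing_induction with
  | h1 x => rw [der_one, map_zero]
  | hc v u hu =>
    have h1 : f (M.par v) = -(M.tens (der M.par f)).par (f v) :=
      hM.par_comm_neg_one (hM.tens _) hf v
    have h2 : concat M.toKBimod (tm (f (M.par v)) (der M.par f u)) =
        -concat M.toKBimod (tm ((M.tens (der M.par f)).par (f v)) (der M.par f u)) := by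
      refine (congrArg (fun z => concat _ (tm z (der M.par f u))) h1).trans ?_
      exact (congrArg (concat _).toLin (tm_neg_left _ _)).trans (map_neg _ _)
    rw [der_cons, map_add, der_concat (D := der M.par f), hff, der_cons, hu, h2, tm_zero_left,
      map_zero, tm_zero_right, map_zero, zero_add, add_zero, add_neg_cancel]
  | ha u u' hu hu' => rw [map_add, map_add, hu, hu', add_zero]

theorem tensProj_der (haug : ∀ v, tensProj _ (f v) = 0)
    (u : (KBimod.tens M.toKBimod).carrier) : tensProj _ (der M.par f u) = 0 := by
  induction u using tensRing_induction with
  | h1 x => rw [der_one, map_zero]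
  | hc v u hu =>
    have h : tensProj _ (concat M.toKBimod (tm (f v) u)) = 0 := by
      rw [tensProj_concat, haug]
      exact zero_mul _
    rw [der_cons, map_add, tensProj_cons, h, add_zero]
  | ha u u' hu hu' => rw [map_add, map_add, hu, hu', add_zero]

theorem tensRing_isAugDGRing (hM : M.IsGraded) (hf : HasDeg M (M.tens (der M.par f)) (-1) f)
    (hff : ∀ v, der M.par f (f v) = 0) (haug : ∀ v, tensProj _ (f v) = 0) :
    (tensRing M f).IsAugDGRing :=
  have hg := hM.tens (der M.par f)
  { internal := hg.internal
    l_mem := hg.l_mem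
    r_mem := hg.r_mem
    par_apply := hg.par_apply
    d_mem := der_hasDeg hM hf
    d_d := der_der hM hf hff
    mul_assoc := concat_assoc
    one_mul := concat_one
    mul_one := concat_one_right
    mul_mem := fun i j a ha b hb => by
      have := concat_hasDeg hM _ _ (tm_mem ha hb)
      rwa [add_zero] at this
    one_mem := fun x => by
      have := tensOne_hasDeg (M := M) (D := der M.par f) 0 x (mem_unit_gr.2 (Or.inl rfl))
      rwa [add_zero] at this
    leibniz := der_concat
    d_one := der_one
    aug_mul := tensProj_concat
    aug_gr := tensProj_gr
    aug_d := tensProj_der haug }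

theorem hasDeg_desusp : HasDeg M M.desusp (-1) (KHom.id _) := fun i m hm => by
  change m ∈ M.gr (i + -1 + 1)
  rwa [neg_add_cancel_right]

theorem hasDeg_of_desusp : HasDeg M.desusp M 1 (KHom.id _) := fun _ _ hm => hm

end PreDGModule

/-! ### The cobar construction as a dg ring, and its twisting morphism ι -/

namespace PreDGCoring

variable {C : PreDGCoring.{u} k t} (hC : C.IsCoaugDGCoring)

namespace IsCoaugDGCoring

include hC

theorem red_isDG : C.red.IsDG :=
  (hC.toIsDG.ker C.counit_coaug hC.counit_gr hC.counit_d).1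

theorem kerIncl_par (m : (KBimod.ker C.counit).carrier) :
    kerIncl C.counit (C.red.par m) = C.par (kerIncl C.counit m) :=
  (hC.toIsDG.ker C.counit_coaug hC.counit_gr hC.counit_d).2.1 m

theorem kerIncl_d (m : (KBimod.ker C.counit).carrier) :
    kerIncl C.counit (C.red.d m) = C.d (kerIncl C.counit m) :=
  (hC.toIsDG.ker C.counit_coaug hC.counit_gr hC.counit_d).2.2 m

theorem par_coaug (x : Fin t → k) : C.par (C.coaug x) = C.coaug x := by
  rw [hC.par_apply 0 _ (hC.coaug_mem x)]
  simp

omit hC in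
theorem kerIncl_redProj (c : C.carrier) :
    kerIncl C.counit (C.redProj c) = c - C.coaug (C.counit c) := rfl

omit hC in
theorem redProj_kerIncl (v : (KBimod.ker C.counit).carrier) :
    C.redProj (kerIncl C.counit v) = v := kerProj_kerIncl C.counit C.coaug C.counit_coaug v

omit hC in
theorem redProj_coaug (x : Fin t → k) : C.redProj (C.coaug x) = 0 :=
  kerProj_unit C.counit C.coaug C.counit_coaug x

theorem redProj_d (c : C.carrier) : C.red.d (C.redProj c) = C.redProj (C.d c) := by
  refine kerIncl_injective C.counit ?_
  refine (hC.kerIncl_d _).trans ?_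
  rw [kerIncl_redProj, kerIncl_redProj, map_sub, hC.d_coaug, hC.counit_d, map_zero]

theorem redProj_par (c : C.carrier) : C.red.par (C.redProj c) = C.redProj (C.par c) := by
  refine kerIncl_injective C.counit ?_
  have hpar : C.counit (C.par c) = C.counit c :=
    hC.toIsDG.isGraded.par_comm_zero unit_isGraded (PreDGRing.counit_hasDeg hC) c
  refine (hC.kerIncl_par _).trans ?_
  rw [kerIncl_redProj, kerIncl_redProj, map_sub, hC.par_coaug, hpar]

theorem redProj_hasDeg : HasDeg C.toPreDGModule C.red 0 C.redProj := fun i c hc => by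
  change kerIncl C.counit (C.redProj c) ∈ C.gr (i + 0)
  rw [kerIncl_redProj, add_zero]
  by_cases h : i = 0
  · subst h
    exact sub_mem hc (hC.coaug_mem _)
  · rw [hC.counit_gr i h c hc, map_zero, sub_zero]
    exact hc

/-- The coproduct of the coaugmentation is killed by the projection to the coideal. Thus the reduced
coproduct is computed from Δ on all of C, and the cobar differential can be expressed by ι and Δ
alone. -/
theorem redComul_redProj (c : C.carrier) :
    C.redComul (C.redProj c) = map C.redProj C.redProj (C.comul c) := by
  change map C.redProj C.redProj (C.comul (kerIncl C.counit (C.redProj c))) = _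
  rw [kerIncl_redProj, map_sub, map_sub, hC.comul_coaug, map_tm, redProj_coaug, tm_zero_left,
    sub_zero]

end IsCoaugDGCoring

variable (C) in
/-- The differential of the cobar construction on generators. -/
def cobarGen : KHom C.red.desusp.toKBimod (KBimod.tens C.red.desusp.toKBimod) :=
  let V := C.red.desusp
  let dQuad : KHom V.toKBimod (KBimod.tens V.toKBimod) :=
    (tensCons V.toKBimod).comp ((map (KHom.id _) (tensIncl V.toKBimod)).comp
      ((map V.par (KHom.id _)).comp C.redComul))
  (tensIncl V.toKBimod).comp V.d + dQuad

theorem cobar_iota_m (c : C.carrier) (u : C.cobar.carrier) :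
    C.cobar.m (C.iota c) u = tensCons C.red.desusp.toKBimod (tm (C.redProj c) u) :=
  concat_incl (V := C.red.desusp.toKBimod) (C.redProj c) u

/-- Generators are written ι(c) with c in C, not in the kernel of the counit, so that Δ and its
axioms apply to them directly. -/
theorem cobar_induction {p : C.cobar.carrier → Prop}
    (h1 : ∀ x : Fin t → k, p (C.cobar.one x))
    (hc : ∀ c u, p u → p (C.cobar.m (C.iota c) u))
    (ha : ∀ u u', p u → p u' → p (u + u')) (u : C.cobar.carrier) : p u := by
  refine tensRing_induction (V := C.red.desusp.toKBimod) (p := p) h1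
    (fun (v : (KBimod.ker C.counit).carrier) u hu => ?_) ha u
  have h := (cobar_iota_m (kerIncl C.counit v) u).trans
    (congrArg (fun z => tensCons C.red.desusp.toKBimod (tm z u))
      (IsCoaugDGCoring.redProj_kerIncl v))
  exact (congrArg p h).mp (hc (kerIncl C.counit v) u hu)

theorem cobar_leibniz (a b : C.cobar.carrier) : C.cobar.d (C.cobar.m a b) =
    C.cobar.m (C.cobar.d a) b + C.cobar.m (C.cobar.par a) (C.cobar.d b) :=
  der_concat (M := C.red.desusp) a b

theorem iota_coaug (x : Fin t → k) : C.iota (C.coaug x) = 0 := by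
  change tensIncl C.red.desusp.toKBimod (C.redProj (C.coaug x)) = 0
  rw [IsCoaugDGCoring.redProj_coaug]
  exact map_zero _

include hC

theorem cobarGen_hasDeg : HasDeg C.red.desusp
    (C.red.desusp.tens (der C.red.desusp.par C.cobarGen)) (-1) C.cobarGen := by
  have hV := hC.red_isDG.desusp
  have h1 : HasDeg C.red (C.red.tensor C.red) 0 C.redComul := by
    have h0 : HasDeg C.red C.toPreDGModule 0 (kerIncl C.counit) := fun i m hm => by
      rw [add_zero]; exact hm
    exact ((hC.redProj_hasDeg.map hC.redProj_hasDeg).comp (hC.comul_deg.comp h0)).congr (by ring)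
  -- The reduced coproduct has degree 0 on C̄. One shift in the source and two in the target give
  -- degree 1 - 2 = -1 on s⁻¹C̄.
  have h2 : HasDeg C.red.desusp (C.red.desusp.tensor C.red.desusp) (-1) C.redComul := by
    have := ((hasDeg_desusp (M := C.red)).map (hasDeg_desusp (M := C.red))).comp
      (h1.comp (hasDeg_of_desusp (M := C.red)))
    intro i m hm
    have h := this i m hm
    rw [show i + (1 + 0 + (-1 + -1)) = i + -1 by ring] at h
    have h3 : ∀ q, map (KHom.id C.red.toKBimod) (KHom.id C.red.toKBimod) q = q := fun q =>
      linear_ext (f := (map (KHom.id C.red.toKBimod) (KHom.id C.red.toKBimod)).toLin)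
        (g := LinearMap.id) (fun _ _ => rfl) q
    exact (congrArg (· ∈ (C.red.desusp.tensor C.red.desusp).gr (i + -1)) (h3 _)).mp h
  refine HasDeg.add (M := C.red.desusp) (N := C.red.desusp.tens _)
    ((tensIncl_hasDeg.comp hV.hasDeg_d).congr (add_zero _)) ?_
  exact (tensCons_hasDeg.comp ((hasDeg_id.map tensIncl_hasDeg).comp
    ((hV.isGraded.hasDeg_par.map hasDeg_id).comp h2))).congr (by ring)

theorem cobar_isGraded : C.cobar.IsGraded :=
  hC.red_isDG.desusp.isGraded.tens _

theorem iota_hasDeg : HasDeg C.toPreDGModule C.cobar.toPreDGModule (-1) C.iota := by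
  have h : HasDeg C.toPreDGModule C.red.desusp (-1) C.redProj :=
    ((hasDeg_desusp (M := C.red)).comp hC.redProj_hasDeg).congr (by ring)
  exact (tensIncl_hasDeg.comp h).congr (by ring)

theorem par_iota (c : C.carrier) : C.cobar.par (C.iota c) = -C.iota (C.par c) := by
  rw [hC.toIsDG.isGraded.par_comm_neg_one (cobar_isGraded hC) (iota_hasDeg hC), neg_neg]

/-- For c in the coaugmentation both sides vanish, so the formula on generators extends from C̄ to
C. It is also the Maurer–Cartan equation for ι. -/
theorem cobar_d_iota (c : C.carrier) : C.cobar.d (C.iota c) =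
    -C.iota (C.d c) - PreDGRing.convSq C.iota (C.comul c) := by
  have h0 : C.cobar.d (C.iota c) = C.cobarGen (C.redProj c) := by
    refine (der_cons (V := C.red.desusp.toKBimod) (s := C.red.desusp.par) (f := C.cobarGen)
      (C.redProj c) (tensOne _ (1 : Fin t → k))).trans ?_
    rw [der_one, tm_zero_right, map_zero, concat_one_right, r_one]
    exact add_zero _
  rw [h0, sub_eq_add_neg]
  refine congrArg₂ (fun a b : C.cobar.carrier => a + b) ?_ ?_
  · change tensIncl C.red.desusp.toKBimod (-C.red.d (C.redProj c)) =
      -tensIncl C.red.desusp.toKBimod (C.redProj (C.d c))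
    rw [hC.redProj_d]
    exact map_neg _ _
  · change tensCons C.red.desusp.toKBimod ((map (KHom.id _) (tensIncl C.red.desusp.toKBimod))
      ((map C.red.desusp.par (KHom.id _)) (C.redComul (C.redProj c)))) = _
    rw [hC.redComul_redProj]
    refine linear_ext
      (f := (tensCons C.red.desusp.toKBimod).toLin ∘ₗ
        (map (KHom.id _) (tensIncl C.red.desusp.toKBimod)).toLin ∘ₗ
        (map C.red.desusp.par (KHom.id _)).toLin ∘ₗ
        (map (V' := C.red.desusp.toKBimod) (W' := C.red.desusp.toKBimod)
          C.redProj C.redProj).toLin)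
      (g := -(PreDGRing.convSq C.iota).toLin) (fun x y => ?_) (C.comul c)
    -- The parity operator of s⁻¹C̄ is the negative of that of C̄; this is the minus sign in front
    -- of the convolution square.
    change tensCons C.red.desusp.toKBimod (tm (-C.red.par (C.redProj x)) (C.iota y)) =
      -C.cobar.m (C.iota (C.par x)) (C.iota y)
    rw [cobar_iota_m, hC.redProj_par]
    exact (congrArg (tensCons C.red.desusp.toKBimod).toLin (tm_neg_left _ _)).trans (map_neg _ _)

omit hC in
variable (C) in
/-- The map `x ⊗ (y ⊗ z) ↦ ι(x) ι(s y) ι(z)`, where `s` is the parity operator. -/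
def iotaCube : KHom (KBimod.tensor C.toKBimod (KBimod.tensor C.toKBimod C.toKBimod))
    C.cobar.toKBimod :=
  C.cobar.mul.comp (map C.iota (PreDGRing.convSq C.iota))

omit hC in
theorem cobar_m_assoc (a b c : C.cobar.carrier) :
    C.cobar.m (C.cobar.m a b) c = C.cobar.m a (C.cobar.m b c) := concat_assoc a b c

omit hC in
theorem convSq_tm (x y : C.carrier) : PreDGRing.convSq C.iota (tm x y) =
    C.cobar.m (C.iota (C.par x)) (C.iota y) := rfl

theorem iotaCube_assoc (q : (KBimod.tensor C.toKBimod C.toKBimod).carrier) (z : C.carrier) :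
    iotaCube C (assoc _ _ _ (tm q z)) =
      C.cobar.m (PreDGRing.convSq C.iota (map C.par C.par q)) (C.iota z) := by
  induction q using tensor_induction with
  | h0 => rw [tm_zero_left, map_zero, map_zero, map_zero, map_zero, PreDGRing.m_zero_left]
  | ht x y =>
    change C.cobar.m (C.iota x) (C.cobar.m (C.iota (C.par y)) (C.iota z)) = _
    rw [map_tm, convSq_tm, hC.toIsDG.isGraded.par_par, cobar_m_assoc]
  | ha q q' hq hq' =>
    rw [tm_add_left, map_add, map_add, hq, hq', map_add, map_add, PreDGRing.m_add_left]

/-- The Leibniz rule produces the two cubic terms ι(x)·(ι ∗ ι)(Δ y) and (ι ∗ ι)(Δ x)·ι(y), up to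
parity; their difference is a single cubic map on the failure of coassociativity. For q = Δ c it
disappears, which gives d² = 0 on generators. -/
theorem cobar_d_convSq (q : (KBimod.tensor C.toKBimod C.toKBimod).carrier) :
    C.cobar.d (PreDGRing.convSq C.iota q) =
      PreDGRing.convSq C.iota (map C.d (KHom.id _) q + map C.par C.d q) +
        iotaCube C (PreDGRing.coassocDefect C q) := by
  induction q using tensor_induction with
  | h0 => simp only [map_zero, add_zero]
  | ht x y =>
    have h2 : PreDGRing.coassocDefect C (tm x y) =
        (tmLin C.toKBimod (KBimod.tensor C.toKBimod C.toKBimod) x (C.comul y)) -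
          assoc _ _ _ (tm (C.comul x) y) := KHom.sub_apply _ _ _
    have h3 : iotaCube C (tmLin C.toKBimod (KBimod.tensor C.toKBimod C.toKBimod) x (C.comul y)) =
      C.cobar.m (C.iota x) (PreDGRing.convSq C.iota (C.comul y)) := rfl
    rw [h2, map_sub, h3, iotaCube_assoc hC, ← hC.comul_par, convSq_tm, cobar_leibniz,
      cobar_d_iota hC, par_iota hC, cobar_d_iota hC, map_tm, map_tm, map_add, convSq_tm,
      convSq_tm, hC.toIsDG.isGraded.par_par, KHom.id_apply, hC.toIsDG.par_d]
    simp only [map_neg, PreDGRing.m_neg_left, PreDGRing.m_sub_left, PreDGRing.m_sub_right,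
      PreDGRing.m_neg_right]
    abel
  | ha q q' hq hq' =>
    simp only [map_add] at hq hq' ⊢
    rw [hq, hq']
    abel

theorem cobar_d_d_iota (c : C.carrier) : C.cobar.d (C.cobar.d (C.iota c)) = 0 := by
  have h0 : PreDGRing.coassocDefect C (C.comul c) = 0 :=
    (KHom.sub_apply _ _ _).trans (sub_eq_zero.2 (hC.coassoc c).symm)
  rw [cobar_d_iota hC, map_sub, map_neg, cobar_d_iota hC, hC.d_d, cobar_d_convSq hC, h0, map_zero,
    map_zero, hC.comul_d]
  abel

theorem cobar_isAugDGRing : C.cobar.IsAugDGRing := by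
  -- On generators the derivation is d ∘ ι, so its square there is covered by `cobar_d_d_iota`.
  have hf : ∀ v : (KBimod.ker C.counit).carrier,
      C.cobarGen v = C.cobar.d (C.iota (kerIncl C.counit v)) := fun v => by
    have h0 : C.cobar.d (C.iota (kerIncl C.counit v)) =
        C.cobarGen (C.redProj (kerIncl C.counit v)) := by
      refine (der_cons (V := C.red.desusp.toKBimod) (s := C.red.desusp.par) (f := C.cobarGen)
        (C.redProj (kerIncl C.counit v)) (tensOne _ (1 : Fin t → k))).trans ?_
      rw [der_one, tm_zero_right, map_zero, concat_one_right, r_one]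
      exact add_zero _
    exact (h0.trans (congrArg (fun z => C.cobarGen z)
      (IsCoaugDGCoring.redProj_kerIncl (C := C) v))).symm
  refine tensRing_isAugDGRing (M := C.red.desusp) (f := C.cobarGen) hC.red_isDG.desusp.isGraded
    (cobarGen_hasDeg hC)
    (fun (v : (KBimod.ker C.counit).carrier) =>
      (congrArg (fun z => C.cobar.d z) (hf v)).trans (cobar_d_d_iota hC _))
    (fun v => ?_)
  -- The differential of a generator has components of lengths 1 and 2 only, and the augmentation
  -- kills both.
  refine (map_add (tensProj C.red.desusp.toKBimod).toLin _ _).trans ?_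
  refine (congrArg₂ (fun a b : Fin t → k => a + b) (?_ : _ = (0 : Fin t → k))
    (?_ : _ = (0 : Fin t → k))).trans (add_zero _)
  · exact tensProj_cons (V := C.red.desusp.toKBimod)
      (map (KHom.id _) (tensOne _) (rightUnitInv _ (C.red.desusp.d v)))
  · exact tensProj_cons (V := C.red.desusp.toKBimod)
      (map (KHom.id _) (tensIncl _) (map C.red.desusp.par (KHom.id _) (C.redComul v)))

theorem iota_isTwisting : C.cobar.IsTwisting C C.iota where
  deg := iota_hasDeg hC
  coaug := iota_coaug
  maurerCartan c := by
    rw [cobar_d_iota hC]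
    change _ - PreDGRing.convSq C.iota (C.comul c) + _ + PreDGRing.convSq C.iota (C.comul c) = 0
    abel

end PreDGCoring

end

/-! ### Deconcatenation, and coderivations of the tensor coring -/

section

open KBimod PreDGModule

variable {k : Type u} [Field k] {t : ℕ}

namespace KBimod

variable {V : KBimod.{u, u} k t}

theorem tensProjV_cons (v : V.carrier) (u : (tens V).carrier) :
    tensProjV V (tensCons V (tm v u)) = V.r (tensProj V u) v := by
  induction u using tensRing_induction with
  | h1 x => rw [tensProjV_cons_one, tensProj_one]
  | hc w u _ => rw [tensProjV_cons_cons, tensProj_cons, map_zero]; rfl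
  | ha u u' hu hu' =>
    rw [tm_add_right, map_add, map_add, hu, hu', map_add]
    exact (congrArg (fun f : Module.End k V.carrier => f v) (map_add V.r _ _)).symm

theorem tensProj_mergeHead (g : KHom (tensor V V) V) (v : V.carrier) (u : (tens V).carrier) :
    tensProj V (mergeHead g (tm v u)) = 0 := by
  induction u using tensRing_induction with
  | h1 x => rw [mergeHead_one, map_zero]
  | hc w u _ => rw [mergeHead_cons, tensProj_cons]
  | ha u u' hu hu' => rw [tm_add_right, map_add, map_add, hu, hu', add_zero]

/-- The map `v ⊗ (a ⊗ q) ↦ (v ⊗ a) ⊗ q`. -/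
def consLeft (V : KBimod.{u, u} k t) (X : KBimod.{u, x} k t) :
    KHom (tensor V (tensor (tens V) X)) (tensor (tens V) X) :=
  (map (tensCons V) (KHom.id X)).comp (assocInv V (tens V) X)

theorem consLeft_tm {X : KBimod.{u, x} k t} (v : V.carrier) (a : (tens V).carrier)
    (q : X.carrier) : consLeft V X (tm v (tm a q)) = tm (tensCons V (tm v a)) q := rfl

/-- The map `v ⊗ (a ⊗ q) ↦ mergeHead(v ⊗ a) ⊗ q`. -/
def mergeLeft (g : KHom (tensor V V) V) (X : KBimod.{u, x} k t) :
    KHom (tensor V (tensor (tens V) X)) (tensor (tens V) X) :=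
  (map (mergeHead g) (KHom.id X)).comp (assocInv V (tens V) X)

theorem mergeLeft_tm {X : KBimod.{u, x} k t} (g : KHom (tensor V V) V) (v : V.carrier)
    (a : (tens V).carrier) (q : X.carrier) :
    mergeLeft g X (tm v (tm a q)) = tm (mergeHead g (tm v a)) q := rfl

theorem deconcat_cons' (v : V.carrier) (u : (tens V).carrier) :
    deconcat V (tensCons V (tm v u)) =
      tm (tensOne V (1 : Fin t → k)) (tensCons V (tm v u)) +
        consLeft V _ (tm v (deconcat V u)) := deconcat_cons v u

theorem mergeLeft_consLeft {X : KBimod.{u, x} k t} (g : KHom (tensor V V) V) (v w : V.carrier)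
    (q : (tensor (tens V) X).carrier) :
    mergeLeft g X (tm v (consLeft V X (tm w q))) = consLeft V X (tm (g (tm v w)) q) := by
  induction q using tensor_induction with
  | h0 => simp only [tm_zero_right, map_zero]
  | ht a b => rw [consLeft_tm, mergeLeft_tm, consLeft_tm, mergeHead_cons]
  | ha q q' hq hq' =>
    rw [tm_add_right, map_add, tm_add_right, map_add, hq, hq', tm_add_right, map_add]

/-- Merging the first two letters is compatible with every cut of the word except the cut between
these letters. That one disappears, because `mergeHead` vanishes on a tail of length 0. -/
theorem deconcat_mergeHead (g : KHom (tensor V V) V) (v : V.carrier) (u : (tens V).carrier) :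
    deconcat V (mergeHead g (tm v u)) =
      tm (tensOne V (1 : Fin t → k)) (mergeHead g (tm v u)) +
        mergeLeft g _ (tm v (deconcat V u)) := by
  induction u using tensRing_induction with
  | h1 x =>
    rw [mergeHead_one, map_zero, tm_zero_right, deconcat_one, mergeLeft_tm, mergeHead_one,
      tm_zero_left, add_zero]
  | hc w u _ =>
    rw [mergeHead_cons, deconcat_cons', deconcat_cons', tm_add_right, map_add, mergeLeft_tm,
      mergeHead_one, tm_zero_left, zero_add, mergeLeft_consLeft]
  | ha u u' hu hu' =>
    rw [tm_add_right, map_add, map_add, hu, hu', tm_add_right, map_add, tm_add_right, map_add]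
    abel

theorem assoc_consLeft (v : V.carrier) (q : (tensor (tens V) (tens V)).carrier)
    (b : (tens V).carrier) : assoc _ _ _ (tm (consLeft V _ (tm v q)) b) =
      consLeft V _ (tm v (assoc _ _ _ (tm q b))) := by
  induction q using tensor_induction with
  | h0 => simp only [tm_zero_right, map_zero, tm_zero_left]
  | ht a c => rfl
  | ha q q' hq hq' =>
    rw [tm_add_right, map_add, tm_add_left, map_add, hq, hq', tm_add_left, map_add,
      tm_add_right, map_add]

theorem deconcat_coassoc (w : (tens V).carrier) :
    assoc _ _ _ (map (deconcat V) (KHom.id _) (deconcat V w)) =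
      map (KHom.id _) (deconcat V) (deconcat V w) := by
  induction w using tensRing_induction with
  | h1 x =>
    rw [deconcat_one, map_tm, map_tm, deconcat_one, deconcat_one]
    rfl
  | hc v u hu =>
    have h1 : ∀ q, assoc _ _ _ (map (deconcat V) (KHom.id _) (consLeft V _ (tm v q))) =
        tm (tensOne V (1 : Fin t → k)) (consLeft V _ (tm v q)) +
          consLeft V _ (tm v (assoc _ _ _ (map (deconcat V) (KHom.id _) q))) := fun q => by
      induction q using tensor_induction with
      | h0 => simp only [tm_zero_right, map_zero, add_zero]
      | ht a b =>
        rw [consLeft_tm, map_tm, deconcat_cons', tm_add_left, map_add, assoc_consLeft]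
        rfl
      | ha q q' hq hq' =>
        rw [tm_add_right, map_add, map_add, map_add, hq, hq', map_add, map_add, tm_add_right,
          tm_add_right, map_add]
        abel
    have h2 : ∀ q, map (KHom.id _) (deconcat V) (consLeft V _ (tm v q)) =
        consLeft V _ (tm v (map (KHom.id _) (deconcat V) q)) := fun q => by
      induction q using tensor_induction with
      | h0 => simp only [tm_zero_right, map_zero]
      | ht a b => rfl
      | ha q q' hq hq' =>
        rw [tm_add_right, map_add, map_add, hq, hq', map_add, tm_add_right, map_add]
    rw [deconcat_cons', map_add, map_add, h1, hu, map_add, h2, map_tm, map_tm, deconcat_cons',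
      deconcat_one, KHom.id_apply, KHom.id_apply, tm_add_right, assoc_tm]
    abel
  | ha u u' hu hu' => simp only [map_add, hu, hu']

theorem deconcat_counit_left (w : (tens V).carrier) :
    leftUnit _ (map (tensProj V) (KHom.id _) (deconcat V w)) = w := by
  induction w using tensRing_induction with
  | h1 x =>
    rw [deconcat_one, map_tm, tensProj_one]
    refine (leftUnit_tm (V := tens V) x _).trans ?_
    rw [KHom.id_apply, ← (tensOne V).map_l]
    exact congrArg (tensOne V).toLin (mul_one x)
  | hc v u _ =>
    have h : ∀ q, map (tensProj V) (KHom.id (tens V)) (consLeft V _ (tm v q)) = 0 := fun q => by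
      induction q using tensor_induction with
      | h0 => simp only [tm_zero_right, map_zero]
      | ht a b => rw [consLeft_tm, map_tm, tensProj_cons, tm_zero_left]
      | ha q q' hq hq' =>
        rw [tm_add_right, map_add, map_add, hq, hq', add_zero]
    rw [deconcat_cons', map_add, h, add_zero, map_tm, tensProj_one]
    refine (leftUnit_tm (V := tens V) _ _).trans ?_
    rw [l_one]
    rfl
  | ha u u' hu hu' => rw [map_add, map_add, map_add, hu, hu']

theorem deconcat_counit_right (w : (tens V).carrier) :
    rightUnit _ (map (KHom.id _) (tensProj V) (deconcat V w)) = w := by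
  induction w using tensRing_induction with
  | h1 x =>
    rw [deconcat_one, map_tm, tensProj_one]
    refine (rightUnit_tm (V := tens V) _ _).trans ?_
    rw [r_one]
    rfl
  | hc v u hu =>
    have h : ∀ q, rightUnit (tens V) (map (KHom.id _) (tensProj V) (consLeft V _ (tm v q))) =
        tensCons V (tm v (rightUnit (tens V) (map (KHom.id _) (tensProj V) q))) := fun q => by
      induction q using tensor_induction with
      | h0 => simp only [tm_zero_right, map_zero]
      | ht a b =>
        rw [consLeft_tm, map_tm, map_tm]
        refine (rightUnit_tm (V := tens V) _ _).trans ?_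
        refine Eq.trans ?_ (congrArg (fun z => tensCons V (tm v z))
          (rightUnit_tm (V := tens V) _ _)).symm
        rw [KHom.id_apply, KHom.id_apply, ← r_tm, (tensCons V).map_r]
      | ha q q' hq hq' =>
        rw [tm_add_right, map_add, map_add, map_add, hq, hq', map_add, map_add, tm_add_right,
          map_add]
    rw [deconcat_cons', map_add, map_add, h, hu, map_tm, tensProj_cons, tm_zero_right, map_zero,
      zero_add]
  | ha u u' hu hu' => rw [map_add, map_add, map_add, hu, hu']

end KBimod

namespace PreDGModule

variable {M : PreDGModule.{u, u} k t}

/-- The coderivation of the tensor coring with components `M.d` and `g`. -/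
def coder (M : PreDGModule.{u, u} k t) (g : KHom (KBimod.tensor M.toKBimod M.toKBimod) M.toKBimod) :
    KHom (KBimod.tens M.toKBimod) (KBimod.tens M.toKBimod) :=
  der M.par ((tensIncl M.toKBimod).comp M.d) + merge M.par g

/-- The tensor coring of a graded bimodule with the coderivation with components `M.d` and `g`. -/
def tensCoring (M : PreDGModule.{u, u} k t)
    (g : KHom (KBimod.tensor M.toKBimod M.toKBimod) M.toKBimod) : PreDGCoring.{u} k t where
  toPreDGModule := M.tens (coder M g)
  comul := deconcat _
  counit := tensProj _
  coaug := tensOne _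
  counit_coaug x := tensProj_tensOne _ x

variable {g : KHom (KBimod.tensor M.toKBimod M.toKBimod) M.toKBimod}

theorem coder_one (x : Fin t → k) : coder M g (tensOne _ x) = 0 :=
  (congrArg₂ (· + ·) (der_one x) (merge_one x)).trans (add_zero _)

theorem coder_cons (v : M.carrier) (u : (KBimod.tens M.toKBimod).carrier) :
    coder M g (tensCons _ (tm v u)) = tensCons _ (tm (M.d v) u) +
      tensCons _ (tm (M.par v) (coder M g u)) + mergeHead g (tm v u) := by
  have h : coder M g u = der M.par ((tensIncl M.toKBimod).comp M.d) u + merge M.par g u := rfl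
  refine (congrArg₂ (· + ·) (der_cons (s := M.par) (f := (tensIncl M.toKBimod).comp M.d) v u)
    (merge_cons v u)).trans ?_
  rw [h, tm_add_right, map_add, KHom.comp_apply, concat_incl]
  abel

/-- The conditions on `g` under which the coderivation is a differential. -/
structure IsBarProduct (M : PreDGModule.{u, u} k t)
    (g : KHom (KBimod.tensor M.toKBimod M.toKBimod) M.toKBimod) : Prop where
  hasDeg : HasDeg (M.tensor M) M (-1) g
  d_add : ∀ v w, M.d (g (tm v w)) + (g (tm (M.d v) w) + g (tm (M.par v) (M.d w))) = 0
  assoc_add : ∀ v w z, g (tm (g (tm v w)) z) + g (tm (M.par v) (g (tm w z))) = 0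

theorem IsBarProduct.par_add (hM : M.IsGraded) (hg : IsBarProduct M g) (v w : M.carrier) :
    M.par (g (tm v w)) + g (tm (M.par v) (M.par w)) = 0 := by
  have h : g (tm (M.par v) (M.par w)) = -M.par (g (tm v w)) :=
    IsGraded.par_comm_neg_one (hM.tensor hM) hM hg.hasDeg (tm v w)
  rw [h, add_neg_cancel]

theorem IsBarProduct.mergeHead_mergeHead (hg : IsBarProduct M g) (v w : M.carrier)
    (u : (KBimod.tens M.toKBimod).carrier) :
    mergeHead g (tm (g (tm v w)) u) + mergeHead g (tm (M.par v) (mergeHead g (tm w u))) = 0 := by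
  induction u using tensRing_induction with
  | h1 x => rw [mergeHead_one, mergeHead_one, tm_zero_right, map_zero, add_zero]
  | hc z u _ =>
    rw [mergeHead_cons, mergeHead_cons, mergeHead_cons, ← map_add, ← tm_add_left, hg.assoc_add,
      tm_zero_left, map_zero]
  | ha u u' hu hu' =>
    rw [tm_add_right, map_add, tm_add_right, map_add, tm_add_right, map_add, add_add_add_comm, hu,
      hu', add_zero]

/-- On v ⊗ [w|u] the terms fall into three groups that vanish separately: compatibility of g with d
(`d_add`), oddness of g (`par_add`), and signed associativity (`mergeHead_mergeHead`). -/
theorem IsBarProduct.coder_mergeHead (hM : M.IsGraded) (hg : IsBarProduct M g) (v : M.carrier)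
    (u : (KBimod.tens M.toKBimod).carrier) : coder M g (mergeHead g (tm v u)) +
      (mergeHead g (tm (M.d v) u) + mergeHead g (tm (M.par v) (coder M g u))) = 0 := by
  induction u using tensRing_induction with
  | h1 x => rw [mergeHead_one, mergeHead_one, coder_one, tm_zero_right, map_zero, map_zero,
      add_zero, add_zero]
  | hc w u _ =>
    have h1 : ∀ q q', tensCons M.toKBimod (tm q u) + tensCons _ (tm q' u) =
      tensCons _ (tm (q + q') u) := fun q q' => by rw [tm_add_left, map_add]
    rw [mergeHead_cons, mergeHead_cons, coder_cons, coder_cons, tm_add_right, map_add,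
      tm_add_right, map_add, mergeHead_cons, mergeHead_cons]
    have h2 := hg.mergeHead_mergeHead v w u
    have h3 : tensCons M.toKBimod (tm (M.par (g (tm v w))) (coder M g u)) +
        tensCons _ (tm (g (tm (M.par v) (M.par w))) (coder M g u)) = 0 := by
      rw [← map_add, ← tm_add_left, hg.par_add hM, tm_zero_left, map_zero]
    have h4 : tensCons M.toKBimod (tm (M.d (g (tm v w))) u) + (tensCons _ (tm (g (tm (M.d v) w)) u)
        + tensCons _ (tm (g (tm (M.par v) (M.d w))) u)) = 0 := by
      rw [h1, h1, hg.d_add, tm_zero_left, map_zero]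
    refine Eq.trans ?_ ((congrArg₂ (· + ·) h4 (congrArg₂ (· + ·) h3 h2)).trans
      ((congrArg _ (add_zero _)).trans (add_zero _)))
    abel
  | ha u u' hu hu' =>
    have h := congrArg₂ (· + ·) hu hu'
    rw [add_zero] at h
    refine Eq.trans ?_ h
    rw [tm_add_right, map_add, map_add, tm_add_right, map_add, map_add, tm_add_right, map_add]
    abel

/-- Expanding twice with `coder_cons`, the terms with d² and with the square on the tail vanish, the
mixed ones cancel, and the rest is exactly `coder_mergeHead`. -/
theorem IsBarProduct.coder_coder (hM : M.IsDG) (hg : IsBarProduct M g)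
    (u : (KBimod.tens M.toKBimod).carrier) : coder M g (coder M g u) = 0 := by
  induction u using tensRing_induction with
  | h1 x => rw [coder_one, map_zero]
  | hc v u hu =>
    have h := hg.coder_mergeHead hM.isGraded v u
    rw [coder_cons, map_add, map_add, coder_cons, coder_cons, hu, hM.d_d, hM.par_d, tm_zero_left,
      tm_zero_right, map_zero, tm_neg_left, map_neg]
    refine Eq.trans ?_ h
    abel
  | ha u u' hu hu' => rw [map_add, map_add, hu, hu', add_zero]

/-- The parity operator of the tensor coring. -/
def tensPar (M : PreDGModule.{u, u} k t) :
    KHom (KBimod.tens M.toKBimod) (KBimod.tens M.toKBimod) := (M.tens (KHom.id _)).par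

theorem deconcat_coder (w : (KBimod.tens M.toKBimod).carrier) :
    deconcat _ (coder M g w) = map (coder M g) (KHom.id _) (deconcat _ w) +
      map (tensPar M) (coder M g) (deconcat _ w) := by
  induction w using tensRing_induction with
  | h1 x =>
    rw [coder_one, deconcat_one, map_tm, map_zero, coder_one, tm_zero_left, zero_add]
    rw [map_tm, coder_one, tm_zero_right]
  | hc v u hu =>
    -- The action of the differential on cuts whose left part begins with v. The term `mergeLeft`
    -- accounts for merging v with the next letter of the left part.
    have h1 : ∀ q, map (coder M g) (KHom.id _) (consLeft M.toKBimod _ (tm v q)) +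
        map (tensPar M) (coder M g) (consLeft _ _ (tm v q)) =
        consLeft _ _ (tm (M.d v) q) + mergeLeft g _ (tm v q) + consLeft _ _ (tm (M.par v)
          (map (coder M g) (KHom.id _) q + map (tensPar M) (coder M g) q)) :=
      fun q => by
      induction q using tensor_induction with
      | h0 => simp only [tm_zero_right, map_zero, add_zero]
      | ht a b =>
        have h2 : map (tensPar M) (coder M g) (tm a b) =
          tm (tensPar M a) (coder M g b) := rfl
        have h3 : map (tensPar M) (coder M g) (consLeft _ _ (tm v (tm a b))) =
          tm (tensCons _ (tm (M.par v) (tensPar M a))) (coder M g b) :=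
          congrArg (fun z => tm (V := KBimod.tens M.toKBimod) z (coder M g b)) (tens_par_cons v a)
        have h4 : consLeft M.toKBimod _ (tm (M.par v)
            (tm (V := KBimod.tens M.toKBimod) (tensPar M a) (coder M g b))) =
            tm (tensCons _ (tm (M.par v) (tensPar M a))) (coder M g b) := rfl
        rw [h3, h2, consLeft_tm, map_tm, map_tm, coder_cons, tm_add_left, tm_add_left,
          tm_add_right, map_add, h4, consLeft_tm, consLeft_tm, mergeLeft_tm]
        rw [KHom.id_apply]
        abel
      | ha q q' hq hq' =>
        have h : map (coder M g) (KHom.id _) (q + q') + map (tensPar M) (coder M g) (q + q') =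
            (map (coder M g) (KHom.id _) q + map (tensPar M) (coder M g) q) +
            (map (coder M g) (KHom.id _) q' + map (tensPar M) (coder M g) q') := by
          rw [map_add, map_add, add_add_add_comm]
        rw [h, tm_add_right v q q', tm_add_right (M.d v) q q', tm_add_right (M.par v), map_add,
          map_add, map_add, map_add, map_add, map_add, add_add_add_comm, hq, hq']
        abel
    have h5 : map (tensPar M) (coder M g)
        (tm (tensOne M.toKBimod (1 : Fin t → k)) (tensCons _ (tm v u))) =
        tm (tensOne M.toKBimod (1 : Fin t → k)) (coder M g (tensCons _ (tm v u))) :=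
      congrArg (fun z => tm (V := KBimod.tens M.toKBimod) z (coder M g (tensCons _ (tm v u))))
        (tens_par_one 1)
    rw [deconcat_cons', map_add, map_add, h5, map_tm, coder_one, tm_zero_left, zero_add]
    have h6 := h1 (deconcat _ u)
    rw [← hu] at h6
    refine Eq.trans ?_ ((congrArg (tm (tensOne M.toKBimod (1 : Fin t → k))
      (coder M g (tensCons _ (tm v u))) + ·) h6.symm).trans ?_)
    · rw [coder_cons, map_add, map_add, deconcat_cons', deconcat_cons', deconcat_mergeHead,
        tm_add_right, tm_add_right]
      abel
    · abel
  | ha u u' hu hu' =>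
    simp only [map_add, hu, hu']
    abel

theorem deconcat_hasDeg {D : KHom (KBimod.tens M.toKBimod) (KBimod.tens M.toKBimod)} :
    HasDeg (M.tens D) ((M.tens D).tensor (M.tens D)) 0 (deconcat M.toKBimod) :=
  desc_hasDeg (X := (M.tens D).tensor (M.tens D)) (F := deconcatAux M.toKBimod) fun n => by
    induction n with
    | zero =>
      exact ((tensOne_hasDeg.map tensOne_hasDeg).comp
        (rightUnitInv_hasDeg (N := PreDGModule.unit k t))).congr (by ring)
    | succ n ih =>
      refine HasDeg.add (M := powModule M (n + 1)) (N := (M.tens D).tensor (M.tens D)) ?_ ?_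
      · exact ((tensOne_hasDeg.map (incl_hasDeg D (n + 1))).comp
          (leftUnitInv_hasDeg (N := powModule M (n + 1)))).congr (by ring)
      · exact ((tensCons_hasDeg.map hasDeg_id).comp
          ((hasDeg_assocInv (M := M) (N := M.tens D) (X := M.tens D)).comp
            (hasDeg_id.map ih))).congr (by ring)

theorem mergeAux_hasDeg (hM : M.IsGraded)
    {D : KHom (KBimod.tens M.toKBimod) (KBimod.tens M.toKBimod)}
    (hg : HasDeg (M.tensor M) M (-1) g) : ∀ n,
    HasDeg (powModule M n) (M.tens D) (-1) (mergeAux M.par g n)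
  | 0 => fun _ _ _ => zero_mem _
  | 1 => fun _ _ _ => zero_mem _
  | n + 2 => by
    have h1 : HasDeg (powModule M (n + 2)) (powModule M (n + 1)) (-1)
        ((map g (KHom.id (KBimod.pow M.toKBimod n))).comp
          (assocInv M.toKBimod M.toKBimod (KBimod.pow M.toKBimod n))) :=
      HasDeg.congr ((HasDeg.map hg (hasDeg_id (M := powModule M n))).comp
        (hasDeg_assocInv (M := M) (N := M) (X := powModule M n))) (by ring)
    have h2 : HasDeg (powModule M (n + 2)) (M.tensor (M.tens D)) (-1)
        (map M.par (mergeAux M.par g (n + 1))) :=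
      HasDeg.congr (HasDeg.map hM.hasDeg_par (mergeAux_hasDeg hM hg (n + 1))) (by ring)
    exact HasDeg.add (M := powModule M (n + 2)) (N := M.tens D)
      (((incl_hasDeg D (n + 1)).comp h1).congr (by ring))
      ((tensCons_hasDeg.comp h2).congr (by ring))

theorem merge_hasDeg (hM : M.IsGraded)
    {D : KHom (KBimod.tens M.toKBimod) (KBimod.tens M.toKBimod)}
    (hg : HasDeg (M.tensor M) M (-1) g) : HasDeg (M.tens D) (M.tens D) (-1) (merge M.par g) :=
  desc_hasDeg (mergeAux_hasDeg hM hg)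

theorem coder_hasDeg (hM : M.IsDG) (hg : HasDeg (M.tensor M) M (-1) g) :
    HasDeg (M.tens (coder M g)) (M.tens (coder M g)) (-1) (coder M g) :=
  HasDeg.add (M := M.tens (coder M g)) (N := M.tens (coder M g))
    (der_hasDeg hM.isGraded ((tensIncl_hasDeg.comp hM.hasDeg_d).congr (by ring)))
    (merge_hasDeg hM.isGraded hg)

theorem tensProj_coder (u : (KBimod.tens M.toKBimod).carrier) :
    tensProj _ (coder M g u) = 0 := by
  induction u using tensRing_induction with
  | h1 x => rw [coder_one, map_zero]
  | hc v u _ => rw [coder_cons, map_add, map_add, tensProj_cons, tensProj_cons,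
      tensProj_mergeHead, add_zero, add_zero]
  | ha u u' hu hu' => rw [map_add, map_add, hu, hu', add_zero]

theorem tensCoring_isCoaugDGCoring (hM : M.IsDG) (hg : IsBarProduct M g) :
    (tensCoring M g).IsCoaugDGCoring :=
  have hT := hM.isGraded.tens (coder M g)
  { internal := hT.internal
    l_mem := hT.l_mem
    r_mem := hT.r_mem
    par_apply := hT.par_apply
    d_mem := coder_hasDeg hM hg.hasDeg
    d_d := hg.coder_coder hM
    coassoc := deconcat_coassoc
    counit_left := deconcat_counit_left
    counit_right := deconcat_counit_right
    comul_deg := deconcat_hasDeg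
    comul_d := deconcat_coder
    comul_coaug := deconcat_one
    coaug_mem := fun x => by
      have := tensOne_hasDeg (M := M) (D := coder M g) 0 x (mem_unit_gr.2 (Or.inl rfl))
      rwa [add_zero] at this
    d_coaug := coder_one
    counit_gr := tensProj_gr
    counit_d := tensProj_coder }

end PreDGModule

end

/-! ### The bar construction as a dg coring, and its twisting morphism π -/

section

open KBimod PreDGModule

variable {k : Type u} [Field k] {t : ℕ}

namespace PreDGRing

variable {R : PreDGRing.{u} k t}

variable (R) in
/-- The product on the suspended augmentation ideal, `[a₁ | a₂] ↦ (-1) ^ |a₁| [a₁ a₂]`. -/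
def barProd : KHom (KBimod.tensor R.red.susp.toKBimod R.red.susp.toKBimod) R.red.susp.toKBimod :=
  R.redMul.comp (map R.red.par (KHom.id _))

variable (R) in
/-- The map `[a] ↦ a`. -/
def barIncl : KHom R.red.susp.toKBimod R.toKBimod := kerIncl R.aug

theorem barIncl_injective : Function.Injective R.barIncl := fun _ _ h =>
  kerIncl_injective R.aug h

theorem aug_barIncl (v : R.red.susp.carrier) : R.aug (R.barIncl v) = 0 := apply_kerIncl R.aug v

theorem barIncl_hasDeg : HasDeg R.red.susp R.toPreDGModule (-1) R.barIncl := fun _ _ hm => hm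

namespace IsAugDGRing

variable (hR : R.IsAugDGRing)
include hR

theorem red_isDG : R.red.IsDG := (hR.toIsDG.ker R.aug_one hR.aug_gr hR.aug_d).1

theorem barIncl_par (v : R.red.susp.carrier) :
    R.barIncl (R.red.susp.par v) = -R.par (R.barIncl v) :=
  (map_neg R.barIncl.toLin _).trans
    (congrArg Neg.neg ((hR.toIsDG.ker R.aug_one hR.aug_gr hR.aug_d).2.1 v))

theorem barIncl_d (v : R.red.susp.carrier) :
    R.barIncl (R.red.susp.d v) = -R.d (R.barIncl v) :=
  (map_neg R.barIncl.toLin _).trans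
    (congrArg Neg.neg ((hR.toIsDG.ker R.aug_one hR.aug_gr hR.aug_d).2.2 v))

/-- Multiplicativity of ε makes the projection to Ā in `redMul` invisible. Identities on sĀ can then
be checked in R through the injection `barIncl`. -/
theorem barIncl_barProd (v w : R.red.susp.carrier) :
    R.barIncl (R.barProd (tm v w)) = R.m (R.par (R.barIncl v)) (R.barIncl w) := by
  have h1 : R.barIncl (R.barProd (tm v w)) =
      R.m (kerIncl R.aug (R.red.par v)) (R.barIncl w) -
        R.one (R.aug (R.m (kerIncl R.aug (R.red.par v)) (R.barIncl w))) := rfl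
  have h2 : kerIncl R.aug (R.red.par v) = R.par (R.barIncl v) :=
    (hR.toIsDG.ker R.aug_one hR.aug_gr hR.aug_d).2.1 v
  rw [h1, hR.aug_mul, aug_barIncl, h2]
  refine (congrArg (_ - R.one ·) (mul_zero _)).trans ?_
  rw [map_zero, sub_zero]

/-- Suspension reverses the signs of d and of the parity operator; with the sign (-1)^{|a₁|} of the
product, the Leibniz rule and associativity of R become the required signed identities. -/
theorem barProd_isBarProduct : IsBarProduct R.red.susp R.barProd where
  hasDeg := by
    refine tensor_hasDeg fun i j v hv w hw => ?_
    change R.barIncl (R.barProd (tm v w)) ∈ R.gr (i + j + -1 - 1)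
    rw [hR.barIncl_barProd]
    have := hR.mul_mem _ _ _ (hR.isGraded.par_mem hv) _ hw
    rwa [show i - 1 + (j - 1) = i + j + -1 - 1 by ring] at this
  d_add v w := barIncl_injective (by
    rw [map_add, map_add, hR.barIncl_d, hR.barIncl_barProd, hR.barIncl_barProd, hR.barIncl_barProd,
      hR.leibniz, hR.barIncl_d, hR.barIncl_par, hR.barIncl_d, map_neg, map_neg, hR.par_d,
      hR.par_par,
      map_zero]
    simp only [m_neg_left, m_neg_right]
    abel)
  assoc_add v w z := barIncl_injective (by
    rw [map_add, hR.barIncl_barProd, hR.barIncl_barProd, hR.barIncl_barProd, hR.barIncl_barProd,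
      hR.barIncl_par, map_neg, hR.par_par, hR.par_m, hR.par_par, hR.mul_assoc, map_zero, m_neg_left,
      add_neg_cancel])

theorem bar_isCoaugDGCoring : R.bar.IsCoaugDGCoring :=
  tensCoring_isCoaugDGCoring hR.red_isDG.susp hR.barProd_isBarProduct

end IsAugDGRing

variable (R) in
/-- The element `[v | u]` of the bar construction. -/
def barCons (v : R.red.susp.carrier) (u : R.bar.carrier) : R.bar.carrier :=
  tensCons R.red.susp.toKBimod (tm v u)

variable (R) in
theorem bar_induction {p : R.bar.carrier → Prop} (h1 : ∀ x : Fin t → k, p (R.bar.coaug x))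
    (hc : ∀ v u, p u → p (R.barCons v u)) (ha : ∀ u u', p u → p u' → p (u + u'))
    (u : R.bar.carrier) : p u :=
  tensRing_induction (V := R.red.susp.toKBimod) (p := p) h1 hc ha u

theorem piBar_coaug (x : Fin t → k) : R.piBar (R.bar.coaug x) = 0 :=
  (congrArg (fun z => R.barIncl z) (tensProjV_one (V := R.red.susp.toKBimod) x)).trans
    (map_zero R.barIncl.toLin)

theorem piBar_barCons (v : R.red.susp.carrier) (u : R.bar.carrier) :
    R.piBar (R.barCons v u) = R.r (R.bar.counit u) (R.barIncl v) :=
  (congrArg (fun z => R.barIncl z) (tensProjV_cons (V := R.red.susp.toKBimod) v u)).trans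
    (R.barIncl.map_r _ _)

theorem bar_counit_coaug (x : Fin t → k) : R.bar.counit (R.bar.coaug x) = x :=
  R.bar.counit_coaug x

theorem bar_counit_barCons (v : R.red.susp.carrier) (u : R.bar.carrier) :
    R.bar.counit (R.barCons v u) = 0 := tensProj_cons (V := R.red.susp.toKBimod) _

theorem bar_d_coaug (x : Fin t → k) : R.bar.d (R.bar.coaug x) = 0 :=
  coder_one (M := R.red.susp) (g := R.barProd) x

variable (R) in
/-- The map `v ⊗ u ↦ [v₀ v | u₂ | ⋯ ]`, up to sign. -/
def barMerge : KHom (KBimod.tensor R.red.susp.toKBimod R.bar.toKBimod) R.bar.toKBimod :=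
  mergeHead R.barProd

theorem barMerge_coaug (v : R.red.susp.carrier) (x : Fin t → k) :
    R.barMerge (tm v (R.bar.coaug x)) = 0 := mergeHead_one (g := R.barProd) v x

theorem barMerge_barCons (v w : R.red.susp.carrier) (u : R.bar.carrier) :
    R.barMerge (tm v (R.barCons w u)) = R.barCons (R.barProd (tm v w)) u :=
  mergeHead_cons (g := R.barProd) v w u

theorem bar_d_barCons (v : R.red.susp.carrier) (u : R.bar.carrier) :
    R.bar.d (R.barCons v u) = R.barCons (R.red.susp.d v) u +
      R.barCons (R.red.susp.par v) (R.bar.d u) + R.barMerge (tm v u) :=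
  coder_cons (M := R.red.susp) (g := R.barProd) v u

theorem bar_par_barCons (v : R.red.susp.carrier) (u : R.bar.carrier) :
    R.bar.par (R.barCons v u) = R.barCons (R.red.susp.par v) (R.bar.par u) :=
  tens_par_cons (M := R.red.susp) v u

variable (R) in
/-- The map `v ⊗ (a ⊗ q) ↦ [v | a] ⊗ q`. -/
def barConsLeft (X : KBimod.{u, x} k t) :
    KHom (KBimod.tensor R.red.susp.toKBimod (KBimod.tensor R.bar.toKBimod X))
      (KBimod.tensor R.bar.toKBimod X) := consLeft R.red.susp.toKBimod X

theorem barConsLeft_tm {X : KBimod.{u, x} k t} (v : R.red.susp.carrier) (a : R.bar.carrier)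
    (q : X.carrier) : R.barConsLeft X (tm v (tm a q)) = tm (R.barCons v a) q := rfl

theorem bar_comul_coaug (x : Fin t → k) : R.bar.comul (R.bar.coaug x) =
    tm (R.bar.coaug x) (R.bar.coaug (1 : Fin t → k)) :=
  deconcat_one (V := R.red.susp.toKBimod) x

theorem bar_comul_barCons (v : R.red.susp.carrier) (u : R.bar.carrier) :
    R.bar.comul (R.barCons v u) = tm (R.bar.coaug (1 : Fin t → k)) (R.barCons v u) +
      R.barConsLeft _ (tm v (R.bar.comul u)) :=
  deconcat_cons' (V := R.red.susp.toKBimod) v u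

theorem barCons_add_left (v v' : R.red.susp.carrier) (u : R.bar.carrier) :
    R.barCons (v + v') u = R.barCons v u + R.barCons v' u :=
  (congrArg (tensCons R.red.susp.toKBimod).toLin (tm_add_left _ _ _)).trans (map_add _ _ _)

theorem piBar_barMerge_barCons (hR : R.IsAugDGRing) (v : R.red.susp.carrier) (u : R.bar.carrier) :
    R.piBar (R.barMerge (tm v u)) = R.m (R.par (R.barIncl v)) (R.piBar u) := by
  induction u using bar_induction with
  | h1 x => rw [barMerge_coaug, map_zero, piBar_coaug, m_zero_right]
  | hc w u _ =>
    rw [barMerge_barCons, piBar_barCons, hR.barIncl_barProd, piBar_barCons, r_m]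
  | ha u u' hu hu' =>
    rw [tm_add_right, map_add, map_add, map_add, hu, hu', m_add_right]

/-- π vanishes on words of length other than one, so among the words [v|a] only those with a of
length 0 contribute. The counit selects them; for q = Δ u this is the cut right after v. -/
theorem convSq_barConsLeft (hR : R.IsAugDGRing) (v : R.red.susp.carrier)
    (q : (KBimod.tensor R.bar.toKBimod R.bar.toKBimod).carrier) :
    convSq R.piBar (R.barConsLeft _ (tm v q)) =
      -R.m (R.par (R.barIncl v)) (R.piBar (leftUnit _ (map R.bar.counit (KHom.id _) q))) := by
  have hB := hR.bar_isCoaugDGCoring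
  induction q using tensor_induction with
  | h0 => rw [tm_zero_right, map_zero, map_zero, map_zero, map_zero, map_zero, m_zero_right,
      neg_zero]
  | ht a b =>
    have h1 : R.bar.counit (R.bar.par a) = R.bar.counit a :=
      hB.toIsDG.isGraded.par_comm_zero unit_isGraded (counit_hasDeg hB) a
    change R.m (R.piBar (R.bar.par (R.barCons v a))) (R.piBar b) = _
    rw [bar_par_barCons, piBar_barCons, hR.barIncl_par, map_tm, h1, KHom.id_apply, leftUnit_tm,
      R.piBar.map_l, map_neg, m_neg_left]
    congr 1
    exact congrArg R.mul.toLin (tm_balance (R.bar.counit a) (R.par (R.barIncl v)) (R.piBar b))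
  | ha q q' hq hq' =>
    rw [tm_add_right, map_add, map_add, hq, hq', map_add, map_add, map_add, m_add_right, neg_add]

theorem piBar_hasDeg (hR : R.IsAugDGRing) :
    HasDeg R.bar.toPreDGModule R.toPreDGModule (-1) R.piBar := by
  have hM := hR.red_isDG.susp.isGraded
  have h1 : HasDeg R.bar.toPreDGModule R.red.susp 0 (tensProjV R.red.susp.toKBimod) := by
    refine desc_hasDeg fun n => ?_
    match n with
    | 0 => exact fun _ _ _ => zero_mem _
    | 1 =>
      refine tensor_hasDeg (N := PreDGModule.unit k t) fun i j v hv x hx => ?_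
      rw [add_zero]
      change R.red.susp.r x v ∈ _
      rcases mem_unit_gr.1 hx with h | h
      · rw [h, add_zero]
        exact hM.r_mem i x v hv
      · have h0 : R.red.susp.r x v = 0 :=
          (congrArg (fun x => R.red.susp.r x v) h).trans (by rw [map_zero]; rfl)
        rw [h0]
        exact zero_mem _
    | n + 2 => exact fun _ _ _ => zero_mem _
  exact (barIncl_hasDeg.comp h1).congr (by ring)

theorem piBar_isTwisting (hR : R.IsAugDGRing) : R.IsTwisting R.bar R.piBar where
  deg := piBar_hasDeg hR
  coaug := piBar_coaug
  maurerCartan c := by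
    have hB := hR.bar_isCoaugDGCoring
    change R.d (R.piBar c) + R.piBar (R.bar.d c) + convSq R.piBar (R.bar.comul c) = 0
    induction c using bar_induction with
    | h1 x =>
      have h : convSq R.piBar (tm (R.bar.coaug x) (R.bar.coaug (1 : Fin t → k))) =
        R.m (R.piBar (R.bar.par (R.bar.coaug x))) (R.piBar (R.bar.coaug (1 : Fin t → k))) := rfl
      rw [piBar_coaug, bar_d_coaug, bar_comul_coaug, h, piBar_coaug, m_zero_right, map_zero,
        map_zero, add_zero, add_zero]
    | hc v u _ =>
      have h : convSq R.piBar (tm (R.bar.coaug (1 : Fin t → k)) (R.barCons v u)) =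
        R.m (R.piBar (R.bar.par (R.bar.coaug (1 : Fin t → k)))) (R.piBar (R.barCons v u)) := rfl
      have h2 : R.bar.par (R.bar.coaug (1 : Fin t → k)) = R.bar.coaug (1 : Fin t → k) :=
        tens_par_one (M := R.red.susp) 1
      -- The terms with the differential of v cancel each other, and the term where v merges with u
      -- cancels the convolution square.
      rw [bar_comul_barCons, map_add, h, h2, piBar_coaug, m_zero_left, convSq_barConsLeft hR,
        hB.counit_left, bar_d_barCons, map_add, map_add, piBar_barCons, piBar_barCons,
        piBar_barCons, hB.counit_d, piBar_barMerge_barCons hR, hR.barIncl_d, map_zero]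
      have h3 : (0 : Module.End k R.carrier) (R.barIncl (R.red.susp.par v)) = 0 := rfl
      rw [h3, R.d.map_r, map_neg]
      abel
    | ha u u' hu hu' =>
      rw [map_add, map_add, map_add, map_add, map_add, map_add]
      have := congrArg₂ (· + ·) hu hu'
      rw [add_zero] at this
      refine Eq.trans ?_ this
      abel

end PreDGRing

end

/-! ### Pseudo-inverses of graded K-bimodule maps; contraction of the kernel of a quasi-isomorphism
-/

section

open KBimod PreDGModule

variable {k : Type u} [Field k] {t : ℕ}

/-- Over a field a map splits over its range, and the splitting extends to the whole target. -/
theorem LinearMap.exists_pseudoInverse {V : Type*} {W : Type*} [AddCommGroup V] [Module k V]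
    [AddCommGroup W] [Module k W] (f : V →ₗ[k] W) :
    ∃ g : W →ₗ[k] V, ∀ x, f (g (f x)) = f x := by
  obtain ⟨s, hs⟩ := f.rangeRestrict.exists_rightInverse_of_surjective f.range_rangeRestrict
  obtain ⟨g, hg⟩ := LinearMap.exists_extend s
  refine ⟨g, fun x => ?_⟩
  have h1 : g (f x) = s (f.rangeRestrict x) := LinearMap.congr_fun hg (f.rangeRestrict x)
  rw [h1]
  exact congrArg Subtype.val (LinearMap.congr_fun hs (f.rangeRestrict x))

namespace KBimod

variable {V : KBimod.{u, v} k t} {W : KBimod.{u, w} k t}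

theorem l_single (V : KBimod.{u, v} k t) (a : Fin t → k) (i : Fin t) (m : V.carrier) :
    V.l (Pi.single i 1) (V.l a m) = a i • V.l (Pi.single i 1) m := by
  have h : (Pi.single i 1 : Fin t → k) * a = a i • Pi.single i 1 := by
    ext j
    by_cases h : j = i
    · subst h; simp
    · simp [h]
  have h2 := congrArg (fun e => V.l e m) h
  simp only [map_mul, map_smul] at h2
  exact h2

theorem r_single (V : KBimod.{u, v} k t) (a : Fin t → k) (i : Fin t) (m : V.carrier) :
    V.r (Pi.single i 1) (V.r a m) = a i • V.r (Pi.single i 1) m := by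
  have h : (Pi.single i 1 : Fin t → k) * a = a i • Pi.single i 1 := by
    ext j
    by_cases h : j = i
    · subst h; simp
    · simp [h]
  have h2 := congrArg (fun e => V.r e m) h
  simp only [map_mul, map_smul] at h2
  exact h2

theorem single_l (V : KBimod.{u, v} k t) (a : Fin t → k) (i : Fin t) (m : V.carrier) :
    V.l a (V.l (Pi.single i 1) m) = a i • V.l (Pi.single i 1) m := by
  rw [← l_single, l_l, l_l, mul_comm]

theorem single_r (V : KBimod.{u, v} k t) (a : Fin t → k) (i : Fin t) (m : V.carrier) :
    V.r a (V.r (Pi.single i 1) m) = a i • V.r (Pi.single i 1) m := by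
  rw [← r_single, r_r, r_r, mul_comm]

theorem sum_single_l (V : KBimod.{u, v} k t) (m : V.carrier) :
    ∑ i : Fin t, V.l (Pi.single i 1) m = m := by
  rw [← LinearMap.sum_apply, ← map_sum, Finset.univ_sum_single (fun _ : Fin t => (1 : k))]
  exact LinearMap.congr_fun (map_one V.l) m

theorem sum_single_r (V : KBimod.{u, v} k t) (m : V.carrier) :
    ∑ i : Fin t, V.r (Pi.single i 1) m = m := by
  rw [← LinearMap.sum_apply, ← map_sum, Finset.univ_sum_single (fun _ : Fin t => (1 : k))]
  exact LinearMap.congr_fun (map_one V.r) m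

/-- The average `∑ e_i f(e_i m e_j) e_j` of a linear map over the idempotents of `K`. -/
noncomputable def average (f : V.carrier →ₗ[k] W.carrier) : KHom V W where
  toLin := ∑ i : Fin t, ∑ j : Fin t, W.l (Pi.single i 1) ∘ₗ W.r (Pi.single j 1) ∘ₗ f ∘ₗ
    V.l (Pi.single i 1) ∘ₗ V.r (Pi.single j 1)
  map_l a m := by
    simp only [LinearMap.sum_apply, LinearMap.comp_apply, map_sum, ← V.comm, l_single, single_l,
      map_smul]
  map_r a m := by
    simp only [LinearMap.sum_apply, LinearMap.comp_apply, map_sum, r_single,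
      map_smul, ← W.comm, single_r]

theorem average_apply (f : V.carrier →ₗ[k] W.carrier) (m : V.carrier) : average f m =
    ∑ i : Fin t, ∑ j : Fin t, W.l (Pi.single i 1) (W.r (Pi.single j 1) (f
    (V.l (Pi.single i 1) (V.r (Pi.single j 1) m)))) := by
  simp only [average, LinearMap.sum_apply, LinearMap.comp_apply]

/-- Since f commutes with the idempotents of K, each summand e_i(·)e_j of the identity fgf = f
persists under averaging, and ∑ e_i = 1 reassembles them. No division is involved, so the
characteristic of k is irrelevant. -/
theorem exists_pseudoInverse (f : KHom V W) : ∃ g : KHom W V, ∀ m, f (g (f m)) = f m := by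
  obtain ⟨g, hg⟩ := LinearMap.exists_pseudoInverse f.toLin
  refine ⟨average g, fun m => ?_⟩
  rw [average_apply]
  simp only [map_sum, f.map_l, f.map_r]
  simp only [← f.map_r, ← f.map_l, hg]
  simp only [f.map_r, f.map_l, ← W.comm]
  simp only [single_l, Pi.single_eq_same, one_smul, single_r]
  simp only [← map_sum, sum_single_r, sum_single_l]

end KBimod

namespace PreDGModule

variable {M : PreDGModule.{u, v} k t} {N : PreDGModule.{u, w} k t}

/-- Only the part of g of degree -e is kept; because f is homogeneous of degree e, this part alone
is still a pseudo-inverse. -/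
theorem exists_pseudoInverse (hM : M.IsGraded) (hN : N.IsGraded) {e : ℤ}
    {f : KHom M.toKBimod N.toKBimod} (hf : HasDeg M N e f) :
    ∃ g : KHom N.toKBimod M.toKBimod, HasDeg N M (-e) g ∧ ∀ m, f (g (f m)) = f m := by
  obtain ⟨g, hg⟩ := KBimod.exists_pseudoInverse f
  have hF : ∀ n, (Function.support fun i => ((hM.pr i).comp (g.comp (hN.pr (i + e)))) n).Finite :=
    fun n => by
    refine ((hN.pr_finite n).preimage (add_left_injective e).injOn).subset fun i hi h => hi ?_
    have h' : hN.pr (i + e) n = 0 := h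
    simp only [KHom.comp_apply, h', map_zero]
  have hv : ∀ i, ∀ n ∈ N.gr (i + e), KHom.finsum _ hF n = hM.pr i (g n) := fun i n hn => by
    rw [KHom.finsum_apply, finsum_eq_single _ i fun j hj => ?_]
    · simp only [KHom.comp_apply, hN.pr_of_mem (i + e) hn, if_true]
    · have h : hN.pr (j + e) n = 0 :=
        (hN.pr_of_mem (j + e) hn).trans (if_neg fun h => hj (by omega))
      simp only [KHom.comp_apply, h, map_zero]
  refine ⟨KHom.finsum _ hF, fun i n hn => ?_, fun m => ?_⟩
  · rw [hv (i + -e) n (by rwa [neg_add_cancel_right])]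
    exact hM.pr_mem _ _
  · have hpr : ∀ i m, f (hM.pr i m) = hN.pr (i + e) (f m) := fun i m => by
      refine hM.linear_ext (f := f.toLin ∘ₗ (hM.pr i).toLin)
        (g := (hN.pr (i + e)).toLin ∘ₗ f.toLin) (fun j m hm => ?_) m
      have h1 := hM.pr_of_mem i hm
      have h2 := hN.pr_of_mem (i + e) (hf j m hm)
      rw [LinearMap.comp_apply, LinearMap.comp_apply, h1, h2]
      by_cases h : j = i
      · rw [if_pos h, if_pos (by rw [h])]
      · rw [if_neg h, if_neg (fun h' => h (add_right_cancel h')), map_zero]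
    refine hM.linear_ext (f := f.toLin ∘ₗ (KHom.finsum _ hF).toLin ∘ₗ f.toLin) (g := f.toLin)
      (fun i m hm => ?_) m
    rw [LinearMap.comp_apply, LinearMap.comp_apply, hv i _ (hf i m hm), hpr, hg,
      hN.pr_of_mem (i + e) (hf i m hm), if_pos rfl]

end PreDGModule

namespace PreDGBimodule

variable {R : PreDGRing.{u} k t} {X : PreDGBimodule.{u, w} R} {Y : PreDGBimodule.{u, w} R}
  {q : KHom X.toKBimod Y.toKBimod}

/-- The kernel of a surjective quasi-isomorphism is acyclic. -/
theorem IsQuasiIso.ker_acyclic (hX : X.IsDG)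
    (hq : HasDeg X.toPreDGModule Y.toPreDGModule 0 q) (hqd : ∀ m, q (X.d m) = Y.d (q m))
    {τ : KHom Y.toKBimod X.toKBimod} (hτ : HasDeg Y.toPreDGModule X.toPreDGModule 0 τ)
    (hqτ : ∀ n, q (τ n) = n) (h : IsQuasiIso (M := X) (N := Y) q)
    {i : ℤ} {m : X.carrier} (hm : m ∈ X.gr i) (hd : X.d m = 0) (hqm : q m = 0) :
    ∃ y ∈ X.gr (i + 1), q y = 0 ∧ X.d y = m := by
  -- q m = 0 is the boundary of 0, so injectivity in homology makes m a boundary dc. Then q c is a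
  -- cycle, which agrees with the image of a cycle z up to a boundary db.
  obtain ⟨c, hc, rfl⟩ := h.2 i m hm hd ⟨0, zero_mem _, by rw [hqm, map_zero]⟩
  obtain ⟨z, hz, hdz, b, hb, hzb⟩ := h.1 (i + 1) (q c)
    (by have := hq _ c hc; rwa [add_zero] at this) (by rw [← hqd, hqm])
  have hτb : τ b ∈ X.gr (i + 1 + 1) := by
    have := hτ _ b hb
    rwa [add_zero] at this
  -- Subtracting z and adding d(τ b) brings c into ker q without changing its differential.
  refine ⟨c - z + X.d (τ b), add_mem (sub_mem hc hz) ?_, ?_, ?_⟩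
  · have := hX.d_mem _ _ hτb
    rwa [add_sub_cancel_right] at this
  · rw [map_add, map_sub, hqd, hqτ, ← hzb]
    abel
  · rw [map_add, map_sub, hdz, hX.d_d, sub_zero, add_zero]

/-- A surjective quasi-isomorphism has a graded section, and its kernel is contractible. -/
theorem IsQuasiIso.exists_contraction (hX : X.IsDG) (hY : Y.IsDG)
    (hq : HasDeg X.toPreDGModule Y.toPreDGModule 0 q) (hqd : ∀ m, q (X.d m) = Y.d (q m))
    (hs : Function.Surjective q) (h : IsQuasiIso (M := X) (N := Y) q) :
    ∃ τ : KHom Y.toKBimod X.toKBimod, HasDeg Y.toPreDGModule X.toPreDGModule 0 τ ∧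
      (∀ n, q (τ n) = n) ∧ ∃ s : KHom X.toKBimod X.toKBimod,
        HasDeg X.toPreDGModule X.toPreDGModule 1 s ∧ (∀ m, q (s m) = 0) ∧
        ∀ m, q m = 0 → X.d (s m) + s (X.d m) = m := by
  have hXg := hX.isGraded
  obtain ⟨τ, hτ, hqτq⟩ := exists_pseudoInverse hXg hY.isGraded hq
  have hτ := hτ.congr neg_zero
  have hqτ : ∀ n, q (τ n) = n := fun n => by
    obtain ⟨m, rfl⟩ := hs n
    exact hqτq m
  refine ⟨τ, hτ, hqτ, ?_⟩
  -- e projects onto ker q along the image of τ. It need not commute with d.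
  obtain ⟨e, he⟩ : ∃ e : KHom X.toKBimod X.toKBimod, e = KHom.id _ - τ.comp q := ⟨_, rfl⟩
  have heq : ∀ m, e m = m - τ (q m) := fun m => by rw [he, KHom.sub_apply]; rfl
  have hedeg : HasDeg X.toPreDGModule X.toPreDGModule 0 e :=
    he ▸ hasDeg_id.sub ((hτ.comp hq).congr (by ring))
  have hqe : ∀ m, q (e m) = 0 := fun m => by rw [heq, map_sub, hqτ, sub_self]
  have heker : ∀ m, q m = 0 → e m = m := fun m hm => by rw [heq, hm, map_zero, sub_zero]
  obtain ⟨σ, hσ, hδ⟩ := exists_pseudoInverse hXg hXg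
    ((hX.hasDeg_d.comp hedeg).congr (zero_add (-1)))
  have hσ := hσ.congr (neg_neg 1)
  simp only [KHom.comp_apply] at hδ
  -- On ker q the operator eσ inverts d on boundaries: d(eσ)d = d. Applying it to the cycle m -
  -- eσdm, and not to m, gives ds m = m - eσdm, while sd m = eσdm.
  let s : KHom X.toKBimod X.toKBimod := (e.comp σ).comp (KHom.id _ - (e.comp σ).comp X.d)
  have hsv : ∀ m, s m = e (σ (m - e (σ (X.d m)))) := fun m => by
    change e (σ ((KHom.id _ - (e.comp σ).comp X.d : KHom _ _) m)) = _
    rw [KHom.sub_apply]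
    rfl
  have heσ : HasDeg X.toPreDGModule X.toPreDGModule 1 (e.comp σ) :=
    (hedeg.comp hσ).congr (by ring)
  refine ⟨s, ?_, fun m => by rw [hsv]; exact hqe _, fun m hm => ?_⟩
  · exact (heσ.comp (hasDeg_id.sub ((heσ.comp hX.hasDeg_d).congr (by ring)))).congr (by ring)
  have hdd : ∀ m, q m = 0 → X.d (e (σ (X.d m))) = X.d m := fun m hm => by
    have := hδ m
    rwa [heker m hm] at this
  have hqd0 : ∀ m, q m = 0 → q (X.d m) = 0 := fun m hm => by rw [hqd, hm, map_zero]
  -- e m - eσd(e m) is a cycle in ker q, hence equal to dy with y in ker q, and d(eσ)dy = dy.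
  -- Passing to homogeneous m is necessary because acyclicity is known degree by degree.
  have key : ∀ m, X.d (e (σ (e m - e (σ (X.d (e m)))))) = e m - e (σ (X.d (e m))) := fun m => by
    refine hXg.linear_ext (f := X.d.toLin ∘ₗ (e.comp σ).toLin ∘ₗ (e.toLin - (e.comp σ).toLin ∘ₗ
      X.d.toLin ∘ₗ e.toLin)) (g := e.toLin - (e.comp σ).toLin ∘ₗ
      X.d.toLin ∘ₗ e.toLin) (fun i m hm => ?_) m
    simp only [LinearMap.comp_apply, LinearMap.sub_apply]
    change X.d (e (σ (e m - e (σ (X.d (e m)))))) = e m - e (σ (X.d (e m)))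
    have hem : e m ∈ X.gr i := by
      have := hedeg i m hm
      rwa [add_zero] at this
    have hmem : e (σ (X.d (e m))) ∈ X.gr i := by
      have := heσ _ _ (hX.d_mem i _ hem)
      rwa [sub_add_cancel] at this
    obtain ⟨y, -, hy, hdy⟩ := h.ker_acyclic hX hq hqd hτ hqτ (sub_mem hem hmem)
      (by rw [map_sub, hdd _ (hqe m), sub_self]) (by rw [map_sub, hqe, hqe, sub_zero])
    rw [← hdy, hdd y hy]
  have hk := key m
  rw [heker m hm] at hk
  rw [hsv, hsv, hk, hX.d_d, map_zero, map_zero, sub_zero]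
  abel

end PreDGBimodule

end

/-! ### Homogeneous bimodule morphisms and their differential -/

section

open KBimod PreDGModule

variable {k : Type u} [Field k] {t : ℕ}

namespace PreDGModule

variable {M : PreDGModule.{u, v} k t}

open Classical in
variable (M) in
/-- The power `s ^ n` of the parity operator. -/
noncomputable def parPow (n : ℤ) : KHom M.toKBimod M.toKBimod :=
  if Even n then KHom.id _ else M.par

theorem parPow_of_mem (hM : M.IsGraded) (n : ℤ) {i : ℤ} {m : M.carrier} (hm : m ∈ M.gr i) :
    M.parPow n m = ((n * i).negOnePow : ℤ) • m := by
  rw [parPow]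
  split_ifs with h
  · rw [Int.negOnePow_even _ (h.mul_right i), Units.val_one, one_smul]
    rfl
  · rw [hM.par_apply i m hm]
    rcases Int.even_or_odd i with hi | hi
    · rw [Int.negOnePow_even _ hi, Int.negOnePow_even _ (hi.mul_left n)]
    · rw [Int.negOnePow_odd _ hi, Int.negOnePow_odd _ ((Int.not_even_iff_odd.1 h).mul hi)]

theorem parPow_add_one (hM : M.IsGraded) (n : ℤ) (m : M.carrier) :
    M.parPow (n + 1) m = M.par (M.parPow n m) := by
  rw [parPow, parPow]
  by_cases h : Even n
  · rw [if_pos h, if_neg (Int.not_even_iff_odd.2 h.add_one)]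
    rfl
  · rw [if_neg h, if_pos (Int.not_even_iff_odd.1 h).add_one, hM.par_par]
    rfl

theorem parPow_mem (hM : M.IsGraded) (n : ℤ) {i : ℤ} {m : M.carrier} (hm : m ∈ M.gr i) :
    M.parPow n m ∈ M.gr i := by
  rw [parPow_of_mem hM n hm]
  exact zsmul_mem hm _

theorem d_parPow (hM : M.IsDG) (n : ℤ) (m : M.carrier) :
    M.d (M.parPow n m) = (n.negOnePow : ℤ) • M.parPow n (M.d m) := by
  rw [parPow]
  by_cases h : Even n
  · rw [if_pos h, Int.negOnePow_even _ h]
    simp only [Units.val_one, one_smul]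
    rfl
  · rw [if_neg h, Int.negOnePow_odd _ (Int.not_even_iff_odd.1 h), hM.par_d]
    simp

end PreDGModule

namespace PreDGBimodule

variable {R : PreDGRing.{u} k t} {M : PreDGBimodule.{u, v} R} {N : PreDGBimodule.{u, w} R}
  {X : PreDGBimodule.{u, x} R}

theorem IsHom.hasDeg {n : ℤ} {f : KHom M.toKBimod N.toKBimod}
    (hf : IsHom (M := M) (N := N) n f) : HasDeg M.toPreDGModule N.toPreDGModule n f := hf.map_gr

/-- Expressing the sign (-1)^{n|a|} by a power of the parity operator makes the rule linear in a,
hence valid for inhomogeneous a. -/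
theorem IsHom.map_la_parPow (hR : R.IsAugDGRing) {n : ℤ} {f : KHom M.toKBimod N.toKBimod}
    (hf : IsHom (M := M) (N := N) n f) (a : R.carrier) (m : M.carrier) :
    f (M.la a m) = N.la (R.parPow n a) (f m) := by
  induction a using hR.isGraded.induction with
  | h0 => rw [la_zero_left, map_zero, map_zero, la_zero_left]
  | hg i a ha => rw [hf.map_la i a ha, parPow_of_mem hR.isGraded n ha, la_zsmul_left]
  | ha a b ha hb => rw [la_add_left, map_add, map_add, la_add_left, ha, hb]

theorem isHom_of_parPow (hR : R.IsAugDGRing) {n : ℤ} {f : KHom M.toKBimod N.toKBimod}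
    (h1 : HasDeg M.toPreDGModule N.toPreDGModule n f)
    (h2 : ∀ a m, f (M.la a m) = N.la (R.parPow n a) (f m))
    (h3 : ∀ m b, f (M.ra m b) = N.ra (f m) b) : IsHom (M := M) (N := N) n f where
  map_gr := h1
  map_la i a ha m := by rw [h2, parPow_of_mem hR.isGraded n ha, la_zsmul_left]
  map_ra := h3

theorem isHom_zero (n : ℤ) : IsHom (M := M) (N := N) n 0 where
  map_gr _ _ _ := zero_mem _
  map_la i a _ m := by
    change (0 : N.carrier) = _ • N.la a 0
    rw [la_zero_right, smul_zero]
  map_ra m b := (ra_zero_left (M := N) b).symm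

theorem IsHom.add {n : ℤ} {f g : KHom M.toKBimod N.toKBimod}
    (hf : IsHom (M := M) (N := N) n f) (hg : IsHom (M := M) (N := N) n g) :
    IsHom (M := M) (N := N) n (f + g) where
  map_gr := hf.hasDeg.add hg.hasDeg
  map_la i a ha m := by
    rw [KHom.add_apply, KHom.add_apply, hf.map_la i a ha, hg.map_la i a ha, la_add_right, smul_add]
  map_ra m b := by
    rw [KHom.add_apply, KHom.add_apply, hf.map_ra, hg.map_ra, ra_add_left]

theorem IsHom.neg {n : ℤ} {f : KHom M.toKBimod N.toKBimod}
    (hf : IsHom (M := M) (N := N) n f) : IsHom (M := M) (N := N) n (-f) where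
  map_gr := hf.hasDeg.neg
  map_la i a ha m := by
    rw [KHom.neg_apply, KHom.neg_apply, hf.map_la i a ha, la_neg_right, smul_neg]
  map_ra m b := by
    rw [KHom.neg_apply, KHom.neg_apply, hf.map_ra, ra_neg_left]

theorem IsHom.sub {n : ℤ} {f g : KHom M.toKBimod N.toKBimod}
    (hf : IsHom (M := M) (N := N) n f) (hg : IsHom (M := M) (N := N) n g) :
    IsHom (M := M) (N := N) n (f - g) := hf.add hg.neg

theorem IsHom.comp {n : ℤ} {f : KHom M.toKBimod N.toKBimod} {g : KHom N.toKBimod X.toKBimod}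
    (hg : IsHom (M := N) (N := X) 0 g) (hf : IsHom (M := M) (N := N) n f) :
    IsHom (M := M) (N := X) n (g.comp f) where
  map_gr := (hg.hasDeg.comp hf.hasDeg).congr (add_zero n)
  map_la i a ha m := by
    rw [KHom.comp_apply, hf.map_la i a ha, map_zsmul, hg.map_la i a ha, zero_mul,
      Int.negOnePow_zero, Units.val_one, one_smul]
    rfl
  map_ra m b := by
    rw [KHom.comp_apply, hf.map_ra, hg.map_ra]
    rfl

/-- The differential of a homogeneous map, as a morphism. -/
def homDiff (n : ℤ) (f : KHom M.toKBimod N.toKBimod) : KHom M.toKBimod N.toKBimod where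
  toLin := N.d.toLin ∘ₗ f.toLin - (n.negOnePow : ℤ) • (f.toLin ∘ₗ M.d.toLin)
  map_l a m := by
    simp only [LinearMap.sub_apply, LinearMap.comp_apply, LinearMap.smul_apply, KHom.map_l,
      map_sub, map_zsmul]
  map_r a m := by
    simp only [LinearMap.sub_apply, LinearMap.comp_apply, LinearMap.smul_apply, KHom.map_r,
      map_sub, map_zsmul]

theorem homDiff_apply (n : ℤ) (f : KHom M.toKBimod N.toKBimod) (m : M.carrier) :
    homDiff (M := M) (N := N) n f m = N.d (f m) - (n.negOnePow : ℤ) • f (M.d m) := rfl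

/-- The sign in d ∘ f - (-1)^{n+1} f ∘ d is the one for which the terms containing the differential
of a scalar cancel, on either side. -/
theorem IsHom.homDiff (hR : R.IsAugDGRing) (hM : M.IsDGBimodule) (hN : N.IsDGBimodule) {n : ℤ}
    {f : KHom M.toKBimod N.toKBimod} (hf : IsHom (M := M) (N := N) (n + 1) f) :
    IsHom (M := M) (N := N) n (homDiff (M := M) (N := N) (n + 1) f) := by
  have hpar : ∀ m, f (M.par m) = ((n + 1).negOnePow : ℤ) • N.par (f m) :=
    hM.toIsDG.isGraded.hasDeg_par_comm hN.toIsDG.isGraded hf.hasDeg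
  refine isHom_of_parPow hR (fun i m hm => ?_) (fun a m => ?_) (fun m b => ?_)
  · rw [homDiff_apply]
    refine sub_mem ?_ (zsmul_mem ?_ _)
    · have := hN.d_mem _ _ (hf.map_gr i m hm)
      rwa [show i + (n + 1) - 1 = i + n by ring] at this
    · have := hf.map_gr _ _ (hM.d_mem _ _ hm)
      rwa [show i - 1 + (n + 1) = i + n by ring] at this
  · rw [homDiff_apply, homDiff_apply, hf.map_la_parPow hR, hN.d_la, hM.d_la, map_add,
      hf.map_la_parPow hR, hf.map_la_parPow hR, d_parPow hR.toIsDG, la_zsmul_left, smul_add,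
      la_sub_right, la_zsmul_right]
    have h1 : R.par (R.parPow (n + 1) a) = R.parPow n a := by
      rw [parPow_add_one hR.isGraded, hR.par_par]
    have h2 : R.parPow (n + 1) (R.par a) = R.parPow n a := by
      rw [parPow_add_one hR.isGraded, ← parPow_add_one hR.isGraded, parPow_add_one hR.isGraded,
        parPow]
      split_ifs
      · exact hR.par_par a
      · rw [hR.par_par]
    rw [h1, h2]
    abel
  · rw [homDiff_apply, homDiff_apply, hf.map_ra, hN.d_ra, hM.d_ra, map_add, hf.map_ra, hf.map_ra,
      hpar, sub_eq_add_neg, sub_eq_add_neg, ra_add_left, ra_neg_left, ra_zsmul_left, smul_add,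
      ra_zsmul_left, negOnePow_smul_smul]
    abel

theorem homDiff_homDiff (hM : M.IsDG) (hN : N.IsDG) (n : ℤ)
    (f : KHom M.toKBimod N.toKBimod) (m : M.carrier) :
    homDiff (M := M) (N := N) n (homDiff (M := M) (N := N) (n + 1) f) m = 0 := by
  rw [homDiff_apply, homDiff_apply, homDiff_apply, map_sub, hN.d_d, hM.d_d, map_zero, smul_zero,
    map_zsmul, zero_sub, sub_zero, Int.negOnePow_succ]
  simp

end PreDGBimodule

/-! ### Extension of maps from C, conilpotent filtrations, semi-projectivity -/

namespace PreDGRing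

open PreDGBimodule

variable {R : PreDGRing.{u} k t} {C : PreDGCoring.{u} k t} {α : KHom C.toKBimod R.toKBimod}
  {X : PreDGBimodule.{u, w} R} {Y : PreDGBimodule.{u, w} R}

theorem IsAugDGRing.parPow_m (hR : R.IsAugDGRing) (n : ℤ) (a b : R.carrier) :
    R.parPow n (R.m a b) = R.m (R.parPow n a) (R.parPow n b) := by
  rw [parPow]
  split_ifs
  · rfl
  · exact hR.par_m a b

variable (α) in
/-- The homogeneous bimodule morphism of degree `n` that extends a map on `C`. -/
noncomputable def twistedExt (n : ℤ) (η : KHom C.toKBimod X.toKBimod) :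
    KHom (twisted R C α).toKBimod X.toKBimod :=
  X.ract.comp (map (X.lact.comp (map (R.parPow n) η)) (KHom.id _))

theorem twistedExt_tw (n : ℤ) (η : KHom C.toKBimod X.toKBimod) (a c b) :
    twistedExt α n η (tw α a c b) = X.ra (X.la (R.parPow n a) (η c)) b := rfl

theorem twistedExt_tw1 (hR : R.IsAugDGRing) (hX : X.IsDGBimodule) (n : ℤ)
    (η : KHom C.toKBimod X.toKBimod) (c : C.carrier) : twistedExt α n η (tw1 α c) = η c := by
  rw [tw1_apply, twistedExt_tw, parPow_of_mem hR.isGraded n (hR.one_mem _), mul_zero,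
    Int.negOnePow_zero, Units.val_one, one_smul, hX.ra_one, hX.one_la, l_one, r_one]

theorem twistedExt_isHom (hR : R.IsAugDGRing) (hX : X.IsDGBimodule) {n : ℤ}
    {η : KHom C.toKBimod X.toKBimod} (hη : HasDeg C.toPreDGModule X.toPreDGModule n η) :
    IsHom (M := twisted R C α) (N := X) n (twistedExt α n η) := by
  refine isHom_of_parPow hR (twisted_hasDeg fun i j l a ha c hc b hb => ?_) (fun x m => ?_)
    (fun m y => ?_)
  · have := hX.ra_mem _ _ _ (hX.la_mem _ _ _ (parPow_mem hR.isGraded n ha) _ (hη j c hc)) _ hb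
    rwa [show i + (j + n) + l = i + j + l + n by ring] at this
  · induction m using twisted_induction with
    | h a c b =>
      rw [la_tw, twistedExt_tw, twistedExt_tw, hR.parPow_m, ← hX.la_la, hX.la_ra]
    | ha p q hp hq => rw [la_add_right, map_add, hp, hq, map_add, la_add_right]
  · induction m using twisted_induction with
    | h a c b => rw [ra_tw, twistedExt_tw, twistedExt_tw, hX.ra_ra]
    | ha p q hp hq => rw [ra_add_left, map_add, hp, hq, map_add, ra_add_left]

theorem isHom_apply_tw (hR : R.IsAugDGRing) {n : ℤ} {f : KHom (twisted R C α).toKBimod X.toKBimod}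
    (hf : IsHom (M := twisted R C α) (N := X) n f) (a c b) :
    f (tw α a c b) = X.la (R.parPow n a) (X.ra (f (tw1 α c)) b) := by
  rw [tw_eq hR, hf.map_la_parPow hR, hf.map_ra]

/-- The elements 1 ⊗ c ⊗ 1 generate the bimodule. With `twistedExt_isHom`, morphisms of degree n out
of R ⊗_α C ⊗_α R correspond to maps of degree n out of C. -/
theorem isHom_ext (hR : R.IsAugDGRing) {n : ℤ} {f g : KHom (twisted R C α).toKBimod X.toKBimod}
    (hf : IsHom (M := twisted R C α) (N := X) n f) (hg : IsHom (M := twisted R C α) (N := X) n g)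
    (h : ∀ c, f (tw1 α c) = g (tw1 α c)) (p : (twisted R C α).carrier) : f p = g p := by
  induction p using twisted_induction with
  | h a c b => rw [isHom_apply_tw hR hf, isHom_apply_tw hR hg, h]
  | ha p q hp hq => rw [map_add, map_add, hp, hq]

/-- An exhaustive filtration of a coring that is lowered by `(α ⊗ id) Δ` and `(id ⊗ α) Δ`. -/
structure ConilpotentFiltration (α : KHom C.toKBimod R.toKBimod) where
  F : ℕ → Submodule k C.carrier
  zero : F 0 = ⊥
  mono : Monotone F
  exhaustive : ∀ c, ∃ n, c ∈ F n
  left : ∀ n, ∀ c ∈ F (n + 1), map α (KHom.id _) (C.comul c) ∈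
    Submodule.span k {q | ∃ a, ∃ c' ∈ F n, q = (tm a c' : (KBimod.tensor _ _).carrier)}
  right : ∀ n, ∀ c ∈ F (n + 1), map (KHom.id _) α (C.comul c) ∈
    Submodule.span k {q | ∃ c' ∈ F n, ∃ a, q = (tm c' a : (KBimod.tensor _ _).carrier)}

namespace ConilpotentFiltration

/-- If `f` vanishes on a step of the filtration, then on the next step `f ∘ d` only sees the
differential of `C`. -/
theorem apply_d_tw1 (𝓕 : ConilpotentFiltration α) (hR : R.IsAugDGRing) (hC : C.IsCoaugDGCoring)
    (hX : X.IsDGBimodule) {n : ℤ}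
    {f : KHom (twisted R C α).toKBimod X.toKBimod}
    (hf : IsHom (M := twisted R C α) (N := X) n f) {i : ℕ}
    (h0 : ∀ c ∈ 𝓕.F i, f (tw1 α c) = 0) {c : C.carrier} (hc : c ∈ 𝓕.F (i + 1)) :
    f ((twisted R C α).d (tw1 α c)) = f (tw1 α (C.d c)) := by
  have hpar : ∀ c, f (tw1 α (C.par c)) = (n.negOnePow : ℤ) • X.par (f (tw1 α c)) := fun c => by
    rw [← par_tw1 hR]
    exact (twisted_isGraded hR hC).hasDeg_par_comm hX.toIsDG.isGraded hf.hasDeg _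
  have hr : ∀ q, f (twR1 α q) = X.ract (map ((f.comp (tw1 α)).comp C.par) (KHom.id _)
      (map (KHom.id _) α q)) := fun q => by
    refine linear_ext (f := f.toLin ∘ₗ twR1 α) (g := X.ract.toLin ∘ₗ
      (map ((f.comp (tw1 α)).comp C.par) (KHom.id _)).toLin ∘ₗ (map (KHom.id _) α).toLin)
      (fun x y => ?_) q
    change f (twR1 α (tm x y)) = X.ra (f (tw1 α (C.par x))) (α y)
    rw [twR1_tm hR, hf.map_ra]
  have hl : ∀ q, f (twL1 α q) = X.lact (map (R.parPow n) (f.comp (tw1 α))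
      (map α (KHom.id _) q)) := fun q => by
    refine linear_ext (f := f.toLin ∘ₗ twL1 α) (g := X.lact.toLin ∘ₗ
      (map (R.parPow n) (f.comp (tw1 α))).toLin ∘ₗ (map α (KHom.id _)).toLin)
      (fun x y => ?_) q
    change f (twL1 α (tm x y)) = X.la (R.parPow n (α x)) (f (tw1 α y))
    rw [twL1_tm hR, hf.map_la_parPow hR]
  -- The twisting term lies in F_i ⊗ R with the parity operator applied to the first factor. F_i
  -- need not be stable under that operator: by `hpar` it can be moved outside f.
  have hr0 : f (twR1 α (C.comul c)) = 0 := by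
    rw [hr]
    refine Submodule.span_induction (p := fun q _ => X.ract
      (map ((f.comp (tw1 α)).comp C.par) (KHom.id _) q) = 0) ?_ ?_ ?_ ?_ (𝓕.right i c hc)
    · rintro _ ⟨c', hc', a, rfl⟩
      change X.ra (f (tw1 α (C.par c'))) a = 0
      rw [hpar, h0 c' hc', map_zero, smul_zero, ra_zero_left]
    · rw [map_zero, map_zero]
    · intro p q _ _ hp hq
      rw [map_add, map_add, hp, hq, add_zero]
    · intro s p _ hp
      rw [map_smul, map_smul, hp, smul_zero]
  have hl0 : f (twL1 α (C.comul c)) = 0 := by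
    rw [hl]
    refine Submodule.span_induction (p := fun q _ => X.lact
      (map (R.parPow n) (f.comp (tw1 α)) q) = 0) ?_ ?_ ?_ ?_ (𝓕.left i c hc)
    · rintro _ ⟨a, c', hc', rfl⟩
      change X.la (R.parPow n a) (f (tw1 α c')) = 0
      rw [h0 c' hc', la_zero_right]
    · rw [map_zero, map_zero]
    · intro p q _ _ hp hq
      rw [map_add, map_add, hp, hq, add_zero]
    · intro s p _ hp
      rw [map_smul, map_smul, hp, smul_zero]
  rw [d_tw1 hR, map_sub, map_add, hr0, hl0, add_zero, sub_zero]

/-- A closed morphism with values in the kernel of a surjective quasi-isomorphism is a boundary. -/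
theorem exists_homDiff_eq (𝓕 : ConilpotentFiltration α) (hR : R.IsAugDGRing)
    (hC : C.IsCoaugDGCoring) (hα : R.IsTwisting C α)
    (hX : X.IsDGBimodule) {q : KHom X.toKBimod Y.toKBimod} (hq : IsDGHom (M := X) (N := Y) q)
    {s : KHom X.toKBimod X.toKBimod} (hs : HasDeg X.toPreDGModule X.toPreDGModule 1 s)
    (hqs : ∀ m, q (s m) = 0) (hds : ∀ m, q m = 0 → X.d (s m) + s (X.d m) = m) {n : ℤ}
    {f : KHom (twisted R C α).toKBimod X.toKBimod}
    (hf : IsHom (M := twisted R C α) (N := X) n f)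
    (hfd : ∀ m, homDiff (M := twisted R C α) (N := X) n f m = 0) (hqf : ∀ m, q (f m) = 0) :
    ∃ h : KHom (twisted R C α).toKBimod X.toKBimod,
      IsHom (M := twisted R C α) (N := X) (n + 1) h ∧ (∀ m, q (h m) = 0) ∧
      ∀ m, homDiff (M := twisted R C α) (N := X) (n + 1) h m = f m := by
  have hP := twisted_isDGBimodule hR hC hα
  let D : KHom (twisted R C α).toKBimod X.toKBimod → KHom (twisted R C α).toKBimod X.toKBimod :=
    homDiff (M := twisted R C α) (N := X) (n + 1)
  let E : KHom (twisted R C α).toKBimod X.toKBimod → KHom C.toKBimod X.toKBimod :=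
    fun f => s.comp (f.comp (tw1 α))
  let S : KHom (twisted R C α).toKBimod X.toKBimod → KHom (twisted R C α).toKBimod X.toKBimod :=
    fun f => twistedExt α (n + 1) (E f)
  -- Successive remainders: T_0 = f, and passing from T_m to T_{m+1} = T_m - D(S T_m) gains one step
  -- of the filtration.
  let T : ℕ → KHom (twisted R C α).toKBimod X.toKBimod :=
    fun m => Nat.rec f (fun _ g => g - D (S g)) m
  have hT1 : ∀ m, T (m + 1) = T m - D (S (T m)) := fun _ => rfl
  have hE : ∀ g, IsHom (M := twisted R C α) (N := X) n g →
      HasDeg C.toPreDGModule X.toPreDGModule (n + 1) (E g) := fun g hg =>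
    (hs.comp (hg.hasDeg.comp (tw1_hasDeg hR))).congr (by ring)
  have hS : ∀ g, IsHom (M := twisted R C α) (N := X) n g →
      IsHom (M := twisted R C α) (N := X) (n + 1) (S g) := fun g hg =>
    twistedExt_isHom hR hX (hE g hg)
  have hS1 : ∀ g c, S g (tw1 α c) = s (g (tw1 α c)) := fun g c => twistedExt_tw1 hR hX _ _ c
  -- The kernel of q is a sub-bimodule, so it is enough to look at generators.
  have hqext : ∀ h : KHom (twisted R C α).toKBimod X.toKBimod,
      IsHom (M := twisted R C α) (N := X) (n + 1) h → (∀ c, q (h (tw1 α c)) = 0) →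
      ∀ m, q (h m) = 0 := fun h hh h0 m => by
    have := isHom_ext (X := Y) hR (hq.1.comp hh) (isHom_zero (n + 1)) (fun c => h0 c) m
    exact this
  have hT : ∀ m, IsHom (M := twisted R C α) (N := X) n (T m) ∧
      (∀ p, homDiff (M := twisted R C α) (N := X) n (T m) p = 0) ∧ (∀ p, q (T m p) = 0) ∧
      ∀ c ∈ 𝓕.F m, T m (tw1 α c) = 0 := fun m => by
    induction m with
    | zero =>
      refine ⟨hf, hfd, hqf, fun c hc => ?_⟩
      rw [𝓕.zero, Submodule.mem_bot] at hc
      rw [hc, map_zero, map_zero]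
    | succ m ih =>
      obtain ⟨h1, h2, h3, h4⟩ := ih
      refine ⟨h1.sub ((hS _ h1).homDiff hR hP hX), fun p => ?_, fun p => ?_, fun c hc => ?_⟩
      · have h5 := homDiff_homDiff hP.toIsDG hX.toIsDG n (S (T m)) p
        have h6 := h2 p
        rw [homDiff_apply] at h5 h6 ⊢
        rw [hT1, KHom.sub_apply, KHom.sub_apply, map_sub, smul_sub, sub_sub_sub_comm, h6]
        exact (zero_sub _).trans (neg_eq_zero.2 h5)
      · have h5 : ∀ m', q (S (T m) m') = 0 := hqext _ (hS _ h1) fun c => by rw [hS1, hqs]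
        have h6 : q (D (S (T m)) p) = 0 := by
          change q (homDiff (M := twisted R C α) (N := X) (n + 1) (S (T m)) p) = 0
          rw [homDiff_apply, map_sub, map_zsmul, hq.2, h5, h5, map_zero, smul_zero, sub_zero]
        rw [hT1, KHom.sub_apply, map_sub, h3, h6, sub_zero]
      -- Both T_m and S T_m vanish on F_m, so on F_{m+1} they see only d_C. As T_m is closed, D(S
      -- T_m) takes the value (ds + sd)(T_m c), and T_m c lies in ker q.
      · have h5 : D (S (T m)) (tw1 α c) = T m (tw1 α c) := by
          change homDiff (M := twisted R C α) (N := X) (n + 1) (S (T m)) (tw1 α c) = _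
          have h6 := h2 (tw1 α c)
          rw [homDiff_apply, 𝓕.apply_d_tw1 hR hC hX h1 h4 hc] at h6
          have h7 : T m (tw1 α (C.d c)) = (n.negOnePow : ℤ) • X.d (T m (tw1 α c)) := by
            rw [sub_eq_zero.1 h6, negOnePow_smul_smul]
          rw [homDiff_apply, 𝓕.apply_d_tw1 hR hC hX (hS _ h1)
            (fun c' hc' => by rw [hS1, h4 c' hc', map_zero]) hc, hS1, hS1, h7, map_zsmul,
            Int.negOnePow_succ, smul_smul]
          have h8 : (((-n.negOnePow : ℤˣ) : ℤ) * (n.negOnePow : ℤ)) = -1 := by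
            rw [← Units.val_mul, neg_mul, Int.units_mul_self]
            rfl
          rw [h8, neg_one_smul, sub_neg_eq_add]
          exact hds _ (h3 _)
        rw [hT1, KHom.sub_apply, h5, sub_self]
  have hTge : ∀ c N m, c ∈ 𝓕.F N → N ≤ m → T m (tw1 α c) = 0 := fun c N m hc hm =>
    (hT m).2.2.2 c (𝓕.mono hm hc)
  -- On an element of F_N only the first N remainders can be nonzero; hence the sum of all
  -- corrections makes sense.
  have hfin : ∀ c, (Function.support fun m => E (T m) c).Finite := fun c => by
    obtain ⟨N, hN⟩ := 𝓕.exhaustive c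
    refine (Set.finite_lt_nat N).subset fun m hm => ?_
    by_contra h
    refine hm ?_
    change s (T m (tw1 α c)) = 0
    rw [hTge c N m hN (not_lt.1 h), map_zero]
  let η : KHom C.toKBimod X.toKBimod := KHom.finsum (fun m => E (T m)) hfin
  have hη : HasDeg C.toPreDGModule X.toPreDGModule (n + 1) η := fun i c hc =>
    finsum_induction (fun x => x ∈ X.gr (i + (n + 1))) (zero_mem _)
      (fun x y hx hy => add_mem hx hy) (fun m => hE _ (hT m).1 i c hc)
  have hh := twistedExt_isHom (α := α) hR hX hη
  refine ⟨twistedExt α (n + 1) η, hh, hqext _ hh fun c => ?_, ?_⟩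
  · rw [twistedExt_tw1 hR hX]
    exact finsum_induction (fun x => q x = 0) (map_zero _)
      (fun x y hx hy => by rw [map_add, hx, hy, add_zero]) (fun m => hqs _)
  · refine isHom_ext hR (hh.homDiff hR hP hX) hf fun c => ?_
    obtain ⟨N, hN⟩ := 𝓕.exhaustive c
    -- Partial sums of the corrections; their boundaries telescope to f - T_m.
    let U : ℕ → KHom (twisted R C α).toKBimod X.toKBimod :=
      fun m => Nat.rec 0 (fun j g => g + S (T j)) m
    have hU1 : ∀ m, U (m + 1) = U m + S (T m) := fun _ => rfl
    have hU : ∀ m, IsHom (M := twisted R C α) (N := X) (n + 1) (U m) := fun m => by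
      induction m with
      | zero => exact isHom_zero _
      | succ m ih => exact ih.add (hS _ (hT m).1)
    have hDU : ∀ m p, D (U m) p = f p - T m p := fun m p => by
      induction m with
      | zero =>
        change X.d (0 : X.carrier) - ((n + 1).negOnePow : ℤ) • (0 : X.carrier) = f p - f p
        rw [map_zero, smul_zero, sub_zero, sub_self]
      | succ m ih =>
        have h1 : D (U (m + 1)) p = D (U m) p + D (S (T m)) p := by
          change homDiff (M := twisted R C α) (N := X) (n + 1) (U m + S (T m)) p =
            homDiff (M := twisted R C α) (N := X) (n + 1) (U m) p +
            homDiff (M := twisted R C α) (N := X) (n + 1) (S (T m)) p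
          rw [homDiff_apply, homDiff_apply, homDiff_apply, KHom.add_apply, KHom.add_apply,
            map_add, smul_add]
          abel
        rw [h1, ih, hT1, KHom.sub_apply]
        abel
    have hUη : ∀ M c, c ∈ 𝓕.F M → twistedExt α (n + 1) η (tw1 α c) = U M (tw1 α c) :=
      fun M c hc => by
      rw [twistedExt_tw1 hR hX]
      have h1 : ∀ m, U m (tw1 α c) = ∑ j ∈ Finset.range m, E (T j) c := fun m => by
        induction m with
        | zero => rfl
        | succ m ih => rw [hU1, KHom.add_apply, ih, Finset.sum_range_succ, hS1]; rfl
      rw [h1]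
      refine finsum_eq_sum_of_support_subset _ fun m hm => ?_
      rw [Finset.coe_range, Set.mem_Iio]
      by_contra h
      refine hm ?_
      change s (T m (tw1 α c)) = 0
      rw [hTge c M m hc (not_lt.1 h), map_zero]
    -- The differential d_C c may lie in a later step than c. The bound L serves for both, and the
    -- full sum agrees with its partial sum U_L on c and on d_C c.
    obtain ⟨N', hN'⟩ := 𝓕.exhaustive (C.d c)
    let L := max N N'
    have h2 := 𝓕.apply_d_tw1 hR hC hX (hh.sub (hU L)) (i := L) (fun c' hc' => by
      rw [KHom.sub_apply, hUη L c' hc', sub_self]) (c := c)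
      (𝓕.mono (Nat.le_succ_of_le (le_max_left _ _)) hN)
    have h3 := hDU L (tw1 α c)
    rw [hTge c N L hN (le_max_left _ _), sub_zero] at h3
    rw [← h3]
    change _ = homDiff (M := twisted R C α) (N := X) (n + 1) (U L) (tw1 α c)
    rw [KHom.sub_apply, KHom.sub_apply, hUη L (C.d c) (𝓕.mono (le_max_right _ _) hN'), sub_self,
      sub_eq_zero] at h2
    rw [homDiff_apply, homDiff_apply, h2, hUη L c (𝓕.mono (le_max_left _ _) hN)]

/-- Morphisms lift along maps with a graded section. -/
theorem exists_lift (hR : R.IsAugDGRing) (hX : X.IsDGBimodule) {q : KHom X.toKBimod Y.toKBimod}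
    (hq : IsHom (M := X) (N := Y) 0 q) {τ : KHom Y.toKBimod X.toKBimod}
    (hτ : HasDeg Y.toPreDGModule X.toPreDGModule 0 τ) (hqτ : ∀ m, q (τ m) = m)
    {n : ℤ} {f : KHom (twisted R C α).toKBimod Y.toKBimod}
    (hf : IsHom (M := twisted R C α) (N := Y) n f) :
    ∃ g : KHom (twisted R C α).toKBimod X.toKBimod, IsHom (M := twisted R C α) (N := X) n g ∧
      ∀ m, q (g m) = f m := by
  -- The values on 1 ⊗ c ⊗ 1 are lifted through τ; nothing is asked of the differentials.
  have hg := twistedExt_isHom (α := α) hR hX (n := n) (η := τ.comp (f.comp (tw1 α)))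
    ((hτ.comp (hf.hasDeg.comp (tw1_hasDeg hR))).congr (by ring))
  refine ⟨_, hg, fun m => isHom_ext (X := Y) hR (hq.comp hg) hf (fun c => ?_) m⟩
  rw [KHom.comp_apply, twistedExt_tw1 hR hX]
  exact hqτ _

/-- Closed morphisms lift strictly along surjective quasi-isomorphisms. -/
theorem exists_closed_lift (𝓕 : ConilpotentFiltration α) (hR : R.IsAugDGRing)
    (hC : C.IsCoaugDGCoring) (hα : R.IsTwisting C α) (hX : X.IsDGBimodule) (hY : Y.IsDGBimodule)
    {q : KHom X.toKBimod Y.toKBimod} (hq : IsDGHom (M := X) (N := Y) q)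
    (hsurj : Function.Surjective q) (hqis : IsQuasiIso (M := X) (N := Y) q) {n : ℤ}
    {f : KHom (twisted R C α).toKBimod Y.toKBimod}
    (hf : IsHom (M := twisted R C α) (N := Y) n f)
    (hfd : ∀ m, homDiff (M := twisted R C α) (N := Y) n f m = 0) :
    ∃ g : KHom (twisted R C α).toKBimod X.toKBimod, IsHom (M := twisted R C α) (N := X) n g ∧
      (∀ m, homDiff (M := twisted R C α) (N := X) n g m = 0) ∧ ∀ m, q (g m) = f m := by
  obtain ⟨τ, hτ, hqτ, s, hs, hqs, hds⟩ :=
    hqis.exists_contraction hX.toIsDG hY.toIsDG hq.1.hasDeg hq.2 hsurj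
  -- The lift g is not closed in general. Its boundary is closed with values in ker q, hence is the
  -- boundary of some h with values in ker q, and g - h is the closed lift.
  obtain ⟨g, hg, hqg⟩ := exists_lift hR hX hq.1 hτ hqτ hf
  -- The degree is written as a successor because a boundary of degree n comes from a morphism of
  -- degree n + 1.
  obtain ⟨n, rfl⟩ : ∃ m, n = m + 1 := ⟨n - 1, by ring⟩
  have hP := twisted_isDGBimodule hR hC hα
  obtain ⟨h, hh, hqh, hhd⟩ := 𝓕.exists_homDiff_eq hR hC hα hX hq hs hqs hds
    (hg.homDiff hR hP hX) (homDiff_homDiff hP.toIsDG hX.toIsDG n g) (fun m => by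
      have := hfd m
      rw [homDiff_apply] at this
      rw [homDiff_apply, map_sub, map_zsmul, hq.2, hqg, hqg, this])
  refine ⟨g - h, hg.sub hh, fun m => ?_, fun m => ?_⟩
  · have := hhd m
    rw [homDiff_apply, homDiff_apply] at this
    rw [homDiff_apply, KHom.sub_apply, KHom.sub_apply, map_sub, smul_sub, sub_sub_sub_comm, this,
      sub_self]
  · rw [KHom.sub_apply, map_sub, hqh, hqg, sub_zero]

/-- A closed morphism that becomes a boundary after a surjective quasi-isomorphism is a
boundary. -/
theorem exists_homDiff_eq_of_comp (𝓕 : ConilpotentFiltration α) (hR : R.IsAugDGRing)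
    (hC : C.IsCoaugDGCoring) (hα : R.IsTwisting C α) (hX : X.IsDGBimodule) (hY : Y.IsDGBimodule)
    {q : KHom X.toKBimod Y.toKBimod} (hq : IsDGHom (M := X) (N := Y) q)
    (hsurj : Function.Surjective q) (hqis : IsQuasiIso (M := X) (N := Y) q) {n : ℤ}
    {g : KHom (twisted R C α).toKBimod X.toKBimod}
    (hg : IsHom (M := twisted R C α) (N := X) n g)
    (hgd : ∀ m, homDiff (M := twisted R C α) (N := X) n g m = 0)
    {h : KHom (twisted R C α).toKBimod Y.toKBimod}
    (hh : IsHom (M := twisted R C α) (N := Y) (n + 1) h)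
    (hgh : ∀ m, q (g m) = homDiff (M := twisted R C α) (N := Y) (n + 1) h m) :
    ∃ h : KHom (twisted R C α).toKBimod X.toKBimod,
      IsHom (M := twisted R C α) (N := X) (n + 1) h ∧
      ∀ m, g m = homDiff (M := twisted R C α) (N := X) (n + 1) h m := by
  obtain ⟨τ, hτ, hqτ, s, hs, hqs, hds⟩ :=
    hqis.exists_contraction hX.toIsDG hY.toIsDG hq.1.hasDeg hq.2 hsurj
  -- After lifting the homotopy to h₁, the morphism g - D h₁ is closed with values in ker q, and so
  -- is D h₂ for some h₂.
  obtain ⟨h₁, hh₁, hqh₁⟩ := exists_lift hR hX hq.1 hτ hqτ hh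
  have hP := twisted_isDGBimodule hR hC hα
  obtain ⟨h₂, hh₂, -, hd₂⟩ := 𝓕.exists_homDiff_eq hR hC hα hX hq hs hqs hds
    (hg.sub (hh₁.homDiff hR hP hX)) (fun m => by
      have h1 := hgd m
      have h2 := homDiff_homDiff hP.toIsDG hX.toIsDG n h₁ m
      rw [homDiff_apply] at h1 h2
      rw [homDiff_apply, KHom.sub_apply, KHom.sub_apply, map_sub, smul_sub, sub_sub_sub_comm, h1,
        h2, sub_self]) (fun m => by
      rw [KHom.sub_apply, map_sub, hgh, homDiff_apply, homDiff_apply, map_sub, map_zsmul, hq.2,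
        hqh₁, hqh₁, sub_self])
  refine ⟨h₁ + h₂, hh₁.add hh₂, fun m => ?_⟩
  have h3 := hd₂ m
  rw [KHom.sub_apply, homDiff_apply, homDiff_apply] at h3
  rw [homDiff_apply, KHom.add_apply, KHom.add_apply, map_add, smul_add, add_sub_add_comm, h3]
  abel

/-- Surjectivity on morphisms needs only a graded section. In homology, strict lifting of closed
morphisms gives surjectivity, with zero homotopy, and reflection of boundaries gives injectivity. -/
theorem isSemiProjective (𝓕 : ConilpotentFiltration α) (hR : R.IsAugDGRing)
    (hC : C.IsCoaugDGCoring) (hα : R.IsTwisting C α) :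
    IsSemiProjective.{u, w} (twisted R C α) := by
  refine ⟨twisted_isDGBimodule hR hC hα, fun X Y hX hY q hq hs hqis n => ⟨?_, ?_, ?_⟩⟩
  · intro f hf
    obtain ⟨τ, hτ, hqτ, -⟩ :=
      hqis.exists_contraction hX.toIsDG hY.toIsDG hq.1.hasDeg hq.2 hs
    exact exists_lift hR hX hq.1 hτ hqτ hf
  · intro f hf hfd
    obtain ⟨g, hg, hgd, hqg⟩ := 𝓕.exists_closed_lift hR hC hα hX hY hq hs hqis hf hfd
    refine ⟨g, hg, hgd, 0, isHom_zero _, fun m => ?_⟩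
    rw [hqg, sub_self]
    change 0 = Y.d (0 : Y.carrier) - ((n + 1).negOnePow : ℤ) • (0 : Y.carrier)
    rw [map_zero, smul_zero, sub_zero]
  · rintro g hg hgd ⟨h, hh, hgh⟩
    exact 𝓕.exists_homDiff_eq_of_comp hR hC hα hX hY hq hs hqis hg hgd hh hgh

end ConilpotentFiltration

end PreDGRing

end

/-! ### The two-sided bar resolution is a resolution -/

section

open KBimod PreDGModule

variable {k : Type u} [Field k] {t : ℕ}

namespace PreDGBimodule

variable {R : PreDGRing.{u} k t} {M : PreDGBimodule.{u, v} R} {N : PreDGBimodule.{u, w} R}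

/-- A morphism of complexes with a section that is inverse to it up to a homotopy is a
quasi-isomorphism. -/
theorem isQuasiIso_of_homotopy {p : KHom M.toKBimod N.toKBimod}
    (σ : N.carrier →ₗ[k] M.carrier) (hσ : ∀ i, ∀ n ∈ N.gr i, σ n ∈ M.gr i)
    (hσd : ∀ n, M.d (σ n) = σ (N.d n)) (hpσ : ∀ n, p (σ n) = n)
    (h : M.carrier →ₗ[k] M.carrier) (hh : ∀ i, ∀ m ∈ M.gr i, h m ∈ M.gr (i + 1))
    (hd : ∀ m, M.d (h m) + h (M.d m) = m - σ (p m)) : IsQuasiIso (M := M) (N := N) p := by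
  refine ⟨fun i n hn hdn => ⟨σ n, hσ i n hn, ?_, 0, zero_mem _, ?_⟩, fun i m hm hdm => ?_⟩
  · rw [hσd, hdn, map_zero]
  · rw [hpσ, sub_self, map_zero]
  · rintro ⟨b, hb, hpb⟩
    -- For a cycle m the homotopy reads m = d(h m) + σ(p m), and σ(p m) = σ(d b) = d(σ b).
    refine ⟨h m + σ b, add_mem (hh i m hm) (hσ _ b hb), ?_⟩
    have := hd m
    rw [hdm, map_zero, add_zero, hpb, ← hσd] at this
    rw [map_add, this, sub_add_cancel]

end PreDGBimodule

namespace PreDGRing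

section twisted

variable {R : PreDGRing.{u} k t} {C : PreDGCoring.{u} k t} {α : KHom C.toKBimod R.toKBimod}

/-- α vanishes on the coaugmentation, so a ⊗ 1 ⊗ b has no twisting terms. This makes the sections b
↦ 1 ⊗ 1 ⊗ b and a ↦ a ⊗ 1 ⊗ 1 chain maps. -/
theorem d_tw_coaug (hC : C.IsCoaugDGCoring) (hα : R.IsTwisting C α)
    (a b : R.carrier) : (twisted R C α).d (tw α a (C.coaug (1 : Fin t → k)) b) =
      tw α (R.d a) (C.coaug (1 : Fin t → k)) b +
        tw α (R.par a) (C.coaug (1 : Fin t → k)) (R.d b) := by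
  rw [d_tw, hC.d_coaug, hC.comul_coaug, twR_tm, twL_tm, hα.coaug, hC.par_coaug, m_zero_left,
    m_zero_right, tw_zero_right, tw_zero_left, tw_zero_mid, sub_zero, add_zero, add_zero]

end twisted

variable {R : PreDGRing.{u} k t}

variable (R) in
/-- The projection `a ↦ [a - ε(a)]`. -/
def barProj : KHom R.toKBimod R.red.susp.toKBimod := kerProj R.aug R.one R.aug_one

theorem barIncl_barProj (a : R.carrier) : R.barIncl (R.barProj a) = a - R.one (R.aug a) := rfl

theorem aug_par (hR : R.IsAugDGRing) (a : R.carrier) : R.aug (R.par a) = R.aug a := by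
  have h : HasDeg R.toPreDGModule (PreDGModule.unit k t) 0 R.aug := fun i a ha => by
    refine mem_unit_gr.2 ?_
    by_cases hi : i = 0
    · exact Or.inl (by rw [hi, add_zero])
    · exact Or.inr (hR.aug_gr i hi a ha)
  exact hR.isGraded.par_comm_zero unit_isGraded h a

theorem barProj_par (hR : R.IsAugDGRing) (a : R.carrier) :
    R.red.susp.par (R.barProj a) = -R.barProj (R.par a) := by
  refine barIncl_injective ?_
  rw [hR.barIncl_par, barIncl_barProj, map_neg, barIncl_barProj, map_sub, hR.par_one, aug_par hR]

theorem barProj_d (hR : R.IsAugDGRing) (a : R.carrier) :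
    R.red.susp.d (R.barProj a) = -R.barProj (R.d a) := by
  refine barIncl_injective ?_
  rw [hR.barIncl_d, barIncl_barProj, map_neg, barIncl_barProj, map_sub, hR.d_one, hR.aug_d,
    map_zero]

theorem barProj_hasDeg (hR : R.IsAugDGRing) : HasDeg R.toPreDGModule R.red.susp 1 R.barProj :=
  fun i a ha => by
  change R.barIncl (R.barProj a) ∈ R.gr (i + 1 - 1)
  rw [barIncl_barProj, add_sub_cancel_right]
  by_cases h : i = 0
  · subst h
    exact sub_mem ha (hR.one_mem _)
  · rw [hR.aug_gr i h a ha, map_zero, sub_zero]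
    exact ha

/-- Split a into a - ε(a) and ε(a): the first part gives the bar product, and the second only
rescales v. -/
theorem barProj_m_barIncl (hR : R.IsAugDGRing) (a : R.carrier) (v : R.red.susp.carrier) :
    R.barProj (R.m (R.par a) (R.barIncl v)) =
      R.barProd (tm (R.barProj a) v) + R.red.susp.l (R.aug a) v := by
  refine barIncl_injective ?_
  rw [map_add, hR.barIncl_barProd, barIncl_barProj, barIncl_barProj, hR.aug_mul, aug_barIncl,
    R.barIncl.map_l, map_sub, hR.par_one, m_sub_left, hR.one_mul, sub_add_cancel]
  refine (congrArg (_ - R.one ·) (mul_zero _)).trans ?_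
  rw [map_zero, sub_zero]

variable (R) in
/-- The contracting homotopy `a ⊗ x ⊗ b ↦ 1 ⊗ [a | x] ⊗ b` of the two-sided bar resolution. -/
def barHomotopy :
    KHom (twisted R R.bar R.piBar).toKBimod (twisted R R.bar R.piBar).toKBimod :=
  map ((map R.one (KHom.id _)).comp ((leftUnitInv R.bar.toKBimod).comp
    ((tensCons R.red.susp.toKBimod).comp (map R.barProj (KHom.id _))))) (KHom.id _)

theorem barHomotopy_tw (a : R.carrier) (x : R.bar.carrier) (b : R.carrier) :
    R.barHomotopy (tw R.piBar a x b) =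
      tw R.piBar (R.one (1 : Fin t → k)) (R.barCons (R.barProj a) x) b := rfl

theorem barCons_neg_left (v : R.red.susp.carrier) (u : R.bar.carrier) :
    R.barCons (-v) u = -R.barCons v u :=
  (congrArg (tensCons R.red.susp.toKBimod).toLin (tm_neg_left _ _)).trans (map_neg _ _)

theorem barCons_l (y : Fin t → k) (v : R.red.susp.carrier) (u : R.bar.carrier) :
    R.barCons (R.red.susp.l y v) u = R.bar.l y (R.barCons v u) :=
  (tensCons R.red.susp.toKBimod).map_l y (tm v u)

/-- The right twisting term acts at the far end of the word and does not meet the letter added by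
the homotopy; exchanging the two costs the sign of the suspension. -/
theorem barHomotopy_twR (hR : R.IsAugDGRing) (a b : R.carrier) (q) :
    R.barHomotopy (twR R.piBar (R.par a) b q) +
      twR R.piBar (R.one (1 : Fin t → k)) b (R.barConsLeft _ (tm (R.barProj a) q)) = 0 := by
  refine linear_ext (f := R.barHomotopy.toLin ∘ₗ twR R.piBar (R.par a) b +
    twR R.piBar (R.one (1 : Fin t → k)) b ∘ₗ (R.barConsLeft _).toLin ∘ₗ tmLin _ _ (R.barProj a))
    (g := 0) (fun x y => ?_) q
  change R.barHomotopy (tw R.piBar (R.par a) (R.bar.par x) (R.m (R.piBar y) b)) +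
    tw R.piBar (R.one (1 : Fin t → k)) (R.bar.par (R.barCons (R.barProj a) x))
      (R.m (R.piBar y) b) = 0
  rw [barHomotopy_tw, bar_par_barCons, barProj_par hR, barCons_neg_left, tw_neg_mid,
    add_neg_cancel]

theorem twL_barConsLeft (a b : R.carrier) (v : R.red.susp.carrier) (q) :
    twL R.piBar a b (R.barConsLeft _ (tm v q)) = tw R.piBar (R.m a (R.barIncl v))
      (leftUnit _ (map R.bar.counit (KHom.id _) q)) b := by
  induction q using tensor_induction with
  | h0 => rw [tm_zero_right, map_zero, map_zero, map_zero, map_zero, tw_zero_mid]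
  | ht x y =>
    rw [barConsLeft_tm, twL_tm, piBar_barCons, map_tm, leftUnit_tm, ← tw_balance_left, r_m]
    rfl
  | ha q q' hq hq' =>
    rw [tm_add_right, map_add, map_add, hq, hq', map_add, map_add, tw_add_mid]

/-- The left twisting term multiplies a by the first letter of x. After the homotopy this is the
merging of [a] with that letter, with an error because a need not lie in Ā. The part of x of length
0 has no first letter and must be removed from the error term. -/
theorem barHomotopy_twL (hR : R.IsAugDGRing) (a b : R.carrier) (x : R.bar.carrier) :
    R.barHomotopy (twL R.piBar (R.par a) b (R.bar.comul x)) =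
      tw R.piBar (R.one (1 : Fin t → k)) (R.barMerge (tm (R.barProj a) x) +
        R.bar.l (R.aug a) (x - R.bar.coaug (R.bar.counit x))) b := by
  induction x using bar_induction with
  | h1 y =>
    rw [bar_comul_coaug, twL_tm, piBar_coaug, m_zero_right, tw_zero_left, map_zero,
      barMerge_coaug, bar_counit_coaug, sub_self, map_zero, add_zero, tw_zero_mid]
  | hc v u _ =>
    rw [bar_comul_barCons, map_add, twL_tm, piBar_coaug, m_zero_right, tw_zero_left, zero_add,
      twL_barConsLeft, hR.bar_isCoaugDGCoring.counit_left, barHomotopy_tw, barProj_m_barIncl hR,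
      bar_counit_barCons, map_zero, sub_zero, barMerge_barCons, barCons_add_left, barCons_l]
  | ha x x' hx hx' =>
    rw [map_add, map_add, map_add, hx, hx', ← tw_add_mid, tm_add_right, map_add, map_add, map_add,
      add_sub_add_comm, map_add]
    congr 1
    abel

/-- Two terms of dh have no partner in hd. The left twisting term takes the new letter a off again
and returns -a ⊗ x ⊗ b; the right twisting term takes it off on the other side when x has length 0,
which produces the canonical map. Corrections by ε(a) cancel. -/
theorem barHomotopy_spec (hR : R.IsAugDGRing) (m : (twisted R R.bar R.piBar).carrier) :
    (twisted R R.bar R.piBar).d (R.barHomotopy m) +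
      R.barHomotopy ((twisted R R.bar R.piBar).d m) =
      tw R.piBar (R.one (1 : Fin t → k)) (R.bar.coaug (1 : Fin t → k))
        (twistedAug R R.bar R.piBar m) - m := by
  have hB := hR.bar_isCoaugDGCoring
  refine twisted_linear_ext (α := R.piBar)
    (f := (twisted R R.bar R.piBar).d.toLin ∘ₗ R.barHomotopy.toLin +
      R.barHomotopy.toLin ∘ₗ (twisted R R.bar R.piBar).d.toLin)
    (g := (tmLin (KBimod.tensor R.toKBimod R.bar.toKBimod) R.toKBimod
      (tm (R.one (1 : Fin t → k)) (R.bar.coaug (1 : Fin t → k))) ∘ₗ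
        (twistedAug R R.bar R.piBar).toLin - LinearMap.id : _ →ₗ[k]
          (twisted R R.bar R.piBar).carrier)) (fun a x b => ?_) m
  change (twisted R R.bar R.piBar).d (R.barHomotopy (tw R.piBar a x b)) +
    R.barHomotopy ((twisted R R.bar R.piBar).d (tw R.piBar a x b)) =
    tw R.piBar (R.one (1 : Fin t → k)) (R.bar.coaug (1 : Fin t → k))
      (twistedAug R R.bar R.piBar (tw R.piBar a x b)) - tw R.piBar a x b
  have h1 := eq_neg_of_add_eq_zero_left (barHomotopy_twR hR a b (R.bar.comul x))
  have hone : ∀ y : Fin t → k, R.r y (R.one (1 : Fin t → k)) = R.one y := fun y => by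
    rw [← R.one.map_r]
    exact congrArg R.one.toLin (mul_one y)
  have hcoaug : ∀ y : Fin t → k, R.bar.r y (R.bar.coaug (1 : Fin t → k)) = R.bar.coaug y :=
    fun y => by
    rw [← R.bar.coaug.map_r]
    exact congrArg R.bar.coaug.toLin (mul_one y)
  have h2 : tw R.piBar (R.one (1 : Fin t → k)) (R.bar.coaug (1 : Fin t → k))
      (R.m (R.r (R.bar.counit x) (R.one (R.aug a))) b) =
      tw R.piBar (R.one (1 : Fin t → k)) (R.bar.l (R.aug a) (R.bar.coaug (R.bar.counit x))) b := by
    have hr : ∀ y z : Fin t → k, R.r y (R.one z) = R.one (y * z) := fun y z =>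
      (R.one.map_r y z).symm
    have hl : ∀ y z : Fin t → k, R.bar.l z (R.bar.coaug y) = R.bar.coaug (y * z) := fun y z => by
      rw [mul_comm]
      exact (R.bar.coaug.map_l z y).symm
    rw [hr, hR.one_mul, ← tw_balance_right, hcoaug, hl]
  have h3 : tw R.piBar (R.one (R.aug a)) x b =
      tw R.piBar (R.one (1 : Fin t → k)) (R.bar.l (R.aug a) x) b := by
    rw [← tw_balance_left, hone]
  have h4 : ∀ b b', tw R.piBar (R.one (1 : Fin t → k)) (R.bar.coaug (1 : Fin t → k)) (b - b') =
      tw R.piBar (R.one (1 : Fin t → k)) (R.bar.coaug (1 : Fin t → k)) b -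
      tw R.piBar (R.one (1 : Fin t → k)) (R.bar.coaug (1 : Fin t → k)) b' := fun b b' => by
    rw [sub_eq_add_neg, tw_add_right, tw_neg_right, sub_eq_add_neg]
  have h5 : R.bar.l (R.aug a) (x - R.bar.coaug (R.bar.counit x)) =
      R.bar.l (R.aug a) x + -R.bar.l (R.aug a) (R.bar.coaug (R.bar.counit x)) := by
    rw [map_sub, sub_eq_add_neg]
  -- The scalars ε(a) appear because the letter that is split off is a - ε(a); they cancel against
  -- the error term of `barHomotopy_twL`.
  have h6 : (twisted R R.bar R.piBar).d (tw R.piBar (R.one (1 : Fin t → k))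
      (R.barCons (R.barProj a) x) b) = -tw R.piBar (R.one (1 : Fin t → k))
      (R.barCons (R.barProj (R.d a)) x) b - tw R.piBar (R.one (1 : Fin t → k))
      (R.barCons (R.barProj (R.par a)) (R.bar.d x)) b + tw R.piBar (R.one (1 : Fin t → k))
      (R.barMerge (tm (R.barProj a) x)) b - tw R.piBar (R.one (1 : Fin t → k))
      (R.barCons (R.barProj (R.par a)) (R.bar.par x)) (R.d b) +
      (tw R.piBar (R.one (1 : Fin t → k)) (R.bar.coaug (1 : Fin t → k))
        (R.m (R.r (R.bar.counit x) a) b) - tw R.piBar (R.one (1 : Fin t → k))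
        (R.bar.l (R.aug a) (R.bar.coaug (R.bar.counit x))) b +
        twR R.piBar (R.one (1 : Fin t → k)) b
          (R.barConsLeft _ (tm (R.barProj a) (R.bar.comul x)))) -
      (tw R.piBar a x b - tw R.piBar (R.one (1 : Fin t → k)) (R.bar.l (R.aug a) x) b) := by
    rw [d_tw, hR.d_one, hR.par_one, tw_zero_left, zero_add, bar_d_barCons, bar_par_barCons,
      bar_comul_barCons, map_add, map_add, twR_tm, twL_tm, piBar_coaug, m_zero_right,
      tw_zero_left, zero_add, piBar_barCons, twL_barConsLeft, hB.counit_left, barProj_par hR,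
      barProj_d hR, hB.par_coaug, hR.one_m, barIncl_barProj, tw_sub_left, h3,
      map_sub (R.r (R.bar.counit x)), m_sub_left, h4, h2]
    rw [tw_add_mid, tw_add_mid, barCons_neg_left, barCons_neg_left, barCons_neg_left, tw_neg_mid,
      tw_neg_mid, tw_neg_mid]
    abel
  have h7 : R.barHomotopy ((twisted R R.bar R.piBar).d (tw R.piBar a x b)) =
      tw R.piBar (R.one (1 : Fin t → k)) (R.barCons (R.barProj (R.d a)) x) b +
      tw R.piBar (R.one (1 : Fin t → k)) (R.barCons (R.barProj (R.par a)) (R.bar.d x)) b +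
      tw R.piBar (R.one (1 : Fin t → k)) (R.barCons (R.barProj (R.par a)) (R.bar.par x)) (R.d b) -
      twR R.piBar (R.one (1 : Fin t → k)) b
          (R.barConsLeft _ (tm (R.barProj a) (R.bar.comul x))) -
      (tw R.piBar (R.one (1 : Fin t → k)) (R.barMerge (tm (R.barProj a) x)) b +
      (tw R.piBar (R.one (1 : Fin t → k)) (R.bar.l (R.aug a) x) b -
      tw R.piBar (R.one (1 : Fin t → k)) (R.bar.l (R.aug a) (R.bar.coaug (R.bar.counit x))) b))
      := by
    rw [d_tw, map_sub, map_add, map_add, map_add, barHomotopy_twL hR, barHomotopy_tw,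
      barHomotopy_tw, barHomotopy_tw, h1, h5, tw_add_mid, tw_add_mid, tw_neg_mid]
    abel
  rw [barHomotopy_tw, h6, h7, twistedAug_tw]
  abel

theorem bar_isQuasiIso (hR : R.IsAugDGRing) :
    PreDGBimodule.IsQuasiIso (M := R.barResolution) (N := R.regular)
      (twistedAug R R.bar R.piBar) := by
  have hB := hR.bar_isCoaugDGCoring
  have hP := twisted_isDGBimodule hR hB (piBar_isTwisting hR)
  -- The section b ↦ 1 ⊗ 1 ⊗ b is only right linear, which is enough here. The homotopy is negated
  -- since `barHomotopy_spec` has the opposite sign convention.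
  refine PreDGBimodule.isQuasiIso_of_homotopy (M := twisted R R.bar R.piBar)
    (tmLin (KBimod.tensor R.toKBimod R.bar.toKBimod) R.toKBimod
      (tm (R.one (1 : Fin t → k)) (R.bar.coaug (1 : Fin t → k)))) (fun i b hb => ?_)
    (fun (b : R.carrier) => ?_) (fun (b : R.carrier) => ?_) (-R.barHomotopy.toLin)
      (fun i m hm => ?_)
    (fun m => ?_)
  · have := tw_mem (α := R.piBar) (hR.one_mem (1 : Fin t → k)) (hB.coaug_mem (1 : Fin t → k)) hb
    rwa [add_zero, zero_add] at this
  · have := d_tw_coaug hB (piBar_isTwisting hR) (R.one (1 : Fin t → k)) b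
    rw [hR.d_one, tw_zero_left, zero_add, hR.par_one] at this
    exact this
  · refine (twistedAug_tw (α := R.piBar) _ _ b).trans ?_
    rw [bar_counit_coaug, r_one, hR.one_m]
  · refine neg_mem ?_
    have : HasDeg (twisted R R.bar R.piBar).toPreDGModule
        (twisted R R.bar R.piBar).toPreDGModule 1 R.barHomotopy :=
      twisted_hasDeg fun i j l a ha x hx b hb => by
        rw [barHomotopy_tw]
        have h1 : R.barCons (R.barProj a) x ∈ R.bar.gr (i + 1 + j) := by
          have := tensCons_hasDeg (M := R.red.susp) (D := coder R.red.susp R.barProd) _ _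
            (tm_mem (barProj_hasDeg hR i a ha) hx)
          rwa [add_zero] at this
        have h2 := tw_mem (α := R.piBar) (hR.one_mem (1 : Fin t → k)) h1 hb
        rwa [show 0 + (i + 1 + j) + l = i + j + l + 1 by ring] at h2
    exact this i m hm
  · have := barHomotopy_spec hR m
    change (twisted R R.bar R.piBar).d (-R.barHomotopy m) +
      -R.barHomotopy ((twisted R R.bar R.piBar).d m) = m - tw R.piBar (R.one (1 : Fin t → k))
        (R.bar.coaug (1 : Fin t → k)) (twistedAug R R.bar R.piBar m)
    rw [map_neg, ← neg_add, this, neg_sub]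

end PreDGRing

end

/-! ### The length filtration of the bar construction -/

section

open KBimod PreDGModule

variable {k : Type u} [Field k] {t : ℕ}

namespace PreDGRing

variable {R : PreDGRing.{u} k t}

variable (R) in
/-- The span of the tensors of length less than `n` in the bar construction. -/
def barFiltration : ℕ → Submodule k R.bar.carrier
  | 0 => ⊥
  | n + 1 => LinearMap.range R.bar.coaug.toLin ⊔
      Submodule.span k {c | ∃ v, ∃ u ∈ barFiltration n, c = R.barCons v u}

theorem coaug_mem_barFiltration (n : ℕ) (x : Fin t → k) :
    R.bar.coaug x ∈ R.barFiltration (n + 1) :=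
  Submodule.mem_sup_left ⟨x, rfl⟩

theorem barCons_mem_barFiltration {n : ℕ} (v : R.red.susp.carrier) {u : R.bar.carrier}
    (hu : u ∈ R.barFiltration n) : R.barCons v u ∈ R.barFiltration (n + 1) :=
  Submodule.mem_sup_right (Submodule.subset_span ⟨v, u, hu, rfl⟩)

theorem barFiltration_le {n : ℕ} {S : Submodule k R.bar.carrier}
    (h1 : ∀ x : Fin t → k, R.bar.coaug x ∈ S)
    (h2 : ∀ v, ∀ u ∈ R.barFiltration n, R.barCons v u ∈ S) : R.barFiltration (n + 1) ≤ S := by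
  refine sup_le ?_ (Submodule.span_le.2 ?_)
  · rintro _ ⟨x, rfl⟩
    exact h1 x
  · rintro _ ⟨v, u, hu, rfl⟩
    exact h2 v u hu

theorem barFiltration_mono : Monotone R.barFiltration := by
  refine monotone_nat_of_le_succ fun n => ?_
  induction n with
  | zero => exact bot_le
  | succ n ih =>
    exact barFiltration_le (coaug_mem_barFiltration _) fun v u hu =>
      barCons_mem_barFiltration v (ih hu)

theorem barFiltration_exhaustive (c : R.bar.carrier) : ∃ n, c ∈ R.barFiltration n := by
  induction c using bar_induction with
  | h1 x => exact ⟨1, coaug_mem_barFiltration 0 x⟩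
  | hc v u hu =>
    obtain ⟨n, hn⟩ := hu
    exact ⟨n + 1, barCons_mem_barFiltration v hn⟩
  | ha u u' hu hu' =>
    obtain ⟨n, hn⟩ := hu
    obtain ⟨n', hn'⟩ := hu'
    exact ⟨max n n', add_mem (barFiltration_mono (le_max_left _ _) hn)
      (barFiltration_mono (le_max_right _ _) hn')⟩

theorem map_piBar_barConsLeft (v : R.red.susp.carrier) (q) :
    map R.piBar (KHom.id R.bar.toKBimod) (R.barConsLeft _ (tm v q)) =
      tm (R.barIncl v) (leftUnit _ (map R.bar.counit (KHom.id _) q)) := by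
  induction q using tensor_induction with
  | h0 => rw [tm_zero_right, map_zero, map_zero, map_zero, map_zero, tm_zero_right]
  | ht x y => rw [barConsLeft_tm, map_tm, piBar_barCons, map_tm, leftUnit_tm, ← tm_balance]
  | ha q q' hq hq' =>
    rw [tm_add_right, map_add, map_add, hq, hq', map_add, map_add, tm_add_right]

theorem map_id_piBar_barConsLeft (v : R.red.susp.carrier) (q) :
    map (KHom.id R.bar.toKBimod) R.piBar (R.barConsLeft _ (tm v q)) =
      R.barConsLeft _ (tm v (map (KHom.id R.bar.toKBimod) R.piBar q)) := by
  induction q using tensor_induction with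
  | h0 => simp only [tm_zero_right, map_zero]
  | ht x y => rfl
  | ha q q' hq hq' =>
    rw [tm_add_right, map_add, map_add, hq, hq', map_add, tm_add_right, map_add]

/-- Here π reads the last letter, which is reached only by induction on the length; in
`barFiltration_left` it reads the first letter and leaves the tail. -/
theorem barFiltration_right (n : ℕ) (c : R.bar.carrier) (hc : c ∈ R.barFiltration (n + 1)) :
    map (KHom.id _) R.piBar (R.bar.comul c) ∈ Submodule.span k
      {q | ∃ c' ∈ R.barFiltration n, ∃ a, q = (tm c' a : (KBimod.tensor _ _).carrier)} := by
  induction n generalizing c with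
  | zero =>
    change c ∈ Submodule.comap (((map (KHom.id _) R.piBar).comp R.bar.comul).toLin)
      (Submodule.span k _)
    refine barFiltration_le (fun x => ?_) (fun v u hu => ?_) hc
    · refine Submodule.mem_comap.2 ?_
      rw [KHom.comp_apply, bar_comul_coaug, map_tm, piBar_coaug, tm_zero_right]
      exact zero_mem _
    · rw [(Submodule.mem_bot k).1 hu, show R.barCons v 0 = 0 from
        (congrArg (tensCons R.red.susp.toKBimod).toLin (tm_zero_right _)).trans (map_zero _)]
      exact zero_mem _
  | succ n ih =>
    change c ∈ Submodule.comap (((map (KHom.id _) R.piBar).comp R.bar.comul).toLin)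
      (Submodule.span k _)
    refine barFiltration_le (fun x => ?_) (fun v u hu => ?_) hc
    · refine Submodule.mem_comap.2 ?_
      rw [KHom.comp_apply, bar_comul_coaug, map_tm, piBar_coaug, tm_zero_right]
      exact zero_mem _
    · refine Submodule.mem_comap.2 ?_
      rw [KHom.comp_apply, bar_comul_barCons, map_add, map_tm, map_id_piBar_barConsLeft]
      -- The cut in front of v has the coaugmentation as left factor. This is allowed because
      -- F_{n+1} contains the words of length 0; for F_0 = 0 it is not, hence the separate base
      -- case.
      refine add_mem (Submodule.subset_span ⟨_, coaug_mem_barFiltration n _, _, rfl⟩) ?_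
      refine Submodule.span_induction (p := fun q _ => R.barConsLeft _ (tm v q) ∈ _) ?_ ?_ ?_ ?_
        (ih u hu)
      · rintro _ ⟨c', hc', a, rfl⟩
        exact Submodule.subset_span ⟨_, barCons_mem_barFiltration v hc', a, rfl⟩
      · rw [tm_zero_right, map_zero]
        exact zero_mem _
      · intro p q _ _ hp hq
        rw [tm_add_right, map_add]
        exact add_mem hp hq
      · intro s p _ hp
        rw [tm_smul_right, map_smul]
        exact Submodule.smul_mem _ _ hp

theorem barFiltration_left (hR : R.IsAugDGRing) (n : ℕ) (c : R.bar.carrier)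
    (hc : c ∈ R.barFiltration (n + 1)) :
    map R.piBar (KHom.id _) (R.bar.comul c) ∈ Submodule.span k
      {q | ∃ a, ∃ c' ∈ R.barFiltration n, q = (tm a c' : (KBimod.tensor _ _).carrier)} := by
  change c ∈ Submodule.comap (((map R.piBar (KHom.id _)).comp R.bar.comul).toLin)
    (Submodule.span k _)
  refine barFiltration_le (fun x => ?_) (fun v u hu => ?_) hc
  · refine Submodule.mem_comap.2 ?_
    rw [KHom.comp_apply, bar_comul_coaug, map_tm, piBar_coaug, tm_zero_left]
    exact zero_mem _
  · refine Submodule.mem_comap.2 ?_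
    rw [KHom.comp_apply, bar_comul_barCons, map_add, map_tm, map_piBar_barConsLeft, piBar_coaug,
      tm_zero_left,
      zero_add, hR.bar_isCoaugDGCoring.counit_left]
    exact Submodule.subset_span ⟨_, u, hu, rfl⟩

variable (R) in
/-- The filtration of the bar construction by the length of tensors. -/
def barConilpotent (hR : R.IsAugDGRing) : ConilpotentFiltration R.piBar where
  F := R.barFiltration
  zero := rfl
  mono := barFiltration_mono
  exhaustive := barFiltration_exhaustive
  left := barFiltration_left hR
  right := barFiltration_right

end PreDGRing

/-! ### The universal derivation of the cobar construction -/

namespace PreDGCoring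

open PreDGRing

variable {C : PreDGCoring.{u} k t}

variable (C) in
/-- The map `c ↦ 1 ⊗ c ⊗ 1` on the coaugmentation coideal. -/
def cobarGenTw : KHom C.red.desusp.toKBimod (twisted C.cobar C C.iota).toKBimod :=
  (tw1 C.iota).comp (kerIncl C.counit)

variable (C) in
/-- The inclusion `s⁻¹ C̄ → Ω` followed by the parity operator. -/
def cobarGenPar : KHom C.red.desusp.toKBimod C.cobar.toKBimod :=
  KHom.comp C.cobar.par (tensIncl C.red.desusp.toKBimod)

variable (C) in
/-- The universal derivation `Ω → Ω ⊗ C ⊗ Ω` on tensors of a given length. -/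
def cobarDerAux : ∀ n, KHom (KBimod.pow C.red.desusp.toKBimod n)
    (twisted C.cobar C C.iota).toKBimod
  | 0 => 0
  | n + 1 => (twisted C.cobar C C.iota).ract.comp (map (cobarGenTw C)
        (KHom.comp (X := C.cobar.toKBimod) (KHom.id C.cobar.toKBimod)
          (incl (KBimod.pow C.red.desusp.toKBimod) n))) +
      (twisted C.cobar C C.iota).lact.comp (map (cobarGenPar C) (cobarDerAux n))

variable (C) in
/-- The derivation `Ω → Ω ⊗ C ⊗ Ω` with `⟨c⟩ ↦ 1 ⊗ c ⊗ 1`. -/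
def cobarDer : KHom C.cobar.toKBimod (twisted C.cobar C C.iota).toKBimod :=
  desc (cobarDerAux C)

theorem cobarDer_one (x : Fin t → k) : cobarDer C (C.cobar.one x) = 0 :=
  desc_incl (cobarDerAux C) 0 x

/-- The Leibniz rule for a generator. The correction by the counit appears because ι forgets the
coaugmentation part of c, while 1 ⊗ c ⊗ 1 does not. -/
theorem cobarDer_iota_m (c : C.carrier) (u : C.cobar.carrier) :
    cobarDer C (C.cobar.m (C.iota c) u) =
      (twisted C.cobar C C.iota).ra (tw1 C.iota (c - C.coaug (C.counit c))) u +
      (twisted C.cobar C C.iota).la (C.cobar.par (C.iota c)) (cobarDer C u) := by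
  rw [cobar_iota_m]
  refine tensor_tens_hom_ext (V := C.red.desusp.toKBimod) (W := C.red.desusp.toKBimod)
    (f := (cobarDer C).comp (tensCons C.red.desusp.toKBimod))
    (g := (twisted C.cobar C C.iota).ract.comp (map (cobarGenTw C) (KHom.id C.cobar.toKBimod)) +
      (twisted C.cobar C C.iota).lact.comp (map (cobarGenPar C) (cobarDer C)))
    (fun n v m => ?_) (tm (C.redProj c) u)
  refine (pow_hom_succ_apply (D := cobarDer C) rfl n v m).trans ?_
  refine congrArg (fun z => (twisted C.cobar C C.iota).ra (cobarGenTw C v)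
    (incl (KBimod.pow C.red.desusp.toKBimod) n m) +
    (twisted C.cobar C C.iota).la (cobarGenPar C v) z) ?_
  exact (desc_incl (cobarDerAux C) n m).symm

end PreDGCoring

end

/-! ### The cobar bimodule Ω ⊗ C ⊗ Ω resolves Ω -/

section

open KBimod PreDGModule

variable {k : Type u} [Field k] {t : ℕ}

namespace PreDGCoring

open PreDGRing PreDGBimodule

variable {C : PreDGCoring.{u} k t} (hC : C.IsCoaugDGCoring)

include hC

theorem cobarResolution_isDGBimodule : (twisted C.cobar C C.iota).IsDGBimodule :=
  twisted_isDGBimodule (cobar_isAugDGRing hC) hC (iota_isTwisting hC)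

theorem cobarDer_hasDeg : HasDeg C.cobar.toPreDGModule
    (twisted C.cobar C C.iota).toPreDGModule 1 (cobarDer C) := by
  have hΩ := cobar_isAugDGRing hC
  have hP := cobarResolution_isDGBimodule hC
  have hr : HasDeg ((twisted C.cobar C C.iota).toPreDGModule.tensor C.cobar.toPreDGModule)
      (twisted C.cobar C C.iota).toPreDGModule 0 (twisted C.cobar C C.iota).ract :=
    tensor_hasDeg fun i j m hm a ha => by
      rw [add_zero]
      exact hP.ra_mem i j m hm a ha
  have hl : HasDeg (C.cobar.toPreDGModule.tensor (twisted C.cobar C C.iota).toPreDGModule)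
      (twisted C.cobar C C.iota).toPreDGModule 0 (twisted C.cobar C C.iota).lact :=
    tensor_hasDeg fun i j m hm a ha => by
      rw [add_zero]
      exact hP.la_mem i j m hm a ha
  have h1 : HasDeg C.red.desusp (twisted C.cobar C C.iota).toPreDGModule 1 (cobarGenTw C) := by
    have h0 : HasDeg C.red C.toPreDGModule 0 (kerIncl C.counit) := fun i m hm => by
      rw [add_zero]
      exact hm
    have h2 : HasDeg C.red.desusp C.toPreDGModule 1 (kerIncl C.counit) :=
      (h0.comp (hasDeg_of_desusp (M := C.red))).congr (add_zero 1)
    exact ((tw1_hasDeg hΩ).comp h2).congr (add_zero 1)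
  have h2 : HasDeg C.red.desusp C.cobar.toPreDGModule 0 (cobarGenPar C) :=
    (hΩ.isGraded.hasDeg_par.comp tensIncl_hasDeg).congr (add_zero 0)
  refine desc_hasDeg (M := C.red.desusp) (F := cobarDerAux C) fun n => ?_
  induction n with
  | zero => exact fun _ _ _ => zero_mem _
  | succ n ih =>
    refine HasDeg.add (M := powModule C.red.desusp (n + 1))
      (N := (twisted C.cobar C C.iota).toPreDGModule) ?_ ?_
    · exact (hr.comp (h1.map (incl_hasDeg _ n))).congr (by ring)
    · exact (hl.comp (h2.map ih)).congr (by ring)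

theorem d_tw1_coaug (x : Fin t → k) :
    (twisted C.cobar C C.iota).d (tw1 C.iota (C.coaug x)) = 0 := by
  have hΩ := cobar_isAugDGRing hC
  rw [d_tw1 hΩ, hC.d_coaug, hC.comul_coaug, twR1_tm hΩ, twL1_tm hΩ, iota_coaug, iota_coaug,
    ra_zero_right, la_zero_left, map_zero, add_zero, sub_zero]

theorem counit_par (c : C.carrier) : C.counit (C.par c) = C.counit c :=
  hC.toIsDG.isGraded.par_comm_zero unit_isGraded (counit_hasDeg hC) c

omit hC in
theorem coaug_eq_r (x : Fin t → k) : C.coaug x = C.r x (C.coaug (1 : Fin t → k)) := by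
  rw [← C.coaug.map_r]
  exact congrArg C.coaug.toLin (mul_one x).symm

omit hC in
theorem coaug_eq_l (x : Fin t → k) : C.coaug x = C.l x (C.coaug (1 : Fin t → k)) := by
  rw [← C.coaug.map_l]
  exact congrArg C.coaug.toLin (mul_one x).symm

/-- Evaluates the derivation on the quadratic part of d⟨c⟩. Its main terms are the twisting terms of
d(1 ⊗ c ⊗ 1); the terms with counits come from the corrections in `cobarDer_iota_m` and reduce to
ι(c) when q = Δ c. -/
theorem cobarDer_convSq_m (q : (KBimod.tensor C.toKBimod C.toKBimod).carrier)
    (u : C.cobar.carrier) :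
    cobarDer C (C.cobar.m (convSq C.iota q) u) =
      (twisted C.cobar C C.iota).ra (twR1 C.iota q) u -
      (twisted C.cobar C C.iota).ra ((twisted C.cobar C C.iota).ra
        (tw1 C.iota (C.coaug (1 : Fin t → k)))
        (C.iota (leftUnit _ (map C.counit (KHom.id _) q)))) u -
      (twisted C.cobar C C.iota).ra (twL1 C.iota q) u +
      (twisted C.cobar C C.iota).ra ((twisted C.cobar C C.iota).la
        (C.iota (rightUnit _ (map (KHom.id _) C.counit q)))
        (tw1 C.iota (C.coaug (1 : Fin t → k)))) u +
      (twisted C.cobar C C.iota).la (C.cobar.par (convSq C.iota q)) (cobarDer C u) := by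
  have hΩ := cobar_isAugDGRing hC
  have hP := cobarResolution_isDGBimodule hC
  induction q using tensor_induction with
  | h0 => simp only [map_zero, m_zero_left, ra_zero_left, la_zero_left, ra_zero_right,
      add_zero, sub_zero]
  | ht x y =>
    have h1 : ∀ e, (twisted C.cobar C C.iota).ra (tw1 C.iota (C.coaug e)) (C.iota y) =
        (twisted C.cobar C C.iota).ra (tw1 C.iota (C.coaug (1 : Fin t → k)))
          (C.iota (C.l e y)) := fun e => by
      rw [coaug_eq_r, (tw1 C.iota).map_r, C.iota.map_l, ← hP.ra_one, hP.ra_ra, hΩ.one_mul]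
    have h2 : ∀ e, (twisted C.cobar C C.iota).la (C.iota x) (tw1 C.iota (C.coaug e)) =
        (twisted C.cobar C C.iota).la (C.iota (C.r e x))
          (tw1 C.iota (C.coaug (1 : Fin t → k))) := fun e => by
      rw [coaug_eq_l, (tw1 C.iota).map_l, C.iota.map_r, ← hP.one_la, hP.la_la, hΩ.mul_one]
    rw [convSq_tm, hΩ.mul_assoc, cobarDer_iota_m, cobarDer_iota_m, hΩ.par_m,
      par_iota hC (C.par x), par_iota hC y, hC.toIsDG.isGraded.par_par, map_tm, map_tm,
      leftUnit_tm, rightUnit_tm, counit_par hC, KHom.id_apply, KHom.id_apply,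
      twR1_tm hΩ, twL1_tm hΩ, ← h1, ← h2, map_sub, map_sub, ← hP.ra_ra]
    simp only [sub_eq_add_neg, la_add_right, la_neg_left, la_neg_right, ra_add_left, ra_neg_left,
      m_neg_left, m_neg_right, hP.la_la, hP.la_ra, neg_neg]
    abel
  | ha q q' hq hq' =>
    simp only [map_add, m_add_left, ra_add_left, la_add_left, ra_add_right, hq, hq']
    abel

/-- By the Leibniz rule, dD + Dd and the inner derivation on the right need comparing only on
generators. There the twisting terms of d(1 ⊗ c ⊗ 1) cancel against the derivation of the quadratic
part of d⟨c⟩, and the counit corrections leave the commutator with 1 ⊗ 1 ⊗ 1. -/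
theorem cobarDer_spec (u : C.cobar.carrier) :
    (twisted C.cobar C C.iota).d (cobarDer C u) + cobarDer C (C.cobar.d u) =
      (twisted C.cobar C C.iota).ra (tw1 C.iota (C.coaug (1 : Fin t → k))) u -
      (twisted C.cobar C C.iota).la u (tw1 C.iota (C.coaug (1 : Fin t → k))) := by
  have hΩ := cobar_isAugDGRing hC
  have hP := cobarResolution_isDGBimodule hC
  induction u using cobar_induction with
  | h1 x =>
    rw [cobarDer_one, hΩ.d_one, map_zero, map_zero, hP.ra_one, hP.one_la, ← (tw1 C.iota).map_l,
      ← (tw1 C.iota).map_r, ← coaug_eq_l, ← coaug_eq_r, sub_self, add_zero]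
  | hc c u hu =>
    have h1 := cobarDer_convSq_m hC (C.comul c) u
    rw [hC.counit_left, hC.counit_right] at h1
    have h2 : C.cobar.d (C.cobar.par (C.iota c)) =
        C.cobar.par (C.iota (C.d c)) + C.cobar.par (convSq C.iota (C.comul c)) := by
      have := hΩ.par_d (C.iota c)
      rw [cobar_d_iota hC, map_sub, map_neg] at this
      rw [← neg_eq_iff_eq_neg.2 this]
      abel
    have h3 := eq_sub_of_add_eq hu
    rw [cobarDer_iota_m, hΩ.leibniz, map_add, map_add, hP.d_ra, hP.d_la, hΩ.par_par, h3, h2,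
      cobar_d_iota hC, m_sub_left, m_neg_left, map_sub (cobarDer C).toLin,
      map_neg (cobarDer C).toLin, cobarDer_iota_m, h1, hC.counit_d,
      par_tw1 hΩ, map_sub C.par.toLin, hC.par_coaug, par_iota hC c, m_neg_left,
      map_neg (cobarDer C).toLin, cobarDer_iota_m, counit_par hC,
      map_sub (tw1 C.iota).toLin c, map_sub (twisted C.cobar C C.iota).d.toLin,
      d_tw1_coaug hC, sub_zero, d_tw1 hΩ, map_zero C.coaug.toLin, sub_zero,
      par_iota hC (C.par c), hC.toIsDG.isGraded.par_par]
    simp only [sub_eq_add_neg, la_add_right, la_neg_left, la_neg_right, ra_add_left, ra_neg_left,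
      la_add_left, hP.la_la, hP.la_ra, hP.ra_ra]
    abel
  | ha u u' hu hu' =>
    rw [map_add, map_add, map_add, map_add, add_add_add_comm, hu, hu', ra_add_right, la_add_left]
    abel

omit hC in
variable (C) in
/-- The contracting homotopy of `Ω ⊗ C ⊗ Ω` induced by the universal derivation. -/
def cobarHomotopy :
    KHom (twisted C.cobar C C.iota).toKBimod (twisted C.cobar C C.iota).toKBimod :=
  (twisted C.cobar C C.iota).lact.comp ((map C.cobar.par (cobarDer C)).comp
    (map ((rightUnit _).comp (map (KHom.id _) C.counit)) (KHom.id _)))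

omit hC in
theorem cobarHomotopy_tw (a : C.cobar.carrier) (c : C.carrier) (b : C.cobar.carrier) :
    cobarHomotopy C (tw C.iota a c b) =
      (twisted C.cobar C C.iota).la (C.cobar.par (C.cobar.r (C.counit c) a)) (cobarDer C b) := rfl

theorem cobarHomotopy_twR (a b : C.cobar.carrier) (q) :
    cobarHomotopy C (twR C.iota (C.cobar.par a) b q) = (twisted C.cobar C C.iota).la a
      (cobarDer C (C.cobar.m (C.iota (leftUnit _ (map C.counit (KHom.id _) q))) b)) := by
  have hΩ := cobar_isAugDGRing hC
  have hP := cobarResolution_isDGBimodule hC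
  induction q using tensor_induction with
  | h0 => simp only [map_zero, m_zero_left, la_zero_right]
  | ht x y =>
    rw [twR_tm, cobarHomotopy_tw, map_tm, leftUnit_tm, KHom.id_apply, counit_par hC,
      C.cobar.par.map_r, hΩ.par_par, C.iota.map_l, ← hΩ.mul_one, ← hP.la_la, hP.one_la,
      ← (cobarDer C).map_l, l_m]
  | ha q q' hq hq' =>
    simp only [map_add, m_add_left, la_add_right, hq, hq']

theorem cobarHomotopy_twL (a b : C.cobar.carrier) (q) :
    cobarHomotopy C (twL C.iota (C.cobar.par a) b q) = (twisted C.cobar C C.iota).la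
      (C.cobar.m a (C.cobar.par (C.iota (rightUnit _ (map (KHom.id _) C.counit q)))))
      (cobarDer C b) := by
  have hΩ := cobar_isAugDGRing hC
  induction q using tensor_induction with
  | h0 => simp only [map_zero, m_zero_right, la_zero_left]
  | ht x y =>
    rw [twL_tm, cobarHomotopy_tw, map_tm, rightUnit_tm, KHom.id_apply, C.cobar.par.map_r,
      hΩ.par_m, hΩ.par_par, C.iota.map_r, C.cobar.par.map_r, r_m]
  | ha q q' hq hq' =>
    simp only [map_add, m_add_right, la_add_left, hq, hq']

/-- By the counit axioms the homotopy turns the twisting terms of d(a ⊗ c ⊗ b) into a D(ι(c)b) and a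
ι(c) D(b) with signs; the Leibniz rule leaves a ⊗ c ⊗ b - a ⊗ ε(c) ⊗ b. The last term is replaced,
through `cobarDer_spec`, by a ε(c) b ⊗ 1 ⊗ 1. -/
theorem cobarHomotopy_spec (m : (twisted C.cobar C C.iota).carrier) :
    (twisted C.cobar C C.iota).d (cobarHomotopy C m) +
      cobarHomotopy C ((twisted C.cobar C C.iota).d m) =
      m - tw C.iota (twistedAug C.cobar C C.iota m) (C.coaug (1 : Fin t → k))
        (C.cobar.one (1 : Fin t → k)) := by
  have hΩ := cobar_isAugDGRing hC
  have hP := cobarResolution_isDGBimodule hC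
  induction m using twisted_induction with
  | h a c b =>
    have h1 : tw C.iota (C.cobar.r (C.counit c) a) (C.coaug (1 : Fin t → k)) b =
        tw C.iota a (C.coaug (C.counit c)) b := by
      rw [tw_balance_left, ← coaug_eq_l]
    have h2 : C.cobar.par (C.cobar.r (C.counit c) (C.cobar.d a)) =
        -C.cobar.d (C.cobar.par (C.cobar.r (C.counit c) a)) := by
      rw [← C.cobar.d.map_r, hΩ.par_d]
    have h3 := eq_sub_of_add_eq (cobarDer_spec hC b)
    rw [cobarHomotopy_tw, hP.d_la, hΩ.par_par, h3, d_tw, map_sub, map_add, map_add, map_add,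
      cobarHomotopy_twR hC, cobarHomotopy_twL hC, cobarHomotopy_tw, cobarHomotopy_tw,
      cobarHomotopy_tw, hC.counit_left, hC.counit_right, hC.counit_d, counit_par hC, h2,
      cobarDer_iota_m, twistedAug_tw, map_zero, map_sub, C.cobar.par.map_r, C.cobar.par.map_r,
      hΩ.par_par]
    have h4 : (0 : Module.End k C.cobar.carrier) (C.cobar.par a) = 0 := rfl
    rw [h4, map_zero, la_zero_left]
    simp only [sub_eq_add_neg, la_add_right, la_neg_left, la_neg_right, ra_add_left, ra_neg_left]
    rw [hP.la_la, hP.la_la, la_tw1 hΩ, ra_tw1 hΩ, ra_tw1 hΩ, ra_tw1 hΩ, la_tw, la_tw, la_tw,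
      hΩ.m_one, hΩ.m_one, h1]
    abel
  | ha p q hp hq =>
    have h1 : tw C.iota (twistedAug C.cobar C C.iota (p + q)) (C.coaug (1 : Fin t → k))
        (C.cobar.one (1 : Fin t → k)) =
        tw C.iota (twistedAug C.cobar C C.iota p) (C.coaug (1 : Fin t → k))
          (C.cobar.one (1 : Fin t → k)) +
        tw C.iota (twistedAug C.cobar C C.iota q) (C.coaug (1 : Fin t → k))
          (C.cobar.one (1 : Fin t → k)) :=
      (congrArg (fun z => tw C.iota z (C.coaug (1 : Fin t → k)) (C.cobar.one (1 : Fin t → k)))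
        (map_add _ _ _)).trans (tw_add_left _ _ _ _)
    rw [h1, map_add, map_add, map_add, map_add, add_add_add_comm, hp, hq]
    abel

/-- The contraction is available for every coaugmented dg coring; a conilpotent filtration matters
only for semi-projectivity. -/
theorem cobar_isQuasiIso : PreDGBimodule.IsQuasiIso (M := C.cobarResolution)
    (N := C.cobar.regular) (twistedAug C.cobar C C.iota) := by
  have hΩ := cobar_isAugDGRing hC
  have hP := cobarResolution_isDGBimodule hC
  let σ : C.cobar.carrier →ₗ[k] (twisted C.cobar C C.iota).carrier :=
    (tmLin (KBimod.tensor C.cobar.toKBimod C.toKBimod) C.cobar.toKBimod).flip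
      (C.cobar.one (1 : Fin t → k)) ∘ₗ (tmLin C.cobar.toKBimod C.toKBimod).flip
      (C.coaug (1 : Fin t → k))
  have hσ : ∀ a, σ a = tw C.iota a (C.coaug (1 : Fin t → k)) (C.cobar.one (1 : Fin t → k)) :=
    fun _ => rfl
  refine PreDGBimodule.isQuasiIso_of_homotopy (M := twisted C.cobar C C.iota)
    (N := C.cobar.regular) σ (fun i a ha => ?_)
    (fun (a : C.cobar.carrier) => ?_) (fun (a : C.cobar.carrier) => ?_)
    (cobarHomotopy C).toLin (fun i m hm => ?_) (cobarHomotopy_spec hC)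
  · have := tw_mem (α := C.iota) ha (hC.coaug_mem (1 : Fin t → k)) (hΩ.one_mem (1 : Fin t → k))
    rwa [add_zero, add_zero] at this
  · have := d_tw_coaug hC (iota_isTwisting hC) a (C.cobar.one (1 : Fin t → k))
    rw [hΩ.d_one, tw_zero_right, add_zero] at this
    exact this
  · refine (twistedAug_tw (α := C.iota) a _ _).trans ?_
    rw [C.counit_coaug, r_one, hΩ.m_one]
  · have : HasDeg (twisted C.cobar C C.iota).toPreDGModule
        (twisted C.cobar C C.iota).toPreDGModule 1 (cobarHomotopy C) :=
      twisted_hasDeg fun i j l a ha c hc b hb => by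
        rw [cobarHomotopy_tw]
        by_cases h : j = 0
        · subst h
          have := hP.la_mem _ _ _ (hΩ.isGraded.par_mem (hΩ.r_mem i (C.counit c) a ha)) _
            (cobarDer_hasDeg hC l b hb)
          rwa [show i + (l + 1) = i + 0 + l + 1 by ring] at this
        · rw [hC.counit_gr j h c hc, map_zero]
          have h4 : (0 : Module.End k C.cobar.carrier) a = 0 := rfl
          rw [h4, map_zero, la_zero_left]
          exact zero_mem _
    exact this i m hm

end PreDGCoring

end

/-! ### Contractions of tensors over K, and faithfulness of the pairing on A^∨ ⊗ A^∨ -/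

section

open KBimod PreDGModule

variable {k : Type u} [Field k] {t : ℕ}

/-- A tensor killed by a family of forms on its first factor is a sum of tensors whose first
components are killed by the family. -/
theorem TensorProduct.mem_span_of_forall_lift_eq_zero {V : Type*} {Y : Type*} [AddCommGroup V]
    [Module k V] [AddCommGroup Y] [Module k Y] {ι : Type*} (φ : ι → V →ₗ[k] k) (T : V ⊗[k] Y)
    (h : ∀ i, TensorProduct.lift (LinearMap.lsmul k Y ∘ₗ φ i) T = 0) :
    T ∈ Submodule.span k {q | ∃ s, (∀ i, φ i s = 0) ∧ ∃ y : Y, q = s ⊗ₜ[k] y} := by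
  -- Expand T along a basis of Y: by linear independence, each form kills each coefficient in V.
  obtain ⟨c, rfl⟩ := TensorProduct.eq_repr_basis_right (Module.Basis.ofVectorSpace k Y) T
  refine Submodule.sum_mem _ fun j hj => Submodule.subset_span ⟨_, fun i => ?_, _, rfl⟩
  have := h i
  rw [Finsupp.sum, map_sum] at this
  simp only [TensorProduct.lift.tmul, LinearMap.comp_apply] at this
  exact linearIndependent_iff'.1 (Module.Basis.ofVectorSpace k Y).linearIndependent c.support
    (fun j => φ i (c j)) this j hj

namespace KBimod

variable {V : KBimod.{u, v} k t} {W : KBimod.{u, w} k t}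

/-- The contraction `m ⊗ n ↦ ∑ φ(m e_j) e_j n`. -/
def contractFst (φ : V.carrier →ₗ[k] k) : (KBimod.tensor V W).carrier →ₗ[k] W.carrier :=
  KBimod.lift
    (∑ j : Fin t, (LinearMap.lsmul k W.carrier).compl₁₂ (φ ∘ₗ V.r (Pi.single j 1))
      (W.l (Pi.single j 1)))
    (fun b m n => by
      simp only [LinearMap.sum_apply, LinearMap.compl₁₂_apply, LinearMap.comp_apply, r_single,
        l_single, LinearMap.lsmul_apply, map_smul, LinearMap.smul_apply])

theorem contractFst_tm (φ : V.carrier →ₗ[k] k) (m : V.carrier) (n : W.carrier) :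
    contractFst φ (tm m n) =
      ∑ j : Fin t, φ (V.r (Pi.single j 1) m) • W.l (Pi.single j 1) n := by
  change (∑ j : Fin t, (LinearMap.lsmul k W.carrier).compl₁₂ (φ ∘ₗ V.r (Pi.single j 1))
      (W.l (Pi.single j 1))) m n = _
  simp only [LinearMap.sum_apply, LinearMap.compl₁₂_apply, LinearMap.comp_apply,
    LinearMap.lsmul_apply]

/-- The contraction `m ⊗ n ↦ ∑ φ(e_j n) m e_j`. -/
def contractSnd (φ : W.carrier →ₗ[k] k) : (KBimod.tensor V W).carrier →ₗ[k] V.carrier :=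
  KBimod.lift
    (∑ j : Fin t, (LinearMap.lsmul k V.carrier).flip.compl₁₂ (V.r (Pi.single j 1))
      (φ ∘ₗ W.l (Pi.single j 1)))
    (fun b m n => by
      simp only [LinearMap.sum_apply, LinearMap.compl₁₂_apply, LinearMap.comp_apply, r_single,
        l_single, LinearMap.lsmul_apply, LinearMap.flip_apply, map_smul, LinearMap.smul_apply])

theorem contractSnd_tm (φ : W.carrier →ₗ[k] k) (m : V.carrier) (n : W.carrier) :
    contractSnd φ (tm m n) =
      ∑ j : Fin t, φ (W.l (Pi.single j 1) n) • V.r (Pi.single j 1) m := by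
  change (∑ j : Fin t, (LinearMap.lsmul k V.carrier).flip.compl₁₂ (V.r (Pi.single j 1))
      (φ ∘ₗ W.l (Pi.single j 1))) m n = _
  simp only [LinearMap.sum_apply, LinearMap.compl₁₂_apply, LinearMap.comp_apply,
    LinearMap.lsmul_apply, LinearMap.flip_apply]

/-- The idempotents of K give a section m ⊗ n ↦ ∑ m e_j ⊗ e_j n of the quotient map from V ⊗_k W to
V ⊗_K W. It carries the contraction to φ ⊗ id, which reduces the claim to tensors over k. -/
theorem mem_span_of_contractFst {ι : Type*} (φ : ι → V.carrier →ₗ[k] k)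
    {q : (KBimod.tensor V W).carrier} (h : ∀ i, contractFst (φ i) q = 0) :
    q ∈ Submodule.span k {q | ∃ m, (∀ i, φ i m = 0) ∧ ∃ n, q = tm m n} := by
  let B : V.carrier →ₗ[k] W.carrier →ₗ[k] V.carrier ⊗[k] W.carrier :=
    ∑ j : Fin t, (TensorProduct.mk k V.carrier W.carrier).compl₁₂
      (V.r (Pi.single j 1)) (W.l (Pi.single j 1))
  have hB : ∀ m n, B m n =
      ∑ j : Fin t, (V.r (Pi.single j 1) m) ⊗ₜ[k] (W.l (Pi.single j 1) n) := fun m n => by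
    simp only [B, LinearMap.sum_apply, LinearMap.compl₁₂_apply, TensorProduct.mk_apply]
  let σ : (KBimod.tensor V W).carrier →ₗ[k] V.carrier ⊗[k] W.carrier :=
    KBimod.lift B (fun b m n => by
      rw [hB, hB]
      exact Finset.sum_congr rfl fun j _ => by rw [r_single, l_single, TensorProduct.smul_tmul])
  have hσ : ∀ m n, σ (tm m n) =
      ∑ j : Fin t, (V.r (Pi.single j 1) m) ⊗ₜ[k] (W.l (Pi.single j 1) n) := hB
  let ρ : V.carrier ⊗[k] W.carrier →ₗ[k] (KBimod.tensor V W).carrier :=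
    TensorProduct.lift (tmLin V W)
  have hρσ : ∀ q, ρ (σ q) = q := KBimod.linear_ext (f := ρ ∘ₗ σ) (g := LinearMap.id)
    fun m n => by
    rw [LinearMap.comp_apply, hσ, map_sum, LinearMap.id_apply]
    have h1 : ∀ j : Fin t, ρ ((V.r (Pi.single j 1) m) ⊗ₜ[k] (W.l (Pi.single j 1) n)) =
        tmLin V W m (W.l (Pi.single j 1) n) := fun j => by
      refine Eq.trans (b := tm (V.r (Pi.single j 1) m) (W.l (Pi.single j 1) n)) rfl ?_
      rw [tm_balance, l_l, ← Pi.single_mul, one_mul]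
      rfl
    rw [Finset.sum_congr rfl fun j _ => h1 j, ← map_sum, sum_single_l]
    rfl
  have hT := TensorProduct.mem_span_of_forall_lift_eq_zero φ (σ q) fun i => by
    have : ∀ q, TensorProduct.lift (LinearMap.lsmul k W.carrier ∘ₗ φ i) (σ q) =
        contractFst (φ i) q := KBimod.linear_ext (f := TensorProduct.lift _ ∘ₗ σ)
          (g := contractFst (φ i)) fun m n => by
      rw [LinearMap.comp_apply, hσ, map_sum, contractFst_tm]
      rfl
    rw [this, h i]
  rw [← hρσ q]
  refine Submodule.mem_comap.1 (Submodule.span_le.2 ?_ hT)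
  rintro _ ⟨m, hm, n, rfl⟩
  exact Submodule.subset_span ⟨m, hm, n, rfl⟩

theorem mem_span_of_contractSnd {ι : Type*} (φ : ι → W.carrier →ₗ[k] k)
    {q : (KBimod.tensor V W).carrier} (h : ∀ i, contractSnd (φ i) q = 0) :
    q ∈ Submodule.span k {q | ∃ n, (∀ i, φ i n = 0) ∧ ∃ m, q = tm m n} := by
  -- The factors are exchanged, so that the forms again act on the first one.
  let B : V.carrier →ₗ[k] W.carrier →ₗ[k] W.carrier ⊗[k] V.carrier :=
    ∑ j : Fin t, (TensorProduct.mk k W.carrier V.carrier).flip.compl₁₂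
      (V.r (Pi.single j 1)) (W.l (Pi.single j 1))
  have hB : ∀ m n, B m n =
      ∑ j : Fin t, (W.l (Pi.single j 1) n) ⊗ₜ[k] (V.r (Pi.single j 1) m) := fun m n => by
    simp only [B, LinearMap.sum_apply, LinearMap.compl₁₂_apply, TensorProduct.mk_apply,
      LinearMap.flip_apply]
  let σ : (KBimod.tensor V W).carrier →ₗ[k] W.carrier ⊗[k] V.carrier :=
    KBimod.lift B (fun b m n => by
      rw [hB, hB]
      exact Finset.sum_congr rfl fun j _ => by rw [r_single, l_single, TensorProduct.smul_tmul])
  have hσ : ∀ m n, σ (tm m n) =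
      ∑ j : Fin t, (W.l (Pi.single j 1) n) ⊗ₜ[k] (V.r (Pi.single j 1) m) := hB
  let ρ : W.carrier ⊗[k] V.carrier →ₗ[k] (KBimod.tensor V W).carrier :=
    TensorProduct.lift (tmLin V W).flip
  have hρσ : ∀ q, ρ (σ q) = q := KBimod.linear_ext (f := ρ ∘ₗ σ) (g := LinearMap.id)
    fun m n => by
    rw [LinearMap.comp_apply, hσ, map_sum, LinearMap.id_apply]
    have h1 : ∀ j : Fin t, ρ ((W.l (Pi.single j 1) n) ⊗ₜ[k] (V.r (Pi.single j 1) m)) =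
        (tmLin V W).flip n (V.r (Pi.single j 1) m) := fun j => by
      refine Eq.trans (b := tm (V.r (Pi.single j 1) m) (W.l (Pi.single j 1) n)) rfl ?_
      rw [← tm_balance, r_r, ← Pi.single_mul, one_mul]
      rfl
    rw [Finset.sum_congr rfl fun j _ => h1 j, ← map_sum, sum_single_r]
    rfl
  have hT := TensorProduct.mem_span_of_forall_lift_eq_zero φ (σ q) fun i => by
    have : ∀ q, TensorProduct.lift (LinearMap.lsmul k V.carrier ∘ₗ φ i) (σ q) =
        contractSnd (φ i) q := KBimod.linear_ext (f := TensorProduct.lift _ ∘ₗ σ)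
          (g := contractSnd (φ i)) fun m n => by
      rw [LinearMap.comp_apply, hσ, map_sum, contractSnd_tm]
      rfl
    rw [this, h i]
  rw [← hρσ q]
  refine Submodule.mem_comap.1 (Submodule.span_le.2 ?_ hT)
  rintro _ ⟨n, hn, m, rfl⟩
  exact Submodule.subset_span ⟨n, hn, m, rfl⟩

theorem eq_of_contractFst {ι : Type*} (φ : ι → V.carrier →ₗ[k] k)
    (hφ : ∀ m, (∀ i, φ i m = 0) → m = 0) {q q' : (KBimod.tensor V W).carrier}
    (h : ∀ i, contractFst (φ i) q = contractFst (φ i) q') : q = q' := by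
  rw [← sub_eq_zero]
  have h1 := mem_span_of_contractFst φ (q := q - q') fun i => by rw [map_sub, h, sub_self]
  refine (Submodule.mem_bot k).1 (Submodule.span_le.2 ?_ h1)
  rintro _ ⟨m, hm, n, rfl⟩
  rw [hφ m hm]
  exact tm_zero_left n

end KBimod

namespace PreDGRing

variable {A : PreDGRing.{u} k t} (hA : A.IsAugDGRing)

/-- The evaluation of linear forms at `a`. -/
def dualEval (a : A.carrier) : (dualBimod hA).carrier →ₗ[k] k :=
  (LinearMap.applyₗ (R := k) a) ∘ₗ A.gradedDual.subtype

/-- The pairing reverses the factors: f ⊗ g takes f on the second argument v and g on the first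
argument u. Contracting the first factor at v therefore leaves a form in u. -/
theorem dualPairing_eq_contractFst (q : (KBimod.tensor (dualBimod hA) (dualBimod hA)).carrier)
    (u v : A.carrier) :
    dualPairing hA q u v = dualEval hA u (contractFst (dualEval hA v) q) := by
  induction q using tensor_induction with
  | h0 => simp only [map_zero, LinearMap.zero_apply]
  | ht f g =>
    rw [contractFst_tm, map_sum]
    refine (dualPairing_tm hA f g u v).trans (Finset.sum_congr rfl fun j _ => ?_)
    rw [map_smul]
    exact mul_comm _ _
  | ha q q' hq hq' =>
    rw [map_add, map_add, LinearMap.add_apply, LinearMap.add_apply, hq, hq', map_add]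

theorem dualPairing_eq_contractSnd (q : (KBimod.tensor (dualBimod hA) (dualBimod hA)).carrier)
    (u v : A.carrier) :
    dualPairing hA q u v = dualEval hA v (contractSnd (dualEval hA u) q) := by
  induction q using tensor_induction with
  | h0 => simp only [map_zero, LinearMap.zero_apply]
  | ht f g =>
    rw [contractSnd_tm, map_sum]
    refine (dualPairing_tm hA f g u v).trans (Finset.sum_congr rfl fun j _ => ?_)
    rw [map_smul]
    exact rfl
  | ha q q' hq hq' =>
    rw [map_add, map_add, LinearMap.add_apply, LinearMap.add_apply, hq, hq', map_add]

/-- A form is determined by its values, so contraction in the first factor and then evaluation of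
the result separate tensors. In this way identities between coproducts become identities between
products in A. -/
theorem eq_of_dualPairing {q q' : (KBimod.tensor (dualBimod hA) (dualBimod hA)).carrier}
    (h : ∀ u v, dualPairing hA q u v = dualPairing hA q' u v) : q = q' := by
  refine eq_of_contractFst (dualEval hA) (fun m hm => Subtype.ext (LinearMap.ext hm)) fun v =>
    Subtype.ext (LinearMap.ext fun u => ?_)
  have := h u v
  rwa [dualPairing_eq_contractFst, dualPairing_eq_contractFst] at this

end PreDGRing

end

/-! ### The graded dual is a coaugmented dg coring -/

section

open KBimod PreDGModule

variable {k : Type u} [Field k] {t : ℕ}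

namespace PreDGRing

variable {A : PreDGRing.{u} k t} (hA : A.IsAugDGRing)

include hA in
theorem gradedDual_ext {f g : A.gradedDual} (h : ∀ i, ∀ a ∈ A.gr i, f.1 a = g.1 a) : f = g :=
  Subtype.ext (LinearMap.ext fun a => hA.isGraded.linear_ext h a)

/-- The degree `n` part of a linear form. -/
noncomputable def dualProj (n : ℤ) : A.gradedDual →ₗ[k] A.gradedDual :=
  extendForm hA (-n) ∘ₗ Module.Dual.transpose (R := k) (A.gr (-n)).subtype ∘ₗ
    A.gradedDual.subtype

theorem dualProj_apply (n : ℤ) (f : A.gradedDual) (a : A.carrier) :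
    (dualProj hA n f).1 a = f.1 (proj hA (-n) a) := rfl

theorem mem_dual_gr {n : ℤ} {f : A.gradedDual} :
    f ∈ (dualModule hA).gr n ↔ ∀ i, i ≠ -n → ∀ a ∈ A.gr i, f.1 a = 0 := Iff.rfl

theorem dual_isInternal : DirectSum.IsInternal (dualModule hA).gr := by
  refine isInternal_of_projections _ (eq_top_iff.2 fun f _ => ?_) (dualProj hA)
    (fun n (f : A.gradedDual) hf => ?_)
    (fun i j hij (f : A.gradedDual) hf => ?_)
  · obtain ⟨f, S, hS⟩ := f
    -- A form supported on the degrees in S is the sum of its parts of degrees -n, for n in S.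
    have h : (⟨f, S, hS⟩ : A.gradedDual) = ∑ n ∈ S, dualProj hA (-n) ⟨f, S, hS⟩ := by
      refine gradedDual_ext hA fun i a ha => ?_
      rw [Submodule.coe_sum, LinearMap.sum_apply]
      simp only [dualProj_apply, neg_neg, proj_of_mem hA _ ha]
      by_cases hi : i ∈ S
      · rw [Finset.sum_eq_single i (fun j _ hj => by rw [if_neg hj.symm, map_zero])
          (fun h => absurd hi h), if_pos rfl]
      · rw [hS i hi a ha]
        refine (Finset.sum_eq_zero fun j hj => ?_).symm
        rw [if_neg (fun h' => hi (by rwa [h'])), map_zero]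
    rw [h]
    refine Submodule.sum_mem _ fun n _ => Submodule.mem_iSup_of_mem (-n) ?_
    refine (mem_dual_gr hA).2 fun i hi a ha => ?_
    rw [dualProj_apply, proj_of_mem hA _ ha, if_neg hi, map_zero]
  · refine gradedDual_ext hA fun i a ha => ?_
    refine (dualProj_apply hA n f a).trans ?_
    rw [proj_of_mem hA _ ha]
    split_ifs with h
    · rfl
    · rw [map_zero, (mem_dual_gr hA).1 hf i h a ha]
  · refine gradedDual_ext hA fun l a ha => ?_
    refine (dualProj_apply hA i f a).trans ?_
    rw [proj_of_mem hA _ ha]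
    split_ifs with h
    · rw [(mem_dual_gr hA).1 hf l (fun h' => hij (by omega)) a ha]
      rfl
    · rw [map_zero]
      rfl

theorem dual_d_apply (f : A.gradedDual) (a : A.carrier) :
    ((dualModule hA).d f : A.gradedDual).1 a = -f.1 (A.par (A.d a)) := rfl

theorem dual_par_apply (f : A.gradedDual) (a : A.carrier) :
    ((dualModule hA).par f : A.gradedDual).1 a = f.1 (A.par a) := rfl

/-- The differential of the graded dual. -/
def dualD : KHom (dualBimod hA) (dualBimod hA) := (dualModule hA).d

/-- The parity operator of the graded dual. -/
def dualPar : KHom (dualBimod hA) (dualBimod hA) := (dualModule hA).par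

theorem dual_isDG : (dualModule hA).IsDG where
  internal := dual_isInternal hA
  l_mem n x f hf i hi a ha := hf i hi _ (hA.r_mem i x a ha)
  r_mem n x f hf i hi a ha := hf i hi _ (hA.l_mem i x a ha)
  par_apply n f hf := by
    refine gradedDual_ext hA fun i a ha => ?_
    refine (dual_par_apply hA f a).trans ?_
    rw [hA.par_apply i a ha, map_zsmul]
    change _ = (n.negOnePow : ℤ) • f.1 a
    by_cases h : i = -n
    · rw [h, Int.negOnePow_neg]
    · rw [(mem_dual_gr hA).1 hf i h a ha, smul_zero, smul_zero]
  d_mem n f hf := (mem_dual_gr hA).2 fun i hi a ha => by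
    refine (dual_d_apply hA f a).trans ?_
    rw [(mem_dual_gr hA).1 hf (i - 1) (by omega) _
      (hA.isGraded.par_mem (hA.d_mem i a ha)), neg_zero]
  d_d f := by
    refine Subtype.ext (LinearMap.ext fun a => ?_)
    have h : A.par (A.d (A.par (A.d a))) = 0 := by
      rw [hA.par_d, hA.isGraded.par_par, hA.d_d, neg_zero]
    refine (dual_d_apply hA ((dualModule hA).d f) a).trans ((congrArg Neg.neg
      (dual_d_apply hA f _)).trans ((neg_neg _).trans ((congrArg f.1 h).trans (map_zero _))))

section pairing

variable {Δ : KHom (dualBimod hA) (KBimod.tensor (dualBimod hA) (dualBimod hA))}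
  (hΔ : ∀ (f : A.gradedDual) (u v : A.carrier), dualPairing hA (Δ f) u v = f.1 (A.m u v))

theorem dualPairing_map {φ ψ : KHom (dualBimod hA) (dualBimod hA)}
    {φ' ψ' : KHom A.toKBimod A.toKBimod} (hφ : ∀ (f : A.gradedDual) a, (φ f).1 a = f.1 (φ' a))
    (hψ : ∀ (f : A.gradedDual) a, (ψ f).1 a = f.1 (ψ' a))
    (q : (KBimod.tensor (dualBimod hA) (dualBimod hA)).carrier) (u v : A.carrier) :
    dualPairing hA (map φ ψ q) u v = dualPairing hA q (ψ' u) (φ' v) := by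
  induction q using tensor_induction with
  | h0 => simp only [map_zero, LinearMap.zero_apply]
  | ht f g =>
    rw [map_tm]
    refine (dualPairing_tm hA (φ f) (ψ g) u v).trans (Eq.trans ?_ (dualPairing_tm hA f g _ _).symm)
    refine Finset.sum_congr rfl fun j _ => ?_
    rw [hφ, hψ, φ'.map_l, ψ'.map_r]
  | ha q q' hq hq' => simp only [map_add, LinearMap.add_apply, hq, hq']

include hΔ

theorem dual_counit_left {ε : KHom (dualBimod hA) (KBimod.unit k t)}
    (hε : ∀ (f : A.gradedDual) j, (ε f : Fin t → k) j = f.1 (A.one (Pi.single j 1 : Fin t → k)))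
    (f : A.gradedDual) : leftUnit _ (map ε (KHom.id _) (Δ f)) = f := by
  -- Applying the counit to the first factor is contraction at 1 = ∑ e_j; what remains is f(u · 1) =
  -- f(u).
  have h : ∀ q, leftUnit _ (map ε (KHom.id (dualBimod hA)) q) =
      contractFst (dualEval hA (A.one (1 : Fin t → k))) q :=
    KBimod.linear_ext (f := (leftUnit (dualBimod hA)).toLin ∘ₗ (map ε (KHom.id _)).toLin)
      (g := contractFst _) fun f g => by
    rw [contractFst_tm, LinearMap.comp_apply]
    refine (congrArg (leftUnit _) (map_tm ε (KHom.id _) f g)).trans ((leftUnit_tm _ _).trans ?_)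
    have h1 : ε f = ∑ j : Fin t, f.1 (A.one (Pi.single j 1 : Fin t → k)) •
        (Pi.single j 1 : Fin t → k) := by
      refine (pi_eq_sum_univ' (ε f : Fin t → k)).trans (Finset.sum_congr rfl fun j _ => ?_)
      rw [← hε]
    rw [h1, map_sum, LinearMap.sum_apply]
    refine Finset.sum_congr rfl fun j _ => ?_
    rw [map_smul, LinearMap.smul_apply]
    refine congrArg (fun c : k => c • (dualBimod hA).l (Pi.single j 1) g) (congrArg f.1 ?_)
    rw [← A.one.map_l]
    exact congrArg A.one.toLin (mul_one _).symm
  rw [h]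
  refine Subtype.ext (LinearMap.ext fun u => ?_)
  have h2 := hΔ f u (A.one (1 : Fin t → k))
  rw [dualPairing_eq_contractFst, hA.mul_one, r_one] at h2
  exact h2

theorem dual_counit_right {ε : KHom (dualBimod hA) (KBimod.unit k t)}
    (hε : ∀ (f : A.gradedDual) j, (ε f : Fin t → k) j = f.1 (A.one (Pi.single j 1 : Fin t → k)))
    (f : A.gradedDual) : rightUnit _ (map (KHom.id _) ε (Δ f)) = f := by
  have h : ∀ q, rightUnit _ (map (KHom.id (dualBimod hA)) ε q) =
      contractSnd (dualEval hA (A.one (1 : Fin t → k))) q :=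
    KBimod.linear_ext (f := (rightUnit (dualBimod hA)).toLin ∘ₗ (map (KHom.id _) ε).toLin)
      (g := contractSnd _) fun g f => by
    rw [contractSnd_tm, LinearMap.comp_apply]
    refine (congrArg (rightUnit _) (map_tm (KHom.id _) ε g f)).trans ((rightUnit_tm _ _).trans ?_)
    have h1 : ε f = ∑ j : Fin t, f.1 (A.one (Pi.single j 1 : Fin t → k)) •
        (Pi.single j 1 : Fin t → k) := by
      refine (pi_eq_sum_univ' (ε f : Fin t → k)).trans (Finset.sum_congr rfl fun j _ => ?_)
      rw [← hε]
    rw [h1, map_sum, LinearMap.sum_apply]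
    refine Finset.sum_congr rfl fun j _ => ?_
    rw [map_smul, LinearMap.smul_apply]
    refine congrArg (fun c : k => c • (dualBimod hA).r (Pi.single j 1) g) (congrArg f.1 ?_)
    rw [← A.one.map_r]
    exact congrArg A.one.toLin (mul_one _).symm
  rw [h]
  refine Subtype.ext (LinearMap.ext fun v => ?_)
  have h2 := hΔ f (A.one (1 : Fin t → k)) v
  rw [dualPairing_eq_contractSnd, hA.one_mul, l_one] at h2
  exact h2

/-- Contract the first of the three factors at w and pair the other two with (u, v): the two sides
are f(u(vw)) and f((uv)w). -/
theorem dual_coassoc (f : A.gradedDual) :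
    assoc _ _ _ (map Δ (KHom.id _) (Δ f)) = map (KHom.id _) Δ (Δ f) := by
  refine eq_of_contractFst (dualEval hA) (fun m hm => Subtype.ext (LinearMap.ext hm)) fun w => ?_
  have h1 : ∀ q, contractFst (dualEval hA w) (map (KHom.id _) Δ q) =
      Δ (contractFst (dualEval hA w) q) :=
    KBimod.linear_ext (f := contractFst (dualEval hA w) ∘ₗ (map (KHom.id _) Δ).toLin)
      (g := Δ.toLin ∘ₗ contractFst (dualEval hA w)) fun g h => by
    rw [LinearMap.comp_apply, LinearMap.comp_apply, contractFst_tm, map_sum]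
    refine (congrArg (contractFst (dualEval hA w)) (map_tm (KHom.id _) Δ g h)).trans ?_
    rw [contractFst_tm]
    refine Finset.sum_congr rfl fun j _ => ?_
    rw [map_smul, Δ.map_l]
    rfl
  refine eq_of_dualPairing hA fun u v => ?_
  rw [h1, hΔ]
  have h2 : ∀ r (g : A.gradedDual), dualPairing hA
      (contractFst (dualEval hA w) (assoc _ _ _ (tm r g))) u v =
      ∑ i : Fin t, g.1 (A.r (Pi.single i 1) u) * dualPairing hA r (A.l (Pi.single i 1) v) w :=
    fun r g => by
    induction r using tensor_induction with
    | h0 =>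
      simp only [tm_zero_left, map_zero, LinearMap.zero_apply, mul_zero, Finset.sum_const_zero]
    | ht a b =>
      rw [assoc_tm, contractFst_tm, map_sum, LinearMap.sum_apply, LinearMap.sum_apply]
      have h3 : ∀ j : Fin t, dualPairing hA (dualEval hA w ((dualBimod hA).r (Pi.single j 1) a) •
          (KBimod.tensor (dualBimod hA) (dualBimod hA)).l (Pi.single j 1) (tm b g)) u v =
          ∑ i : Fin t, a.1 (A.l (Pi.single j 1) w) * (g.1 (A.r (Pi.single i 1) u) *
            b.1 (A.r (Pi.single j 1) (A.l (Pi.single i 1) v))) := fun j => by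
        rw [map_smul, LinearMap.smul_apply, LinearMap.smul_apply, l_tm, smul_eq_mul,
          ← Finset.mul_sum]
        exact congrArg (a.1 (A.l (Pi.single j 1) w) * ·)
          (dualPairing_tm hA ((dualBimod hA).l (Pi.single j 1) b) g u v)
      refine (Finset.sum_congr rfl fun j _ => h3 j).trans (Finset.sum_comm.trans ?_)
      refine Finset.sum_congr rfl fun i _ => ?_
      refine Eq.trans ?_ (congrArg (g.1 (A.r (Pi.single i 1) u) * ·)
        (dualPairing_tm hA a b (A.l (Pi.single i 1) v) w).symm)
      rw [Finset.mul_sum]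
      exact Finset.sum_congr rfl fun j _ => by ring
    | ha r r' hr hr' =>
      rw [tm_add_left, map_add, map_add, map_add, LinearMap.add_apply, LinearMap.add_apply, hr,
        hr', ← Finset.sum_add_distrib]
      exact Finset.sum_congr rfl fun i _ => by
        rw [map_add, LinearMap.add_apply, LinearMap.add_apply, mul_add]
  have h4 : ∀ q, dualPairing hA (contractFst (dualEval hA w)
      (assoc _ _ _ (map Δ (KHom.id _) q))) u v = dualPairing hA q u (A.m v w) := fun q => by
    induction q using tensor_induction with
    | h0 => simp only [map_zero, LinearMap.zero_apply]
    | ht g h =>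
      rw [map_tm]
      refine (h2 (Δ g) h).trans (Eq.trans ?_ (dualPairing_tm hA g h u (A.m v w)).symm)
      refine Finset.sum_congr rfl fun i _ => ?_
      rw [hΔ, l_m]
    | ha q q' hq hq' => simp only [map_add, LinearMap.add_apply, hq, hq']
  rw [h4, hΔ, ← hA.mul_assoc]
  have h5 := hΔ f (A.m u v) w
  rw [dualPairing_eq_contractFst] at h5
  exact h5.symm

/-- The transpose of the Leibniz rule. Because the pairing reverses factors, the first summand
differentiates v, and the second differentiates u with the parity operator on v; the signs agree
since d f = -f ∘ par ∘ d. -/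
theorem dual_comul_d (f : A.gradedDual) : Δ (dualD hA f) =
    map (dualD hA) (KHom.id _) (Δ f) + map (dualPar hA) (dualD hA) (Δ f) := by
  refine eq_of_dualPairing hA fun u v => ?_
  have h1 : ∀ (f : A.gradedDual) a, (dualD hA f : A.gradedDual).1 a =
      f.1 ((-(A.par.comp A.d) : KHom A.toKBimod A.toKBimod) a) := fun f a => by
    refine (dual_d_apply hA f a).trans ?_
    rw [KHom.neg_apply, map_neg, KHom.comp_apply]
  rw [map_add, LinearMap.add_apply, LinearMap.add_apply]
  refine (hΔ _ u v).trans (Eq.trans ?_ (congrArg₂ (· + ·)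
    (dualPairing_map hA (ψ := KHom.id _) (ψ' := KHom.id _) h1 (fun _ _ => rfl) (Δ f) u v)
    (dualPairing_map hA (φ := dualPar hA) (φ' := A.par) (fun _ _ => rfl) h1
      (Δ f) u v)).symm)
  rw [hΔ, hΔ, ← map_add]
  refine (dual_d_apply hA f _).trans ?_
  rw [← map_neg, KHom.neg_apply, KHom.neg_apply, KHom.comp_apply, KHom.comp_apply, KHom.id_apply,
    hA.leibniz, map_add, hA.par_m, hA.par_m, hA.isGraded.par_par, m_neg_left, m_neg_right,
    neg_add, add_comm]

/-- Each homogeneous component of Δ f is tested by the pairing. A tensor of degree l pairs to zero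
with A_i ⊗ A_j unless l = -(i + j), and f(uv) is zero unless i + j = -n. -/
theorem dual_comul_deg : HasDeg (dualModule hA) ((dualModule hA).tensor (dualModule hA)) 0 Δ := by
  intro n f hf
  have hT := (dual_isDG hA).isGraded.tensor (dual_isDG hA).isGraded
  rw [add_zero]
  refine hT.mem_of_pr fun m hm => ?_
  have h1 : ∀ i j u v, u ∈ A.gr i → v ∈ A.gr j → ∀ l,
      ∀ q ∈ ((dualModule hA).tensor (dualModule hA)).gr l, l ≠ -(i + j) →
      dualPairing hA q u v = 0 := fun i j u v hu hv l q hq hl => by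
    refine Submodule.span_le (p := LinearMap.ker (((dualPairing hA).flip u).flip v)).2 ?_ hq
    rintro _ ⟨i', j', a, b, ha, hb, hij, rfl⟩
    refine (dualPairing_tm hA a b u v).trans (Finset.sum_eq_zero fun e _ => ?_)
    by_cases h : i = -j'
    · rw [(mem_dual_gr hA).1 ha j (by omega) _ (hA.l_mem j _ v hv), mul_zero]
    · rw [(mem_dual_gr hA).1 hb i h _ (hA.r_mem i _ u hu), zero_mul]
  refine eq_of_dualPairing hA fun u v => ?_
  have h0 : dualPairing hA 0 u v = 0 := by rw [map_zero, LinearMap.zero_apply, LinearMap.zero_apply]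
  refine Eq.trans ?_ h0.symm
  clear h0
  induction u using hA.isGraded.induction with
  | h0 => rw [map_zero, LinearMap.zero_apply]
  | hg i u hu =>
    induction v using hA.isGraded.induction with
    | h0 => rw [map_zero]
    | hg j v hv =>
      by_cases h : m = -(i + j)
      · have h2 : ∀ q, dualPairing hA (hT.pr m q) u v = dualPairing hA q u v :=
          hT.linear_ext (f := ((dualPairing hA).flip u).flip v ∘ₗ (hT.pr m).toLin)
            (g := ((dualPairing hA).flip u).flip v) fun l q hq => by
          refine (congrArg (((dualPairing hA).flip u).flip v) (hT.pr_of_mem m hq)).trans ?_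
          split_ifs with h'
          · rfl
          · exact (map_zero _).trans (h1 i j u v hu hv l q hq (fun h'' => h' (by omega))).symm
        refine (h2 _).trans ((hΔ f u v).trans ?_)
        exact (mem_dual_gr hA).1 hf (i + j) (by omega) _ (hA.mul_mem i j u hu v hv)
      · exact h1 i j u v hu hv m _ (hT.pr_mem m _) h
    | ha v v' hv hv' => rw [map_add, hv, hv', add_zero]
  | ha u u' hu hu' => rw [map_add, LinearMap.add_apply, hu, hu', add_zero]

end pairing

variable (hf : A.LocallyFinite) (hb : A.BoundedAbove ∨ A.BoundedBelow)

theorem dual_comul_spec (f : A.gradedDual) (u v : A.carrier) :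
    dualPairing hA ((dual hA hf hb).comul f) u v = f.1 (A.m u v) :=
  (exists_comul hA hf hb).choose_spec f u v

theorem dual_coaug_apply (x : Fin t → k) (a : A.carrier) :
    ((dual hA hf hb).coaug x : A.gradedDual).1 a = ∑ j : Fin t, x j * (A.aug a : Fin t → k) j := rfl

theorem dual_counit_apply (f : A.gradedDual) (j : Fin t) :
    ((dual hA hf hb).counit f : Fin t → k) j = f.1 (A.one (Pi.single j 1 : Fin t → k)) := rfl

/-- The transpose of the multiplicativity of ε. -/
theorem dual_comul_coaug (x : Fin t → k) :
    (dual hA hf hb).comul ((dual hA hf hb).coaug x) =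
      tm ((dual hA hf hb).coaug x) ((dual hA hf hb).coaug (1 : Fin t → k)) := by
  refine eq_of_dualPairing hA fun u v => ?_
  refine (dual_comul_spec hA hf hb _ u v).trans (Eq.trans ?_ (dualPairing_tm hA _ _ u v).symm)
  rw [dual_coaug_apply]
  refine Finset.sum_congr rfl fun j _ => ?_
  rw [dual_coaug_apply, dual_coaug_apply]
  have h1 : ∀ i, (A.aug (A.r (Pi.single j 1) u) : Fin t → k) i =
      (Pi.single j 1 : Fin t → k) i * (A.aug u : Fin t → k) i :=
    fun i => congrFun (A.aug.map_r (Pi.single j 1) u) i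
  have h2 : ∀ i, (A.aug (A.l (Pi.single j 1) v) : Fin t → k) i =
      (Pi.single j 1 : Fin t → k) i * (A.aug v : Fin t → k) i :=
    fun i => congrFun (A.aug.map_l (Pi.single j 1) v) i
  have h3 : (A.aug (A.m u v) : Fin t → k) j = (A.aug u : Fin t → k) j * (A.aug v : Fin t → k) j :=
    congrFun (hA.aug_mul u v) j
  simp only [h1, h2, h3, Pi.single_apply, Pi.one_apply, ite_mul, one_mul, zero_mul, mul_ite,
    mul_zero, Finset.sum_ite_eq', Finset.mem_univ, if_true]
  ring

theorem dual_isCoaugDGCoring : (dual hA hf hb).IsCoaugDGCoring where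
  toIsDG := dual_isDG hA
  coassoc := dual_coassoc hA (dual_comul_spec hA hf hb)
  counit_left := dual_counit_left hA (dual_comul_spec hA hf hb) (ε := (dual hA hf hb).counit)
    (dual_counit_apply hA hf hb)
  counit_right := dual_counit_right hA (dual_comul_spec hA hf hb) (ε := (dual hA hf hb).counit)
    (dual_counit_apply hA hf hb)
  comul_deg := dual_comul_deg hA (dual_comul_spec hA hf hb)
  comul_d := dual_comul_d hA (dual_comul_spec hA hf hb)
  comul_coaug := dual_comul_coaug hA hf hb
  coaug_mem x := (mem_dual_gr hA).2 fun i hi a ha => by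
    refine (dual_coaug_apply hA hf hb x a).trans (Finset.sum_eq_zero fun j _ => ?_)
    rw [hA.aug_gr i (by simpa using hi) a ha]
    exact mul_zero _
  d_coaug x := by
    refine Subtype.ext (LinearMap.ext fun a => ?_)
    refine (dual_d_apply hA _ a).trans ?_
    rw [dual_coaug_apply]
    refine neg_eq_zero.2 (Finset.sum_eq_zero fun j _ => ?_)
    rw [hA.par_d, map_neg, hA.aug_d, neg_zero]
    exact mul_zero _
  counit_gr n hn f hf' := by
    ext j
    exact (mem_dual_gr hA).1 hf' 0 (by omega) _ (hA.one_mem _)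
  counit_d f := by
    ext j
    refine (dual_counit_apply hA hf hb _ j).trans ((dual_d_apply hA f _).trans ?_)
    rw [hA.d_one, map_zero, map_zero, neg_zero]
    rfl

end PreDGRing

end

/-! ### Powers of the augmentation ideal and the dual filtration of A^∨ -/

section

open KBimod PreDGModule

variable {k : Type u} [Field k] {t : ℕ}

namespace PreDGRing

variable {A : PreDGRing.{u} k t}

variable (A) in
/-- The filtration `A ⊇ Ā ⊇ Ā² ⊇ …`. -/
def augFiltration : ℕ → Submodule k A.carrier
  | 0 => ⊤
  | n + 1 => A.augPow n

theorem m_mem_augFiltration_left {u v : A.carrier} (hu : A.aug u = 0) {n : ℕ}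
    (hv : v ∈ A.augFiltration n) (hA : A.IsAugDGRing) : A.m u v ∈ A.augFiltration (n + 1) := by
  cases n with
  | zero =>
    change A.aug (A.m u v) = 0
    rw [hA.aug_mul, hu]
    exact zero_mul (A.aug v : Fin t → k)
  | succ n => exact Submodule.subset_span ⟨u, v, hu, hv, rfl⟩

/-- Powers of Ā are built by multiplying on the left, so absorbing a factor on the right takes
associativity and an induction. -/
theorem m_mem_augFiltration_right {u v : A.carrier} {n : ℕ} (hu : u ∈ A.augFiltration n)
    (hv : A.aug v = 0) (hA : A.IsAugDGRing) : A.m u v ∈ A.augFiltration (n + 1) := by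
  induction n generalizing u with
  | zero =>
    change A.aug (A.m u v) = 0
    rw [hA.aug_mul, hv]
    exact mul_zero (A.aug u : Fin t → k)
  | succ n ih =>
    -- The first power of Ā is a kernel and not a span, so it has no generators to run through and
    -- is treated apart.
    cases n with
    | zero => exact Submodule.subset_span ⟨u, v, hu, hv, rfl⟩
    | succ n =>
      refine Submodule.span_le (p := Submodule.comap
        (((tmLin A.toKBimod A.toKBimod).compr₂ A.mul.toLin).flip v)
        (A.augFiltration (n + 1 + 1 + 1))).2 ?_ hu
      rintro _ ⟨a, b, ha, hb, rfl⟩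
      change A.m (A.m a b) v ∈ A.augFiltration (n + 1 + 1 + 1)
      rw [hA.mul_assoc]
      exact m_mem_augFiltration_left ha (ih hb) hA

theorem augFiltration_succ_le (hA : A.IsAugDGRing) (n : ℕ) :
    A.augFiltration (n + 1) ≤ A.augFiltration n := by
  induction n with
  | zero => exact le_top
  | succ n ih =>
    refine Submodule.span_le.2 ?_
    rintro _ ⟨a, b, ha, hb, rfl⟩
    exact m_mem_augFiltration_left ha (ih hb) hA

theorem augFiltration_antitone (hA : A.IsAugDGRing) : Antitone A.augFiltration :=
  antitone_nat_of_succ_le (augFiltration_succ_le hA)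

/-- Ā is homogeneous because ε is concentrated in degree 0; hence so are its powers. -/
theorem proj_mem_augFiltration (hA : A.IsAugDGRing) (n : ℕ) (s : ℤ) {a : A.carrier}
    (ha : a ∈ A.augFiltration n) : (proj hA s a : A.carrier) ∈ A.augFiltration n := by
  have haug : ∀ s (a : A.carrier), A.aug a = 0 → A.aug (proj hA s a : A.carrier) = 0 :=
    fun s a ha => by
    by_cases hs : s = 0
    · subst hs
      obtain ⟨S, hS, h⟩ := exists_sum_proj hA a
      by_cases h0 : (0 : ℤ) ∈ S
      · rw [← ha]
        conv_rhs => rw [← h]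
        rw [map_sum]
        exact (Finset.sum_eq_single (0 : ℤ) (fun j _ hj => hA.aug_gr j hj _ (proj hA j a).2)
          (fun h => absurd h0 h)).symm
      · rw [hS 0 h0]
        exact map_zero _
    · exact hA.aug_gr s hs _ (proj hA s a).2
  cases n with
  | zero => trivial
  | succ n =>
    induction n generalizing s a with
    | zero => exact haug s a ha
    | succ n ih =>
      refine Submodule.span_le (p := Submodule.comap ((A.gr s).subtype ∘ₗ proj hA s)
        (A.augFiltration (n + 1 + 1))).2 ?_ ha
      rintro _ ⟨a, b, ha, hb, rfl⟩
      refine Submodule.mem_comap.2 ?_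
      obtain ⟨S, -, hS⟩ := exists_sum_proj hA a
      obtain ⟨T, -, hT⟩ := exists_sum_proj hA b
      rw [← hS, ← hT, m_sum_left, map_sum]
      refine Submodule.sum_mem _ fun i _ => ?_
      rw [m_sum_right, map_sum]
      refine Submodule.sum_mem _ fun j _ => ?_
      change (proj hA s _ : A.carrier) ∈ _
      rw [proj_of_mem hA s (hA.mul_mem i j _ (proj hA i a).2 _ (proj hA j b).2)]
      split_ifs
      · exact m_mem_augFiltration_left (haug i a ha) (ih j hb) hA
      · exact zero_mem _

/-- A_s is finite dimensional, hence artinian: the chain Ā^n ∩ A_s becomes stationary, and its final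
value lies in the intersection of all powers, which is zero by completeness. -/
theorem exists_forall_augFiltration_eq_zero (hA : A.IsAugDGRing) (hf : A.LocallyFinite)
    (hc : A.IsComplete) (s : ℤ) :
    ∃ n, ∀ a ∈ A.gr s, a ∈ A.augFiltration n → a = 0 := by
  have := hf s
  let J : ℕ →o (Submodule k (A.gr s))ᵒᵈ :=
    ⟨fun n => OrderDual.toDual ((A.augFiltration n).comap (A.gr s).subtype),
      fun m n h => OrderDual.toDual_le_toDual.2 (Submodule.comap_mono
        (augFiltration_antitone hA h))⟩
  obtain ⟨N, hN⟩ := IsArtinian.monotone_stabilizes J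
  refine ⟨N, fun a ha haN => ?_⟩
  have h1 : a ∈ ⨅ n, A.augPow n := (Submodule.mem_iInf _).2 fun n => by
    -- The index is shifted: `augPow n` is step n + 1 of the filtration.
    by_cases h : N ≤ n + 1
    · have h2 : (⟨a, ha⟩ : A.gr s) ∈ OrderDual.ofDual (J N) := haN
      rw [hN _ h] at h2
      exact h2
    · exact augFiltration_antitone hA (le_of_not_ge h) haN
  rw [show (⨅ n, A.augPow n) = ⊥ from hc] at h1
  exact (Submodule.mem_bot k).1 h1

/-- Only the finitely many degrees seen by the form matter; the largest of their bounds works, since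
the components of an element of Ā^n lie in Ā^n. -/
theorem exists_forall_augFiltration_apply_eq_zero (hA : A.IsAugDGRing) (hf : A.LocallyFinite)
    (hc : A.IsComplete) (f : A.gradedDual) : ∃ n, ∀ a ∈ A.augFiltration n, f.1 a = 0 := by
  choose N hN using exists_forall_augFiltration_eq_zero hA hf hc
  obtain ⟨f, S, hS⟩ := f
  refine ⟨S.sup N, fun a ha => ?_⟩
  obtain ⟨T, -, hT⟩ := exists_sum_proj hA a
  change f a = 0
  rw [← hT, map_sum]
  refine Finset.sum_eq_zero fun s _ => ?_
  by_cases hs : s ∈ S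
  · rw [hN s _ (proj hA s a).2 (augFiltration_antitone hA (Finset.le_sup hs)
      (proj_mem_augFiltration hA _ s ha)), map_zero]
  · exact hS s hs _ (proj hA s a).2

section pairing

variable {hA : A.IsAugDGRing} {W : KBimod.{u, u} k t}
  {Δ : KHom (dualBimod hA) (KBimod.tensor (dualBimod hA) (dualBimod hA))}
  (hΔ : ∀ (f : A.gradedDual) (u v : A.carrier), dualPairing hA (Δ f) u v = f.1 (A.m u v))
  {p : KHom (dualBimod hA) (dualBimod hA)}
  (hp : ∀ (f : A.gradedDual) a, (p f).1 a = f.1 (a - A.one (A.aug a)))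
  {α : KHom (dualBimod hA) W} (hα : ∀ f, α (p f) = α f)
include hΔ hp hα

/-- As α factors through p, one may first apply p ⊗ id. Pairing the result with u ∈ Ā^n and any v
gives f(u(v - ε(v))), which vanishes because the product lies in Ā^{n+1}. So the second factors can
be chosen among the forms that vanish on Ā^n. -/
theorem map_dual_comul_mem_left {n : ℕ} {f : A.gradedDual}
    (hf : ∀ a ∈ A.augFiltration (n + 1), f.1 a = 0) :
    map α (KHom.id _) (Δ f) ∈ Submodule.span k {q | ∃ w, ∃ g : A.gradedDual,
      (∀ a ∈ A.augFiltration n, g.1 a = 0) ∧ q = tm (W := dualBimod hA) w g} := by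
  have hp' : ∀ (f : A.gradedDual) a, (p f).1 a =
      f.1 ((KHom.id A.toKBimod - A.one.comp A.aug : KHom _ _) a) := fun f a => by
    rw [hp, KHom.sub_apply]
    rfl
  have h1 := mem_span_of_contractSnd (fun u : A.augFiltration n => dualEval hA u.1)
    (q := map p (KHom.id _) (Δ f)) fun u => by
      refine Subtype.ext (LinearMap.ext fun v => ?_)
      refine (dualPairing_eq_contractSnd hA _ u.1 v).symm.trans ?_
      rw [dualPairing_map hA hp' (ψ := KHom.id _) (ψ' := KHom.id _) (fun _ _ => rfl), hΔ]
      refine hf _ (m_mem_augFiltration_right u.2 ?_ hA)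
      rw [KHom.sub_apply, map_sub, KHom.comp_apply, A.aug_one]
      exact sub_self _
  have h2 : ∀ q, map α (KHom.id _) (map p (KHom.id (dualBimod hA)) q) = map α (KHom.id _) q :=
    KBimod.linear_ext (f := (map α (KHom.id _)).toLin ∘ₗ (map p (KHom.id (dualBimod hA))).toLin)
      (g := (map α (KHom.id _)).toLin) fun f g => by
    rw [LinearMap.comp_apply, map_tm, map_tm, map_tm, hα, KHom.id_apply]
  rw [← h2]
  refine Submodule.mem_comap.1 (Submodule.span_le.2 ?_ h1)
  rintro _ ⟨g, hg, m, rfl⟩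
  refine Submodule.mem_comap.2 (Submodule.subset_span ⟨α m, g, fun a ha => hg ⟨a, ha⟩, ?_⟩)
  rw [map_tm, KHom.id_apply]

theorem map_dual_comul_mem_right {n : ℕ} {f : A.gradedDual}
    (hf : ∀ a ∈ A.augFiltration (n + 1), f.1 a = 0) :
    map (KHom.id _) α (Δ f) ∈ Submodule.span k {q | ∃ g : A.gradedDual,
      (∀ a ∈ A.augFiltration n, g.1 a = 0) ∧ ∃ w, q = tm (V := dualBimod hA) g w} := by
  have hp' : ∀ (f : A.gradedDual) a, (p f).1 a =
      f.1 ((KHom.id A.toKBimod - A.one.comp A.aug : KHom _ _) a) := fun f a => by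
    rw [hp, KHom.sub_apply]
    rfl
  have h1 := mem_span_of_contractFst (fun v : A.augFiltration n => dualEval hA v.1)
    (q := map (KHom.id _) p (Δ f)) fun v => by
      refine Subtype.ext (LinearMap.ext fun u => ?_)
      refine (dualPairing_eq_contractFst hA _ u v.1).symm.trans ?_
      rw [dualPairing_map hA (φ := KHom.id _) (φ' := KHom.id _) (fun _ _ => rfl) hp', hΔ]
      refine hf _ (m_mem_augFiltration_left ?_ v.2 hA)
      rw [KHom.sub_apply, map_sub, KHom.comp_apply, A.aug_one]
      exact sub_self _
  have h2 : ∀ q, map (KHom.id _) α (map (KHom.id (dualBimod hA)) p q) = map (KHom.id _) α q :=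
    KBimod.linear_ext (f := (map (KHom.id _) α).toLin ∘ₗ (map (KHom.id (dualBimod hA)) p).toLin)
      (g := (map (KHom.id _) α).toLin) fun f g => by
    rw [LinearMap.comp_apply, map_tm, map_tm, map_tm, hα, KHom.id_apply]
  rw [← h2]
  refine Submodule.mem_comap.1 (Submodule.span_le.2 ?_ h1)
  rintro _ ⟨g, hg, m, rfl⟩
  refine Submodule.mem_comap.2 (Submodule.subset_span ⟨g, fun a ha => hg ⟨a, ha⟩, α m, ?_⟩)
  rw [map_tm, KHom.id_apply]

end pairing

variable (hA : A.IsAugDGRing) (hf : A.LocallyFinite) (hb : A.BoundedAbove ∨ A.BoundedBelow)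

/-- The linear forms that vanish on the `n`-th step of the augmentation filtration. -/
def dualFiltration (n : ℕ) : Submodule k (dual hA hf hb).carrier where
  carrier := {f | ∀ a ∈ A.augFiltration n, f.1 a = 0}
  zero_mem' _ _ := rfl
  add_mem' {f g} hf hg a ha := by
    refine (LinearMap.add_apply f.1 g.1 a).trans ?_
    rw [hf a ha, hg a ha, add_zero]
  smul_mem' c f hf a ha := by
    refine (LinearMap.smul_apply c f.1 a).trans ?_
    rw [hf a ha, smul_zero]

theorem mem_dualFiltration {n : ℕ} {f : A.gradedDual} :
    f ∈ dualFiltration hA hf hb n ↔ ∀ a ∈ A.augFiltration n, f.1 a = 0 :=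
  Iff.rfl

/-- The projection of `A^∨` onto its coaugmentation coideal, `f ↦ f ∘ (id - η ε)`. -/
noncomputable def dualReduce : KHom (dualBimod hA) (dualBimod hA) :=
  (kerIncl (dual hA hf hb).counit).comp (dual hA hf hb).redProj

theorem dualReduce_apply (f : A.gradedDual) (a : A.carrier) :
    (dualReduce hA hf hb f).1 a = f.1 (a - A.one (A.aug a)) := by
  let g : A.gradedDual := (dual hA hf hb).coaug ((dual hA hf hb).counit f)
  have h1 : dualReduce hA hf hb f = f - g :=
    kerIncl_kerProj (dual hA hf hb).counit (dual hA hf hb).coaug (dual hA hf hb).counit_coaug f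
  have h2 : f.1 (A.one (A.aug a)) = g.1 a := by
    refine Eq.trans ?_ (dual_coaug_apply hA hf hb _ a).symm
    have h3 : A.aug a = ∑ j : Fin t, (A.aug a : Fin t → k) j • (Pi.single j 1 : Fin t → k) :=
      pi_eq_sum_univ' _
    conv_lhs => rw [h3]
    rw [map_sum, map_sum]
    refine Finset.sum_congr rfl fun j _ => ?_
    rw [map_smul, map_smul, dual_counit_apply]
    exact mul_comm _ _
  rw [h1, map_sub, h2]
  rfl

theorem iota_dualReduce (f : A.gradedDual) :
    (dual hA hf hb).iota (dualReduce hA hf hb f) = (dual hA hf hb).iota f :=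
  congrArg (tensIncl (dual hA hf hb).red.desusp.toKBimod)
    (kerProj_kerIncl (dual hA hf hb).counit (dual hA hf hb).coaug (dual hA hf hb).counit_coaug
      ((dual hA hf hb).redProj f))

/-- The forms on a complete ring that vanish on the powers of the augmentation ideal filter the
dual coring. -/
noncomputable def dualConilpotent (hc : A.IsComplete) :
    ConilpotentFiltration (dual hA hf hb).iota where
  F := dualFiltration hA hf hb
  -- Step 0 of the filtration of A is all of A, not Ā, so a form that vanishes on it is zero.
  zero := by
    refine eq_bot_iff.2 fun (f : A.gradedDual) h => ?_
    refine (Submodule.mem_bot k).2 (Subtype.ext (LinearMap.ext fun a => ?_))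
    exact (mem_dualFiltration hA hf hb).1 h a trivial
  mono m n h (f : A.gradedDual) hfm := (mem_dualFiltration hA hf hb).2 fun a ha =>
    (mem_dualFiltration hA hf hb).1 hfm a (augFiltration_antitone hA h ha)
  exhaustive f := exists_forall_augFiltration_apply_eq_zero hA hf hc f
  left n f h := map_dual_comul_mem_left (dual_comul_spec hA hf hb) (dualReduce_apply hA hf hb)
    (iota_dualReduce hA hf hb) ((mem_dualFiltration hA hf hb).1 h)
  right n f h := map_dual_comul_mem_right (dual_comul_spec hA hf hb) (dualReduce_apply hA hf hb)
    (iota_dualReduce hA hf hb) ((mem_dualFiltration hA hf hb).1 h)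

end PreDGRing

end

/-! ### Comparison of two resolutions over R -/

section

open KBimod PreDGModule

variable {k : Type u} [Field k] {t : ℕ}

namespace PreDGRing

open PreDGBimodule

variable {R : PreDGRing.{u} k t} {C D : PreDGCoring.{u} k t} {α : KHom C.toKBimod R.toKBimod}
  {β : KHom D.toKBimod R.toKBimod} {X Y : PreDGBimodule.{u, u} R}

theorem isDGHom_of_homDiff {f : KHom X.toKBimod Y.toKBimod} (hf : IsHom (M := X) (N := Y) 0 f)
    (hd : ∀ m, homDiff (M := X) (N := Y) 0 f m = 0) : IsDGHom (M := X) (N := Y) f :=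
  ⟨hf, fun m => by
    have := hd m
    rw [homDiff_apply, Int.negOnePow_zero, Units.val_one, one_smul] at this
    exact (sub_eq_zero.1 this).symm⟩

theorem _root_.PreDGBimodule.IsDGHom.homDiff_eq_zero {f : KHom X.toKBimod Y.toKBimod}
    (hf : IsDGHom (M := X) (N := Y) f) (m : X.carrier) : homDiff (M := X) (N := Y) 0 f m = 0 := by
  rw [homDiff_apply, Int.negOnePow_zero, Units.val_one, one_smul, hf.2, sub_self]

theorem isDGHom_id : IsDGHom (M := X) (N := X) (KHom.id _) :=
  ⟨⟨fun i m hm => by rwa [add_zero], fun i a _ m => by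
    rw [zero_mul, Int.negOnePow_zero, Units.val_one, one_smul]; rfl, fun _ _ => rfl⟩, fun _ => rfl⟩

/-- With surjectivity, lifting along the canonical map is strict; this is why the comparison maps
commute with the canonical maps exactly and not only up to homotopy. -/
theorem twistedAug_surjective (hR : R.IsAugDGRing) :
    Function.Surjective (twistedAug R C α) := fun (a : R.carrier) =>
  ⟨tw α a (C.coaug (1 : Fin t → k)) (R.one (1 : Fin t → k)), by
    refine (twistedAug_tw (α := α) a _ _).trans ?_
    rw [C.counit_coaug, r_one, hR.mul_one, r_one]⟩

namespace ConilpotentFiltration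

/-- A two-sided twisted tensor product maps, over the regular bimodule, to any other one that
resolves it. -/
theorem exists_twistedAug_lift (𝓕 : ConilpotentFiltration α) (hR : R.IsAugDGRing)
    (hC : C.IsCoaugDGCoring) (hα : R.IsTwisting C α) (hD : D.IsCoaugDGCoring)
    (hβ : R.IsTwisting D β)
    (hq : IsQuasiIso (M := twisted R D β) (N := R.regular) (twistedAug R D β)) :
    ∃ f : KHom (twisted R C α).toKBimod (twisted R D β).toKBimod,
      IsDGHom (M := twisted R C α) (N := twisted R D β) f ∧
      ∀ m, twistedAug R D β (f m) = twistedAug R C α m := by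
  have hp := twistedAug_isDGHom hR hC hα
  obtain ⟨f, hf, hfd, hqf⟩ := 𝓕.exists_closed_lift hR hC hα (twisted_isDGBimodule hR hD hβ)
    (regular_isDGBimodule hR) (twistedAug_isDGHom hR hD hβ) (twistedAug_surjective hR) hq hp.1
    hp.homDiff_eq_zero
  exact ⟨f, isDGHom_of_homDiff hf hfd, hqf⟩

/-- An endomorphism of a two-sided twisted tensor product over the regular bimodule is homotopic to
the identity, if the twisted tensor product is a resolution. -/
theorem homotopic_id (𝓕 : ConilpotentFiltration α) (hR : R.IsAugDGRing)
    (hC : C.IsCoaugDGCoring) (hα : R.IsTwisting C α)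
    (hp : IsQuasiIso (M := twisted R C α) (N := R.regular) (twistedAug R C α))
    {f : KHom (twisted R C α).toKBimod (twisted R C α).toKBimod}
    (hf : IsDGHom (M := twisted R C α) (N := twisted R C α) f)
    (hpf : ∀ m, twistedAug R C α (f m) = twistedAug R C α m) :
    Homotopic (M := twisted R C α) (N := twisted R C α) f (KHom.id _) := by
  have hid := isDGHom_id (X := twisted R C α)
  -- f - id is closed and vanishes after the canonical map, so there it is the boundary of 0;
  -- reflection of boundaries produces the homotopy.
  obtain ⟨h, hh, hfh⟩ := 𝓕.exists_homDiff_eq_of_comp hR hC hα (twisted_isDGBimodule hR hC hα)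
    (regular_isDGBimodule hR) (twistedAug_isDGHom hR hC hα) (twistedAug_surjective hR) hp
    (g := f - KHom.id _) (hf.1.sub hid.1) (fun m => by
      have h1 := hf.homDiff_eq_zero m
      have h2 := hid.homDiff_eq_zero m
      rw [homDiff_apply] at h1 h2 ⊢
      rw [KHom.sub_apply, KHom.sub_apply, map_sub, smul_sub, sub_sub_sub_comm, h1, h2, sub_zero])
    (h := 0) (isHom_zero (0 + 1)) (fun m => by
      refine (congrArg (twistedAug R C α) (KHom.sub_apply _ _ _)).trans ?_
      rw [map_sub, hpf, homDiff_apply, KHom.zero_apply, KHom.zero_apply, map_zero, smul_zero]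
      exact (sub_self _).trans (sub_self _).symm)
  refine ⟨h, hh, fun m => ?_⟩
  have := hfh m
  rw [KHom.sub_apply, homDiff_apply, zero_add, Int.negOnePow_one, Units.val_neg, Units.val_one,
    neg_smul, one_smul, sub_neg_eq_add] at this
  exact this

/-- Two-sided twisted tensor products that resolve the regular bimodule are homotopy equivalent. -/
theorem exists_homotopyEquiv (𝓕 : ConilpotentFiltration α) (𝓖 : ConilpotentFiltration β)
    (hR : R.IsAugDGRing) (hC : C.IsCoaugDGCoring) (hα : R.IsTwisting C α)
    (hD : D.IsCoaugDGCoring) (hβ : R.IsTwisting D β)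
    (hp : IsQuasiIso (M := twisted R C α) (N := R.regular) (twistedAug R C α))
    (hq : IsQuasiIso (M := twisted R D β) (N := R.regular) (twistedAug R D β)) :
    ∃ f : KHom (twisted R C α).toKBimod (twisted R D β).toKBimod,
      IsHomotopyEquiv (M := twisted R C α) (N := twisted R D β) f ∧
      ∀ m, twistedAug R D β (f m) = twistedAug R C α m := by
  obtain ⟨f, hf, hqf⟩ := 𝓕.exists_twistedAug_lift hR hC hα hD hβ hq
  obtain ⟨g, hg, hpg⟩ := 𝓖.exists_twistedAug_lift hR hD hβ hC hα hp
  refine ⟨f, ⟨hf, g, hg, 𝓕.homotopic_id hR hC hα hp ⟨hg.1.comp hf.1, fun m => ?_⟩ fun m => ?_,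
    𝓖.homotopic_id hR hD hβ hq ⟨hf.1.comp hg.1, fun m => ?_⟩ fun m => ?_⟩, hqf⟩
  · rw [KHom.comp_apply, KHom.comp_apply, hf.2, hg.2]
  · rw [KHom.comp_apply, hpg, hqf]
  · rw [KHom.comp_apply, KHom.comp_apply, hg.2, hf.2]
  · rw [KHom.comp_apply, hqf, hpg]

end ConilpotentFiltration

end PreDGRing

end

theorem proposition6 {k : Type u} [Field k] {t : ℕ} (ht : 0 < t) (A : PreDGRing.{u} k t)
    (hA : A.IsAugDGRing) (hfin : A.LocallyFinite) (hbdd : A.BoundedAbove ∨ A.BoundedBelow)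
    (hcompl : A.IsComplete) :
    -- the graded dual coring `C = A^∨` and its cobar construction `Ω = Ω A^∨`
    let C : PreDGCoring.{u} k t := PreDGRing.dual hA hfin hbdd
    let Ω : PreDGRing.{u} k t := C.cobar
    -- the augmentations `μ (id ⊗ ε ⊗ id)` of `P = Ω ⊗_ι C ⊗_ι Ω` and of the two-sided bar resolution
    let p : KHom C.cobarResolution.toKBimod Ω.regular.toKBimod := PreDGRing.twistedAug Ω C C.iota
    let q : KHom Ω.barResolution.toKBimod Ω.regular.toKBimod :=
      PreDGRing.twistedAug Ω Ω.bar Ω.piBar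
    Ω.IsAugDGRing ∧
    PreDGBimodule.IsSemiProjectiveResolution.{u, w, u, u}
      (P := C.cobarResolution) (M := Ω.regular) p ∧
    Ω.barResolution.IsDGBimodule ∧
    ∃ f : KHom C.cobarResolution.toKBimod Ω.barResolution.toKBimod,
      PreDGBimodule.IsHomotopyEquiv (M := C.cobarResolution) (N := Ω.barResolution) f ∧
      ∀ m, q (f m) = p m := by
  intro C Ω p q
  have hC : C.IsCoaugDGCoring := PreDGRing.dual_isCoaugDGCoring hA hfin hbdd
  have hΩ : Ω.IsAugDGRing := PreDGCoring.cobar_isAugDGRing hC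
  have hι : Ω.IsTwisting C C.iota := PreDGCoring.iota_isTwisting hC
  have hπ : Ω.IsTwisting Ω.bar Ω.piBar := PreDGRing.piBar_isTwisting hΩ
  have hB : Ω.bar.IsCoaugDGCoring := hΩ.bar_isCoaugDGCoring
  -- Completeness of A enters only here, to make the dual filtration exhaustive.
  let 𝓕 : PreDGRing.ConilpotentFiltration C.iota := PreDGRing.dualConilpotent hA hfin hbdd hcompl
  have hp := PreDGCoring.cobar_isQuasiIso hC
  refine ⟨hΩ, ⟨𝓕.isSemiProjective hΩ hC hι, PreDGRing.twistedAug_isDGHom hΩ hC hι, hp⟩,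
    PreDGRing.twisted_isDGBimodule hΩ hB hπ, ?_⟩
  exact 𝓕.exists_homotopyEquiv (PreDGRing.barConilpotent Ω hΩ) hΩ hC hι hB hπ hp
    (PreDGRing.bar_isQuasiIso hΩ)
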